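/- Work with germs at the origin of $\mathbb C^2$. A germ of holomorphic foliation $\mathcal F$ is called nondegenerate reduced if in some holomorphic coordinate system $(x,y)$ it is defined by a $1$-form with linear part $\lambda_1\,y\,dx+\lambda_2\,x\,dy$, where $\lambda_1,\lambda_2\neq 0$ and $\lambda_2/\lambda_1\notin\mathbb Q_{<0}$. Such a foliation has exactly two separatrices (irreducible invariant germs of analytic curves through $0$). If the separatrix $S$ is the one tangent to $\{x=0\}$, the Camacho–Sad index of $\mathcal F$ along $S$ is $-\lambda_2/\lambda_1$ (and it is $-\lambda_1/\lambda_2$ along the other separatrix). Let $\mathcal F,\mathcal F'$ be nondegenerate reduced foliations, with separatrices $S_1,S_2$ and $S_1',S_2'$ respectively. Let $\mathcal L$ and $\mathcal L'$ be germs of regular holomorphic foliations whose invariant curves through $0$ are transverse to $S_1,S_2$ and to $S_1',S_2'$ respectively. Let $T=T(\mathcal F,\mathcal L)$ be the tangent curve, i.e. the germ of the locus where $\mathcal F$ and $\mathcal L$ are tangent (the zero set of $\omega\wedge\eta$, where $\omega$ and $\eta$ are $1$-forms defining $\mathcal F$ and $\mathcal L$); it is a smooth curve transverse to $S_1$ and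 $S_2$. Blow up the origin, and let $D\cong\mathbb P^1$ be the exceptional divisor, $p_1,p_2,p\in D$ the points corresponding to the tangent directions of $S_1,S_2,T$. The holonomy $h:(T,0)\to(T,0)$ of $\mathcal F$ on the tangent curve is the holonomy of the blown-up foliation, computed on the strict transform of $T$, of the loop in $D\setminus\{p_1,p_2\}$ based at $p$ that turns once counterclockwise around $p_1$; it is the germ obtained by lifting this loop to the leaves. Define $T'=T(\mathcal F',\mathcal L')$ and $h'$ in the same way from $\mathcal F',\mathcal L',S_1',S_2'$. Suppose that the Camacho–Sad index of $\mathcal F$ along $S_1$ is equal to that of $\mathcal F'$ along $S_1'$, and let $\phi:(T,0)\to(T',0)$ be a germ of holomorphic diffeomorphism that commutes with the holonomies, i.e. $\phi\circ h=h'\circ\phi$. Then there is a germ of holomorphic diffeomorphism $\Phi$ of $(\mathbb C^2,0)$ that sends $\mathcal F$ to $\mathcal F'$, $\mathcal L$ to $\mathcal L'$, $S_1$ to $S_1'$ and $S_2$ to $S_2'$, and such that $\Phi|_T=\phi$. Moreover, the germ $\Phi$ with these properties is unique. -/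

import Mathlib

open Filter Topology Set

namespace PlaneFoliation

/-- The complex plane `ℂ²` with coordinates `x = p.1`, `y = p.2`. -/
abbrev Plane : Type := ℂ × ℂ

/-- A 1-form on the plane: `ω p w` is the value at the point `p` on the tangent vector `w`.
Germs at the origin are represented by functions; only their values near `0` are used. -/
abbrev OneForm : Type := Plane → (Plane →L[ℂ] ℂ)

/-- The pullback `Φ^* ω`. -/
noncomputable def pullback (Φ : Plane → Plane) (ω : OneForm) : OneForm :=
  fun p => (ω (Φ p)).comp (fderiv ℂ Φ p)

/-- The coefficient of `dx ∧ dy` in `ω ∧ η`. -/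
noncomputable def wedge (ω η : OneForm) (p : Plane) : ℂ :=
  ω p (1, 0) * η p (0, 1) - ω p (0, 1) * η p (1, 0)

/-- The determinant of two vectors of the plane. -/
noncomputable def det₂ (v w : Plane) : ℂ := v.1 * w.2 - v.2 * w.1

/-- `f` is (a representative of) a germ of analytic diffeomorphism from the germ at `0` of `A`
to the germ at `0` of `B`: a holomorphic map of the ambient spaces whose restriction to `A`
takes values in `B` and has a holomorphic inverse. Only the values of `f` on `A` near `0`
matter. -/
def IsDiffeoGerm {E F : Type} [NormedAddCommGroup E] [NormedSpace ℂ E]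
    [NormedAddCommGroup F] [NormedSpace ℂ F] (A : Set E) (B : Set F) (f : E → F) : Prop :=
  AnalyticAt ℂ f 0 ∧ f 0 = 0 ∧ ∃ g : F → E, AnalyticAt ℂ g 0 ∧ g 0 = 0 ∧
    (∀ᶠ p in 𝓝[A] (0 : E), f p ∈ B ∧ g (f p) = p) ∧
    (∀ᶠ q in 𝓝[B] (0 : F), g q ∈ A ∧ f (g q) = q)

/-- In the coordinate system `Ψ`, the foliation `ω = 0` is singular at the origin and is given
by a 1-form with linear part `l₁ y dx + l₂ x dy`. -/
def HasLinearPart (ω : OneForm) (Ψ : Plane → Plane) (l₁ l₂ : ℂ) : Prop :=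
  IsDiffeoGerm univ univ Ψ ∧ pullback Ψ ω 0 = 0 ∧
    ∀ p w : Plane, fderiv ℂ (pullback Ψ ω) 0 p w = l₁ * p.2 * w.1 + l₂ * p.1 * w.2

/-- The germ of holomorphic foliation `ω = 0` is reduced and nondegenerate. -/
def IsNondegenerateReduced (ω : OneForm) : Prop :=
  AnalyticAt ℂ ω 0 ∧ ∃ (Ψ : Plane → Plane) (l₁ l₂ : ℂ), HasLinearPart ω Ψ l₁ l₂ ∧
    l₁ ≠ 0 ∧ l₂ ≠ 0 ∧ ∀ r : ℚ, r < 0 → l₂ / l₁ ≠ (r : ℂ)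

/-- The germ of holomorphic foliation `η = 0` is regular. -/
def IsRegularFoliation (η : OneForm) : Prop := AnalyticAt ℂ η 0 ∧ η 0 ≠ 0

/-- A separatrix of `ω = 0`: an invariant irreducible germ of analytic curve through the
origin, given by an injective holomorphic parametrization `γ : (ℂ,0) → (ℂ²,0)`. -/
def IsSeparatrix (ω : OneForm) (γ : ℂ → Plane) : Prop :=
  AnalyticAt ℂ γ 0 ∧ γ 0 = 0 ∧ (∃ U ∈ 𝓝 (0 : ℂ), InjOn γ U) ∧
    ∀ᶠ t in 𝓝 (0 : ℂ), ω (γ t) (deriv γ t) = 0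

/-- Two parametrizations of irreducible curve germs have the same image germ. -/
def SameBranch (γ δ : ℂ → Plane) : Prop :=
  ∃ α : ℂ → ℂ, IsDiffeoGerm univ univ α ∧ γ =ᶠ[𝓝 0] δ ∘ α

/-- `γ₁` and `γ₂` are two distinct separatrices of `ω = 0`. (A nondegenerate reduced
foliation has exactly two.) -/
def AreSeparatrices (ω : OneForm) (γ₁ γ₂ : ℂ → Plane) : Prop :=
  IsSeparatrix ω γ₁ ∧ IsSeparatrix ω γ₂ ∧ ¬ SameBranch γ₁ γ₂

/-- The nonzero vector `v` spans the tangent line at the origin of the branch `γ`. -/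
def IsTangentVector (γ : ℂ → Plane) (v : Plane) : Prop :=
  v ≠ 0 ∧ ∃ (k : ℕ) (c : ℂ), Tendsto (fun t : ℂ => (c / t ^ k) • γ t) (𝓝[≠] 0) (𝓝 v)

/-- `l` is the Camacho–Sad index of `ω = 0` along the separatrix `γ`: in some coordinates the
linear part is `l₁ y dx + l₂ x dy`, the separatrix is tangent to `{x = 0}`, and
`l = - l₂ / l₁`. -/
def HasCamachoSadIndex (ω : OneForm) (γ : ℂ → Plane) (l : ℂ) : Prop :=
  ∃ (Ψ : Plane → Plane) (l₁ l₂ : ℂ), HasLinearPart ω Ψ l₁ l₂ ∧ l₁ ≠ 0 ∧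
    IsTangentVector γ (fderiv ℂ Ψ 0 (0, 1)) ∧ l = -(l₂ / l₁)

/-- The invariant curve through `0` of the regular foliation `η = 0`, whose tangent line is
`ker (η 0)`, is transverse to the branch `γ`. -/
def IsTransverse (η : OneForm) (γ : ℂ → Plane) : Prop :=
  ∀ v : Plane, IsTangentVector γ v → η 0 v ≠ 0

/-- The tangent curve `T(ω, η)`, the locus where `ω = 0` and `η = 0` are tangent. -/
def tangentCurve (ω η : OneForm) : Set Plane := {p | wedge ω η p = 0}

/-- Holonomy of the blown-up foliation `ω = 0` along the loop of directions
`s ∈ [0,1] ↦ [v s]` in the exceptional divisor `ℙ¹`, read on the transverse curve `T`. A point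
`q ≠ 0` of `T` is sent to the point `h q` of `T` that is reached by a path which stays in the
leaf of `q` and whose lift to the blow-up stays close to the loop, as close as we please if
`q` is close to `0`. This determines the germ of `h` on `T`. -/
def IsHolonomyAlong (ω : OneForm) (T : Set Plane) (v : ℝ → Plane) (h : Plane → Plane) : Prop :=
  h 0 = 0 ∧ (∀ᶠ q in 𝓝[T] (0 : Plane), h q ∈ T) ∧
    ∀ ε : ℝ, 0 < ε → ∀ᶠ q in 𝓝[T \ {0}] (0 : Plane), ∃ c c' : ℝ → Plane,
      c 0 = q ∧ c 1 = h q ∧ ∀ s ∈ Icc (0 : ℝ) 1,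
        HasDerivWithinAt c (c' s) (Icc 0 1) s ∧ ω (c s) (c' s) = 0 ∧
        c s ≠ 0 ∧ ‖c s‖ ≤ ε ∧ ‖det₂ (v s) (c s)‖ ≤ ε * ‖c s‖

/-- `h` is the holonomy of `ω = 0` on the tangent curve `T(ω, η)`, for the generator of the
fundamental group of the exceptional divisor minus the two singular points `[v₁]`, `[v₂]`
(the directions of the separatrices) which is based at the direction `[v₁ + v₂]` of the
tangent curve and turns once around `[v₁]`, counterclockwise. -/
def IsTangentCurveHolonomy (ω η : OneForm) (γ₁ γ₂ : ℂ → Plane) (h : Plane → Plane) : Prop :=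
  ∃ v₁ v₂ : Plane, IsTangentVector γ₁ v₁ ∧ IsTangentVector γ₂ v₂ ∧
    fderiv ℂ (wedge ω η) 0 (v₁ + v₂) = 0 ∧
    IsHolonomyAlong ω (tangentCurve ω η)
      (fun s : ℝ => v₁ + Complex.exp (2 * Real.pi * Complex.I * s) • v₂) h

/-- `Φ` sends the foliation `ω = 0` to the foliation `ω' = 0`. -/
def SendsFoliation (Φ : Plane → Plane) (ω ω' : OneForm) : Prop :=
  ∃ u : Plane → ℂ, AnalyticAt ℂ u 0 ∧ u 0 ≠ 0 ∧
    ∀ᶠ p in 𝓝 (0 : Plane), pullback Φ ω' p = u p • ω p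

/-- `Φ` is a diffeomorphism germ of `(ℂ²,0)` which sends the pair `(ω, η)` to `(ω', η')` and
coincides with `φ` on the tangent curve of `(ω, η)`. -/
def IsConjugacyExtending (Φ φ : Plane → Plane) (ω η ω' η' : OneForm) : Prop :=
  IsDiffeoGerm univ univ Φ ∧ SendsFoliation Φ ω ω' ∧ SendsFoliation Φ η η' ∧
    ∀ᶠ p in 𝓝[tangentCurve ω η] (0 : Plane), Φ p = φ p

end PlaneFoliation

open PlaneFoliation

/-! In suitable charts both pairs take the same shape: S₁ is x = 0, S₂ is y = 0, the foliation is y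
dx + μ x dy = 0 with μ(0) = lam, the opposite of the Camacho–Sad index along S₁, and the pencil is x
+ y = const. The tangent curve is then y = μ x. The first integral of the second pencil may be
reparametrized, and this freedom is used to make φ the identity in the parameter v = x + y of the
two tangent curves. A conjugacy is now forced to preserve x + y and both axes, so it is (x (1 + y
G), y (1 - x G)) for some germ G (`exists_eq_slide`). Being a conjugacy amounts to a single
first-order equation, `conjDefect μ μ' G = 0`, which is singular at the origin.

The equation is first solved near the point p of the exceptional divisor. Put x = e^w y, with w in a
disc of radius 8 about w₀, where e^{w₀} = 1/lam is the direction of the tangent curve. The disc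
contains w₀ + 2πi, hence a full turn. On it the foliation has a first integral H = y e^k
(`exists_first_integral_exponent`). The holonomy f satisfies A = B ∘ f, where A and B are the values
of H on the tangent curve over w₀ and over w₀ + 2πi. Since the holonomies correspond, the same f
serves for the target, and one germ θ matches θ ∘ H with H' at both ends of the turn
(`exists_transition`). For fixed z = x + y, the function H / z of w has a nondegenerate critical
point on the tangent curve. Equality of the indices makes the two functions agree on the divisor,
and a Morse lemma with parameter gives a unique local solution g near p (`exists_fold_conjugation`,
`IsMatched.exists_local_shear`).

It remains to see that g descends to the plane. By `exists_blowdown` it is enough that the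
coefficients of y^m in g are successively polynomials of degree at most m in e^w = x / y. Suppose
that g is known up to order m, as a germ P of the plane plus y^m ρ. The error H' ∘ shear P - θ ∘ H
is y^{m+2} D on the whole strip. Differentiating along the leaves gives a linear equation for D(w,
0), whose source term is an exponential times a polynomial of degree at most m + 1 in e^w. Moreover
D(w, 0) vanishes at w₀, where the curve is critical, and at w₀ + 2πi, because θ also matches the
first integrals after one turn and the curve is critical there too. As lam is not a negative
rational number, equal values at both ends force a polynomial in e^w, up to the same exponential
(`exists_polynomial_of_ode`). Its root at 1/lam is divided out and the degree drops to m.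

For uniqueness, any conjugacy yields a first integral of the source that vanishes on the tangent
curve, hence vanishes identically, and the local uniqueness near p applies. An analytic germ of the
plane is determined near one direction of the blow-up. -/

namespace PlaneFoliation

/-! ### Convergent power series of two variables -/

/-- `f` is the sum near the origin of the double power series `∑ a i j x ^ i y ^ j`, whose
coefficients grow at most geometrically. -/
def HasDoubleSeries (f : ℂ × ℂ → ℂ) (a : ℕ → ℕ → ℂ) : Prop :=
  (∃ C R : ℝ, ∀ i j, ‖a i j‖ ≤ C * R ^ (i + j)) ∧
    ∀ᶠ p in 𝓝 (0 : ℂ × ℂ), HasSum (fun n : ℕ × ℕ => a n.1 n.2 * p.1 ^ n.1 * p.2 ^ n.2) (f p)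

/-- The monomial `x ^ i y ^ (n - i)` as a multilinear map. -/
noncomputable def monomialForm (n i : ℕ) :
    ContinuousMultilinearMap ℂ (fun _ : Fin n => ℂ × ℂ) ℂ :=
  (ContinuousMultilinearMap.mkPiAlgebra ℂ (Fin n) ℂ).compContinuousLinearMap
    (fun k => if k.1 < i then ContinuousLinearMap.fst ℂ ℂ ℂ else ContinuousLinearMap.snd ℂ ℂ ℂ)

lemma norm_monomialForm_le (n i : ℕ) : ‖monomialForm n i‖ ≤ 1 := by
  refine (ContinuousMultilinearMap.norm_compContinuousLinearMap_le _ _).trans ?_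
  rw [ContinuousMultilinearMap.norm_mkPiAlgebra, one_mul]
  refine Finset.prod_le_one (fun _ _ => norm_nonneg _) fun k _ => ?_
  split_ifs
  · exact ContinuousLinearMap.norm_fst_le _ _ _
  · exact ContinuousLinearMap.norm_snd_le _ _ _

lemma monomialForm_apply {n i : ℕ} (hi : i ≤ n) (p : ℂ × ℂ) :
    monomialForm n i (fun _ => p) = p.1 ^ i * p.2 ^ (n - i) := by
  have h : monomialForm n i (fun _ => p) = ∏ k : Fin n, (if k.1 < i then p.1 else p.2) := by
    simp only [monomialForm, ContinuousMultilinearMap.compContinuousLinearMap_apply,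
      ContinuousMultilinearMap.mkPiAlgebra_apply]
    refine Finset.prod_congr rfl fun k _ => ?_
    split_ifs <;> rfl
  rw [h, Fin.prod_univ_eq_prod_range (fun k => if k < i then p.1 else p.2) n]
  obtain ⟨m, rfl⟩ := Nat.exists_eq_add_of_le hi
  rw [Finset.prod_range_add]
  congr 1
  · rw [Finset.prod_congr rfl (g := fun _ => p.1)]
    · simp
    · intro k hk
      simp [Finset.mem_range.1 hk]
  · rw [Finset.prod_congr rfl (g := fun _ => p.2)]
    · simp
    · intro k _
      simp

/-- Regrouping a double sum by total degree. -/
lemma hasSum_antidiagonal {f : ℕ × ℕ → ℂ} {s : ℂ} (h : HasSum f s) :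
    HasSum (fun n => ∑ k ∈ Finset.HasAntidiagonal.antidiagonal n, f k) s := by
  have h1 : HasSum (f ∘ Finset.HasAntidiagonal.sigmaAntidiagonalEquivProd) s :=
    (Equiv.hasSum_iff _).2 h
  refine (h1.sigma (g := fun n => ∑ k ∈ Finset.HasAntidiagonal.antidiagonal n, f k) fun n => ?_)
  have := hasSum_fintype (fun c : Finset.HasAntidiagonal.antidiagonal n => f c.1)
  rw [Finset.sum_coe_sort (Finset.HasAntidiagonal.antidiagonal n) f] at this
  exact this

/-- Grouping the monomials by total degree gives homogeneous polynomials whose norms grow at most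
geometrically, up to the factor n + 1 that counts the monomials of degree n. -/
lemma HasDoubleSeries.analyticAt {f : ℂ × ℂ → ℂ} {a : ℕ → ℕ → ℂ} (h : HasDoubleSeries f a) :
    AnalyticAt ℂ f 0 := by
  obtain ⟨⟨C, R, hC⟩, hs⟩ := h
  set R' : ℝ := |R| + 1
  set C' : ℝ := |C|
  have hR' : 0 < R' := by positivity
  have hC' : ∀ i j, ‖a i j‖ ≤ C' * R' ^ (i + j) := fun i j => (hC i j).trans <| by
    calc C * R ^ (i + j) ≤ |C * R ^ (i + j)| := le_abs_self _
      _ = |C| * |R| ^ (i + j) := by rw [abs_mul, abs_pow]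
      _ ≤ C' * R' ^ (i + j) := by
        gcongr
        simp [R']
  let p : FormalMultilinearSeries ℂ (ℂ × ℂ) ℂ := fun n =>
    ∑ k ∈ Finset.HasAntidiagonal.antidiagonal n, a k.1 k.2 • monomialForm n k.1
  have hp : ∀ n, ‖p n‖ ≤ (n + 1) * (C' * R' ^ n) := fun n => by
    refine (norm_sum_le _ _).trans ?_
    have : ∀ k ∈ Finset.HasAntidiagonal.antidiagonal n, ‖a k.1 k.2 • monomialForm n k.1‖ ≤ C' * R' ^ n := by
      intro k hk
      rw [norm_smul]
      have h1 := hC' k.1 k.2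
      rw [Finset.HasAntidiagonal.mem_antidiagonal.1 hk] at h1
      calc _ ≤ (C' * R' ^ n) * 1 := by
            gcongr
            exact norm_monomialForm_le _ _
        _ = _ := mul_one _
    refine (Finset.sum_le_sum this).trans ?_
    simp
  -- Half of 1/R': the gain 2^{-n} absorbs the number n + 1 of monomials of degree n.
  let r : NNReal := ⟨1 / (2 * R'), by positivity⟩
  have hr : (r : ENNReal) ≤ p.radius := by
    refine p.le_radius_of_bound C' fun n => ?_
    have h2 : ((n : ℝ) + 1) ≤ 2 ^ n := by
      have := n.lt_two_pow_self
      exact_mod_cast this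
    calc ‖p n‖ * (1 / (2 * R')) ^ n ≤ ((n + 1) * (C' * R' ^ n)) * (1 / (2 * R')) ^ n := by
          gcongr
          exact hp n
      _ ≤ (2 ^ n * (C' * R' ^ n)) * (1 / (2 * R')) ^ n := by gcongr
      _ = C' := by
        rw [div_pow, mul_pow, one_pow]
        field_simp
  obtain ⟨ε, hε, hball⟩ := Metric.eventually_nhds_iff.1 hs
  have hrpos : 0 < (r : ENNReal) := by
    have : 0 < r := by
      rw [← NNReal.coe_pos]
      change 0 < 1 / (2 * R')
      positivity
    exact_mod_cast this
  refine ⟨p, min r (ENNReal.ofReal ε), (min_le_left _ _).trans hr, lt_min hrpos (by simpa using hε),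
    fun {y} hy => ?_⟩
  have hy' : dist y 0 < ε := by
    have := lt_of_lt_of_le (Metric.mem_eball.1 hy) (min_le_right _ _)
    rwa [edist_dist, ENNReal.ofReal_lt_ofReal_iff hε] at this
  rw [zero_add]
  suffices hps : (fun n => p n fun _ => y) = fun n =>
      ∑ k ∈ Finset.HasAntidiagonal.antidiagonal n, a k.1 k.2 * y.1 ^ k.1 * y.2 ^ k.2 by
    rw [hps]
    exact hasSum_antidiagonal (hball hy')
  funext n
  have hpn : p n (fun _ => y) = ∑ k ∈ Finset.HasAntidiagonal.antidiagonal n,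
      a k.1 k.2 • monomialForm n k.1 (fun _ => y) := by
    simp only [p, sum_apply, smul_apply]
  rw [hpn]
  refine Finset.sum_congr rfl fun k hk => ?_
  have hk' := Finset.HasAntidiagonal.mem_antidiagonal.1 hk
  rw [monomialForm_apply (by omega), smul_eq_mul, ← hk', Nat.add_sub_cancel_left, mul_assoc]

/-- The coefficient of `x ^ i y ^ j` in the expansion of a power series of two variables. -/
noncomputable def doubleCoeff (p : FormalMultilinearSeries ℂ (ℂ × ℂ) ℂ) (i j : ℕ) : ℂ :=
  ∑ s ∈ Finset.powersetCard i (Finset.univ : Finset (Fin (i + j))),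
    p (i + j) (s.piecewise (fun _ => ((1 : ℂ), (0 : ℂ))) (fun _ => ((0 : ℂ), (1 : ℂ))))

lemma norm_doubleCoeff_le (p : FormalMultilinearSeries ℂ (ℂ × ℂ) ℂ) (i j : ℕ) :
    ‖doubleCoeff p i j‖ ≤ 2 ^ (i + j) * ‖p (i + j)‖ := by
  refine (norm_sum_le _ _).trans ?_
  have : ∀ s ∈ Finset.powersetCard i (Finset.univ : Finset (Fin (i + j))),
      ‖p (i + j) (s.piecewise (fun _ => ((1 : ℂ), (0 : ℂ))) (fun _ => ((0 : ℂ), (1 : ℂ))))‖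
        ≤ ‖p (i + j)‖ := by
    intro s _
    refine (ContinuousMultilinearMap.le_opNorm _ _).trans ?_
    have h1 : ∏ k, ‖s.piecewise (fun _ : Fin (i + j) => ((1 : ℂ), (0 : ℂ)))
        (fun _ => ((0 : ℂ), (1 : ℂ))) k‖ ≤ 1 := by
      refine Finset.prod_le_one (fun _ _ => norm_nonneg _) fun k _ => ?_
      by_cases hk : k ∈ s <;> simp [hk]
    calc _ ≤ ‖p (i + j)‖ * 1 := by gcongr
      _ = _ := mul_one _
  refine (Finset.sum_le_sum this).trans ?_
  rw [Finset.sum_const, nsmul_eq_mul]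
  gcongr
  rw [Finset.card_powersetCard, Finset.card_univ, Fintype.card_fin]
  exact_mod_cast Nat.choose_le_two_pow _ _

/-- Multilinear expansion of p n at q = x e₁ + y e₂: the subset s records the slots that receive e₁,
and only its cardinality matters for the monomial. -/
lemma sum_doubleCoeff (p : FormalMultilinearSeries ℂ (ℂ × ℂ) ℂ) (n : ℕ) (q : ℂ × ℂ) :
    p n (fun _ => q)
      = ∑ k ∈ Finset.HasAntidiagonal.antidiagonal n, doubleCoeff p k.1 k.2 * q.1 ^ k.1 * q.2 ^ k.2 := by
  have hq : (fun _ : Fin n => q) = (fun _ => q.1 • ((1 : ℂ), (0 : ℂ)))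
      + (fun _ => q.2 • ((0 : ℂ), (1 : ℂ))) := by
    funext k
    ext <;> simp
  have key : ∀ s : Finset (Fin n),
      p n (s.piecewise (fun _ => q.1 • ((1 : ℂ), (0 : ℂ))) (fun _ => q.2 • ((0 : ℂ), (1 : ℂ))))
        = p n (s.piecewise (fun _ => ((1 : ℂ), (0 : ℂ))) (fun _ => ((0 : ℂ), (1 : ℂ))))
          * q.1 ^ s.card * q.2 ^ (n - s.card) := by
    intro s
    have h1 : s.piecewise (fun _ : Fin n => q.1 • ((1 : ℂ), (0 : ℂ)))
        (fun _ => q.2 • ((0 : ℂ), (1 : ℂ)))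
        = fun k => (s.piecewise (fun _ => q.1) (fun _ => q.2) k) •
          s.piecewise (fun _ => ((1 : ℂ), (0 : ℂ))) (fun _ => ((0 : ℂ), (1 : ℂ))) k := by
      funext k
      by_cases hk : k ∈ s <;> simp [hk]
    rw [h1, ContinuousMultilinearMap.map_smul_univ, smul_eq_mul]
    have h2 : ∏ k, s.piecewise (fun _ => q.1) (fun _ => q.2) k
        = q.1 ^ s.card * q.2 ^ (n - s.card) := by
      rw [Finset.prod_piecewise]
      simp [Finset.card_sdiff]
    rw [h2]
    ring
  have expand : p n (fun _ => q) = ∑ s : Finset (Fin n), p n (s.piecewise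
      (fun _ => q.1 • ((1 : ℂ), (0 : ℂ))) (fun _ => q.2 • ((0 : ℂ), (1 : ℂ)))) := by
    rw [hq]
    exact (p n).map_add_univ _ _
  rw [expand]
  simp only [key]
  rw [← Finset.powerset_univ, Finset.sum_powerset (Finset.univ : Finset (Fin n)), Finset.Nat.sum_antidiagonal_eq_sum_range_succ_mk,
    Finset.card_univ, Fintype.card_fin]
  refine Finset.sum_congr rfl fun i hi => ?_
  have hi' : i ≤ n := by simpa [Nat.lt_succ_iff] using hi
  generalize hj : n - i = j
  obtain rfl : n = i + j := by omega
  simp only [doubleCoeff, Finset.sum_mul]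
  apply Finset.sum_congr rfl
  intro s hs
  rw [(Finset.mem_powersetCard.1 hs).2, Nat.add_sub_cancel_left]

/-- Geometrically bounded coefficients give an absolutely convergent double series near `0`. -/
lemma eventually_summable_of_bound {a : ℕ → ℕ → ℂ} {C R : ℝ}
    (h : ∀ i j, ‖a i j‖ ≤ C * R ^ (i + j)) :
    ∀ᶠ p in 𝓝 (0 : ℂ × ℂ),
      Summable (fun n : ℕ × ℕ => ‖a n.1 n.2 * p.1 ^ n.1 * p.2 ^ n.2‖) := by
  have hR : 0 < |R| + 1 := by positivity
  filter_upwards [Metric.ball_mem_nhds (0 : ℂ × ℂ) (ε := 1 / (2 * (|R| + 1))) (by positivity)]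
    with p hp
  rw [mem_ball_zero_iff] at hp
  have h1 : ‖p.1‖ ≤ 1 / (2 * (|R| + 1)) := (norm_fst_le p).trans hp.le
  have h2 : ‖p.2‖ ≤ 1 / (2 * (|R| + 1)) := (norm_snd_le p).trans hp.le
  have hg : Summable (fun n : ℕ × ℕ => |C| * ((1 / 2 : ℝ) ^ n.1 * (1 / 2 : ℝ) ^ n.2)) :=
    (Summable.mul_of_nonneg summable_geometric_two summable_geometric_two
      (fun _ => by positivity) (fun _ => by positivity)).mul_left _
  refine Summable.of_nonneg_of_le (fun _ => norm_nonneg _) (fun n => ?_) hg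
  have h3 : ‖a n.1 n.2‖ ≤ |C| * (|R| + 1) ^ (n.1 + n.2) := by
    refine (h n.1 n.2).trans ?_
    calc C * R ^ (n.1 + n.2) ≤ |C * R ^ (n.1 + n.2)| := le_abs_self _
      _ = |C| * |R| ^ (n.1 + n.2) := by rw [abs_mul, abs_pow]
      _ ≤ _ := by
        gcongr
        simp
  rw [norm_mul, norm_mul, norm_pow, norm_pow]
  calc _ ≤ (|C| * (|R| + 1) ^ (n.1 + n.2)) * (1 / (2 * (|R| + 1))) ^ n.1
        * (1 / (2 * (|R| + 1))) ^ n.2 := by gcongr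
    _ = |C| * ((1 / 2 : ℝ) ^ n.1 * (1 / 2 : ℝ) ^ n.2) := by
      rw [div_pow, div_pow, div_pow, div_pow, mul_pow, mul_pow, pow_add]
      field_simp

lemma hasDoubleSeries_tsum {a : ℕ → ℕ → ℂ} {C R : ℝ} (h : ∀ i j, ‖a i j‖ ≤ C * R ^ (i + j)) :
    HasDoubleSeries (fun p => ∑' n : ℕ × ℕ, a n.1 n.2 * p.1 ^ n.1 * p.2 ^ n.2) a :=
  ⟨⟨C, R, h⟩, (eventually_summable_of_bound h).mono fun _ hp => hp.of_norm.hasSum⟩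

lemma exists_hasDoubleSeries {f : ℂ × ℂ → ℂ} (hf : AnalyticAt ℂ f 0) :
    ∃ a, HasDoubleSeries f a := by
  obtain ⟨p, r, hp⟩ := hf
  obtain ⟨r', hr'0, hr'⟩ := ENNReal.lt_iff_exists_nnreal_btwn.1 (hp.r_pos.trans_le hp.r_le)
  have hr'pos : 0 < (r' : ℝ) := by
    have : 0 < r' := by exact_mod_cast hr'0
    exact_mod_cast this
  obtain ⟨C, hC, hb⟩ := p.norm_mul_pow_le_of_lt_radius hr'
  have hbd : ∀ i j, ‖doubleCoeff p i j‖ ≤ C * (2 / r') ^ (i + j) := fun i j => by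
    refine (norm_doubleCoeff_le p i j).trans ?_
    have := hb (i + j)
    rw [div_pow, mul_div_assoc', le_div_iff₀ (by positivity)]
    calc _ = 2 ^ (i + j) * (‖p (i + j)‖ * r' ^ (i + j)) := by ring
      _ ≤ 2 ^ (i + j) * C := by gcongr
      _ = _ := by ring
  refine ⟨doubleCoeff p, ⟨C, 2 / r', hbd⟩, ?_⟩
  filter_upwards [eventually_summable_of_bound hbd, Metric.eball_mem_nhds 0 hp.r_pos] with q hq hq'
  have h1 := hp.hasSum hq'
  rw [zero_add] at h1
  have h2 := hasSum_antidiagonal hq.of_norm.hasSum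
  have h3 : (fun n => p n fun _ => q) = fun n => ∑ k ∈ Finset.HasAntidiagonal.antidiagonal n,
      doubleCoeff p k.1 k.2 * q.1 ^ k.1 * q.2 ^ k.2 := funext fun n => sum_doubleCoeff p n q
  rw [h3] at h1
  rw [h1.unique h2]
  exact hq.of_norm.hasSum

attribute [fun_prop] analyticAt_fst analyticAt_snd

/-! ### Power series of one variable -/

lemma coeff_unique {c d : ℕ → ℂ} {F : ℂ → ℂ}
    (hc : ∀ᶠ y in 𝓝 (0 : ℂ), HasSum (fun k => c k * y ^ k) (F y))
    (hd : ∀ᶠ y in 𝓝 (0 : ℂ), HasSum (fun k => d k * y ^ k) (F y)) : c = d := by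
  have key : ∀ c : ℕ → ℂ, (∀ᶠ y in 𝓝 (0 : ℂ), HasSum (fun k => c k * y ^ k) (F y)) →
      HasFPowerSeriesAt F (FormalMultilinearSeries.ofScalars ℂ c) 0 := fun c h => by
    refine hasFPowerSeriesAt_iff.2 ?_
    filter_upwards [h] with y hy
    simpa [FormalMultilinearSeries.coeff_ofScalars, mul_comm] using hy
  have := (key c hc).eq_formalMultilinearSeries (key d hd)
  funext k
  simpa [FormalMultilinearSeries.coeff_ofScalars] using
    congrArg (fun p : FormalMultilinearSeries ℂ ℂ ℂ => p.coeff k) this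

lemma exists_hasSum_of_analyticAt {F : ℂ → ℂ} (hF : AnalyticAt ℂ F 0) :
    ∃ c : ℕ → ℂ, ∀ᶠ y in 𝓝 (0 : ℂ), HasSum (fun k => c k * y ^ k) (F y) := by
  obtain ⟨p, hp⟩ := hF
  refine ⟨p.coeff, ?_⟩
  filter_upwards [hasFPowerSeriesAt_iff.1 hp] with y hy
  simpa [mul_comm] using hy

/-- If `F y = y ^ n r y` then the `n`-th Taylor coefficient of `F` is `r 0`. -/
lemma coeff_of_eq_pow_mul {c : ℕ → ℂ} {F r : ℂ → ℂ} {n : ℕ}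
    (hc : ∀ᶠ y in 𝓝 (0 : ℂ), HasSum (fun k => c k * y ^ k) (F y))
    (hr : AnalyticAt ℂ r 0) (h : ∀ᶠ y in 𝓝 (0 : ℂ), F y = y ^ n * r y) : c n = r 0 := by
  obtain ⟨d, hd⟩ := exists_hasSum_of_analyticAt hr
  have h0 : d 0 = r 0 := by
    have := hd.self_of_nhds
    have h1 := hasSum_single (f := fun k => d k * (0 : ℂ) ^ k) 0 (fun k hk => by simp [hk])
    simpa using h1.unique this
  have : c = fun k => if k < n then 0 else d (k - n) := by
    refine coeff_unique hc ?_
    filter_upwards [hd, h] with y hy hFy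
    rw [hFy, ← hasSum_nat_add_iff' n]
    rw [Finset.sum_eq_zero, sub_zero]
    · refine ((hy.mul_left (y ^ n)).congr_fun ?_)
      intro k
      simp [pow_add]
      ring
    · intro k hk
      simp [Finset.mem_range.1 hk]
  rw [this]
  simpa using h0

/-! ### Double series -/

lemma HasDoubleSeries.bound {f : ℂ × ℂ → ℂ} {a : ℕ → ℕ → ℂ} (h : HasDoubleSeries f a) :
    ∃ C R : ℝ, 0 ≤ C ∧ 1 ≤ R ∧ ∀ i j, ‖a i j‖ ≤ C * R ^ (i + j) := by
  obtain ⟨⟨C, R, hC⟩, -⟩ := h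
  refine ⟨|C|, |R| + 1, abs_nonneg _, by simp, fun i j => (hC i j).trans ?_⟩
  calc C * R ^ (i + j) ≤ |C * R ^ (i + j)| := le_abs_self _
    _ = |C| * |R| ^ (i + j) := by rw [abs_mul, abs_pow]
    _ ≤ |C| * (|R| + 1) ^ (i + j) := by
      gcongr
      simp

lemma tendsto_prod_zero : Tendsto (fun x : ℂ => (x, (0 : ℂ))) (𝓝 0) (𝓝 (0 : ℂ × ℂ)) := by
  have : ContinuousAt (fun x : ℂ => (x, (0 : ℂ))) 0 := by fun_prop
  exact this

lemma HasDoubleSeries.hasSum_fst {f : ℂ × ℂ → ℂ} {a : ℕ → ℕ → ℂ} (h : HasDoubleSeries f a) :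
    ∀ᶠ x in 𝓝 (0 : ℂ), HasSum (fun i => a i 0 * x ^ i) (f (x, 0)) := by
  filter_upwards [tendsto_prod_zero.eventually h.2] with x hx
  have hinj : Function.Injective (fun i : ℕ => (i, 0)) := fun i j hij => by simpa using hij
  rw [← hinj.hasSum_iff] at hx
  · simpa [Function.comp_def] using hx
  · rintro ⟨i, j⟩ hij
    have : j ≠ 0 := fun h0 => hij ⟨i, by simp [h0]⟩
    simp [this]

/-- Division with remainder of a double series by the second variable. -/
lemma HasDoubleSeries.step {f : ℂ × ℂ → ℂ} {a : ℕ → ℕ → ℂ} (h : HasDoubleSeries f a) :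
    ∃ g, HasDoubleSeries g (fun i j => a i (j + 1)) ∧
      ∀ᶠ p in 𝓝 (0 : ℂ × ℂ), f p = f (p.1, 0) + p.2 * g p := by
  obtain ⟨C, R, hC, hR, hb⟩ := h.bound
  have hb' : ∀ i j, ‖(fun i j => a i (j + 1)) i j‖ ≤ (C * R) * R ^ (i + j) := fun i j =>
    (hb i (j + 1)).trans_eq (by ring)
  refine ⟨_, hasDoubleSeries_tsum hb', ?_⟩
  have hfst : Tendsto (fun p : ℂ × ℂ => p.1) (𝓝 0) (𝓝 0) := by
    have : ContinuousAt (fun p : ℂ × ℂ => p.1) 0 := by fun_prop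
    simpa [ContinuousAt] using this
  filter_upwards [h.2, eventually_summable_of_bound hb, eventually_summable_of_bound hb',
    hfst.eventually h.hasSum_fst] with p h1 h2 h3 h4
  rw [← h1.tsum_eq, ← h4.tsum_eq, h2.of_norm.tsum_prod, h3.of_norm.tsum_prod, ← tsum_mul_left]
  have h5 : ∀ i, Summable (fun j => a i j * p.1 ^ i * p.2 ^ j) := h2.of_norm.prod_factor
  have h6 : ∀ i, ∑' j, a i j * p.1 ^ i * p.2 ^ j
      = a i 0 * p.1 ^ i + p.2 * ∑' j, a i (j + 1) * p.1 ^ i * p.2 ^ j := fun i => by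
    rw [(h5 i).tsum_eq_zero_add, pow_zero, mul_one, ← tsum_mul_left]
    congr 2
    funext j
    ring
  simp only [h6]
  refine Summable.tsum_add h4.summable ?_
  exact (h3.of_norm.prod).mul_left _

/-- An analytic function which vanishes on `y = 0` is divisible by `y`. -/
lemma exists_eq_snd_mul_zero {f : ℂ × ℂ → ℂ} (hf : AnalyticAt ℂ f 0)
    (h0 : ∀ᶠ x in 𝓝 (0 : ℂ), f (x, 0) = 0) :
    ∃ g, AnalyticAt ℂ g 0 ∧ ∀ᶠ p in 𝓝 (0 : ℂ × ℂ), f p = p.2 * g p := by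
  obtain ⟨a, ha⟩ := exists_hasDoubleSeries hf
  obtain ⟨g, hg, hfg⟩ := ha.step
  refine ⟨g, hg.analyticAt, ?_⟩
  have hfst : Tendsto (fun p : ℂ × ℂ => p.1) (𝓝 0) (𝓝 0) := by
    have : ContinuousAt (fun p : ℂ × ℂ => p.1) 0 := by fun_prop
    simpa [ContinuousAt] using this
  filter_upwards [hfg, hfst.eventually h0] with p hp hp0
  rw [hp, hp0, zero_add]

lemma tendsto_translate (c d : ℂ × ℂ) : Tendsto (fun p : ℂ × ℂ => p + d) (𝓝 c) (𝓝 (c + d)) := by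
  have : ContinuousAt (fun p : ℂ × ℂ => p + d) c := by fun_prop
  simpa [ContinuousAt] using this

lemma exists_eq_snd_mul {f : ℂ × ℂ → ℂ} {c : ℂ} (hf : AnalyticAt ℂ f (c, 0))
    (h0 : ∀ᶠ x in 𝓝 c, f (x, 0) = 0) :
    ∃ g, AnalyticAt ℂ g (c, 0) ∧ ∀ᶠ p in 𝓝 (c, (0 : ℂ)), f p = p.2 * g p := by
  have h1 : AnalyticAt ℂ (fun p : ℂ × ℂ => f (p + (c, 0))) 0 := by
    have : AnalyticAt ℂ (fun p : ℂ × ℂ => p + (c, 0)) 0 := by fun_prop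
    exact AnalyticAt.fun_comp (by simpa using hf) this
  have h2 : ∀ᶠ x in 𝓝 (0 : ℂ), f ((x, (0 : ℂ)) + (c, 0)) = 0 := by
    have : Tendsto (fun x : ℂ => x + c) (𝓝 0) (𝓝 c) := by
      have : ContinuousAt (fun x : ℂ => x + c) 0 := by fun_prop
      simpa [ContinuousAt] using this
    filter_upwards [this.eventually h0] with x hx
    simpa using hx
  obtain ⟨g, hg, hfg⟩ := exists_eq_snd_mul_zero h1 h2
  refine ⟨fun p => g (p + (-c, 0)), ?_, ?_⟩
  · have : AnalyticAt ℂ (fun p : ℂ × ℂ => p + (-c, 0)) (c, 0) := by fun_prop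
    exact AnalyticAt.fun_comp (g := g) (by simpa [← Prod.zero_eq_mk] using hg) this
  · have := tendsto_translate (c, 0) (-c, 0)
    simp only [Prod.mk_add_mk, add_neg_cancel, add_zero, Prod.mk_zero_zero] at this
    filter_upwards [this.eventually hfg] with p hp
    simpa [add_assoc, Prod.mk_zero_zero] using hp

lemma exists_eq_fst_mul {f : ℂ × ℂ → ℂ} {c : ℂ} (hf : AnalyticAt ℂ f (0, c))
    (h0 : ∀ᶠ y in 𝓝 c, f (0, y) = 0) :
    ∃ g, AnalyticAt ℂ g (0, c) ∧ ∀ᶠ p in 𝓝 ((0 : ℂ), c), f p = p.1 * g p := by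
  have hsw : ∀ p : ℂ × ℂ, AnalyticAt ℂ (fun p : ℂ × ℂ => (p.2, p.1)) p := fun p => by fun_prop
  have h1 : AnalyticAt ℂ (fun p : ℂ × ℂ => f (p.2, p.1)) (c, 0) :=
    AnalyticAt.fun_comp (g := f) (by simpa using hf) (hsw _)
  obtain ⟨g, hg, hfg⟩ := exists_eq_snd_mul h1 h0
  refine ⟨fun p => g (p.2, p.1), AnalyticAt.fun_comp (g := g) (by simpa using hg) (hsw _), ?_⟩
  have : Tendsto (fun p : ℂ × ℂ => (p.2, p.1)) (𝓝 (0, c)) (𝓝 (c, 0)) := (hsw (0, c)).continuousAt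
  filter_upwards [this.eventually hfg] with p hp
  simpa using hp

/-! ### Inverse function theorem -/

/-- In finite dimension an injective differential is invertible, so the inverse function theorem
applies and its inverse is analytic. -/
lemma exists_analytic_inverse {E : Type*} [NormedAddCommGroup E] [NormedSpace ℂ E]
    [FiniteDimensional ℂ E] {f : E → E} {a : E} (hf : AnalyticAt ℂ f a)
    (hinj : ∀ v, fderiv ℂ f a v = 0 → v = 0) :
    ∃ g : E → E, AnalyticAt ℂ g (f a) ∧ g (f a) = a ∧ (∀ᶠ p in 𝓝 a, g (f p) = p) ∧
      ∀ᶠ q in 𝓝 (f a), f (g q) = q := by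
  have : CompleteSpace E := FiniteDimensional.complete ℂ E
  let e : E ≃L[ℂ] E := (LinearEquiv.ofInjectiveEndo (fderiv ℂ f a : E →ₗ[ℂ] E)
    ((injective_iff_map_eq_zero _).2 hinj)).toContinuousLinearEquiv
  have he : (e : E →L[ℂ] E) = fderiv ℂ f a := by
    ext v
    rfl
  have hs : HasStrictFDerivAt f (e : E →L[ℂ] E) a := he ▸ hf.hasStrictFDerivAt
  refine ⟨hs.localInverse f e a, ?_, hs.localInverse_apply_image, hs.eventually_left_inverse,
    hs.eventually_right_inverse⟩
  have hc : ContDiffAt ℂ ⊤ f a := hf.contDiffAt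
  have := hc.to_localInverse (f' := e) hs.hasFDerivAt (by simp)
  exact this.analyticAt

/-! ### Partial derivatives and Taylor coefficients in the second variable -/

lemma hasDerivAt_fst {f : ℂ × ℂ → ℂ} {p : ℂ × ℂ} (hf : AnalyticAt ℂ f p) :
    HasDerivAt (fun w => f (w, p.2)) (fderiv ℂ f p (1, 0)) p.1 := by
  have h1 : HasDerivAt (fun w : ℂ => (w, p.2)) ((1 : ℂ), (0 : ℂ)) p.1 :=
    (hasDerivAt_id _).prodMk (hasDerivAt_const _ _)
  exact hf.differentiableAt.hasFDerivAt.comp_hasDerivAt (f := fun w : ℂ => (w, p.2)) p.1 h1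

lemma hasDerivAt_snd {f : ℂ × ℂ → ℂ} {p : ℂ × ℂ} (hf : AnalyticAt ℂ f p) :
    HasDerivAt (fun y => f (p.1, y)) (fderiv ℂ f p (0, 1)) p.2 := by
  have h1 : HasDerivAt (fun y : ℂ => (p.1, y)) ((0 : ℂ), (1 : ℂ)) p.2 :=
    (hasDerivAt_const _ _).prodMk (hasDerivAt_id _)
  exact hf.differentiableAt.hasFDerivAt.comp_hasDerivAt (f := fun y : ℂ => (p.1, y)) p.2 h1

lemma analyticAt_fderiv_apply {f : ℂ × ℂ → ℂ} {p : ℂ × ℂ} (hf : AnalyticAt ℂ f p) (v : ℂ × ℂ) :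
    AnalyticAt ℂ (fun q => fderiv ℂ f q v) p :=
  ((ContinuousLinearMap.apply ℂ ℂ v).analyticAt _).comp hf.fderiv

/-- The tube lemma: neighbourhoods of the points (w, 0), for w in a compact set, contain a product
neighbourhood. It provides a common width in y. -/
lemma exists_uniform_of_eventually {K : Set ℂ} (hK : IsCompact K) {P : ℂ × ℂ → Prop}
    (h : ∀ w ∈ K, ∀ᶠ p in 𝓝 (w, (0 : ℂ)), P p) :
    ∃ δ > 0, ∀ w ∈ K, ∀ y : ℂ, ‖y‖ < δ → P (w, y) := by
  have h1 : ∀ᶠ p in 𝓝ˢ (K ×ˢ {(0 : ℂ)}), P p := by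
    rw [eventually_nhdsSet_iff_forall]
    rintro ⟨w, y⟩ ⟨hw, hy⟩
    obtain rfl : y = 0 := hy
    exact h w hw
  rw [hK.nhdsSet_prod_eq isCompact_singleton, nhdsSet_singleton] at h1
  obtain ⟨pa, ha, pb, hb, H⟩ := eventually_prod_iff.1 h1
  obtain ⟨δ, hδ, hb⟩ := Metric.eventually_nhds_iff.1 hb
  exact ⟨δ, hδ, fun w hw y hy => H (ha.self_of_nhdsSet _ hw) (hb (by simpa using hy))⟩

/-- The `j`-th Taylor coefficient at `y = 0` of `y ↦ f (w, y)`. -/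
noncomputable def taylorSnd (f : ℂ × ℂ → ℂ) (j : ℕ) (w : ℂ) : ℂ :=
  (j.factorial : ℂ)⁻¹ * iteratedDeriv j (fun y => f (w, y)) 0

lemma analyticAt_slice {f : ℂ × ℂ → ℂ} {p : ℂ × ℂ} (hf : AnalyticAt ℂ f p) :
    AnalyticAt ℂ (fun y => f (p.1, y)) p.2 :=
  AnalyticAt.fun_comp (g := f) (f := fun y => (p.1, y)) hf (by fun_prop)

lemma eventually_hasSum_taylorSnd {f : ℂ × ℂ → ℂ} {w : ℂ} (hf : AnalyticAt ℂ f (w, 0)) :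
    ∀ᶠ y in 𝓝 (0 : ℂ), HasSum (fun j => taylorSnd f j w * y ^ j) (f (w, y)) := by
  obtain ⟨s, hs, h⟩ := (analyticAt_slice hf).exists_mem_nhds_analyticOnNhd
  obtain ⟨r, hr, hb⟩ := Metric.mem_nhds_iff.1 hs
  have hd : DifferentiableOn ℂ (fun y => f (w, y)) (Metric.ball 0 r) :=
    fun y hy => (h y (hb hy)).differentiableAt.differentiableWithinAt
  filter_upwards [Metric.ball_mem_nhds (0 : ℂ) hr] with y hy
  have := Complex.hasSum_taylorSeries_on_ball hd hy
  simp only [sub_zero, smul_eq_mul] at this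
  refine this.congr_fun fun j => ?_
  simp only [taylorSnd]
  ring

lemma taylorSnd_succ {f g : ℂ × ℂ → ℂ} {w : ℂ} (hf : AnalyticAt ℂ f (w, 0))
    (hg : AnalyticAt ℂ g (w, 0)) (h : ∀ᶠ y in 𝓝 (0 : ℂ), f (w, y) = f (w, 0) + y * g (w, y))
    (j : ℕ) : taylorSnd f (j + 1) w = taylorSnd g j w := by
  have h1 := eventually_hasSum_taylorSnd hf
  have h2 : ∀ᶠ y in 𝓝 (0 : ℂ), HasSum
      (fun j => (fun | 0 => f (w, 0) | j + 1 => taylorSnd g j w : ℕ → ℂ) j * y ^ j) (f (w, y)) := by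
    filter_upwards [eventually_hasSum_taylorSnd hg, h] with y hy hfy
    rw [hfy, ← hasSum_nat_add_iff' 1]
    simp only [Finset.range_one, Finset.sum_singleton, pow_zero, mul_one, add_sub_cancel_left]
    refine (hy.mul_left y).congr_fun fun k => ?_
    ring
  exact congrFun (coeff_unique h1 h2) (j + 1)

lemma exists_eq_add_snd_mul {f : ℂ × ℂ → ℂ} {c : ℂ} (hf : AnalyticAt ℂ f (c, 0)) :
    ∃ g, AnalyticAt ℂ g (c, 0) ∧ ∀ᶠ p in 𝓝 (c, (0 : ℂ)), f p = f (p.1, 0) + p.2 * g p := by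
  have h1 : AnalyticAt ℂ (fun p : ℂ × ℂ => f (p.1, 0)) (c, 0) :=
    AnalyticAt.fun_comp (g := f) (f := fun p : ℂ × ℂ => (p.1, (0 : ℂ))) hf (by fun_prop)
  obtain ⟨g, hg, h⟩ := exists_eq_snd_mul (f := fun p => f p - f (p.1, 0)) (hf.sub h1)
    (Eventually.of_forall fun x => by simp)
  refine ⟨g, hg, ?_⟩
  filter_upwards [h] with p hp
  rw [← hp]
  ring

lemma tendsto_fst_nhds (c d : ℂ) : Tendsto (fun p : ℂ × ℂ => p.1) (𝓝 (c, d)) (𝓝 c) :=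
  continuousAt_fst

lemma tendsto_mk_left (c d : ℂ) : Tendsto (fun w : ℂ => (w, d)) (𝓝 c) (𝓝 (c, d)) := by
  have : ContinuousAt (fun w : ℂ => (w, d)) c := by fun_prop
  exact this

lemma tendsto_mk_right (c d : ℂ) : Tendsto (fun y : ℂ => (c, y)) (𝓝 d) (𝓝 (c, d)) := by
  have : ContinuousAt (fun y : ℂ => (c, y)) d := by fun_prop
  exact this

/-- Induction by division: the coefficient of index j + 1 of f is the coefficient of index j of (f -
f(w, 0)) / y, which is again analytic. -/
lemma analyticAt_taylorSnd {f : ℂ × ℂ → ℂ} {c : ℂ} (hf : AnalyticAt ℂ f (c, 0)) (j : ℕ) :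
    AnalyticAt ℂ (taylorSnd f j) c := by
  induction j generalizing f with
  | zero =>
    have : taylorSnd f 0 = fun w => f (w, 0) := by
      funext w
      simp [taylorSnd]
    rw [this]
    exact AnalyticAt.fun_comp (g := f) (f := fun w : ℂ => (w, (0 : ℂ))) hf (by fun_prop)
  | succ j ih =>
    obtain ⟨g, hg, h⟩ := exists_eq_add_snd_mul hf
    refine (ih hg).congr ?_
    have ht := tendsto_mk_left c 0
    filter_upwards [ht.eventually hf.eventually_analyticAt, ht.eventually hg.eventually_analyticAt,
      ht.eventually h.eventually_nhds] with w h1 h2 h3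
    exact (taylorSnd_succ h1 h2 ((tendsto_mk_right w 0).eventually h3) j).symm

/-- Uniform Cauchy estimates for the Taylor coefficients in the second variable. -/
lemma exists_uniform_taylor {K : Set ℂ} (hK : IsCompact K) {f : ℂ × ℂ → ℂ}
    (hf : ∀ w ∈ K, AnalyticAt ℂ f (w, 0)) :
    ∃ C A : ℝ, 0 < C ∧ 0 < A ∧ (∀ w ∈ K, ∀ j, ‖taylorSnd f j w‖ ≤ C * A ^ j) ∧
      ∀ w ∈ K, ∀ y : ℂ, ‖y‖ < 1 / A → AnalyticAt ℂ f (w, y) ∧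
        HasSum (fun j => taylorSnd f j w * y ^ j) (f (w, y)) := by
  obtain ⟨δ, hδ, h⟩ := exists_uniform_of_eventually hK (P := fun p => AnalyticAt ℂ f p)
    fun w hw => (hf w hw).eventually_analyticAt
  have hK2 : IsCompact (K ×ˢ Metric.closedBall (0 : ℂ) (δ / 2)) :=
    hK.prod (isCompact_closedBall _ _)
  obtain ⟨C, hC⟩ := hK2.exists_bound_of_continuousOn (f := f) fun p hp =>
    (h p.1 hp.1 p.2 (by have := mem_closedBall_zero_iff.1 hp.2; linarith)).continuousAt.continuousWithinAt
  -- Cauchy's estimates on the circle of radius δ/2; the added 1 only makes the constant positive.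
  refine ⟨|C| + 1, 2 / δ, by positivity, by positivity, fun w hw j => ?_, fun w hw y hy => ?_⟩
  · have hd : DiffContOnCl ℂ (fun y => f (w, y)) (Metric.ball 0 (δ / 2)) := by
      apply DifferentiableOn.diffContOnCl
      rw [closure_ball _ (by positivity)]
      intro y hy
      have hy' := mem_closedBall_zero_iff.1 hy
      exact (analyticAt_slice (h w hw y (by linarith))).differentiableAt.differentiableWithinAt
    have := Complex.norm_iteratedDeriv_le_of_forall_mem_sphere_norm_le j (C := |C| + 1)
      (by positivity) hd fun y hy => by
        refine ((hC (w, y) ⟨hw, Metric.sphere_subset_closedBall hy⟩).trans (le_abs_self C)).trans ?_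
        simp
    rw [taylorSnd, norm_mul, norm_inv, Complex.norm_natCast, inv_mul_le_iff₀ (by positivity)]
    refine this.trans_eq ?_
    rw [div_pow, div_pow]
    field_simp
  · rw [one_div_div] at hy
    refine ⟨h w hw y (by linarith), ?_⟩
    have hd : DifferentiableOn ℂ (fun y => f (w, y)) (Metric.ball 0 (δ / 2)) := by
      intro y hy
      have hy' := mem_ball_zero_iff.1 hy
      exact (analyticAt_slice (h w hw y (by linarith))).differentiableAt.differentiableWithinAt
    have := Complex.hasSum_taylorSeries_on_ball hd (mem_ball_zero_iff.2 hy)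
    simp only [sub_zero, smul_eq_mul] at this
    refine this.congr_fun fun j => ?_
    simp only [taylorSnd]
    ring

/-! ### Sums of holomorphic functions times powers -/

/-- If the `k j` are holomorphic and geometrically bounded on a disc then `∑ k j w * y ^ j`
is analytic in both variables. -/
lemma analyticAt_tsum_mul_pow {k : ℕ → ℂ → ℂ} {c : ℂ} {r C B : ℝ} (hr : 0 < r)
    (hk : ∀ j, DifferentiableOn ℂ (k j) (Metric.ball c r))
    (hb : ∀ j, ∀ w ∈ Metric.ball c r, ‖k j w‖ ≤ C * B ^ j) :
    AnalyticAt ℂ (fun p : ℂ × ℂ => ∑' j, k j p.1 * p.2 ^ j) (c, 0) := by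
  have hcC : 0 ≤ C := by
    have := hb 0 c (Metric.mem_ball_self hr)
    simp only [pow_zero, mul_one] at this
    exact (norm_nonneg _).trans this
  set ρ := r / 2
  have hρ : 0 < ρ := by positivity
  -- Coefficients of the double expansion in w - c and y. Cauchy's estimates on the circle of radius
  -- ρ = r/2 about c make them geometrically bounded.
  let a : ℕ → ℕ → ℂ := fun i j => (i.factorial : ℂ)⁻¹ * iteratedDeriv i (k j) c
  have ha : ∀ i j, ‖a i j‖ ≤ C * (1 / ρ + |B|) ^ (i + j) := fun i j => by
    have hd : DiffContOnCl ℂ (k j) (Metric.ball c ρ) := by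
      apply DifferentiableOn.diffContOnCl
      rw [closure_ball _ hρ.ne']
      exact (hk j).mono (Metric.closedBall_subset_ball (by simp only [ρ]; linarith))
    have := Complex.norm_iteratedDeriv_le_of_forall_mem_sphere_norm_le i (C := C * |B| ^ j)
      hρ hd fun w hw => by
        refine (hb j w ?_).trans ?_
        · rw [mem_sphere_iff_norm] at hw
          rw [mem_ball_iff_norm, hw]
          simp only [ρ]
          linarith
        · have : B ^ j ≤ |B| ^ j := by
            rw [← abs_pow]
            exact le_abs_self _
          gcongr
    simp only [a]
    rw [norm_mul, norm_inv, Complex.norm_natCast, inv_mul_le_iff₀ (by positivity)]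
    refine this.trans ?_
    rw [mul_div_assoc]
    gcongr
    calc C * |B| ^ j / ρ ^ i = C * ((1 / ρ) ^ i * |B| ^ j) := by
          rw [div_pow 1 ρ, one_pow]
          field_simp
      _ ≤ C * ((1 / ρ + |B|) ^ i * (1 / ρ + |B|) ^ j) := by
          gcongr
          · simp
          · have : 0 ≤ 1 / ρ := by positivity
            linarith
      _ = _ := by rw [pow_add]
  have hds := hasDoubleSeries_tsum ha
  have h0 : AnalyticAt ℂ (fun p : ℂ × ℂ => ∑' j, k j (p.1 + c) * p.2 ^ j) 0 := by
    refine hds.analyticAt.congr ?_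
    have hfst := tendsto_fst_nhds 0 0
    filter_upwards [eventually_summable_of_bound ha, hfst.eventually (Metric.ball_mem_nhds 0 hr)]
      with p hp hpr
    have hs := hp.of_norm
    rw [← (Equiv.prodComm ℕ ℕ).summable_iff] at hs
    rw [← (Equiv.prodComm ℕ ℕ).tsum_eq]
    refine hs.tsum_prod.trans (tsum_congr fun j => ?_)
    have hpc : p.1 + c ∈ Metric.ball c r := by
      simpa [mem_ball_iff_norm] using hpr
    have := Complex.hasSum_taylorSeries_on_ball (hk j) hpc
    simp only [add_sub_cancel_right, smul_eq_mul] at this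
    rw [← this.tsum_eq, ← tsum_mul_right]
    refine tsum_congr fun i => ?_
    simp only [Function.comp_apply, Equiv.prodComm_apply, Prod.swap, a]
    ring
  have : AnalyticAt ℂ (fun p : ℂ × ℂ => p + (-c, 0)) (c, 0) := by fun_prop
  have h2 := AnalyticAt.fun_comp (g := fun p : ℂ × ℂ => ∑' j, k j (p.1 + c) * p.2 ^ j)
    (f := fun p : ℂ × ℂ => p + (-c, 0)) (x := (c, 0)) (by simpa [← Prod.zero_eq_mk] using h0) this
  simpa [add_assoc] using h2

/-! ### Scalar linear differential equations on a disc -/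

/-- Variation of constants. Both primitives, of a and of e^{-A} b, exist because a disc is simply
connected. -/
lemma exists_linear_ode_solution {c : ℂ} {R : ℝ} {a b : ℂ → ℂ}
    (ha : DifferentiableOn ℂ a (Metric.ball c R)) (hb : DifferentiableOn ℂ b (Metric.ball c R)) :
    ∃ u : ℂ → ℂ, u c = 0 ∧ ∀ w ∈ Metric.ball c R, HasDerivAt u (a w * u w + b w) w := by
  obtain ⟨A, hA⟩ := ha.isExactOn_ball
  have h1 : DifferentiableOn ℂ (fun w => Complex.exp (-A w) * b w) (Metric.ball c R) := by
    refine DifferentiableOn.mul ?_ hb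
    exact fun w hw => (hA w hw).neg.cexp.differentiableAt.differentiableWithinAt
  obtain ⟨V, hV⟩ := h1.isExactOn_ball
  refine ⟨fun w => Complex.exp (A w) * (V w - V c), by simp, fun w hw => ?_⟩
  refine ((hA w hw).cexp.mul ((hV w hw).sub_const (V c))).congr_deriv ?_
  have : Complex.exp (A w) * Complex.exp (-A w) = 1 := by
    rw [← Complex.exp_add, add_neg_cancel, Complex.exp_zero]
  linear_combination b w * this

/-- The solution of `u' = a u + b` on the disc which vanishes at the centre. -/
noncomputable def odeSolution (c : ℂ) (R : ℝ) (a b : ℂ → ℂ) : ℂ → ℂ :=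
  open Classical in
  if h : ∃ u : ℂ → ℂ, u c = 0 ∧ ∀ w ∈ Metric.ball c R, HasDerivAt u (a w * u w + b w) w
  then h.choose else 0

lemma odeSolution_spec {c : ℂ} {R : ℝ} {a b : ℂ → ℂ}
    (ha : DifferentiableOn ℂ a (Metric.ball c R)) (hb : DifferentiableOn ℂ b (Metric.ball c R)) :
    odeSolution c R a b c = 0 ∧ ∀ w ∈ Metric.ball c R,
      HasDerivAt (odeSolution c R a b) (a w * odeSolution c R a b w + b w) w := by
  have h := exists_linear_ode_solution ha hb
  rw [odeSolution, dif_pos h]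
  exact h.choose_spec

/-! ### The equation `k_w = M (1 + y k_y)` -/

/-- The Taylor coefficients in `y` of the solution of `k_w = M (1 + y k_y)`, where
`M = ∑ m j w * y ^ j`. -/
noncomputable def pdeCoeff (c : ℂ) (R : ℝ) (m : ℕ → ℂ → ℂ) : ℕ → ℂ → ℂ
  | j => odeSolution c R (fun w => j * m 0 w)
      (fun w => m j w + ∑ l : Fin j, m (j - l) w * ((l : ℕ) * pdeCoeff c R m l w))
  decreasing_by exact l.2

/-- This is the coefficient of y^j in k_w = M (1 + y k_y). The term l = j carries the factor j m₀
and is the homogeneous part of a linear equation; the others involve earlier coefficients only.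
Vanishing at c is the choice of zero initial data on w = c. -/
lemma pdeCoeff_spec {c : ℂ} {R : ℝ} {m : ℕ → ℂ → ℂ}
    (hm : ∀ j, DifferentiableOn ℂ (m j) (Metric.ball c R)) (j : ℕ) :
    pdeCoeff c R m j c = 0 ∧ ∀ w ∈ Metric.ball c R, HasDerivAt (pdeCoeff c R m j)
      (m j w + ∑ l ∈ Finset.range (j + 1), m (j - l) w * (l * pdeCoeff c R m l w)) w := by
  induction j using Nat.strong_induction_on with
  | _ j ih =>
    have hk : ∀ l < j, DifferentiableOn ℂ (pdeCoeff c R m l) (Metric.ball c R) :=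
      fun l hl w hw => ((ih l hl).2 w hw).differentiableAt.differentiableWithinAt
    have h1 : DifferentiableOn ℂ (fun w => j * m 0 w) (Metric.ball c R) :=
      (hm 0).const_mul _
    have h2 : DifferentiableOn ℂ
        (fun w => m j w + ∑ l : Fin j, m (j - l) w * ((l : ℕ) * pdeCoeff c R m l w))
        (Metric.ball c R) := by
      refine (hm j).add (DifferentiableOn.fun_sum fun l _ => ?_)
      exact (hm _).mul ((hk l l.2).const_mul _)
    have h3 := odeSolution_spec h1 h2
    rw [pdeCoeff]
    refine ⟨h3.1, fun w hw => ?_⟩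
    refine (h3.2 w hw).congr_deriv ?_
    rw [Finset.sum_range_succ, Finset.sum_range, Nat.sub_self, ← pdeCoeff]
    ring

/-- As A / B is at most 1/2, a geometric series bounds the sum by 2 C j B^j, and the first term is
at most C j B^j. The slack between 3 and 4 gives the strict inequality that a comparison of
derivatives needs. -/
lemma majorant_sum_lt {C A B : ℝ} (hC : 0 < C) (hA : 0 < A) (hB : 2 * A ≤ B) {j : ℕ}
    (hj : 1 ≤ j) :
    C * A ^ j + ∑ l ∈ Finset.range (j + 1), C * A ^ (j - l) * (l * B ^ l)
      < j * (4 * C * B ^ j) := by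
  have hBpos : 0 < B := by linarith
  have h1 : ∑ l ∈ Finset.range (j + 1), C * A ^ (j - l) * (l * B ^ l)
      ≤ ∑ l ∈ Finset.range (j + 1), C * j * B ^ j * (1 / 2) ^ (j - l) := by
    refine Finset.sum_le_sum fun l hl => ?_
    have hl' : l ≤ j := Nat.lt_succ_iff.1 (Finset.mem_range.1 hl)
    have hA' : A ^ (j - l) ≤ (B * (1 / 2)) ^ (j - l) := by
      gcongr
      linarith
    have hlj : (l : ℝ) ≤ j := by exact_mod_cast hl'
    calc C * A ^ (j - l) * (l * B ^ l) ≤ C * (B * (1 / 2)) ^ (j - l) * (j * B ^ l) := by gcongr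
      _ = C * j * (B ^ (j - l) * B ^ l) * (1 / 2) ^ (j - l) := by
        rw [mul_pow]
        ring
      _ = _ := by rw [← pow_add, Nat.sub_add_cancel hl']
  have h2 : ∑ l ∈ Finset.range (j + 1), C * j * B ^ j * (1 / 2 : ℝ) ^ (j - l)
      ≤ C * j * B ^ j * 2 := by
    rw [← Finset.mul_sum]
    have h3 : ∑ l ∈ Finset.range (j + 1), (1 / 2 : ℝ) ^ (j - l) ≤ 2 := by
      have := Finset.sum_range_reflect (fun i => (1 / 2 : ℝ) ^ i) (j + 1)
      simp only [Nat.add_sub_cancel] at this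
      rw [this]
      have h4 := Summable.sum_le_tsum (Finset.range (j + 1))
        (fun i _ => by positivity : ∀ i ∉ Finset.range (j + 1), 0 ≤ (1 / 2 : ℝ) ^ i)
        summable_geometric_two
      rwa [tsum_geometric_two] at h4
    gcongr
  have h5 : C * A ^ j ≤ C * j * B ^ j := by
    have hAB : A ≤ B := by linarith
    have hj1 : (1 : ℝ) ≤ j := by exact_mod_cast hj
    calc C * A ^ j ≤ C * B ^ j := by gcongr
      _ = C * 1 * B ^ j := by ring
      _ ≤ _ := by gcongr
  have h6 : 0 < C * j * B ^ j := by
    have : (0 : ℝ) < j := by exact_mod_cast hj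
    positivity
  linarith

/-- A majorant along radii: with B(s) = 2 A e^{4 C s}, the function B(s)^j has derivative 4 C j
B(s)^j, which is the right-hand side of `majorant_sum_lt`. The exponential growth of B makes one
bound serve for all j. -/
lemma pdeCoeff_bound {c : ℂ} {R C A : ℝ} {m : ℕ → ℂ → ℂ}
    (hm : ∀ j, DifferentiableOn ℂ (m j) (Metric.ball c R)) (hC : 0 < C) (hA : 0 < A)
    (hb : ∀ w ∈ Metric.ball c R, ∀ j, ‖m j w‖ ≤ C * A ^ j) (j : ℕ) (hj : 1 ≤ j) :
    ∀ w ∈ Metric.ball c R,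
      ‖pdeCoeff c R m j w‖ ≤ (2 * A * Real.exp (4 * C * dist w c)) ^ j := by
  induction j using Nat.strong_induction_on with
  | _ j ih =>
    intro w hw
    rcases eq_or_ne w c with rfl | hwc
    · rw [(pdeCoeff_spec hm j).1, norm_zero]
      positivity
    set d := dist w c
    have hd : 0 < d := dist_pos.2 hwc
    have hdn : d = ‖w - c‖ := dist_eq_norm _ _
    set v : ℂ := (w - c) / d
    have hv : ‖v‖ = 1 := by
      simp only [v]
      rw [norm_div, Complex.norm_real, Real.norm_of_nonneg hd.le, ← hdn, div_self hd.ne']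
    have hmem : ∀ s ∈ Icc 0 d, c + s * v ∈ Metric.ball c R ∧ dist (c + s * v) c = s := by
      intro s hs
      have h1 : dist (c + s * v) c = s := by
        rw [dist_eq_norm, add_sub_cancel_left, norm_mul, hv, mul_one, Complex.norm_real,
          Real.norm_of_nonneg hs.1]
      exact ⟨by rw [Metric.mem_ball, h1]; exact hs.2.trans_lt hw, h1⟩
    have hder : ∀ s ∈ Icc 0 d, HasDerivAt (fun s : ℝ => pdeCoeff c R m j (c + s * v))
        ((m j (c + s * v) + ∑ l ∈ Finset.range (j + 1),
          m (j - l) (c + s * v) * (l * pdeCoeff c R m l (c + s * v))) * v) s := by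
      intro s hs
      have h1 : HasDerivAt (fun s : ℝ => c + s * v) v s := by
        simpa using ((hasDerivAt_id s).ofReal_comp.mul_const v).const_add c
      have h2 := ((pdeCoeff_spec hm j).2 _ (hmem s hs).1).scomp (h := fun s : ℝ => c + s * v) s h1
      rw [smul_eq_mul, mul_comm] at h2
      exact h2
    -- Comparison on the segment from c to w: where the norm reaches the majorant, the majorant
    -- grows strictly faster.
    have key := image_norm_le_of_norm_deriv_right_lt_deriv_boundary
      (f := fun s : ℝ => pdeCoeff c R m j (c + s * v)) (a := 0) (b := d)
      (fun s hs => (hder s hs).continuousAt.continuousWithinAt)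
      (fun s hs => (hder s ⟨hs.1, hs.2.le⟩).hasDerivWithinAt)
      (B := fun s => (2 * A * Real.exp (4 * C * s)) ^ j)
      (B' := fun s => j * (4 * C * (2 * A * Real.exp (4 * C * s)) ^ j)) ?_ ?_ ?_
      (right_mem_Icc.2 hd.le)
    · have hvd : c + d * v = w := by
        simp only [v]
        rw [mul_div_cancel₀]
        · ring
        · exact_mod_cast hd.ne'
      simp only [hvd] at key
      exact key
    · simp only [Complex.ofReal_zero, zero_mul, add_zero, (pdeCoeff_spec hm j).1, norm_zero]
      positivity
    · intro s
      have h1 : HasDerivAt (fun s => 2 * A * Real.exp (4 * C * s))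
          (2 * A * (Real.exp (4 * C * s) * (4 * C))) s := by
        have := (((hasDerivAt_id s).const_mul (4 * C)).exp).const_mul (2 * A)
        simpa using this
      refine (h1.pow j).congr_deriv ?_
      obtain ⟨i, rfl⟩ := Nat.exists_eq_add_of_le' hj
      rw [Nat.add_sub_cancel]
      push_cast
      ring
    · intro s hs heq
      have hs' : s ∈ Icc 0 d := ⟨hs.1, hs.2.le⟩
      set B := 2 * A * Real.exp (4 * C * s)
      have hB : 2 * A ≤ B := by
        have : 1 ≤ Real.exp (4 * C * s) := Real.one_le_exp (by have := hs.1; positivity)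
        calc 2 * A = 2 * A * 1 := by ring
          _ ≤ 2 * A * Real.exp (4 * C * s) := by gcongr
      refine lt_of_le_of_lt ?_ (majorant_sum_lt hC hA hB hj)
      rw [norm_mul, hv, mul_one]
      refine (norm_add_le _ _).trans (add_le_add (hb _ (hmem s hs').1 j) ?_)
      refine (norm_sum_le _ _).trans (Finset.sum_le_sum fun l hl => ?_)
      rw [norm_mul, norm_mul, Complex.norm_natCast]
      have hbm := hb _ (hmem s hs').1 (j - l)
      -- The coefficient of index 0 is not covered by the bound, but it enters with the factor l =
      -- 0.
      rcases Nat.eq_zero_or_pos l with rfl | hl0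
      · simp
      have hkl : ‖pdeCoeff c R m l (c + s * v)‖ ≤ B ^ l := by
        rcases (Nat.lt_succ_iff.1 (Finset.mem_range.1 hl)).lt_or_eq with hlj | rfl
        · have := ih l hlj hl0 _ (hmem s hs').1
          rwa [(hmem s hs').2] at this
        · exact heq.le
      gcongr

/-- The equation `k_w = M (1 + y k_y)` has an analytic solution along a disc of `y = 0`: the
function `y * exp k` is then a first integral of `dy = - y M dw`. -/
theorem exists_first_integral_exponent {c : ℂ} {R : ℝ} (hR : 0 < R) {M : ℂ × ℂ → ℂ}
    (hM : ∀ w ∈ Metric.closedBall c R, AnalyticAt ℂ M (w, 0)) :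
    ∃ k : ℂ × ℂ → ℂ, k (c, 0) = 0 ∧ ∀ w ∈ Metric.ball c R, AnalyticAt ℂ k (w, 0) ∧
      ∀ᶠ p in 𝓝 (w, (0 : ℂ)),
        fderiv ℂ k p (1, 0) = M p * (1 + p.2 * fderiv ℂ k p (0, 1)) := by
  obtain ⟨C, A, hC, hA, hb, hsum⟩ := exists_uniform_taylor (isCompact_closedBall c R) hM
  have hb' : ∀ w ∈ Metric.ball c R, ∀ j, ‖taylorSnd M j w‖ ≤ C * A ^ j :=
    fun w hw => hb w (Metric.ball_subset_closedBall hw)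
  have hm : ∀ j, DifferentiableOn ℂ (taylorSnd M j) (Metric.ball c R) := fun j w hw =>
    (analyticAt_taylorSnd (hM w (Metric.ball_subset_closedBall hw)) j).differentiableAt
      |>.differentiableWithinAt
  set κ := pdeCoeff c R (taylorSnd M)
  have hκ : ∀ j, κ j c = 0 ∧ ∀ w ∈ Metric.ball c R, HasDerivAt (κ j) (taylorSnd M j w
      + ∑ l ∈ Finset.range (j + 1), taylorSnd M (j - l) w * (l * κ l w)) w := pdeCoeff_spec hm
  have hκd : ∀ j, DifferentiableOn ℂ (κ j) (Metric.ball c R) :=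
    fun j w hw => ((hκ j).2 w hw).differentiableAt.differentiableWithinAt
  set B := 2 * A * Real.exp (4 * C * R)
  have hBpos : 0 < B := by positivity
  have hκb : ∀ j, ∀ w ∈ Metric.ball c R, ‖κ j w‖ ≤ (C * R + 1) * B ^ j := by
    intro j w hw
    -- The majorant has no growth for j = 0; there the mean value inequality gives C R.
    rcases Nat.eq_zero_or_pos j with rfl | hj
    · have h1 := (convex_ball c R).norm_image_sub_le_of_norm_hasDerivWithin_le (f := κ 0)
        (f' := fun w => taylorSnd M 0 w) (C := C)
        (fun x hx => by simpa using ((hκ 0).2 x hx).hasDerivWithinAt)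
        (fun x hx => by simpa using hb' x hx 0) (Metric.mem_ball_self hR) hw
      rw [(hκ 0).1, sub_zero] at h1
      have h2 : ‖w - c‖ ≤ R := (mem_ball_iff_norm.1 hw).le
      rw [pow_zero, mul_one]
      have : C * ‖w - c‖ ≤ C * R := by gcongr
      linarith
    · have h1 : dist w c ≤ R := (Metric.mem_ball.1 hw).le
      calc ‖κ j w‖ ≤ (2 * A * Real.exp (4 * C * dist w c)) ^ j :=
            pdeCoeff_bound hm hC hA hb' j hj w hw
        _ ≤ (2 * A * Real.exp (4 * C * R)) ^ j := by gcongr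
        _ = 1 * B ^ j := (one_mul _).symm
        _ ≤ _ := by
          gcongr
          have : 0 ≤ C * R := by positivity
          linarith
  have hB1 : ∀ y : ℂ, ‖y‖ < 1 / B → Summable fun j => (C * R + 1) * (B * ‖y‖) ^ j := by
    intro y hy
    refine (summable_geometric_of_lt_one (by positivity) ?_).mul_left _
    rwa [lt_div_iff₀ hBpos, mul_comm] at hy
  have hterm : ∀ j, ∀ w ∈ Metric.ball c R, ∀ y : ℂ,
      ‖κ j w * y ^ j‖ ≤ (C * R + 1) * (B * ‖y‖) ^ j := by
    intro j w hw y
    rw [norm_mul, norm_pow, mul_pow, ← mul_assoc]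
    gcongr
    exact hκb j w hw
  refine ⟨fun p => ∑' j, κ j p.1 * p.2 ^ j, by simp [(hκ _).1], fun w₁ hw₁ => ?_⟩
  obtain ⟨r, hr, hrR⟩ := Metric.isOpen_iff.1 Metric.isOpen_ball w₁ hw₁
  have hkan := analyticAt_tsum_mul_pow (k := κ) hr (fun j => (hκd j).mono hrR)
    fun j w hw => hκb j w (hrR hw)
  refine ⟨hkan, ?_⟩
  have hU : ∀ᶠ p in 𝓝 (w₁, (0 : ℂ)), p.1 ∈ Metric.ball c R ∧ ‖p.2‖ < 1 / A ∧ ‖p.2‖ < 1 / B := by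
    have h1 : ∀ᶠ p in 𝓝 (w₁, (0 : ℂ)), p.1 ∈ Metric.ball c R :=
      continuousAt_fst.eventually (Metric.isOpen_ball.mem_nhds hw₁)
    have h2 : ∀ ε > 0, ∀ᶠ p in 𝓝 (w₁, (0 : ℂ)), ‖p.2‖ < ε := fun ε hε => by
      have := (continuousAt_snd (p := (w₁, (0 : ℂ)))).eventually (Metric.ball_mem_nhds 0 hε)
      simpa using this
    exact h1.and ((h2 _ (by positivity)).and (h2 _ (by positivity)))
  filter_upwards [hU, hkan.eventually_analyticAt] with p hp hpan
  obtain ⟨hp1, hp2, hp3⟩ := hp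
  have hw : HasSum (fun j => (taylorSnd M j p.1
      + ∑ l ∈ Finset.range (j + 1), taylorSnd M (j - l) p.1 * (l * κ l p.1)) * p.2 ^ j)
      (fderiv ℂ (fun p : ℂ × ℂ => ∑' j, κ j p.1 * p.2 ^ j) p (1, 0)) := by
    have h1 := Complex.hasSum_deriv_of_summable_norm (hB1 p.2 hp3)
      (F := fun j w => κ j w * p.2 ^ j) (fun j => (hκd j).mul_const _) Metric.isOpen_ball
      (fun j w hw => hterm j w hw p.2) hp1
    rw [(hasDerivAt_fst hpan).deriv] at h1
    refine h1.congr_fun fun j => ?_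
    exact (((hκ j).2 p.1 hp1).mul_const (p.2 ^ j)).deriv.symm
  have hy : HasSum (fun j => (j * κ j p.1) * p.2 ^ j)
      (p.2 * fderiv ℂ (fun p : ℂ × ℂ => ∑' j, κ j p.1 * p.2 ^ j) p (0, 1)) := by
    obtain ⟨ρ, hρ1, hρ2⟩ := exists_between hp3
    have hρ0 : 0 < ρ := (norm_nonneg _).trans_lt hρ1
    have h1 := Complex.hasSum_deriv_of_summable_norm
      (hB1 ρ (by rwa [Complex.norm_real, Real.norm_of_nonneg hρ0.le]))
      (F := fun j y => κ j p.1 * y ^ j) (U := Metric.ball 0 ρ)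
      (fun j => (differentiable_id.pow j).const_mul _ |>.differentiableOn) Metric.isOpen_ball
      (fun j y hy => (hterm j p.1 hp1 y).trans <| by
        rw [Complex.norm_real, Real.norm_of_nonneg hρ0.le]
        have : ‖y‖ ≤ ρ := (mem_ball_zero_iff.1 hy).le
        have : 0 ≤ C * R := by positivity
        gcongr) (mem_ball_zero_iff.2 hρ1)
    rw [(hasDerivAt_snd hpan).deriv] at h1
    refine (h1.mul_left p.2).congr_fun fun j => ?_
    rw [((hasDerivAt_pow j p.2).const_mul (κ j p.1)).deriv]
    rcases j with _ | j
    · simp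
    · rw [Nat.add_sub_cancel]
      ring
  have hMs := (hsum p.1 (Metric.ball_subset_closedBall hp1) p.2 hp2).2
  -- The recursion for κ is the Cauchy product of the series of M with that of y k_y.
  have hprod := tsum_mul_tsum_eq_tsum_sum_antidiagonal_of_summable_norm hMs.summable.norm
    hy.summable.norm
  rw [hMs.tsum_eq, hy.tsum_eq] at hprod
  have hcauchy : Summable (fun j => ∑ kl ∈ Finset.HasAntidiagonal.antidiagonal j,
      taylorSnd M kl.1 p.1 * p.2 ^ kl.1 * (kl.2 * κ kl.2 p.1 * p.2 ^ kl.2)) :=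
    (summable_norm_sum_mul_antidiagonal_of_summable_norm hMs.summable.norm
      hy.summable.norm).of_norm
  have hall := hMs.add hcauchy.hasSum
  rw [← hprod] at hall
  have heq := hw.unique (hall.congr_fun fun j => ?_)
  · rw [heq]
    ring
  · rw [← Finset.Nat.sum_antidiagonal_swap, Finset.Nat.sum_antidiagonal_eq_sum_range_succ_mk, add_mul,
      Finset.sum_mul]
    congr 1
    refine Finset.sum_congr rfl fun l hl => ?_
    have hl' : l ≤ j := Nat.lt_succ_iff.1 (Finset.mem_range.1 hl)
    simp only [Prod.swap]
    rw [← Nat.sub_add_cancel hl', Nat.add_sub_cancel, pow_add]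
    ring

/-! ### Division by powers of y and descent from the blow-up to the plane -/

/-- Cancellation of a power of `y`. -/
lemma eventuallyEq_of_pow_snd_mul_eq {A B : ℂ × ℂ → ℂ} {c : ℂ} {n : ℕ}
    (hA : AnalyticAt ℂ A (c, 0)) (hB : AnalyticAt ℂ B (c, 0))
    (h : ∀ᶠ p in 𝓝 (c, (0 : ℂ)), p.2 ^ n * A p = p.2 ^ n * B p) :
    A =ᶠ[𝓝 (c, 0)] B := by
  filter_upwards [h.eventually_nhds, hA.eventually_analyticAt, hB.eventually_analyticAt]
    with p hp hAp hBp
  by_cases hy : p.2 = 0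
  · have hA' : ContinuousAt (fun y => A (p.1, y)) p.2 := (analyticAt_slice hAp).continuousAt
    have hB' : ContinuousAt (fun y => B (p.1, y)) p.2 := (analyticAt_slice hBp).continuousAt
    have h1 : (fun y => A (p.1, y)) =ᶠ[𝓝[≠] p.2] fun y => B (p.1, y) := by
      have := ((tendsto_mk_right p.1 p.2).eventually hp).filter_mono
        (nhdsWithin_le_nhds (s := {p.2}ᶜ))
      filter_upwards [this, self_mem_nhdsWithin] with y hy1 hy2
      have hy2' : y ≠ 0 := by
        rw [← hy]
        exact hy2
      exact mul_left_cancel₀ (pow_ne_zero n hy2') hy1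
    exact tendsto_nhds_unique (hA'.tendsto.mono_left nhdsWithin_le_nhds)
      ((hB'.tendsto.mono_left nhdsWithin_le_nhds).congr' h1.symm)
  · exact mul_left_cancel₀ (pow_ne_zero n hy) hp.self_of_nhds

/-- Division by `y ^ n` of an analytic function along a disc of `y = 0`. -/
lemma exists_eq_pow_snd_mul_of_disc {f : ℂ × ℂ → ℂ} {c : ℂ} {R : ℝ} (hR : 0 < R)
    (hf : ∀ w ∈ Metric.ball c R, AnalyticAt ℂ f (w, 0)) (n : ℕ) {r : ℂ × ℂ → ℂ}
    (hr : AnalyticAt ℂ r (c, 0)) (h : ∀ᶠ p in 𝓝 (c, (0 : ℂ)), f p = p.2 ^ n * r p) :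
    ∃ D : ℂ × ℂ → ℂ, (∀ w ∈ Metric.ball c R, AnalyticAt ℂ D (w, 0)) ∧
      ∀ w ∈ Metric.ball c R, ∀ᶠ p in 𝓝 (w, (0 : ℂ)), f p = p.2 ^ n * D p := by
  induction n generalizing r with
  | zero => exact ⟨f, hf, fun w _ => Eventually.of_forall fun p => by simp⟩
  | succ n ih =>
    have hyr : AnalyticAt ℂ (fun p : ℂ × ℂ => p.2 * r p) (c, 0) := analyticAt_snd.mul hr
    obtain ⟨D, hD, hfD⟩ := ih hyr (h.mono fun p hp => by rw [hp]; ring)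
    have hcen := Metric.mem_ball_self (x := c) hR
    have hDr : D =ᶠ[𝓝 (c, 0)] fun p => p.2 * r p := by
      refine eventuallyEq_of_pow_snd_mul_eq (n := n) (hD c hcen) hyr ?_
      filter_upwards [h, hfD c hcen] with p h1 h2
      rw [← h2, h1]
      ring
    -- The identity theorem carries the vanishing on y = 0 from the centre to the whole disc.
    have hD0 : ∀ w ∈ Metric.ball c R, D (w, 0) = 0 := by
      have han : AnalyticOnNhd ℂ (fun w => D (w, 0)) (Metric.ball c R) := fun w hw =>
        AnalyticAt.fun_comp (g := D) (f := fun w => (w, (0 : ℂ))) (hD w hw) (by fun_prop)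
      have := han.eqOn_of_preconnected_of_eventuallyEq (g := fun _ => 0) analyticOnNhd_const
        (convex_ball c R).isPreconnected hcen (by
          filter_upwards [(tendsto_mk_left c 0).eventually hDr] with w hw
          simpa using hw)
      exact this
    -- One quotient is needed over the whole disc, so D / y is written explicitly and extended to y
    -- = 0 by the value of ∂D/∂y.
    refine ⟨fun p => if p.2 = 0 then fderiv ℂ D p (0, 1) else D p / p.2, ?_, ?_⟩
    · intro w hw
      obtain ⟨g, hg, hDg⟩ := exists_eq_snd_mul (hD w hw) (by
        filter_upwards [Metric.isOpen_ball.mem_nhds hw] with x hx using hD0 x hx)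
      refine hg.congr ?_
      filter_upwards [hDg.eventually_nhds, hg.eventually_analyticAt] with p hp hgp
      split_ifs with hy
      · have h1 : HasFDerivAt D (p.2 • fderiv ℂ g p + g p • ContinuousLinearMap.snd ℂ ℂ ℂ) p :=
          ((hasFDerivAt_snd (p := p)).mul hgp.differentiableAt.hasFDerivAt).congr_of_eventuallyEq hp
        rw [h1.fderiv]
        simp [hy]
      · rw [hp.self_of_nhds]
        field_simp
    · intro w hw
      filter_upwards [hfD w hw, (continuousAt_fst (p := (w, (0 : ℂ)))).eventually
        (Metric.isOpen_ball.mem_nhds hw)] with p hp hpw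
      rw [hp]
      split_ifs with hy
      · have : D p = 0 := by
          have hp0 : p = (p.1, 0) := by rw [← hy]
          rw [hp0]
          exact hD0 p.1 hpw
        simp [hy, this]
      · rw [pow_succ]
        field_simp

/-- The homogeneous component of degree `n` of an analytic function. -/
lemma exists_homogeneous_component {N : ℂ × ℂ → ℂ} (hN : AnalyticAt ℂ N 0) (n : ℕ) :
    ∃ q : Polynomial ℂ, q.natDegree ≤ n ∧ ∀ (t : ℂ) (r : ℂ → ℂ), AnalyticAt ℂ r 0 →
      (∀ᶠ y in 𝓝 (0 : ℂ), N (t * y, y) = y ^ n * r y) → r 0 = q.eval t := by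
  obtain ⟨a, ha⟩ := exists_hasDoubleSeries hN
  refine ⟨∑ k ∈ Finset.HasAntidiagonal.antidiagonal n,
    Polynomial.C (a k.1 k.2) * Polynomial.X ^ k.1, ?_, fun t r hr h => ?_⟩
  · refine Polynomial.natDegree_sum_le_of_forall_le _ _ fun k hk => ?_
    refine (Polynomial.natDegree_C_mul_X_pow_le _ _).trans ?_
    have := Finset.HasAntidiagonal.mem_antidiagonal.1 hk
    omega
  · have ht : Tendsto (fun y : ℂ => (t * y, y)) (𝓝 0) (𝓝 0) := by
      have : ContinuousAt (fun y : ℂ => (t * y, y)) 0 := by fun_prop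
      simpa [ContinuousAt, ← Prod.zero_eq_mk] using this
    have h1 : ∀ᶠ y in 𝓝 (0 : ℂ), HasSum (fun n => (∑ k ∈ Finset.HasAntidiagonal.antidiagonal n,
        a k.1 k.2 * t ^ k.1) * y ^ n) (N (t * y, y)) := by
      filter_upwards [ht.eventually ha.2] with y hy
      refine (hasSum_antidiagonal hy).congr_fun fun n => ?_
      rw [Finset.sum_mul]
      refine Finset.sum_congr rfl fun k hk => ?_
      rw [← Finset.HasAntidiagonal.mem_antidiagonal.1 hk, mul_pow, pow_add]
      ring
    rw [← coeff_of_eq_pow_mul h1 hr h, Polynomial.eval_finsetSum]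
    simp

/-- An analytic germ which vanishes near one direction vanishes. -/
lemma eventually_eq_zero_of_blowup {N : ℂ × ℂ → ℂ} (hN : AnalyticAt ℂ N 0) {t₀ : ℂ}
    (h : ∀ᶠ p in 𝓝 (t₀, (0 : ℂ)), p.2 ≠ 0 → N (p.1 * p.2, p.2) = 0) :
    ∀ᶠ p in 𝓝 (0 : ℂ × ℂ), N p = 0 := by
  obtain ⟨ε, hε, hb⟩ := Metric.eventually_nhds_iff_ball.1 hN.eventually_analyticAt
  have ht : Tendsto (fun y : ℂ => (t₀ * y, y)) (𝓝 0) (𝓝 0) := by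
    have : ContinuousAt (fun y : ℂ => (t₀ * y, y)) 0 := by fun_prop
    simpa [ContinuousAt, ← Prod.zero_eq_mk] using this
  have h1 : ∀ᶠ y in 𝓝[≠] (0 : ℂ), (t₀ * y, y) ∈ Metric.ball (0 : ℂ × ℂ) ε ∧
      ∀ᶠ p in 𝓝 (t₀, y), p.2 ≠ 0 → N (p.1 * p.2, p.2) = 0 :=
    ((ht.eventually (Metric.ball_mem_nhds _ hε)).and
      ((tendsto_mk_right t₀ 0).eventually h.eventually_nhds)).filter_mono nhdsWithin_le_nhds
  -- The cone of directions close to t₀ has interior points arbitrarily close to the origin; the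
  -- identity theorem on a ball starts from one of them.
  obtain ⟨y, ⟨hy1, hy2⟩, hy0⟩ := (h1.and self_mem_nhdsWithin).exists
  have hy0' : y ≠ 0 := hy0
  have hev : N =ᶠ[𝓝 (t₀ * y, y)] fun _ => 0 := by
    have hc : ContinuousAt (fun p : ℂ × ℂ => (p.1 / p.2, p.2)) (t₀ * y, y) :=
      (continuousAt_fst.div continuousAt_snd hy0').prodMk continuousAt_snd
    have hc' : Tendsto (fun p : ℂ × ℂ => (p.1 / p.2, p.2)) (𝓝 (t₀ * y, y)) (𝓝 (t₀, y)) := by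
      simpa [ContinuousAt, hy0'] using hc
    filter_upwards [hc'.eventually hy2, continuousAt_snd.eventually_ne hy0'] with p hp hp0
    simpa [div_mul_cancel₀ _ hp0] using hp hp0
  have := AnalyticOnNhd.eqOn_of_preconnected_of_eventuallyEq (f := N) (g := fun _ => 0)
    (fun p hp => hb p hp) analyticOnNhd_const (convex_ball 0 ε).isPreconnected hy1 hev
  filter_upwards [Metric.ball_mem_nhds _ hε] with p hp using this hp

/-- Repeated division by y. The assumption on the coefficients makes the remainder of index j a
polynomial of degree at most j in the first variable, which is what a monomial of the plane gives
after blow-up. -/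
lemma HasDoubleSeries.iterate_step {f : ℂ × ℂ → ℂ} {b : ℕ → ℕ → ℂ} (h : HasDoubleSeries f b)
    (m : ℕ) (hb : ∀ j < m, ∀ i, j < i → b i j = 0) :
    ∃ g, HasDoubleSeries g (fun i j => b i (j + m)) ∧ ∀ᶠ p in 𝓝 (0 : ℂ × ℂ),
      f p = ∑ j ∈ Finset.range m, p.2 ^ j * ∑ i ∈ Finset.range (j + 1), b i j * p.1 ^ i
        + p.2 ^ m * g p := by
  induction m with
  | zero => exact ⟨f, h, Eventually.of_forall fun p => by simp⟩
  | succ m ih =>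
    obtain ⟨g, hg, hfg⟩ := ih fun j hj => hb j (by omega)
    obtain ⟨g', hg', hgg'⟩ := hg.step
    refine ⟨g', by simpa [add_right_comm, add_assoc] using hg', ?_⟩
    filter_upwards [hfg, hgg', (tendsto_fst_nhds 0 0).eventually hg.hasSum_fst] with p h1 h2 h3
    have h4 : HasSum (fun i => b i (0 + m) * p.1 ^ i)
        (∑ i ∈ Finset.range (m + 1), b i (0 + m) * p.1 ^ i) :=
      hasSum_sum_of_ne_finset_zero fun i hi => by
        rw [zero_add, hb m (by omega) i (by simpa using hi), zero_mul]
    rw [h1, h2, h3.unique h4, zero_add, Finset.sum_range_succ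
      (fun j => p.2 ^ j * ∑ i ∈ Finset.range (j + 1), b i j * p.1 ^ i) m]
    ring

/-- A function analytic near a point `(t₀, 0)` of the blow-up comes from an analytic function
on the plane if its Taylor coefficients in `y` are successively polynomials in `t = x / y` of
the right degree. -/
lemma exists_blowdown {G : ℂ × ℂ → ℂ} {t₀ : ℂ} (hG : AnalyticAt ℂ G (t₀, 0))
    (H : ∀ (m : ℕ) (P r : ℂ × ℂ → ℂ), AnalyticAt ℂ P 0 → AnalyticAt ℂ r (t₀, 0) →
      (∀ᶠ p in 𝓝 (t₀, (0 : ℂ)), G p - P (p.1 * p.2, p.2) = p.2 ^ m * r p) →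
      ∃ q : Polynomial ℂ, q.natDegree ≤ m ∧ ∀ᶠ t in 𝓝 t₀, r (t, 0) = q.eval t) :
    ∃ F : ℂ × ℂ → ℂ, AnalyticAt ℂ F 0 ∧ ∀ᶠ p in 𝓝 (t₀, (0 : ℂ)), F (p.1 * p.2, p.2) = G p := by
  have hG0 : AnalyticAt ℂ (fun p : ℂ × ℂ => G (p + (t₀, 0))) 0 :=
    AnalyticAt.fun_comp (g := G) (f := fun p : ℂ × ℂ => p + (t₀, 0)) (by simpa using hG)
      (by fun_prop)
  obtain ⟨b, hb⟩ := exists_hasDoubleSeries hG0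
  have htr : Tendsto (fun p : ℂ × ℂ => p + (-t₀, 0)) (𝓝 (t₀, 0)) (𝓝 0) := by
    have := tendsto_translate (t₀, 0) (-t₀, 0)
    simpa [← Prod.zero_eq_mk] using this
  -- The coefficients b i m, for fixed m, expand r(·, 0) at t₀, where y^m r remains after
  -- subtracting the lower orders. By induction those lower orders come from a polynomial P of the
  -- plane, so the hypothesis bounds the degree of r(·, 0) by m.
  have hb0 : ∀ m, ∀ i, m < i → b i m = 0 := by
    intro m
    induction m using Nat.strong_induction_on with
    | _ m ih =>
      obtain ⟨g, hg, hfg⟩ := hb.iterate_step m ih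
      let P : ℂ × ℂ → ℂ := fun p => ∑ j ∈ Finset.range m, ∑ i ∈ Finset.range (j + 1),
        b i j * (p.1 - t₀ * p.2) ^ i * p.2 ^ (j - i)
      have hP : AnalyticAt ℂ P 0 := by
        refine Finset.analyticAt_fun_sum _ fun j _ => Finset.analyticAt_fun_sum _ fun i _ => ?_
        fun_prop
      obtain ⟨q, hq, hrq⟩ := H m P (fun p => g (p + (-t₀, 0))) hP
        (AnalyticAt.fun_comp (g := g) (f := fun p : ℂ × ℂ => p + (-t₀, 0))
          (by simpa [← Prod.zero_eq_mk] using hg.analyticAt) (by fun_prop)) (by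
        filter_upwards [htr.eventually hfg] with p hp
        have hp' : p + (-t₀, 0) + (t₀, 0) = p := by ext <;> simp
        rw [hp'] at hp
        rw [hp, sub_eq_iff_eq_add, add_comm]
        have h2 : (p + (-t₀, 0)).2 = p.2 := by simp
        have h1 : (p + (-t₀, 0)).1 = p.1 - t₀ := by simp [sub_eq_add_neg]
        rw [h2, h1]
        suffices hs : ∑ j ∈ Finset.range m, p.2 ^ j * ∑ i ∈ Finset.range (j + 1),
            b i j * (p.1 - t₀) ^ i = P (p.1 * p.2, p.2) by
          rw [hs]
        refine Finset.sum_congr rfl fun j _ => ?_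
        rw [Finset.mul_sum]
        refine Finset.sum_congr rfl fun i hi => ?_
        have hij : i ≤ j := Nat.lt_succ_iff.1 (Finset.mem_range.1 hi)
        obtain ⟨l, rfl⟩ := Nat.exists_eq_add_of_le hij
        rw [Nat.add_sub_cancel_left, ← sub_mul, mul_pow, pow_add]
        ring)
      have hsum1 := hg.hasSum_fst
      have hq' : ∀ᶠ x in 𝓝 (0 : ℂ), HasSum
          (fun i => (q.comp (Polynomial.X + Polynomial.C t₀)).coeff i * x ^ i) (g (x, 0)) := by
        have hx : Tendsto (fun x : ℂ => x + t₀) (𝓝 0) (𝓝 t₀) := by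
          have : ContinuousAt (fun x : ℂ => x + t₀) 0 := by fun_prop
          simpa [ContinuousAt] using this
        filter_upwards [hx.eventually hrq] with x hx
        have h1 : g (x, 0) = (q.comp (Polynomial.X + Polynomial.C t₀)).eval x := by
          simpa using hx
        rw [h1, Polynomial.eval_eq_sum_range]
        exact hasSum_sum_of_ne_finset_zero fun i hi => by
          rw [Polynomial.coeff_eq_zero_of_natDegree_lt (by simpa using hi), zero_mul]
      intro i hi
      have := congrFun (coeff_unique hsum1 hq') i
      rw [zero_add] at this
      rw [this]
      refine Polynomial.coeff_eq_zero_of_natDegree_lt (lt_of_le_of_lt ?_ hi)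
      rw [Polynomial.natDegree_comp, Polynomial.natDegree_X_add_C, mul_one]
      exact hq
  obtain ⟨C, R, hC, hR, hbd⟩ := hb.bound
  -- The term (t - t₀)^i y^{i+k} becomes (x - t₀ y)^i y^k. Its old total exponent 2 i + k is at most
  -- 2 (i + k), whence the square of R.
  have hbd' : ∀ i k, ‖(fun i k => b i (i + k)) i k‖ ≤ C * (R ^ 2) ^ (i + k) := fun i k => by
    refine (hbd i (i + k)).trans ?_
    rw [← pow_mul]
    gcongr
    omega
  have hF := hasDoubleSeries_tsum hbd'
  refine ⟨fun p => ∑' n : ℕ × ℕ, b n.1 (n.1 + n.2) * (p.1 - t₀ * p.2) ^ n.1 * p.2 ^ n.2, ?_, ?_⟩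
  · refine AnalyticAt.fun_comp
      (g := fun p => ∑' n : ℕ × ℕ, b n.1 (n.1 + n.2) * p.1 ^ n.1 * p.2 ^ n.2)
      (f := fun p : ℂ × ℂ => (p.1 - t₀ * p.2, p.2)) (x := 0) ?_ ?_
    · simpa [← Prod.zero_eq_mk] using hF.analyticAt
    · fun_prop
  · filter_upwards [htr.eventually hb.2] with p hp
    have hp' : p + (-t₀, 0) + (t₀, 0) = p := by ext <;> simp
    rw [hp'] at hp
    have h2 : (p + (-t₀, 0)).2 = p.2 := by simp
    have h1 : (p + (-t₀, 0)).1 = p.1 - t₀ := by simp [sub_eq_add_neg]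
    rw [h2, h1] at hp
    have hinj : Function.Injective (fun n : ℕ × ℕ => (n.1, n.1 + n.2)) := by
      rintro ⟨i, j⟩ ⟨i', j'⟩ h
      simp only [Prod.mk.injEq] at h
      ext <;> simp only <;> omega
    rw [← hinj.hasSum_iff] at hp
    · rw [← hp.tsum_eq]
      refine tsum_congr fun n => ?_
      simp only [Function.comp_apply]
      rw [← sub_mul, mul_pow, pow_add]
      ring
    · rintro ⟨i, j⟩ hij
      have : j < i := by
        by_contra hle
        exact hij ⟨(i, j - i), by simp only [Prod.mk.injEq, true_and]; omega⟩
      simp [hb0 j i this]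

/-! ### First integrals of regular foliations -/

lemma clm_apply_prod (T : ℂ × ℂ →L[ℂ] ℂ) (v : ℂ × ℂ) :
    T v = v.1 * T (1, 0) + v.2 * T (0, 1) := by
  have : v = v.1 • ((1 : ℂ), (0 : ℂ)) + v.2 • ((0 : ℂ), (1 : ℂ)) := by ext <;> simp
  conv_lhs => rw [this]
  rw [map_add, map_smul, map_smul, smul_eq_mul, smul_eq_mul]

/-- The chain rule for the blow-up `(t, y) ↦ (t y, y)`. -/
lemma fderiv_blowup {P : ℂ × ℂ → ℂ} {p : ℂ × ℂ} (hP : AnalyticAt ℂ P (p.1 * p.2, p.2))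
    (v : ℂ × ℂ) : fderiv ℂ (fun p : ℂ × ℂ => P (p.1 * p.2, p.2)) p v
      = fderiv ℂ P (p.1 * p.2, p.2) (p.1 * v.2 + p.2 * v.1, v.2) := by
  have h1 : HasFDerivAt (fun p : ℂ × ℂ => (p.1 * p.2, p.2)) _ p :=
    ((hasFDerivAt_fst (p := p)).mul hasFDerivAt_snd).prodMk (hasFDerivAt_snd (𝕜 := ℂ))
  have h2 := hP.differentiableAt.hasFDerivAt.comp (f := fun p : ℂ × ℂ => (p.1 * p.2, p.2)) p h1
  have h3 : fderiv ℂ (fun p : ℂ × ℂ => P (p.1 * p.2, p.2)) p = _ := h2.fderiv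
  rw [h3]
  simp

/-- The additional factor y on both sides replaces the exponent m - 1 by m, so that m = 0 needs no
separate treatment. -/
lemma fderiv_pow_snd_mul {r : ℂ × ℂ → ℂ} {p : ℂ × ℂ} (hr : AnalyticAt ℂ r p) (m : ℕ)
    (v : ℂ × ℂ) : p.2 * fderiv ℂ (fun p : ℂ × ℂ => p.2 ^ m * r p) p v
      = p.2 ^ m * (m * v.2 * r p + p.2 * fderiv ℂ r p v) := by
  have h1 : HasFDerivAt (fun p : ℂ × ℂ => p.2 ^ m * r p) _ p :=
    ((hasFDerivAt_snd (p := p) (𝕜 := ℂ)).pow m).mul hr.differentiableAt.hasFDerivAt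
  rw [h1.fderiv]
  rcases m with _ | m
  · simp
  · simp only [add_apply, smul_apply, ContinuousLinearMap.coe_snd', smul_eq_mul, nsmul_eq_mul,
      Nat.add_sub_cancel]
    ring

lemma tendsto_blowup (t : ℂ) :
    Tendsto (fun p : ℂ × ℂ => (p.1 * p.2, p.2)) (𝓝 (t, 0)) (𝓝 0) := by
  have : ContinuousAt (fun p : ℂ × ℂ => (p.1 * p.2, p.2)) (t, 0) := by fun_prop
  simpa [ContinuousAt, ← Prod.zero_eq_mk] using this

lemma analyticAt_blowup {P : ℂ × ℂ → ℂ} (hP : AnalyticAt ℂ P 0) (t : ℂ) :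
    AnalyticAt ℂ (fun p : ℂ × ℂ => P (p.1 * p.2, p.2)) (t, 0) :=
  AnalyticAt.fun_comp (g := P) (f := fun p : ℂ × ℂ => (p.1 * p.2, p.2))
    (by simpa [← Prod.zero_eq_mk] using hP) (by fun_prop)

lemma exists_polynomial_antideriv {n : ℕ} (q : Polynomial ℂ) (hq : q.natDegree ≤ n) :
    ∃ Q : Polynomial ℂ, Q.natDegree ≤ n + 1 ∧ Q.derivative = q := by
  refine ⟨∑ i ∈ Finset.range (n + 1), Polynomial.C (q.coeff i / (i + 1)) * Polynomial.X ^ (i + 1),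
    ?_, ?_⟩
  · refine Polynomial.natDegree_sum_le_of_forall_le _ _ fun i hi => ?_
    refine (Polynomial.natDegree_C_mul_X_pow_le _ _).trans ?_
    have := Finset.mem_range.1 hi
    omega
  · rw [Polynomial.derivative_sum]
    conv_rhs => rw [q.as_sum_range_C_mul_X_pow' (n := n + 1) (by omega)]
    refine Finset.sum_congr rfl fun i _ => ?_
    rw [Polynomial.derivative_C_mul_X_pow, Nat.add_sub_cancel]
    congr 2
    push_cast
    have : (i : ℂ) + 1 ≠ 0 := by exact_mod_cast i.succ_ne_zero
    field_simp

/-- A function whose derivative is a polynomial is a polynomial. -/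
lemma eventually_eq_polynomial_of_deriv {r : ℂ → ℂ} {t₀ : ℂ} (hr : AnalyticAt ℂ r t₀)
    {Q : Polynomial ℂ} (h : ∀ᶠ t in 𝓝 t₀, deriv r t = Q.derivative.eval t) :
    ∃ c : ℂ, ∀ᶠ t in 𝓝 t₀, r t = (Q + Polynomial.C c).eval t := by
  obtain ⟨ε, hε, hb⟩ := Metric.eventually_nhds_iff_ball.1 (h.and hr.eventually_analyticAt)
  refine ⟨r t₀ - Q.eval t₀, ?_⟩
  have hd : ∀ t ∈ Metric.ball t₀ ε, HasDerivAt (fun t => r t - Q.eval t) 0 t := fun t ht => by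
    have h1 := (hb t ht).2.differentiableAt.hasDerivAt.sub (Q.hasDerivAt t)
    rwa [(hb t ht).1, sub_self] at h1
  filter_upwards [Metric.ball_mem_nhds t₀ hε] with t ht
  have := (convex_ball t₀ ε).norm_image_sub_le_of_norm_hasDerivWithin_le
    (f := fun t => r t - Q.eval t) (f' := fun _ => 0) (C := 0)
    (fun x hx => (hd x hx).hasDerivWithinAt) (fun x _ => by simp) (Metric.mem_ball_self hε) ht
  rw [zero_mul, norm_le_zero_iff, sub_eq_zero] at this
  simp only [Polynomial.eval_add, Polynomial.eval_C, ← this]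
  ring

/-- A first integral of the foliation `dy = f dx` when `f` vanishes at the origin. -/
lemma exists_first_integral_graph {f : ℂ × ℂ → ℂ} (hf : AnalyticAt ℂ f 0) (hf0 : f 0 = 0) :
    ∃ H : ℂ × ℂ → ℂ, AnalyticAt ℂ H 0 ∧ H 0 = 0 ∧ fderiv ℂ H 0 (0, 1) ≠ 0 ∧
      ∀ᶠ p in 𝓝 (0 : ℂ × ℂ), fderiv ℂ H p (1, f p) = 0 := by
  set F : ℂ × ℂ → ℂ := fun p => f (p.1 * p.2, p.2)
  have hF : ∀ t, AnalyticAt ℂ F (t, 0) := analyticAt_blowup hf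
  have hF0 : ∀ t, F (t, 0) = 0 := fun t => by simpa [F, ← Prod.zero_eq_mk] using hf0
  have hden : ∀ t : ℂ, 1 - t * F (t, 0) ≠ 0 := fun t => by simp [hF0]
  -- With x = t y the equation dy = f dx becomes (1 - t F) dy = y F dt. The divisor y = 0 is a leaf,
  -- and y e^k is a first integral for this M.
  obtain ⟨k, hk0, hk⟩ := exists_first_integral_exponent (c := 0) (R := 1) one_pos
    (M := fun p => -F p / (1 - p.1 * F p)) fun w _ => by
      have := hF w
      exact this.neg.div (analyticAt_const.sub (analyticAt_fst.mul this)) (hden w)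
  obtain ⟨hkan, hkpde⟩ := hk 0 (Metric.mem_ball_self one_pos)
  set G : ℂ × ℂ → ℂ := fun p => p.2 * Complex.exp (k p)
  have hG : AnalyticAt ℂ G (0, 0) := analyticAt_snd.mul hkan.cexp
  let V : ℂ × ℂ → ℂ × ℂ := fun p => (1 - p.1 * F p, p.2 * F p)
  have hGV : ∀ᶠ p in 𝓝 ((0 : ℂ), (0 : ℂ)), fderiv ℂ G p (V p) = 0 := by
    have hden' : ∀ᶠ p in 𝓝 ((0 : ℂ), (0 : ℂ)), 1 - p.1 * F p ≠ 0 :=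
      (continuousAt_const.sub (continuousAt_fst.mul (hF 0).continuousAt)).eventually_ne (hden 0)
    filter_upwards [hkpde, hkan.eventually_analyticAt, hden'] with p hp hkp hdp
    have h1 : HasFDerivAt G _ p :=
      (hasFDerivAt_snd (p := p) (𝕜 := ℂ)).mul hkp.differentiableAt.hasFDerivAt.cexp
    rw [h1.fderiv]
    simp only [add_apply, smul_apply, ContinuousLinearMap.coe_snd', smul_eq_mul, V]
    rw [clm_apply_prod (fderiv ℂ k p), hp]
    field_simp
    ring
  have hVc : ∀ r : ℂ × ℂ → ℂ, AnalyticAt ℂ r (0, 0) →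
      AnalyticAt ℂ (fun p => fderiv ℂ r p (V p)) (0, 0) := fun r hr => by
    have h1 : (fun p => fderiv ℂ r p (V p)) = fun p => (1 - p.1 * F p) * fderiv ℂ r p (1, 0)
        + p.2 * F p * fderiv ℂ r p (0, 1) := by
      funext p
      rw [clm_apply_prod]
    rw [h1]
    exact ((analyticAt_const.sub (analyticAt_fst.mul (hF 0))).mul (analyticAt_fderiv_apply hr _)).add
      ((analyticAt_snd.mul (hF 0)).mul (analyticAt_fderiv_apply hr _))
  have hPV : ∀ P : ℂ × ℂ → ℂ, AnalyticAt ℂ P 0 → ∀ᶠ p in 𝓝 ((0 : ℂ), (0 : ℂ)),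
      fderiv ℂ (fun p : ℂ × ℂ => P (p.1 * p.2, p.2)) p (V p)
        = p.2 * fderiv ℂ P (p.1 * p.2, p.2) (1, f (p.1 * p.2, p.2)) := by
    intro P hP
    filter_upwards [(tendsto_blowup 0).eventually hP.eventually_analyticAt] with p hp
    rw [fderiv_blowup hp, clm_apply_prod, clm_apply_prod _ (1, f (p.1 * p.2, p.2))]
    simp only [V, F]
    ring
  have hE : ∀ P : ℂ × ℂ → ℂ, AnalyticAt ℂ P 0 →
      AnalyticAt ℂ (fun p => fderiv ℂ P p (1, f p)) 0 := fun P hP => by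
    have h1 : (fun p => fderiv ℂ P p (1, f p)) = fun p => fderiv ℂ P p (1, 0)
        + f p * fderiv ℂ P p (0, 1) := by
      funext p
      rw [clm_apply_prod, one_mul]
    rw [h1]
    exact (analyticAt_fderiv_apply hP _).add (hf.mul (analyticAt_fderiv_apply hP _))
  -- The leaf derivation V kills G. Applied to G - P = y^m r it shows, on y = 0, that the derivative
  -- of r(·, 0) is minus the homogeneous component of degree m - 1 of the derivative of P along (1,
  -- f). Thus r(·, 0) is a primitive of a polynomial of degree at most m - 1, and it is constant if
  -- m = 0.
  obtain ⟨H, hH, hHG⟩ := exists_blowdown (t₀ := 0) hG fun m P r hP hr hGP => by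
    have hS : AnalyticAt ℂ (fun p => m * F p * r p + fderiv ℂ r p (V p)) (0, 0) :=
      ((analyticAt_const.mul (hF 0)).mul hr).add (hVc r hr)
    have key : ∀ᶠ p in 𝓝 ((0 : ℂ), (0 : ℂ)), p.2 ^ m * (m * F p * r p + fderiv ℂ r p (V p))
        = p.2 ^ 1 * -(fderiv ℂ P (p.1 * p.2, p.2) (1, f (p.1 * p.2, p.2))) := by
      have hEP : AnalyticAt ℂ
          (fun p : ℂ × ℂ => -(fderiv ℂ P (p.1 * p.2, p.2) (1, f (p.1 * p.2, p.2)))) (0, 0) :=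
        (analyticAt_blowup (hE P hP) 0).neg
      refine eventuallyEq_of_pow_snd_mul_eq (n := 1)
        ((analyticAt_snd.pow m).mul hS) ((analyticAt_snd.pow 1).mul hEP) ?_
      filter_upwards [hGP.eventually_nhds, hGV, hPV P hP, hr.eventually_analyticAt,
        hG.eventually_analyticAt, (analyticAt_blowup hP 0).eventually_analyticAt]
        with p h1 h2 h3 h4 h5 h6
      have h7 := fderiv_pow_snd_mul h4 m (V p)
      have h8 : (fun p : ℂ × ℂ => p.2 ^ m * r p) =ᶠ[𝓝 p] fun p => G p - P (p.1 * p.2, p.2) := by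
        filter_upwards [h1] with q hq using hq.symm
      rw [h8.fderiv_eq, fderiv_fun_sub h5.differentiableAt h6.differentiableAt, sub_apply, h2, h3]
        at h7
      simp only [pow_one]
      have h9 : (V p).2 = p.2 * F p := rfl
      rw [h9] at h7
      linear_combination -h7
    have hrt : AnalyticAt ℂ (fun t => r (t, 0)) 0 :=
      AnalyticAt.fun_comp (g := r) (f := fun t => (t, (0 : ℂ))) hr (by fun_prop)
    have hderiv : ∀ᶠ t in 𝓝 (0 : ℂ), deriv (fun t => r (t, 0)) t
        = m * F (t, 0) * r (t, 0) + fderiv ℂ r (t, 0) (V (t, 0)) := by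
      filter_upwards [(tendsto_mk_left 0 0).eventually hr.eventually_analyticAt] with t ht
      rw [(hasDerivAt_fst ht).deriv]
      simp [V, hF0]
    rcases m with _ | n
    · obtain ⟨c, hc⟩ := eventually_eq_polynomial_of_deriv hrt (Q := 0) (by
        filter_upwards [hderiv, (tendsto_mk_left 0 0).eventually key] with t h1 h2
        rw [h1]
        simpa using h2)
      exact ⟨_, by simp, hc⟩
    · obtain ⟨q, hq, hqr⟩ := exists_homogeneous_component (hE P hP) n
      obtain ⟨Q, hQ, hQq⟩ := exists_polynomial_antideriv (n := n) (-q) (by rwa [Polynomial.natDegree_neg])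
      obtain ⟨c, hc⟩ := eventually_eq_polynomial_of_deriv hrt (Q := Q) (by
        have key' : ∀ᶠ p in 𝓝 ((0 : ℂ), (0 : ℂ)),
            p.2 ^ n * ((n + 1 : ℕ) * F p * r p + fderiv ℂ r p (V p))
              = -(fderiv ℂ P (p.1 * p.2, p.2) (1, f (p.1 * p.2, p.2))) :=
          eventuallyEq_of_pow_snd_mul_eq (n := 1) ((analyticAt_snd.pow n).mul hS)
            (analyticAt_blowup (hE P hP) 0).neg (by
              filter_upwards [key] with p hp
              rw [← hp]
              ring)
        filter_upwards [hderiv, (tendsto_mk_left 0 0).eventually key'.eventually_nhds,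
          (tendsto_mk_left 0 0).eventually hS.eventually_analyticAt] with t h1 h2 h3
        rw [h1, hQq, Polynomial.eval_neg]
        have := hqr t (fun y => -((n + 1 : ℕ) * F (t, y) * r (t, y) + fderiv ℂ r (t, y) (V (t, y))))
          (analyticAt_slice h3).neg (by
            filter_upwards [(tendsto_mk_right t 0).eventually h2] with y hy
            linear_combination hy)
        rw [← this, neg_neg])
      refine ⟨_, ?_, hc⟩
      rw [Polynomial.natDegree_add_C]
      exact hQ
  have hHy : ∀ᶠ y in 𝓝 (0 : ℂ), H (0, y) = G (0, y) := by
    filter_upwards [(tendsto_mk_right 0 0).eventually hHG] with y hy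
    simpa using hy
  refine ⟨H, hH, ?_, ?_, ?_⟩
  · have := hHy.self_of_nhds
    simpa [G, ← Prod.zero_eq_mk] using this
  · have h1 : HasDerivAt (fun y => H (0, y)) (fderiv ℂ H 0 (0, 1)) 0 := hasDerivAt_snd hH
    have h2 : HasDerivAt (fun y => G (0, y)) (fderiv ℂ G (0, 0) (0, 1)) 0 := hasDerivAt_snd hG
    have h3 : HasDerivAt (fun y => G (0, y)) (1 * Complex.exp (k (0, 0))
        + 0 * (Complex.exp (k (0, 0)) * fderiv ℂ k (0, 0) (0, 1))) 0 :=
      (hasDerivAt_id (0 : ℂ)).mul (hasDerivAt_snd hkan).cexp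
    rw [h1.unique (h3.congr_of_eventuallyEq hHy)]
    simp
  · refine eventually_eq_zero_of_blowup (hE H hH) (t₀ := 0) ?_
    filter_upwards [hPV H hH, hHG.eventually_nhds, hGV] with p h1 h2 h3 hp
    have h4 : (fun p : ℂ × ℂ => H (p.1 * p.2, p.2)) =ᶠ[𝓝 p] G := h2
    rw [h4.fderiv_eq, h3] at h1
    exact (mul_eq_zero.1 h1.symm).resolve_left hp

/-- A germ of regular holomorphic foliation of the plane has a holomorphic first integral. -/
theorem exists_first_integral_of_regular {η : OneForm} (hη : IsRegularFoliation η) :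
    ∃ z u : Plane → ℂ, AnalyticAt ℂ z 0 ∧ z 0 = 0 ∧ AnalyticAt ℂ u 0 ∧ u 0 ≠ 0 ∧
      ∀ᶠ p in 𝓝 (0 : Plane), η p = u p • fderiv ℂ z p := by
  obtain ⟨hηa, hη0⟩ := hη
  set a := η 0 (1, 0)
  set b := η 0 (0, 1)
  obtain ⟨u, hu⟩ : ∃ u, η 0 u = 1 := by
    obtain ⟨v, hv⟩ : ∃ v, η 0 v ≠ 0 := by
      by_contra hcon
      push Not at hcon
      exact hη0 (ContinuousLinearMap.ext hcon)
    exact ⟨(η 0 v)⁻¹ • v, by rw [map_smul, smul_eq_mul, inv_mul_cancel₀ hv]⟩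
  have hdet : u.1 * a + u.2 * b = 1 := by rw [← hu, clm_apply_prod]
  -- The linear coordinates turn η at the origin into dy: the first basis vector goes to (b, -a) in
  -- the kernel of η 0 and the second to a vector on which η 0 is 1. The map B is the inverse.
  let A : Plane →L[ℂ] Plane := (ContinuousLinearMap.fst ℂ ℂ ℂ).smulRight (b, -a)
    + (ContinuousLinearMap.snd ℂ ℂ ℂ).smulRight u
  let B : Plane →L[ℂ] Plane :=
    (u.2 • ContinuousLinearMap.fst ℂ ℂ ℂ - u.1 • ContinuousLinearMap.snd ℂ ℂ ℂ).prod
      (a • ContinuousLinearMap.fst ℂ ℂ ℂ + b • ContinuousLinearMap.snd ℂ ℂ ℂ)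
  have hA : ∀ p, A p = (p.1 * b + p.2 * u.1, -(p.1 * a) + p.2 * u.2) := fun p => by
    ext <;> simp [A]
  have hB : ∀ p, B p = (u.2 * p.1 - u.1 * p.2, a * p.1 + b * p.2) := fun p => by
    ext <;> simp [B]
  have hAB : ∀ p, A (B p) = p := fun p => by
    rw [hA, hB]
    ext
    · simp only
      linear_combination p.1 * hdet
    · simp only
      linear_combination p.2 * hdet
  have hηA : ∀ v, AnalyticAt ℂ (fun p => η (A p) v) 0 := fun v => by
    have h1 : AnalyticAt ℂ (fun p => η (A p)) 0 :=
      AnalyticAt.fun_comp (g := η) (f := A) (by simpa using hηa) (A.analyticAt 0)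
    exact ((ContinuousLinearMap.apply ℂ ℂ v).analyticAt _).comp h1
  set α : Plane → ℂ := fun p => η (A p) (b, -a)
  set β : Plane → ℂ := fun p => η (A p) u
  have hα0 : α 0 = 0 := by
    simp only [α, map_zero]
    rw [clm_apply_prod]
    ring
  have hβ0 : β 0 = 1 := by simp only [β, map_zero, hu]
  have hβne : β 0 ≠ 0 := by rw [hβ0]; exact one_ne_zero
  obtain ⟨H, hH, hH0, hHy, hHf⟩ := exists_first_integral_graph (f := fun p => -α p / β p)
    ((hηA _).neg.div (hηA _) hβne) (by simp [hα0])
  have hBt : Tendsto B (𝓝 0) (𝓝 0) := by simpa using B.continuous.tendsto 0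
  have hHya := analyticAt_fderiv_apply hH (0, 1)
  refine ⟨fun q => H (B q), fun q => β (B q) / fderiv ℂ H (B q) (0, 1), ?_, by simpa using hH0,
    ?_, ?_, ?_⟩
  · exact AnalyticAt.fun_comp (g := H) (f := B) (by simpa using hH) (B.analyticAt 0)
  · exact AnalyticAt.fun_comp (g := fun p => β p / fderiv ℂ H p (0, 1)) (f := B)
      (by rw [map_zero]; exact (hηA u).div hHya hHy) (B.analyticAt 0)
  · simp only [map_zero]
    exact div_ne_zero hβne hHy
  · have hev : ∀ᶠ p in 𝓝 (0 : Plane), fderiv ℂ H p (1, -α p / β p) = 0 ∧ β p ≠ 0 ∧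
        fderiv ℂ H p (0, 1) ≠ 0 ∧ AnalyticAt ℂ H p :=
      hHf.and (((hηA u).continuousAt.eventually_ne hβne).and
        ((hHya.continuousAt.eventually_ne hHy).and hH.eventually_analyticAt))
    filter_upwards [hBt.eventually hev] with q hq
    obtain ⟨h1, h2, h3, h4⟩ := hq
    have h5 : HasFDerivAt (fun q => H (B q)) ((fderiv ℂ H (B q)).comp B) q :=
      h4.differentiableAt.hasFDerivAt.comp q B.hasFDerivAt
    rw [h5.fderiv]
    refine ContinuousLinearMap.ext fun v => ?_
    obtain ⟨w, rfl⟩ : ∃ w, v = A w := ⟨B v, (hAB v).symm⟩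
    have hBA : B (A w) = w := by
      rw [hA, hB]
      ext
      · simp only
        linear_combination w.1 * hdet
      · simp only
        linear_combination w.2 * hdet
    simp only [smul_apply, ContinuousLinearMap.comp_apply, hBA, smul_eq_mul]
    have h6 : η q (A w) = w.1 * α (B q) + w.2 * β (B q) := by
      simp only [α, β, hAB]
      have : A w = w.1 • (b, -a) + w.2 • u := by simp [A]
      rw [this, map_add, map_smul, map_smul, smul_eq_mul, smul_eq_mul]
    rw [h6, clm_apply_prod _ w]
    rw [clm_apply_prod] at h1
    simp only [one_mul] at h1
    have h7 : fderiv ℂ H (B q) (1, 0) = α (B q) / β (B q) * fderiv ℂ H (B q) (0, 1) := by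
      linear_combination h1
    rw [h7]
    field_simp

/-! ### Germs of diffeomorphisms -/

lemma isDiffeoGerm_univ_iff {E F : Type} [NormedAddCommGroup E] [NormedSpace ℂ E]
    [NormedAddCommGroup F] [NormedSpace ℂ F] {f : E → F} :
    IsDiffeoGerm univ univ f ↔ AnalyticAt ℂ f 0 ∧ f 0 = 0 ∧ ∃ g : F → E, AnalyticAt ℂ g 0 ∧
      g 0 = 0 ∧ (∀ᶠ p in 𝓝 (0 : E), g (f p) = p) ∧ ∀ᶠ q in 𝓝 (0 : F), f (g q) = q := by
  simp [IsDiffeoGerm, nhdsWithin_univ]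

lemma isDiffeoGerm_of_injective_fderiv {E : Type} [NormedAddCommGroup E] [NormedSpace ℂ E]
    [FiniteDimensional ℂ E] {f : E → E} (hf : AnalyticAt ℂ f 0) (h0 : f 0 = 0)
    (hinj : ∀ v, fderiv ℂ f 0 v = 0 → v = 0) : IsDiffeoGerm univ univ f := by
  obtain ⟨g, h1, h2, h3, h4⟩ := exists_analytic_inverse hf hinj
  rw [h0] at h1 h2 h4
  exact isDiffeoGerm_univ_iff.2 ⟨hf, h0, g, h1, h2, h3, h4⟩

lemma isDiffeoGerm_of_deriv_ne_zero {f : ℂ → ℂ} (hf : AnalyticAt ℂ f 0) (h0 : f 0 = 0)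
    (hd : deriv f 0 ≠ 0) : IsDiffeoGerm univ univ f := by
  refine isDiffeoGerm_of_injective_fderiv hf h0 fun v hv => ?_
  have : fderiv ℂ f 0 v = v * deriv f 0 := by
    rw [fderiv_eq_smul_deriv, smul_eq_mul]
  rw [this] at hv
  exact (mul_eq_zero.1 hv).resolve_right hd

lemma analyticAt_tendsto_zero {E F : Type*} [NormedAddCommGroup E] [NormedSpace ℂ E]
    [NormedAddCommGroup F] [NormedSpace ℂ F] {f : E → F} (hf : AnalyticAt ℂ f 0) (h0 : f 0 = 0) :
    Tendsto f (𝓝 0) (𝓝 0) := by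
  simpa [h0] using hf.continuousAt.tendsto

lemma IsDiffeoGerm.injective_fderiv {E F : Type} [NormedAddCommGroup E] [NormedSpace ℂ E]
    [NormedAddCommGroup F] [NormedSpace ℂ F] {f : E → F} (hf : IsDiffeoGerm univ univ f) (v : E)
    (hv : fderiv ℂ f 0 v = 0) : v = 0 := by
  obtain ⟨h1, h2, g, h3, h4, h5, h6⟩ := isDiffeoGerm_univ_iff.1 hf
  have h7 : HasFDerivAt g (fderiv ℂ g 0) (f 0) := by
    rw [h2]
    exact h3.differentiableAt.hasFDerivAt
  have h8 : HasFDerivAt (fun p => g (f p)) ((fderiv ℂ g 0).comp (fderiv ℂ f 0)) 0 :=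
    h7.comp 0 h1.differentiableAt.hasFDerivAt
  have h9 : HasFDerivAt (fun p : E => p) ((fderiv ℂ g 0).comp (fderiv ℂ f 0)) 0 :=
    h8.congr_of_eventuallyEq (h5.mono fun p hp => hp.symm)
  have h10 := congrArg (fun T : E →L[ℂ] E => T v) (h9.unique (hasFDerivAt_id 0))
  simpa [hv] using h10.symm

/-! ### Limits along strictly differentiable functions -/

/-- Strict differentiability is what is needed, since both points of the difference move. This is
the tool for extracting leading terms in what follows. -/
lemma tendsto_smul_sub_of_strict {E F ι : Type*} [NormedAddCommGroup E] [NormedSpace ℂ E]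
    [NormedAddCommGroup F] [NormedSpace ℂ F] {P : E → F} {P' : E →L[ℂ] F} {x : E}
    (hP : HasStrictFDerivAt P P' x) {l : Filter ι} {a b : ι → E} {k : ι → ℂ} {v : E}
    (ha : Tendsto a l (𝓝 x)) (hb : Tendsto b l (𝓝 x))
    (hv : Tendsto (fun s => k s • (a s - b s)) l (𝓝 v)) :
    Tendsto (fun s => k s • (P (a s) - P (b s))) l (𝓝 (P' v)) := by
  have h1 : (fun s => P (a s) - P (b s) - P' (a s - b s)) =o[l] fun s => a s - b s :=
    hP.isLittleO.comp_tendsto (by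
      have := ha.prodMk_nhds hb
      exact this)
  have h2 : (fun s => k s • (P (a s) - P (b s) - P' (a s - b s))) =o[l]
      fun s => k s • (a s - b s) := (Asymptotics.isBigO_refl k l).smul_isLittleO h1
  have h3 : (fun s => k s • (a s - b s)) =O[l] (fun _ => (1 : ℝ)) := hv.isBigO_one ℝ
  have h4 := (Asymptotics.isLittleO_one_iff ℝ).1 (h2.trans_isBigO h3)
  have h5 := h4.add ((P'.continuous.tendsto v).comp hv)
  rw [zero_add] at h5
  refine h5.congr fun s => ?_
  rw [Function.comp_apply, map_smul, ← smul_add, sub_add_cancel]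

lemma tendsto_clm_apply {E F ι : Type*} [NormedAddCommGroup E] [NormedSpace ℂ E]
    [NormedAddCommGroup F] [NormedSpace ℂ F] {l : Filter ι} {T : ι → E →L[ℂ] F} {v : ι → E}
    {T₀ : E →L[ℂ] F} {v₀ : E} (hT : Tendsto T l (𝓝 T₀)) (hv : Tendsto v l (𝓝 v₀)) :
    Tendsto (fun s => T s (v s)) l (𝓝 (T₀ v₀)) :=
  (isBoundedBilinearMap_apply.continuous.tendsto (T₀, v₀)).comp (hT.prodMk_nhds hv)

/-! ### One-variable factorisations -/

lemma exists_eq_mul_of_apply_zero {E : Type*} [NormedAddCommGroup E] [NormedSpace ℂ E]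
    {f : ℂ → E} (hf : AnalyticAt ℂ f 0) (h0 : f 0 = 0) :
    ∃ g : ℂ → E, AnalyticAt ℂ g 0 ∧ g 0 = deriv f 0 ∧ ∀ t, f t = t • g t := by
  obtain ⟨p, hp⟩ := hf
  refine ⟨dslope f 0, ⟨_, hp.has_fpower_series_dslope_fslope⟩, dslope_same _ _, fun t => ?_⟩
  have := sub_smul_dslope f 0 t
  rw [sub_zero, h0, sub_zero] at this
  exact this.symm

/-- Extraction of a `k`-th root. -/
lemma exists_root_param {y g : ℂ → ℂ} {k : ℕ} (hk : k ≠ 0) (hg : AnalyticAt ℂ g 0)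
    (hg0 : g 0 ≠ 0) (hy : ∀ᶠ t in 𝓝 (0 : ℂ), y t = t ^ k * g t) :
    ∃ α : ℂ → ℂ, IsDiffeoGerm univ univ α ∧ ∀ᶠ t in 𝓝 (0 : ℂ), y t = α t ^ k := by
  obtain ⟨c, hc⟩ := IsAlgClosed.exists_pow_nat_eq (g 0) (Nat.pos_of_ne_zero hk)
  have hc0 : c ≠ 0 := by
    rintro rfl
    exact hg0 (by rw [← hc, zero_pow hk])
  have hq : AnalyticAt ℂ (fun t => g t / g 0) 0 := hg.div analyticAt_const hg0
  have hlog : AnalyticAt ℂ (fun t => Complex.log (g t / g 0)) 0 :=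
    hq.clog (by simp [div_self hg0])
  set b : ℂ → ℂ := fun t => c * Complex.exp (Complex.log (g t / g 0) / k)
  have hb : AnalyticAt ℂ b 0 := analyticAt_const.mul (hlog.div analyticAt_const (by exact_mod_cast hk)).cexp
  have hb0 : b 0 = c := by simp [b, div_self hg0]
  have hα : AnalyticAt ℂ (fun t => t * b t) 0 := analyticAt_id.mul hb
  refine ⟨fun t => t * b t, isDiffeoGerm_of_deriv_ne_zero hα (by simp) ?_, ?_⟩
  · have : HasDerivAt (fun t => t * b t) (1 * b 0 + 0 * deriv b 0) 0 :=
      (hasDerivAt_id (0 : ℂ)).mul hb.differentiableAt.hasDerivAt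
    rw [this.deriv, hb0]
    simpa using hc0
  · filter_upwards [hy, hg.continuousAt.eventually_ne hg0] with t ht hgt
    have hk' : (k : ℂ) ≠ 0 := by exact_mod_cast hk
    rw [ht, mul_pow, mul_pow, hc, ← Complex.exp_nat_mul, mul_div_cancel₀ _ hk',
      Complex.exp_log (div_ne_zero hgt hg0), mul_div_cancel₀ _ hg0]

/-! ### Separatrices in linear normal form -/

/-- The linear part of `ω` at the origin is `l₁ y dx + l₂ x dy`. -/
def HasStandardLinearPart (ω : OneForm) (l₁ l₂ : ℂ) : Prop :=
  AnalyticAt ℂ ω 0 ∧ ω 0 = 0 ∧ ∀ p w, fderiv ℂ ω 0 p w = l₁ * p.2 * w.1 + l₂ * p.1 * w.2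

/-- The curve `(X s, s ^ N)` is invariant, and tangent to the `y`-axis. -/
def IsInvariantGraph (ω : OneForm) (N : ℕ) (X : ℂ → ℂ) : Prop :=
  (∃ h, AnalyticAt ℂ h 0 ∧ X =ᶠ[𝓝 0] fun s => s ^ (N + 1) * h s) ∧
    ∀ᶠ s in 𝓝 (0 : ℂ), ω (X s, s ^ N) (deriv X s, N * s ^ (N - 1)) = 0

lemma s_mul_deriv_pow_mul {h : ℂ → ℂ} {s : ℂ} (hh : AnalyticAt ℂ h s) (n : ℕ) :
    s * deriv (fun s => s ^ n * h s) s = s ^ n * (n * h s + s * deriv h s) := by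
  have : HasDerivAt (fun s => s ^ n * h s) (n * s ^ (n - 1) * h s + s ^ n * deriv h s) s :=
    (hasDerivAt_pow n s).mul hh.differentiableAt.hasDerivAt
  rw [this.deriv]
  rcases n with _ | n
  · simp
  · rw [Nat.add_sub_cancel]
    ring

/-- If the graphs differ, X₁ - X₂ = s^m e(s) with e(0) ≠ 0. Subtract the two invariance relations as
ω(a)(a' - b') + (ω(a) - ω(b))(b') = 0. The terms of order s^{N+m-1} give (l₁ m + l₂ N) e(0) = 0, so
l₂ / l₁ = -m / N would be a negative rational number. `L1` to `L4` are the limits of the four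
factors. -/
lemma HasStandardLinearPart.graph_unique {ω : OneForm} {l₁ l₂ : ℂ}
    (hω : HasStandardLinearPart ω l₁ l₂) (hl₁ : l₁ ≠ 0)
    (hnr : ∀ r : ℚ, r < 0 → l₂ / l₁ ≠ (r : ℂ)) {N : ℕ} (hN : N ≠ 0) {X₁ X₂ : ℂ → ℂ}
    (h₁ : IsInvariantGraph ω N X₁) (h₂ : IsInvariantGraph ω N X₂) : X₁ =ᶠ[𝓝 0] X₂ := by
  obtain ⟨⟨g₁, hg₁, hX₁⟩, hi₁⟩ := h₁
  obtain ⟨⟨g₂, hg₂, hX₂⟩, hi₂⟩ := h₂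
  obtain ⟨hωa, hω0, hωl⟩ := hω
  by_contra hne
  have hd : AnalyticAt ℂ (fun s => s ^ (N + 1) * g₁ s - s ^ (N + 1) * g₂ s) 0 :=
    ((analyticAt_id.pow _).mul hg₁).sub ((analyticAt_id.pow _).mul hg₂)
  have hdne : ¬ ∀ᶠ s in 𝓝 (0 : ℂ), s ^ (N + 1) * g₁ s - s ^ (N + 1) * g₂ s = 0 := by
    intro hcon
    refine hne ?_
    filter_upwards [hcon, hX₁, hX₂] with s h1 h2 h3
    rw [h2, h3]
    exact sub_eq_zero.1 h1
  obtain ⟨m, e, he, he0, hde⟩ := hd.exists_eventuallyEq_pow_smul_nonzero_iff.2 hdne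
  simp only [sub_zero, smul_eq_mul] at hde
  have hm : m ≠ 0 := by
    rintro rfl
    have := hde.self_of_nhds
    simp only [pow_zero, one_mul, ne_eq, Nat.add_eq_zero_iff, one_ne_zero, and_false,
      not_false_eq_true, zero_pow, zero_mul, sub_zero] at this
    exact he0 this.symm
  set a : ℂ → ℂ × ℂ := fun s => (s ^ (N + 1) * g₁ s, s ^ N)
  set b : ℂ → ℂ × ℂ := fun s => (s ^ (N + 1) * g₂ s, s ^ N)
  have ht : ∀ g : ℂ → ℂ, AnalyticAt ℂ g 0 →
      Tendsto (fun s => (s ^ (N + 1) * g s, s ^ N)) (𝓝[≠] 0) (𝓝 (0 : ℂ × ℂ)) := fun g hg => by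
    have : ContinuousAt (fun s : ℂ => (s ^ (N + 1) * g s, s ^ N)) 0 :=
      ((continuousAt_id.pow _).mul hg.continuousAt).prodMk (continuousAt_id.pow _)
    have h := this.tendsto
    simp only [ne_eq, Nat.add_eq_zero_iff, one_ne_zero, and_false, not_false_eq_true, zero_pow,
      zero_mul, hN, Prod.mk_zero_zero] at h
    exact h.mono_left nhdsWithin_le_nhds
  have hs0 : Tendsto (fun s : ℂ => s) (𝓝[≠] 0) (𝓝 0) := tendsto_id.mono_left nhdsWithin_le_nhds
  have hc : ∀ g : ℂ → ℂ, AnalyticAt ℂ g 0 → Tendsto g (𝓝[≠] 0) (𝓝 (g 0)) :=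
    fun g hg => hg.continuousAt.tendsto.mono_left nhdsWithin_le_nhds
  have hst := hωa.hasStrictFDerivAt
  have L1 : Tendsto (fun s : ℂ => (s ^ N)⁻¹ • (ω (a s) - ω 0)) (𝓝[≠] 0)
      (𝓝 (fderiv ℂ ω 0 (0, 1))) := by
    refine tendsto_smul_sub_of_strict hst (b := fun _ => 0) (ht g₁ hg₁) tendsto_const_nhds ?_
    have h1 : Tendsto (fun s => (s * g₁ s, (1 : ℂ))) (𝓝[≠] 0) (𝓝 ((0 : ℂ) * g₁ 0, 1)) :=
      (hs0.mul (hc g₁ hg₁)).prodMk_nhds tendsto_const_nhds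
    rw [zero_mul] at h1
    refine h1.congr' ?_
    filter_upwards [self_mem_nhdsWithin] with s hs
    have hs' : s ≠ 0 := hs
    ext
    · simp only [a, sub_zero, Prod.smul_fst, smul_eq_mul, pow_succ]
      field_simp
    · simp only [a, sub_zero, Prod.smul_snd, smul_eq_mul]
      field_simp
  have L2 : Tendsto (fun s : ℂ => (s ^ m)⁻¹ • (ω (a s) - ω (b s))) (𝓝[≠] 0)
      (𝓝 (fderiv ℂ ω 0 (e 0, 0))) := by
    refine tendsto_smul_sub_of_strict hst (ht g₁ hg₁) (ht g₂ hg₂) ?_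
    have h1 : Tendsto (fun s => (e s, (0 : ℂ))) (𝓝[≠] 0) (𝓝 (e 0, 0)) :=
      (hc e he).prodMk_nhds tendsto_const_nhds
    refine h1.congr' ?_
    filter_upwards [self_mem_nhdsWithin, hde.filter_mono nhdsWithin_le_nhds] with s hs hds
    have hs' : s ≠ 0 := hs
    ext
    · simp only [a, b, Prod.smul_fst, Prod.fst_sub, smul_eq_mul, hds]
      field_simp
    · simp [a, b]
  have hde' : ∀ᶠ s in 𝓝 (0 : ℂ), s * (deriv X₁ s - deriv X₂ s)
      = s ^ m * (m * e s + s * deriv e s) := by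
    filter_upwards [hde.eventually_nhds, hX₁.eventually_nhds, hX₂.eventually_nhds,
      he.eventually_analyticAt, hg₁.eventually_analyticAt, hg₂.eventually_analyticAt]
      with s h1 h2 h3 h4 h5 h6
    rw [← s_mul_deriv_pow_mul h4]
    have h7 : (fun s => s ^ m * e s) =ᶠ[𝓝 s] fun s => s ^ (N + 1) * g₁ s - s ^ (N + 1) * g₂ s :=
      h1.mono fun s hs => hs.symm
    rw [h7.deriv_eq, EventuallyEq.deriv_eq h2, EventuallyEq.deriv_eq h3, deriv_fun_sub]
    · exact ((analyticAt_id.pow _).mul h5).differentiableAt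
    · exact ((analyticAt_id.pow _).mul h6).differentiableAt
  have L3 : Tendsto (fun s : ℂ => ((s ^ m)⁻¹ * (s * (deriv X₁ s - deriv X₂ s)), (0 : ℂ)))
      (𝓝[≠] 0) (𝓝 (m * e 0 + 0 * deriv e 0, 0)) := by
    have h1 : Tendsto (fun s => (m * e s + s * deriv e s, (0 : ℂ))) (𝓝[≠] 0)
        (𝓝 (m * e 0 + 0 * deriv e 0, 0)) :=
      (((hc e he).const_mul _).add (hs0.mul (hc _ he.deriv))).prodMk_nhds tendsto_const_nhds
    refine h1.congr' ?_
    filter_upwards [self_mem_nhdsWithin, hde'.filter_mono nhdsWithin_le_nhds] with s hs hds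
    have hs' : s ≠ 0 := hs
    rw [hds]
    ext
    · simp only
      field_simp
    · simp
  have L4 : Tendsto (fun s : ℂ => ((s ^ N)⁻¹ * (s * deriv X₂ s), (N : ℂ))) (𝓝[≠] 0)
      (𝓝 (0 * (((N + 1 : ℕ) : ℂ) * g₂ 0 + 0 * deriv g₂ 0), (N : ℂ))) := by
    have h1 : Tendsto (fun s => (s * (((N + 1 : ℕ) : ℂ) * g₂ s + s * deriv g₂ s), (N : ℂ)))
        (𝓝[≠] 0) (𝓝 (0 * (((N + 1 : ℕ) : ℂ) * g₂ 0 + 0 * deriv g₂ 0), (N : ℂ))) :=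
      (hs0.mul (((hc g₂ hg₂).const_mul _).add (hs0.mul (hc _ hg₂.deriv)))).prodMk_nhds
        tendsto_const_nhds
    refine h1.congr' ?_
    filter_upwards [self_mem_nhdsWithin, hX₂.eventually_nhds.filter_mono nhdsWithin_le_nhds,
      hg₂.eventually_analyticAt.filter_mono nhdsWithin_le_nhds] with s hs hds hgs
    have hs' : s ≠ 0 := hs
    rw [EventuallyEq.deriv_eq hds, s_mul_deriv_pow_mul hgs, pow_succ]
    ext
    · simp only
      field_simp
    · simp
  have Ltot := (tendsto_clm_apply L1 L3).add (tendsto_clm_apply L2 L4)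
  have hzero : ∀ᶠ s in 𝓝[≠] (0 : ℂ),
      ((s ^ N)⁻¹ • (ω (a s) - ω 0)) ((s ^ m)⁻¹ * (s * (deriv X₁ s - deriv X₂ s)), (0 : ℂ))
        + ((s ^ m)⁻¹ • (ω (a s) - ω (b s))) ((s ^ N)⁻¹ * (s * deriv X₂ s), (N : ℂ)) = 0 := by
    filter_upwards [self_mem_nhdsWithin, hX₁.filter_mono nhdsWithin_le_nhds,
      hX₂.filter_mono nhdsWithin_le_nhds, hi₁.filter_mono nhdsWithin_le_nhds,
      hi₂.filter_mono nhdsWithin_le_nhds] with s hs e1 e2 i1 i2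
    have hs' : s ≠ 0 := hs
    have ea : (X₁ s, s ^ N) = a s := by simp only [a, e1]
    have eb : (X₂ s, s ^ N) = b s := by simp only [b, e2]
    rw [ea] at i1
    rw [eb] at i2
    have v1 : (((s ^ m)⁻¹ * (s * (deriv X₁ s - deriv X₂ s)), (0 : ℂ)) : ℂ × ℂ)
        = ((s ^ m)⁻¹ * s) • ((deriv X₁ s, N * s ^ (N - 1)) - (deriv X₂ s, N * s ^ (N - 1))) := by
      ext <;> simp
      ring
    have v2 : (((s ^ N)⁻¹ * (s * deriv X₂ s), (N : ℂ)) : ℂ × ℂ)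
        = ((s ^ N)⁻¹ * s) • (deriv X₂ s, N * s ^ (N - 1)) := by
      obtain ⟨n, rfl⟩ := Nat.exists_eq_succ_of_ne_zero hN
      ext
      · simp only [Prod.smul_fst, smul_eq_mul]
        ring
      · simp only [Prod.smul_snd, smul_eq_mul, Nat.succ_eq_add_one, Nat.add_sub_cancel, pow_succ]
        field_simp
    rw [v1, v2, hω0, sub_zero]
    simp only [smul_apply, sub_apply, map_smul, map_sub, smul_eq_mul, i1, i2]
    ring
  have hlim := tendsto_nhds_unique (Ltot.congr' hzero) tendsto_const_nhds
  simp only [hωl] at hlim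
  have hrel : l₁ * m + l₂ * N = 0 := by
    have h1 : (l₁ * m + l₂ * N) * e 0 = 0 := by
      linear_combination hlim
    exact (mul_eq_zero.1 h1).resolve_right he0
  have hN' : (N : ℂ) ≠ 0 := by exact_mod_cast hN
  refine hnr (-(m / N)) ?_ ?_
  · have h1 : (0 : ℚ) < m := by exact_mod_cast Nat.pos_of_ne_zero hm
    have h2 : (0 : ℚ) < N := by exact_mod_cast Nat.pos_of_ne_zero hN
    have := div_pos h1 h2
    linarith
  · push_cast
    rw [div_eq_iff hl₁]
    field_simp
    linear_combination hrel

/-! ### The separatrices of a nondegenerate reduced foliation -/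

/-- In the linear coordinates `A`, the linear part of `ω` at `0` is `l₁ y dx + l₂ x dy`, and
`l₂ / l₁` is not a negative rational number. -/
structure IsReducedIn (ω : OneForm) (A : Plane ≃L[ℂ] Plane) (l₁ l₂ : ℂ) : Prop where
  analytic : AnalyticAt ℂ ω 0
  zero : ω 0 = 0
  linear : ∀ p w, fderiv ℂ ω 0 (A p) (A w) = l₁ * p.2 * w.1 + l₂ * p.1 * w.2
  left_ne : l₁ ≠ 0
  right_ne : l₂ ≠ 0
  ratio : ∀ r : ℚ, r < 0 → l₂ / l₁ ≠ (r : ℂ)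

lemma HasLinearPart.exists_equiv {ω : OneForm} (hω : AnalyticAt ℂ ω 0) {Ψ : Plane → Plane}
    {l₁ l₂ : ℂ} (h : HasLinearPart ω Ψ l₁ l₂) : ω 0 = 0 ∧ ∃ A : Plane ≃L[ℂ] Plane,
      (∀ p, A p = fderiv ℂ Ψ 0 p) ∧
      ∀ p w, fderiv ℂ ω 0 (A p) (A w) = l₁ * p.2 * w.1 + l₂ * p.1 * w.2 := by
  obtain ⟨hΨ, h0, hl⟩ := h
  obtain ⟨hΨa, hΨ0, -⟩ := id hΨ
  let A : Plane ≃L[ℂ] Plane := (LinearEquiv.ofInjectiveEndo (fderiv ℂ Ψ 0).toLinearMap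
    ((injective_iff_map_eq_zero _).2 hΨ.injective_fderiv)).toContinuousLinearEquiv
  have hA : ∀ p, A p = fderiv ℂ Ψ 0 p := fun p => rfl
  have hω0 : ω 0 = 0 := by
    refine ContinuousLinearMap.ext fun v => ?_
    have h1 := congrArg (fun T : Plane →L[ℂ] ℂ => T (A.symm v)) h0
    simp only [pullback, hΨ0, ContinuousLinearMap.comp_apply, ← hA,
      ContinuousLinearEquiv.apply_symm_apply, zero_apply] at h1
    exact h1
  refine ⟨hω0, A, hA, fun p w => ?_⟩
  rw [← hl]
  have h2 : HasFDerivAt (fun p => ω (Ψ p)) ((fderiv ℂ ω 0).comp (fderiv ℂ Ψ 0)) 0 :=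
    HasFDerivAt.comp 0 (by rw [hΨ0]; exact hω.differentiableAt.hasFDerivAt)
      hΨa.differentiableAt.hasFDerivAt
  have h3 := h2.clm_comp hΨa.fderiv.differentiableAt.hasFDerivAt
  rw [show pullback Ψ ω = fun p => (ω (Ψ p)).comp (fderiv ℂ Ψ p) from rfl, h3.fderiv]
  simp [hΨ0, hω0, hA]

namespace IsReducedIn

variable {ω : OneForm} {A : Plane ≃L[ℂ] Plane} {l₁ l₂ : ℂ}

/-- The linear coordinates with the axes exchanged. -/
noncomputable def swapEquiv (A : Plane ≃L[ℂ] Plane) : Plane ≃L[ℂ] Plane :=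
  (ContinuousLinearEquiv.prodComm ℂ ℂ ℂ).trans A

lemma swapEquiv_apply (A : Plane ≃L[ℂ] Plane) (p : Plane) : swapEquiv A p = A (p.2, p.1) := rfl

lemma swap (h : IsReducedIn ω A l₁ l₂) : IsReducedIn ω (swapEquiv A) l₂ l₁ where
  analytic := h.analytic
  zero := h.zero
  linear p w := by
    rw [swapEquiv_apply, swapEquiv_apply, h.linear]
    ring
  left_ne := h.right_ne
  right_ne := h.left_ne
  ratio r hr hc := by
    refine h.ratio r⁻¹ (inv_lt_zero.2 hr) ?_
    rw [Rat.cast_inv, ← hc, inv_div]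

lemma add_ne_zero (h : IsReducedIn ω A l₁ l₂) : l₁ + l₂ ≠ 0 := by
  intro hc
  refine h.ratio (-1) (by norm_num) ?_
  rw [div_eq_iff h.left_ne]
  push_cast
  linear_combination hc

/-- The form read in the linear coordinates. -/
noncomputable def form (ω : OneForm) (A : Plane ≃L[ℂ] Plane) : OneForm :=
  fun p => (ω (A p)).comp (A : Plane →L[ℂ] Plane)

lemma standard (h : IsReducedIn ω A l₁ l₂) : HasStandardLinearPart (form ω A) l₁ l₂ := by
  have hA : AnalyticAt ℂ (fun p => ω (A p)) 0 :=
    AnalyticAt.fun_comp (g := ω) (f := A) (by rw [map_zero]; exact h.analytic)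
      ((A : Plane →L[ℂ] Plane).analyticAt 0)
  refine ⟨?_, ?_, fun p w => ?_⟩
  · exact (((ContinuousLinearMap.compL ℂ Plane Plane ℂ).flip
      (A : Plane →L[ℂ] Plane)).analyticAt _).comp hA
  · simp [form, h.zero]
  · have h1 : HasFDerivAt (fun p => ω (A p)) ((fderiv ℂ ω 0).comp (A : Plane →L[ℂ] Plane)) 0 :=
      HasFDerivAt.comp 0 (by rw [map_zero]; exact h.analytic.differentiableAt.hasFDerivAt)
        A.hasFDerivAt
    have h2 := ((ContinuousLinearMap.compL ℂ Plane Plane ℂ).flip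
      (A : Plane →L[ℂ] Plane)).hasFDerivAt.comp (0 : Plane) h1
    have h3 : fderiv ℂ (form ω A) 0 = _ := h2.fderiv
    rw [h3]
    simpa using h.linear p w

end IsReducedIn

/-- The order and the tangent direction of a branch. -/
lemma IsSeparatrix.exists_order {ω : OneForm} {γ : ℂ → Plane} (hγ : IsSeparatrix ω γ) :
    ∃ (k : ℕ) (g : ℂ → Plane), k ≠ 0 ∧ AnalyticAt ℂ g 0 ∧ g 0 ≠ 0 ∧
      γ =ᶠ[𝓝 0] fun t => t ^ k • g t := by
  obtain ⟨ha, h0, ⟨U, hU, hinj⟩, -⟩ := hγ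
  have hne : ¬ ∀ᶠ t in 𝓝 (0 : ℂ), γ t = 0 := by
    intro hc
    have h1 : ∀ᶠ t in 𝓝[≠] (0 : ℂ), False := by
      filter_upwards [nhdsWithin_le_nhds hc, nhdsWithin_le_nhds hU, self_mem_nhdsWithin]
        with t h1 h2 h3
      exact h3 (hinj h2 (mem_of_mem_nhds hU) (h1.trans h0.symm))
    exact h1.exists.choose_spec
  obtain ⟨k, g, hg, hg0, he⟩ := ha.exists_eventuallyEq_pow_smul_nonzero_iff.2 hne
  simp only [sub_zero] at he
  refine ⟨k, g, ?_, hg, hg0, he⟩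
  rintro rfl
  have := he.self_of_nhds
  simp only [pow_zero, one_smul] at this
  exact hg0 (this.symm.trans h0)

lemma det₂_eq_zero {v w : Plane} (hv : v ≠ 0) (h : det₂ v w = 0) : ∃ c : ℂ, w = c • v := by
  unfold det₂ at h
  by_cases h1 : v.1 = 0
  · have h2 : v.2 ≠ 0 := fun h2 => hv (Prod.ext h1 h2)
    refine ⟨w.2 / v.2, Prod.ext ?_ ?_⟩
    · rw [h1, zero_mul, zero_sub, neg_eq_zero] at h
      simp [h1, (mul_eq_zero.1 h).resolve_left h2]
    · simp [h2]
  · refine ⟨w.1 / v.1, Prod.ext ?_ ?_⟩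
    · simp [h1]
    · simp only [Prod.smul_snd, smul_eq_mul]
      field_simp
      linear_combination h

/-- The determinant of g(t) with any multiple of γ(t) vanishes, and this passes to the limit; so all
limit directions are proportional to g(0), whatever power of t is used. -/
lemma isTangentVector_iff {γ g : ℂ → Plane} {k : ℕ} (hg : ContinuousAt g 0)
    (hg0 : g 0 ≠ 0) (he : γ =ᶠ[𝓝 0] fun t => t ^ k • g t) (v : Plane) :
    IsTangentVector γ v ↔ ∃ c : ℂ, c ≠ 0 ∧ v = c • g 0 := by
  have hgt : Tendsto g (𝓝[≠] 0) (𝓝 (g 0)) := hg.tendsto.mono_left nhdsWithin_le_nhds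
  constructor
  · rintro ⟨hv, j, c, hl⟩
    have hdet : Continuous fun q : Plane × Plane => det₂ q.1 q.2 := by
      unfold det₂
      fun_prop
    have h1 := (hdet.tendsto (g 0, v)).comp (hgt.prodMk_nhds hl)
    have h2 : ∀ᶠ t in 𝓝[≠] (0 : ℂ),
        ((fun q : Plane × Plane => det₂ q.1 q.2) ∘ fun t => (g t, (c / t ^ j) • γ t)) t = 0 := by
      filter_upwards [he.filter_mono nhdsWithin_le_nhds] with t ht
      simp only [Function.comp_apply, ht, det₂, Prod.smul_fst, Prod.smul_snd, smul_eq_mul]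
      ring
    have h3 : det₂ (g 0) v = 0 := tendsto_nhds_unique (h1.congr' h2) tendsto_const_nhds
    obtain ⟨c, rfl⟩ := det₂_eq_zero hg0 h3
    exact ⟨c, fun hc => hv (by rw [hc, zero_smul]), rfl⟩
  · rintro ⟨c, hc, rfl⟩
    refine ⟨smul_ne_zero hc hg0, k, c, (hgt.const_smul c).congr' ?_⟩
    filter_upwards [he.filter_mono nhdsWithin_le_nhds, self_mem_nhdsWithin] with t ht ht0
    have ht0' : t ≠ 0 := ht0
    rw [ht, smul_smul, div_mul_cancel₀ _ (pow_ne_zero _ ht0')]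

/-- Leading term of the invariance relation: ω(γ) is t^k Dω(g(0)) and γ' is k t^{k-1} g(0), up to
higher order. -/
lemma IsSeparatrix.apply_tangent {ω : OneForm} {γ g : ℂ → Plane} {k : ℕ}
    (hγ : IsSeparatrix ω γ) (hω : AnalyticAt ℂ ω 0) (h0 : ω 0 = 0) (hk : k ≠ 0)
    (hg : AnalyticAt ℂ g 0) (he : γ =ᶠ[𝓝 0] fun t => t ^ k • g t) :
    fderiv ℂ ω 0 (g 0) (g 0) = 0 := by
  obtain ⟨-, -, -, hinv⟩ := hγ
  have hgt : Tendsto g (𝓝[≠] 0) (𝓝 (g 0)) := hg.continuousAt.tendsto.mono_left nhdsWithin_le_nhds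
  have hst : Tendsto (fun t : ℂ => t) (𝓝[≠] 0) (𝓝 0) := tendsto_id.mono_left nhdsWithin_le_nhds
  have L1 : Tendsto (fun t : ℂ => (t ^ k)⁻¹ • (ω (t ^ k • g t) - ω 0)) (𝓝[≠] 0)
      (𝓝 (fderiv ℂ ω 0 (g 0))) := by
    refine tendsto_smul_sub_of_strict hω.hasStrictFDerivAt (b := fun _ => 0) ?_
      tendsto_const_nhds (hgt.congr' ?_)
    · have := (hst.pow k).smul hgt
      simpa [hk] using this
    · filter_upwards [self_mem_nhdsWithin] with t ht
      have ht' : t ≠ 0 := ht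
      rw [sub_zero, smul_smul, inv_mul_cancel₀ (pow_ne_zero _ ht'), one_smul]
  have L2 : Tendsto (fun t : ℂ => (k : ℂ) • g t + t • deriv g t) (𝓝[≠] 0)
      (𝓝 ((k : ℂ) • g 0 + (0 : ℂ) • deriv g 0)) :=
    (hgt.const_smul _).add
      (hst.smul (hg.deriv.continuousAt.tendsto.mono_left nhdsWithin_le_nhds))
  have hz : ∀ᶠ t in 𝓝[≠] (0 : ℂ),
      ((t ^ k)⁻¹ • (ω (t ^ k • g t) - ω 0)) ((k : ℂ) • g t + t • deriv g t) = 0 := by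
    filter_upwards [self_mem_nhdsWithin, he.eventually_nhds.filter_mono nhdsWithin_le_nhds,
      hinv.filter_mono nhdsWithin_le_nhds,
      hg.eventually_analyticAt.filter_mono nhdsWithin_le_nhds] with t ht h1 h2 h3
    have ht' : t ≠ 0 := ht
    have h4 : HasDerivAt (fun t => t ^ k • g t)
        (t ^ k • deriv g t + ((k : ℂ) * t ^ (k - 1)) • g t) t :=
      (hasDerivAt_pow k t).smul h3.differentiableAt.hasDerivAt
    rw [h1.self_of_nhds, EventuallyEq.deriv_eq h1, h4.deriv] at h2
    have h5 : (k : ℂ) • g t + t • deriv g t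
        = (t * (t ^ k)⁻¹) • (t ^ k • deriv g t + ((k : ℂ) * t ^ (k - 1)) • g t) := by
      obtain ⟨n, rfl⟩ := Nat.exists_eq_succ_of_ne_zero hk
      rw [smul_add, smul_smul, smul_smul, add_comm]
      congr 2
      · rw [mul_assoc, inv_mul_cancel₀ (pow_ne_zero _ ht'), mul_one]
      · rw [Nat.succ_eq_add_one, Nat.add_sub_cancel, pow_succ]
        field_simp
    rw [h5, map_smul, smul_apply, h0, sub_zero, h2, smul_zero, smul_zero]
  have := tendsto_nhds_unique ((tendsto_clm_apply L1 L2).congr' hz) tendsto_const_nhds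
  rw [zero_smul, add_zero, map_smul, smul_eq_mul] at this
  exact (mul_eq_zero.1 this).resolve_left (by exact_mod_cast hk)

lemma SameBranch.of_comp {γ δ : ℂ → Plane} {α β : ℂ → ℂ} (hα : IsDiffeoGerm univ univ α)
    (hβ : IsDiffeoGerm univ univ β) (h : (γ ∘ α) =ᶠ[𝓝 0] δ ∘ β) : SameBranch γ δ := by
  obtain ⟨ha, ha0, a, haa, haa0, ha1, ha2⟩ := isDiffeoGerm_univ_iff.1 hα
  obtain ⟨hb, hb0, b, hbb, hbb0, hb1, hb2⟩ := isDiffeoGerm_univ_iff.1 hβ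
  have ta := analyticAt_tendsto_zero haa haa0
  have tb := analyticAt_tendsto_zero hb hb0
  have ta' := analyticAt_tendsto_zero ha ha0
  have tb' := analyticAt_tendsto_zero hbb hbb0
  refine ⟨β ∘ a, isDiffeoGerm_univ_iff.2 ⟨?_, by simp [haa0, hb0], α ∘ b, ?_,
    by simp [hbb0, ha0], ?_, ?_⟩, ?_⟩
  · exact AnalyticAt.comp (by rwa [haa0]) haa
  · exact AnalyticAt.comp (by rwa [hbb0]) hbb
  · filter_upwards [ta.eventually hb1, ha2] with t h1 h2
    simp only [Function.comp_apply, h1, h2]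
  · filter_upwards [tb'.eventually ha1, hb2] with t h1 h2
    simp only [Function.comp_apply, h1, h2]
  · filter_upwards [ta.eventually h, ha2] with t h1 h2
    simp only [Function.comp_apply, h2] at h1 ⊢
    exact h1

/-- A separatrix tangent to the second axis is a graph over a power of the second coordinate. -/
lemma IsSeparatrix.exists_graph {ω : OneForm} {A : Plane ≃L[ℂ] Plane}
    {γ g : ℂ → Plane} {k : ℕ} (hγ : IsSeparatrix ω γ) (hk : k ≠ 0)
    (hg : AnalyticAt ℂ g 0) (he : γ =ᶠ[𝓝 0] fun t => t ^ k • g t) {c : ℂ} (hc : c ≠ 0)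
    (hgc : g 0 = c • A (0, 1)) :
    ∃ (β : ℂ → ℂ) (X : ℂ → ℂ), IsDiffeoGerm univ univ β ∧
      IsInvariantGraph (IsReducedIn.form ω A) k X ∧ ∀ᶠ s in 𝓝 (0 : ℂ), γ (β s) = A (X s, s ^ k) := by
  set e : ℂ → Plane := fun t => A.symm (g t) with he_def
  have hea : AnalyticAt ℂ e 0 := ((A.symm : Plane →L[ℂ] Plane).analyticAt _).comp hg
  have he0 : e 0 = (0, c) := by
    simp only [e, hgc, map_smul, A.symm_apply_apply]
    simp
  have he1 : AnalyticAt ℂ (fun t => (e t).1) 0 := analyticAt_fst.fun_comp hea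
  have he2 : AnalyticAt ℂ (fun t => (e t).2) 0 := analyticAt_snd.fun_comp hea
  obtain ⟨α, hα, hα1⟩ := exists_root_param (y := fun t => t ^ k * (e t).2) hk he2
    (by rw [he0]; exact hc) (Eventually.of_forall fun t => rfl)
  obtain ⟨haa, ha0, β, hβa, hβ0, ha1, ha2⟩ := isDiffeoGerm_univ_iff.1 hα
  have tβ := analyticAt_tendsto_zero hβa hβ0
  obtain ⟨b, hb, -, hβb⟩ := exists_eq_mul_of_apply_zero hβa hβ0
  have hcomp : AnalyticAt ℂ (fun s => (e (β s)).1) 0 :=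
    AnalyticAt.fun_comp (g := fun t => (e t).1) (by rwa [hβ0]) hβa
  obtain ⟨f, hf, -, hef⟩ := exists_eq_mul_of_apply_zero hcomp (by rw [hβ0, he0])
  have hX : ∀ s, β s ^ k * (e (β s)).1 = s ^ (k + 1) * (b s ^ k * f s) := fun s => by
    rw [hef s, hβb s, smul_eq_mul, smul_eq_mul]
    ring
  have hgr : ∀ᶠ s in 𝓝 (0 : ℂ), γ (β s) = A (s ^ (k + 1) * (b s ^ k * f s), s ^ k) := by
    filter_upwards [tβ.eventually he, tβ.eventually hα1, ha2] with s h1 h2 h3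
    rw [h3] at h2
    rw [h1, ← hX s, ← h2, ← A.apply_symm_apply (g (β s)), ← map_smul]
    rfl
  refine ⟨β, fun s => s ^ (k + 1) * (b s ^ k * f s), isDiffeoGerm_univ_iff.2
    ⟨hβa, hβ0, α, haa, ha0, ha2, ha1⟩, ⟨⟨_, (hb.pow k).mul hf, EventuallyEq.rfl⟩, ?_⟩, hgr⟩
  have hγa := hγ.1
  filter_upwards [hgr.eventually_nhds, tβ.eventually hγ.2.2.2, hβa.eventually_analyticAt,
    tβ.eventually hγa.eventually_analyticAt, hb.eventually_analyticAt,
    hf.eventually_analyticAt] with s h1 h2 h3 h4 h5 h6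
  have d1 : HasDerivAt (fun s => γ (β s)) (deriv β s • deriv γ (β s)) s :=
    h4.differentiableAt.hasDerivAt.scomp s h3.differentiableAt.hasDerivAt
  have hXa : AnalyticAt ℂ (fun s => s ^ (k + 1) * (b s ^ k * f s)) s :=
    (analyticAt_id.pow _).mul ((h5.pow k).mul h6)
  have d2 : HasDerivAt (fun s => ((s ^ (k + 1) * (b s ^ k * f s), s ^ k) : ℂ × ℂ))
      (deriv (fun s => s ^ (k + 1) * (b s ^ k * f s)) s, (k : ℂ) * s ^ (k - 1)) s :=
    hXa.differentiableAt.hasDerivAt.prodMk (hasDerivAt_pow k s)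
  have d3 := ((A : Plane →L[ℂ] Plane).hasFDerivAt.comp_hasDerivAt s d2)
  have d4 : deriv β s • deriv γ (β s) = A (deriv (fun s => s ^ (k + 1) * (b s ^ k * f s)) s,
      (k : ℂ) * s ^ (k - 1)) := d1.unique (d3.congr_of_eventuallyEq h1)
  change ω (A _) (A _) = 0
  rw [← d4, map_smul, ← h1.self_of_nhds, h2, smul_zero]

/-- Since (ζ s)^k = s^k, the substitution s ↦ ζ s reparametrizes the same curve without leaving the
class of graphs over s^k. -/
lemma IsInvariantGraph.twist {ω : OneForm} {k : ℕ} (hk : k ≠ 0) {X : ℂ → ℂ}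
    (h : IsInvariantGraph ω k X) {ζ : ℂ} (hζ : ζ ^ k = 1) :
    IsInvariantGraph ω k fun s => X (ζ * s) := by
  obtain ⟨⟨f, hf, hX⟩, hi⟩ := h
  have hm : AnalyticAt ℂ (fun s : ℂ => ζ * s) 0 := analyticAt_const.mul analyticAt_id
  have ht := analyticAt_tendsto_zero hm (mul_zero ζ)
  have hf' : AnalyticAt ℂ (fun s => f (ζ * s)) 0 :=
    AnalyticAt.fun_comp (g := f) (by rwa [mul_zero]) hm
  refine ⟨⟨fun s => ζ ^ (k + 1) * f (ζ * s), analyticAt_const.mul hf', ?_⟩, ?_⟩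
  · filter_upwards [ht.eventually hX] with s hs
    rw [hs]
    ring
  · filter_upwards [ht.eventually hi, ht.eventually hX.eventually_nhds,
      ht.eventually hf.eventually_analyticAt] with s h1 h2 h3
    have hXd : DifferentiableAt ℂ X (ζ * s) :=
      (((analyticAt_id.pow (k + 1)).mul h3).congr
        (h2.mono fun s hs => hs.symm)).differentiableAt
    have d : HasDerivAt (fun s => X (ζ * s)) (deriv X (ζ * s) * (ζ * 1)) s :=
      hXd.hasDerivAt.comp s ((hasDerivAt_id s).const_mul ζ)
    obtain ⟨n, rfl⟩ := Nat.exists_eq_succ_of_ne_zero hk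
    rw [mul_pow, hζ, one_mul] at h1
    have hv : ((deriv (fun s => X (ζ * s)) s, ((n.succ : ℕ) : ℂ) * s ^ (n.succ - 1)) : ℂ × ℂ)
        = ζ • (deriv X (ζ * s), ((n.succ : ℕ) : ℂ) * (ζ * s) ^ (n.succ - 1)) := by
      rw [d.deriv]
      refine Prod.ext ?_ ?_
      · simp only [Prod.smul_fst, smul_eq_mul]
        ring
      · simp only [Prod.smul_snd, smul_eq_mul, Nat.succ_eq_add_one, Nat.add_sub_cancel] at hζ ⊢
        rw [pow_succ] at hζ
        linear_combination -((n + 1 : ℕ) : ℂ) * s ^ n * hζ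
    rw [hv, map_smul, h1, smul_zero]

/-- Uniqueness of the graph gives X(ζ s) = X(s) for a primitive k-th root of unity ζ. The
parametrization then takes the same value at s and at ζ s, and its injectivity forces ζ = 1.
Smoothness of the separatrices is thus proved rather than assumed. -/
lemma IsReducedIn.order_eq_one {ω : OneForm} {A : Plane ≃L[ℂ] Plane} {l₁ l₂ : ℂ}
    (h : IsReducedIn ω A l₁ l₂) {γ g : ℂ → Plane} {k : ℕ} (hγ : IsSeparatrix ω γ) (hk : k ≠ 0)
    (hg : AnalyticAt ℂ g 0) (he : γ =ᶠ[𝓝 0] fun t => t ^ k • g t) {c : ℂ} (hc : c ≠ 0)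
    (hgc : g 0 = c • A (0, 1)) : k = 1 := by
  obtain ⟨β, X, hβ, hX, hgr⟩ := IsSeparatrix.exists_graph hγ hk hg he hc hgc
  have hprim := Complex.isPrimitiveRoot_exp k hk
  set ζ := Complex.exp (2 * Real.pi * Complex.I / k)
  have hζ : ζ ^ k = 1 := hprim.pow_eq_one
  have huniq := h.standard.graph_unique h.left_ne h.ratio hk hX (hX.twist hk hζ)
  obtain ⟨ha, hb0, b, -, -, hb1, -⟩ := isDiffeoGerm_univ_iff.1 hβ
  obtain ⟨U, hU, hinj⟩ := hγ.2.2.1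
  have tβ := analyticAt_tendsto_zero ha hb0
  have tm : Tendsto (fun s : ℂ => ζ * s) (𝓝 0) (𝓝 0) :=
    (continuous_const_mul ζ).tendsto' 0 0 (mul_zero ζ)
  have hev : ∀ᶠ s in 𝓝[≠] (0 : ℂ), ζ = 1 := by
    filter_upwards [self_mem_nhdsWithin, nhdsWithin_le_nhds huniq, nhdsWithin_le_nhds hgr,
      nhdsWithin_le_nhds (tm.eventually hgr), nhdsWithin_le_nhds (tβ.eventually hU),
      nhdsWithin_le_nhds (tm.eventually (tβ.eventually hU)), nhdsWithin_le_nhds hb1,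
      nhdsWithin_le_nhds (tm.eventually hb1)] with s hs h1 h2 h3 h4 h5 h6 h7
    have hs' : s ≠ 0 := hs
    rw [mul_pow, hζ, one_mul, ← h1, ← h2] at h3
    have h8 := hinj h5 h4 h3
    have h9 : ζ * s = s := by
      rw [← h7, h8, h6]
    exact mul_right_cancel₀ hs' (by rw [h9, one_mul])
  have h1 : ζ = 1 := hev.exists.choose_spec
  exact hprim.unique (by rw [h1]; exact IsPrimitiveRoot.one)

/-- A separatrix is smooth, and tangent to one of the axes. -/
lemma IsReducedIn.deriv_separatrix {ω : OneForm} {A : Plane ≃L[ℂ] Plane} {l₁ l₂ : ℂ}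
    (h : IsReducedIn ω A l₁ l₂) {γ : ℂ → Plane} (hγ : IsSeparatrix ω γ) :
    ∃ c : ℂ, c ≠ 0 ∧ (deriv γ 0 = c • A (0, 1) ∨ deriv γ 0 = c • A (1, 0)) := by
  obtain ⟨k, g, hk, hg, hg0, he⟩ := hγ.exists_order
  have h1 := hγ.apply_tangent h.analytic h.zero hk hg he
  have hd : k = 1 → deriv γ 0 = g 0 := by
    rintro rfl
    have d : HasDerivAt (fun t : ℂ => t ^ 1 • g t)
        ((0 : ℂ) ^ 1 • deriv g 0 + (((1 : ℕ) : ℂ) * 0 ^ (1 - 1)) • g 0) 0 :=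
      (hasDerivAt_pow 1 (0 : ℂ)).smul hg.differentiableAt.hasDerivAt
    rw [EventuallyEq.deriv_eq he, d.deriv]
    simp
  set q := A.symm (g 0) with hq
  have hq0 : q ≠ 0 := by
    intro hc
    exact hg0 (A.symm.map_eq_zero_iff.1 hc)
  have hgq : g 0 = A q := (A.apply_symm_apply _).symm
  rw [hgq, h.linear] at h1
  -- On the diagonal the linear part is (l₁ + l₂) x y, and l₁ + l₂ ≠ 0 because the ratio is not -1.
  have h2 : q.1 * q.2 = 0 := by
    have : (l₁ + l₂) * (q.1 * q.2) = 0 := by linear_combination h1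
    exact (mul_eq_zero.1 this).resolve_left h.add_ne_zero
  rcases mul_eq_zero.1 h2 with h3 | h3
  · have h4 : q.2 ≠ 0 := fun h4 => hq0 (Prod.ext h3 h4)
    have h5 : g 0 = q.2 • A (0, 1) := by
      rw [hgq, ← map_smul]
      congr 1
      ext <;> simp [h3]
    exact ⟨q.2, h4, Or.inl (by rw [hd (h.order_eq_one hγ hk hg he h4 h5), h5])⟩
  · have h4 : q.1 ≠ 0 := fun h4 => hq0 (Prod.ext h4 h3)
    have h5 : g 0 = q.1 • A (1, 0) := by
      rw [hgq, ← map_smul]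
      congr 1
      ext <;> simp [h3]
    exact ⟨q.1, h4, Or.inr (by rw [hd (h.swap.order_eq_one hγ hk hg he h4 h5), h5])⟩

lemma IsSeparatrix.exists_eq_smul {ω : OneForm} {γ : ℂ → Plane} (hγ : IsSeparatrix ω γ) :
    ∃ g : ℂ → Plane, AnalyticAt ℂ g 0 ∧ g 0 = deriv γ 0 ∧ γ =ᶠ[𝓝 0] fun t => t ^ 1 • g t := by
  obtain ⟨g, h1, h2, h3⟩ := exists_eq_mul_of_apply_zero hγ.1 hγ.2.1
  exact ⟨g, h1, h2, Eventually.of_forall fun t => by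
    simp only [pow_one, h3 t]⟩

/-- Each branch is a reparametrization of an invariant graph over the same axis, and there is only
one such graph. -/
lemma IsReducedIn.sameBranch {ω : OneForm} {A : Plane ≃L[ℂ] Plane} {l₁ l₂ : ℂ}
    (h : IsReducedIn ω A l₁ l₂) {γ δ : ℂ → Plane} (hγ : IsSeparatrix ω γ)
    (hδ : IsSeparatrix ω δ) {c d : ℂ} (hc : c ≠ 0) (hd : d ≠ 0)
    (h1 : deriv γ 0 = c • A (0, 1)) (h2 : deriv δ 0 = d • A (0, 1)) : SameBranch γ δ := by
  obtain ⟨g, hg, hg0, hge⟩ := hγ.exists_eq_smul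
  obtain ⟨f, hf, hf0, hfe⟩ := hδ.exists_eq_smul
  obtain ⟨β, X, hβ, hX, hgr⟩ := IsSeparatrix.exists_graph hγ one_ne_zero hg hge hc (hg0.trans h1)
  obtain ⟨β', X', hβ', hX', hgr'⟩ :=
    IsSeparatrix.exists_graph hδ one_ne_zero hf hfe hd (hf0.trans h2)
  refine SameBranch.of_comp hβ hβ' ?_
  filter_upwards [h.standard.graph_unique h.left_ne h.ratio one_ne_zero hX hX', hgr, hgr']
    with s h3 h4 h5
  simp only [Function.comp_apply]
  rw [h4, h5, h3]

lemma det₂_map (A : Plane ≃L[ℂ] Plane) : det₂ (A (1, 0)) (A (0, 1)) ≠ 0 := by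
  intro hc
  have h0 : A (1, 0) ≠ 0 := fun h => by
    have := A.map_eq_zero_iff.1 h
    simp at this
  obtain ⟨c, h1⟩ := det₂_eq_zero h0 hc
  rw [← map_smul] at h1
  have := A.injective h1
  simp [Prod.ext_iff] at this

/-- The linear data of the pair of separatrices. -/
structure HasSeparatrixFrame (ω : OneForm) (S₁ S₂ : ℂ → Plane) (lam : ℂ) : Prop where
  zero : ω 0 = 0
  ne_zero : lam ≠ 0
  ratio : ∀ r : ℚ, r < 0 → lam ≠ (r : ℂ)
  det_ne_zero : det₂ (deriv S₂ 0) (deriv S₁ 0) ≠ 0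
  mixed_ne_zero : fderiv ℂ ω 0 (deriv S₁ 0) (deriv S₂ 0) ≠ 0
  mixed : fderiv ℂ ω 0 (deriv S₂ 0) (deriv S₁ 0)
    = lam * fderiv ℂ ω 0 (deriv S₁ 0) (deriv S₂ 0)

lemma IsSeparatrix.isTangentVector_iff {ω : OneForm} {γ : ℂ → Plane} (hγ : IsSeparatrix ω γ)
    (h0 : deriv γ 0 ≠ 0) (v : Plane) :
    IsTangentVector γ v ↔ ∃ c : ℂ, c ≠ 0 ∧ v = c • deriv γ 0 := by
  obtain ⟨g, hg, hg0, hge⟩ := hγ.exists_eq_smul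
  rw [← hg0] at h0 ⊢
  exact PlaneFoliation.isTangentVector_iff hg.continuousAt h0 hge v

/-- The index may be read in other coordinates than A, where only the axis tangent to S₁ is known to
correspond. Writing the other basis vector as A f, both mixed values of the bilinear form Dω(0)
acquire the same factor, so the ratio l₂ / l₁ is intrinsic. -/
lemma IsReducedIn.frame {ω : OneForm} {A : Plane ≃L[ℂ] Plane} {l₁ l₂ : ℂ}
    (h : IsReducedIn ω A l₁ l₂) {S₁ S₂ : ℂ → Plane} (hS₁ : IsSeparatrix ω S₁) {c d : ℂ}
    (hc : c ≠ 0) (hd : d ≠ 0) (h1 : deriv S₁ 0 = c • A (0, 1))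
    (h2 : deriv S₂ 0 = d • A (1, 0)) {l : ℂ} (hl : HasCamachoSadIndex ω S₁ l) :
    HasSeparatrixFrame ω S₁ S₂ (-l) := by
  obtain ⟨Ψ, m₁, m₂, hΨ, hm₁, htan, rfl⟩ := hl
  obtain ⟨-, A', hA', hlin⟩ := hΨ.exists_equiv h.analytic
  have hA01 : A (0, 1) ≠ 0 := fun hz => by simpa using A.map_eq_zero_iff.1 hz
  have hS0 : deriv S₁ 0 ≠ 0 := by
    rw [h1]
    exact smul_ne_zero hc hA01
  obtain ⟨e, he, hve⟩ := (hS₁.isTangentVector_iff hS0 _).1 htan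
  rw [← hA', h1, smul_smul, ← map_smul] at hve
  set f := A.symm (A' (1, 0)) with hf
  have hfA : A' (1, 0) = A f := (A.apply_symm_apply _).symm
  have e1 := hlin (0, 1) (1, 0)
  have e2 := hlin (1, 0) (0, 1)
  rw [hfA, hve, h.linear] at e1 e2
  simp only [Prod.smul_fst, Prod.smul_snd, smul_eq_mul] at e1 e2
  ring_nf at e1 e2
  have hnn : -(-(m₂ / m₁)) = l₂ / l₁ := by
    rw [neg_neg, div_eq_div_iff hm₁ h.left_ne, ← e1, ← e2]
    ring
  rw [hnn]
  have hl₁ := h.left_ne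
  have hl₂ := h.right_ne
  refine ⟨h.zero, div_ne_zero hl₂ hl₁, h.ratio, ?_, ?_, ?_⟩
  · have h3 := mul_ne_zero (mul_ne_zero hd hc) (det₂_map A)
    rw [h1, h2]
    refine ne_of_eq_of_ne ?_ h3
    simp only [det₂, Prod.smul_fst, Prod.smul_snd, smul_eq_mul]
    ring
  · rw [h1, h2, ← map_smul, ← map_smul, h.linear]
    simp [hc, hd, hl₁]
  · rw [h1, h2, ← map_smul, ← map_smul, h.linear, h.linear]
    simp
    field_simp

lemma exists_separatrixFrame {ω : OneForm} (hω : IsNondegenerateReduced ω) {S₁ S₂ : ℂ → Plane}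
    (hS : AreSeparatrices ω S₁ S₂) {l : ℂ} (hl : HasCamachoSadIndex ω S₁ l) :
    HasSeparatrixFrame ω S₁ S₂ (-l) := by
  obtain ⟨hωa, Ψ, l₁, l₂, hΨ, hl₁, hl₂, hr⟩ := hω
  obtain ⟨h0, A, -, hlin⟩ := hΨ.exists_equiv hωa
  have h : IsReducedIn ω A l₁ l₂ := ⟨hωa, h0, hlin, hl₁, hl₂, hr⟩
  obtain ⟨hS₁, hS₂, hne⟩ := hS
  obtain ⟨c, hc, h1⟩ := h.deriv_separatrix hS₁
  obtain ⟨d, hd, h2⟩ := h.deriv_separatrix hS₂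
  rcases h1 with h1 | h1 <;> rcases h2 with h2 | h2
  · exact absurd (h.sameBranch hS₁ hS₂ hc hd h1 h2) hne
  · exact h.frame hS₁ hc hd h1 h2 hl
  · exact h.swap.frame hS₁ hc hd h1 h2 hl
  · exact absurd (h.swap.sameBranch hS₁ hS₂ hc hd h1 h2) hne

/-! ### Normal charts -/

lemma tendsto_apply_prod_left {E : Type*} [NormedAddCommGroup E] [NormedSpace ℂ E]
    {f : Plane → E} (hf : ContinuousAt f 0) : Tendsto (fun x : ℂ => f (x, 0)) (𝓝 0) (𝓝 (f 0)) :=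
  hf.tendsto.comp (tendsto_mk_left 0 0)

lemma analyticAt_comp_mk_left {E : Type*} [NormedAddCommGroup E] [NormedSpace ℂ E]
    {f : Plane → E} {c d : ℂ} (hf : AnalyticAt ℂ f (c, d)) : AnalyticAt ℂ (fun x => f (x, d)) c :=
  AnalyticAt.fun_comp (g := f) (f := fun x : ℂ => (x, d)) hf (analyticAt_id.prod analyticAt_const)

lemma analyticAt_comp_mk_right {E : Type*} [NormedAddCommGroup E] [NormedSpace ℂ E]
    {f : Plane → E} {c d : ℂ} (hf : AnalyticAt ℂ f (c, d)) : AnalyticAt ℂ (fun y => f (c, y)) d :=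
  AnalyticAt.fun_comp (g := f) (f := fun y : ℂ => (c, y)) hf (analyticAt_const.prod analyticAt_id)

lemma hasDerivAt_mk_left {E : Type*} [NormedAddCommGroup E] [NormedSpace ℂ E] {f : Plane → E}
    {c d : ℂ} (hf : AnalyticAt ℂ f (c, d)) :
    HasDerivAt (fun x => f (x, d)) (fderiv ℂ f (c, d) (1, 0)) c :=
  hf.differentiableAt.hasFDerivAt.comp_hasDerivAt c
    ((hasDerivAt_id c).prodMk (hasDerivAt_const c d))

lemma hasDerivAt_mk_right {E : Type*} [NormedAddCommGroup E] [NormedSpace ℂ E] {f : Plane → E}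
    {c d : ℂ} (hf : AnalyticAt ℂ f (c, d)) :
    HasDerivAt (fun y => f (c, y)) (fderiv ℂ f (c, d) (0, 1)) d :=
  hf.differentiableAt.hasFDerivAt.comp_hasDerivAt d
    ((hasDerivAt_const d c).prodMk (hasDerivAt_id d))

lemma analyticAt_pullback {Ψ : Plane → Plane} {ω : OneForm} {p : Plane}
    (hω : AnalyticAt ℂ ω (Ψ p)) (hΨ : AnalyticAt ℂ Ψ p) : AnalyticAt ℂ (pullback Ψ ω) p := by
  have h1 : AnalyticAt ℂ (fun p => ω (Ψ p)) p := hω.comp hΨ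
  exact AnalyticAt.fun_comp
    (g := fun x : (Plane →L[ℂ] ℂ) × (Plane →L[ℂ] Plane) =>
      ContinuousLinearMap.compL ℂ Plane Plane ℂ x.1 x.2)
    (f := fun p => (ω (Ψ p), fderiv ℂ Ψ p))
    ((ContinuousLinearMap.compL ℂ Plane Plane ℂ).analyticAt_bilinear _) (h1.prod hΨ.fderiv)

lemma analyticAt_apply_const {ω : OneForm} {p : Plane} (hω : AnalyticAt ℂ ω p) (v : Plane) :
    AnalyticAt ℂ (fun p => ω p v) p :=
  ((ContinuousLinearMap.apply ℂ ℂ v).analyticAt _).comp hω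

lemma fderiv_apply_const {ω : OneForm} {p : Plane} (hω : AnalyticAt ℂ ω p) (v w : Plane) :
    fderiv ℂ (fun p => ω p v) p w = fderiv ℂ ω p w v := by
  have := (ContinuousLinearMap.apply ℂ ℂ v).hasFDerivAt.comp p
    hω.differentiableAt.hasFDerivAt
  rw [show (fun p => ω p v) = (ContinuousLinearMap.apply ℂ ℂ v) ∘ ω from rfl, this.fderiv]
  rfl

lemma fderiv_pullback {Ψ : Plane → Plane} {ω : OneForm} (hω : AnalyticAt ℂ ω 0) (h0 : ω 0 = 0)
    (hΨ : AnalyticAt ℂ Ψ 0) (hΨ0 : Ψ 0 = 0) (p w : Plane) :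
    fderiv ℂ (pullback Ψ ω) 0 p w = fderiv ℂ ω 0 (fderiv ℂ Ψ 0 p) (fderiv ℂ Ψ 0 w) := by
  have h2 : HasFDerivAt (fun p => ω (Ψ p)) ((fderiv ℂ ω 0).comp (fderiv ℂ Ψ 0)) 0 :=
    HasFDerivAt.comp 0 (by rw [hΨ0]; exact hω.differentiableAt.hasFDerivAt)
      hΨ.differentiableAt.hasFDerivAt
  have h3 := h2.clm_comp hΨ.fderiv.differentiableAt.hasFDerivAt
  rw [show pullback Ψ ω = fun p => (ω (Ψ p)).comp (fderiv ℂ Ψ p) from rfl, h3.fderiv]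
  simp [hΨ0, h0]

lemma fderiv_comp_apply {E : Type*} [NormedAddCommGroup E] [NormedSpace ℂ E] {f : Plane → E}
    {Θ : Plane → Plane} {p : Plane} (hf : AnalyticAt ℂ f (Θ p)) (hΘ : AnalyticAt ℂ Θ p)
    (v : Plane) : fderiv ℂ (fun q => f (Θ q)) p v = fderiv ℂ f (Θ p) (fderiv ℂ Θ p v) := by
  have := hf.differentiableAt.hasFDerivAt.comp p hΘ.differentiableAt.hasFDerivAt
  rw [show (fun q => f (Θ q)) = f ∘ Θ from rfl, this.fderiv]
  rfl

/-- A chart `Θ` in which the separatrices are the axes, the foliation is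
`y dx + μ x dy = 0` and the function `z` is `x + y`. -/
structure IsNormalChart (ω : OneForm) (z : Plane → ℂ) (S₁ S₂ : ℂ → Plane) (lam : ℂ)
    (Θ : Plane → Plane) (μ a : Plane → ℂ) : Prop where
  diffeo : IsDiffeoGerm univ univ Θ
  mu_analytic : AnalyticAt ℂ μ 0
  mu_zero : μ 0 = lam
  unit_analytic : AnalyticAt ℂ a 0
  unit_ne_zero : a 0 ≠ 0
  form_eq : ∀ᶠ p in 𝓝 (0 : Plane), ∀ v : Plane,
    pullback Θ ω p v = a p * (p.2 * v.1 + μ p * p.1 * v.2)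
  integral_eq : ∀ᶠ p in 𝓝 (0 : Plane), z (Θ p) = p.1 + p.2
  left : ∃ α : ℂ → ℂ, IsDiffeoGerm univ univ α ∧ ∀ᶠ y in 𝓝 (0 : ℂ), Θ (0, y) = S₁ (α y)
  right : ∃ α : ℂ → ℂ, IsDiffeoGerm univ univ α ∧ ∀ᶠ x in 𝓝 (0 : ℂ), Θ (x, 0) = S₂ (α x)

lemma isDiffeoGerm_comp {E F H : Type} [NormedAddCommGroup E] [NormedSpace ℂ E]
    [NormedAddCommGroup F] [NormedSpace ℂ F] [NormedAddCommGroup H] [NormedSpace ℂ H]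
    {f : F → H} {g : E → F} (hf : IsDiffeoGerm univ univ f) (hg : IsDiffeoGerm univ univ g) :
    IsDiffeoGerm univ univ (f ∘ g) := by
  obtain ⟨ha, ha0, a, haa, haa0, ha1, ha2⟩ := isDiffeoGerm_univ_iff.1 hf
  obtain ⟨hb, hb0, b, hbb, hbb0, hb1, hb2⟩ := isDiffeoGerm_univ_iff.1 hg
  refine isDiffeoGerm_univ_iff.2 ⟨AnalyticAt.comp (by rwa [hb0]) hb, by simp [hb0, ha0], b ∘ a,
    AnalyticAt.comp (by rwa [haa0]) haa, by simp [hbb0, haa0], ?_, ?_⟩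
  · filter_upwards [(analyticAt_tendsto_zero hb hb0).eventually ha1, hb1] with t h1 h2
    simp only [Function.comp_apply, h1, h2]
  · filter_upwards [(analyticAt_tendsto_zero haa haa0).eventually hb2, ha2] with t h1 h2
    simp only [Function.comp_apply, h1, h2]

lemma IsDiffeoGerm.exists_symm {E F : Type} [NormedAddCommGroup E] [NormedSpace ℂ E]
    [NormedAddCommGroup F] [NormedSpace ℂ F] {f : E → F} (hf : IsDiffeoGerm univ univ f) :
    ∃ g : F → E, IsDiffeoGerm univ univ g ∧ (∀ᶠ p in 𝓝 (0 : E), g (f p) = p) ∧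
      ∀ᶠ q in 𝓝 (0 : F), f (g q) = q := by
  obtain ⟨ha, ha0, a, haa, haa0, ha1, ha2⟩ := isDiffeoGerm_univ_iff.1 hf
  exact ⟨a, isDiffeoGerm_univ_iff.2 ⟨haa, haa0, f, ha, ha0, ha2, ha1⟩, ha1, ha2⟩

/-- Coordinates adapted to two transverse smooth branches and to a function. -/
lemma exists_adapted_chart {S₁ S₂ : ℂ → Plane} (h₁ : AnalyticAt ℂ S₁ 0) (h₁0 : S₁ 0 = 0)
    (h₂ : AnalyticAt ℂ S₂ 0) (h₂0 : S₂ 0 = 0) (hdet : det₂ (deriv S₂ 0) (deriv S₁ 0) ≠ 0)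
    {z : Plane → ℂ} (hz : AnalyticAt ℂ z 0) (hz0 : z 0 = 0)
    (hz₁ : fderiv ℂ z 0 (deriv S₁ 0) ≠ 0) (hz₂ : fderiv ℂ z 0 (deriv S₂ 0) ≠ 0) :
    ∃ Θ : Plane → Plane, IsDiffeoGerm univ univ Θ ∧
      (∀ᶠ p in 𝓝 (0 : Plane), z (Θ p) = p.1 + p.2) ∧
      (∃ α : ℂ → ℂ, IsDiffeoGerm univ univ α ∧ ∀ᶠ y in 𝓝 (0 : ℂ), Θ (0, y) = S₁ (α y)) ∧
      (∃ α : ℂ → ℂ, IsDiffeoGerm univ univ α ∧ ∀ᶠ x in 𝓝 (0 : ℂ), Θ (x, 0) = S₂ (α x)) := by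
  set Θ₀ : Plane → Plane := fun p => S₂ p.1 + S₁ p.2 with hΘ₀
  have h1f : AnalyticAt ℂ (fun p : Plane => S₁ p.2) 0 :=
    AnalyticAt.fun_comp (g := S₁) (f := fun p : Plane => p.2) h₁ analyticAt_snd
  have h2f : AnalyticAt ℂ (fun p : Plane => S₂ p.1) 0 :=
    AnalyticAt.fun_comp (g := S₂) (f := fun p : Plane => p.1) h₂ analyticAt_fst
  have hΘa : AnalyticAt ℂ Θ₀ 0 := h2f.add h1f
  have hΘ0 : Θ₀ 0 = 0 := by simp [Θ₀, h₁0, h₂0]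
  have hΘd : ∀ v : Plane, fderiv ℂ Θ₀ 0 v = v.1 • deriv S₂ 0 + v.2 • deriv S₁ 0 := fun v => by
    have d1 : HasFDerivAt (fun p : Plane => S₂ p.1)
        ((fderiv ℂ S₂ 0).comp (ContinuousLinearMap.fst ℂ ℂ ℂ)) 0 :=
      HasFDerivAt.comp (g := S₂) (f := fun p : Plane => p.1) (0 : Plane)
        h₂.differentiableAt.hasFDerivAt hasFDerivAt_fst
    have d2 : HasFDerivAt (fun p : Plane => S₁ p.2)
        ((fderiv ℂ S₁ 0).comp (ContinuousLinearMap.snd ℂ ℂ ℂ)) 0 :=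
      HasFDerivAt.comp (g := S₁) (f := fun p : Plane => p.2) (0 : Plane)
        h₁.differentiableAt.hasFDerivAt hasFDerivAt_snd
    have d3 : HasFDerivAt Θ₀ _ 0 := d1.add d2
    rw [d3.fderiv]
    simp [fderiv_eq_smul_deriv]
  have hΘ : IsDiffeoGerm univ univ Θ₀ := by
    refine isDiffeoGerm_of_injective_fderiv hΘa hΘ0 fun v hv => ?_
    rw [hΘd] at hv
    have e1 := congrArg Prod.fst hv
    have e2 := congrArg Prod.snd hv
    simp only [Prod.fst_add, Prod.snd_add, Prod.smul_fst, Prod.smul_snd, smul_eq_mul,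
      Prod.fst_zero, Prod.snd_zero] at e1 e2
    unfold det₂ at hdet
    refine Prod.ext ?_ ?_
    · refine (mul_eq_zero.1 (?_ : v.1 * _ = 0)).resolve_right hdet
      linear_combination e1 * (deriv S₁ 0).2 - e2 * (deriv S₁ 0).1
    · refine (mul_eq_zero.1 (?_ : v.2 * _ = 0)).resolve_right hdet
      linear_combination -e1 * (deriv S₂ 0).2 + e2 * (deriv S₂ 0).1
  set F : Plane → ℂ := fun p => z (Θ₀ p) with hF
  have hzΘ : AnalyticAt ℂ z (Θ₀ 0) := by rwa [hΘ0]
  have hFa : AnalyticAt ℂ F 0 := hzΘ.comp hΘa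
  have hF0 : F 0 = 0 := by simp [F, hΘ0, hz0]
  have hFd : ∀ v : Plane, fderiv ℂ F 0 v
      = v.1 * fderiv ℂ z 0 (deriv S₂ 0) + v.2 * fderiv ℂ z 0 (deriv S₁ 0) := fun v => by
    rw [hF, fderiv_comp_apply hzΘ hΘa, hΘd, hΘ0, map_add, map_smul, map_smul, smul_eq_mul,
      smul_eq_mul]
  let A : Plane →L[ℂ] Plane := (0 : Plane →L[ℂ] ℂ).prod (ContinuousLinearMap.snd ℂ ℂ ℂ)
  have hA : ∀ p : Plane, A p = (0, p.2) := fun p => rfl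
  have hFA : AnalyticAt ℂ (fun p => F (A p)) 0 :=
    AnalyticAt.fun_comp (g := F) (f := A) (by rwa [map_zero]) (A.analyticAt 0)
  -- In the chart Θ₀ the branches are the axes. The map K = (F(x, y) - F(0, y), F(0, y)) preserves
  -- each axis and its components add up to F, so its inverse normalizes z to x + y while keeping
  -- the branches.
  set K : Plane → Plane := fun p => (F p - F (A p), F (A p)) with hK
  have hKa : AnalyticAt ℂ K 0 := (hFa.sub hFA).prod hFA
  have hK0 : K 0 = 0 := by simp [K, hF0]
  have hKd : IsDiffeoGerm univ univ K := by
    refine isDiffeoGerm_of_injective_fderiv hKa hK0 fun v hv => ?_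
    have d1 : HasFDerivAt F (fderiv ℂ F 0) 0 := hFa.differentiableAt.hasFDerivAt
    have d2 : HasFDerivAt (fun p => F (A p)) ((fderiv ℂ F 0).comp A) 0 :=
      HasFDerivAt.comp (g := F) (f := A) 0 (by rwa [map_zero]) A.hasFDerivAt
    have d3 : HasFDerivAt K _ 0 := (d1.sub d2).prodMk d2
    rw [d3.fderiv] at hv
    simp only [ContinuousLinearMap.prod_apply, sub_apply, ContinuousLinearMap.comp_apply, hA, hFd,
      zero_mul, zero_add, add_sub_cancel_right, Prod.mk_eq_zero, mul_eq_zero, hz₁, hz₂,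
      or_false] at hv
    exact Prod.ext hv.1 hv.2
  obtain ⟨J, hJ, hJ1, hJ2⟩ := hKd.exists_symm
  have hJt := analyticAt_tendsto_zero hJ.1 hJ.2.1
  refine ⟨Θ₀ ∘ J, isDiffeoGerm_comp hΘ hJ, ?_, ?_, ?_⟩
  · filter_upwards [hJ2] with p hp
    have e1 := congrArg Prod.fst hp
    have e2 := congrArg Prod.snd hp
    simp only [hK] at e1 e2
    rw [← e1, ← e2, sub_add_cancel, hF, Function.comp_apply]
  · have hFr : AnalyticAt ℂ (fun y => F (0, y)) 0 := analyticAt_comp_mk_right hFa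
    have hd : IsDiffeoGerm univ univ fun y => F (0, y) := by
      refine isDiffeoGerm_of_deriv_ne_zero hFr hF0 ?_
      rw [(hasDerivAt_mk_right hFa).deriv, Prod.mk_zero_zero, hFd]
      simpa using hz₁
    obtain ⟨α, hα, -, hα2⟩ := hd.exists_symm
    refine ⟨α, hα, ?_⟩
    have ht : Tendsto (fun y => ((0 : ℂ), α y)) (𝓝 0) (𝓝 0) :=
      (tendsto_mk_right 0 0).comp (analyticAt_tendsto_zero hα.1 hα.2.1)
    filter_upwards [hα2, ht.eventually hJ1] with y h1 h2
    have h3 : K (0, α y) = (0, y) := by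
      simp only [hK, hA, sub_self, h1]
    rw [h3] at h2
    simp [h2, hΘ₀, h₂0]
  · have hFr : AnalyticAt ℂ (fun x => F (x, 0)) 0 := analyticAt_comp_mk_left hFa
    have hd : IsDiffeoGerm univ univ fun x => F (x, 0) := by
      refine isDiffeoGerm_of_deriv_ne_zero hFr hF0 ?_
      rw [(hasDerivAt_mk_left hFa).deriv, Prod.mk_zero_zero, hFd]
      simpa using hz₂
    obtain ⟨α, hα, -, hα2⟩ := hd.exists_symm
    refine ⟨α, hα, ?_⟩
    have ht : Tendsto (fun x => (α x, (0 : ℂ))) (𝓝 0) (𝓝 0) :=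
      (tendsto_mk_left 0 0).comp (analyticAt_tendsto_zero hα.1 hα.2.1)
    filter_upwards [hα2, ht.eventually hJ1] with x h1 h2
    have h3 : K (α x, 0) = (x, 0) := by
      simp only [hK, hA, Prod.mk_zero_zero, hF0, sub_zero, h1]
    rw [h3] at h2
    simp [h2, hΘ₀, h₁0]

/-- The branch read in a chart along an axis. -/
lemma deriv_axis {Θ : Plane → Plane} {S : ℂ → Plane} {α : ℂ → ℂ} {e : Plane} {x : ℂ}
    (hΘ : AnalyticAt ℂ Θ (x • e)) (hS : AnalyticAt ℂ S (α x)) (hα : AnalyticAt ℂ α x)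
    (h : ∀ᶠ y in 𝓝 x, Θ (y • e) = S (α y)) :
    fderiv ℂ Θ (x • e) e = deriv α x • deriv S (α x) := by
  have h0 : HasDerivAt (fun y : ℂ => y • e) e x := by
    simpa using (hasDerivAt_id x).smul_const e
  have h1 : HasDerivAt (fun y : ℂ => Θ (y • e)) (fderiv ℂ Θ (x • e) e) x :=
    hΘ.differentiableAt.hasFDerivAt.comp_hasDerivAt x h0
  have h2 : HasDerivAt (fun y => S (α y)) (deriv α x • deriv S (α x)) x :=
    hS.differentiableAt.hasDerivAt.scomp x hα.differentiableAt.hasDerivAt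
  exact h1.unique (h2.congr_of_eventuallyEq h)

lemma IsDiffeoGerm.deriv_ne_zero {α : ℂ → ℂ} (hα : IsDiffeoGerm univ univ α) :
    deriv α 0 ≠ 0 := by
  intro hc
  have := hα.injective_fderiv 1 (by rw [fderiv_eq_smul_deriv, hc, smul_zero])
  exact one_ne_zero this

/-- Invariance of y = 0 makes the dx coefficient of the pullback divisible by y, and invariance of x
= 0 makes the dy coefficient divisible by x. The two quotients a and b have at the origin the mixed
values of the linear part, up to a common factor, so a is a unit and μ = b / a has the value lam. -/
lemma exists_normalChart {ω : OneForm} (hω : AnalyticAt ℂ ω 0) {S₁ S₂ : ℂ → Plane} {lam : ℂ}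
    (h₁ : IsSeparatrix ω S₁) (h₂ : IsSeparatrix ω S₂) (hf : HasSeparatrixFrame ω S₁ S₂ lam)
    {z : Plane → ℂ} (hz : AnalyticAt ℂ z 0) (hz0 : z 0 = 0)
    (hz₁ : fderiv ℂ z 0 (deriv S₁ 0) ≠ 0) (hz₂ : fderiv ℂ z 0 (deriv S₂ 0) ≠ 0) :
    ∃ Θ μ a, IsNormalChart ω z S₁ S₂ lam Θ μ a := by
  obtain ⟨Θ, hΘ, hzΘ, ⟨α₁, hα₁, hl⟩, ⟨α₂, hα₂, hr⟩⟩ :=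
    exists_adapted_chart h₁.1 h₁.2.1 h₂.1 h₂.2.1 hf.det_ne_zero hz hz0 hz₁ hz₂
  have hΘa := hΘ.1
  have hΘ0 := hΘ.2.1
  have hPa : AnalyticAt ℂ (pullback Θ ω) 0 := analyticAt_pullback (by rwa [hΘ0]) hΘa
  have ea : ∀ y : ℂ, y • ((0 : ℂ), (1 : ℂ)) = (0, y) := fun y => by simp
  have eb : ∀ y : ℂ, y • ((1 : ℂ), (0 : ℂ)) = (y, 0) := fun y => by simp
  have tα₁ := analyticAt_tendsto_zero hα₁.1 hα₁.2.1
  have tα₂ := analyticAt_tendsto_zero hα₂.1 hα₂.2.1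
  have ta : Tendsto (fun y : ℂ => ((0 : ℂ), y)) (𝓝 0) (𝓝 0) := tendsto_mk_right 0 0
  have tb : Tendsto (fun x : ℂ => (x, (0 : ℂ))) (𝓝 0) (𝓝 0) := tendsto_mk_left 0 0
  have hd₁ : ∀ᶠ y in 𝓝 (0 : ℂ), fderiv ℂ Θ (0, y) (0, 1) = deriv α₁ y • deriv S₁ (α₁ y) := by
    filter_upwards [hl.eventually_nhds, ta.eventually hΘa.eventually_analyticAt,
      hα₁.1.eventually_analyticAt, tα₁.eventually h₁.1.eventually_analyticAt] with y e1 e2 e3 e4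
    rw [← ea] at e2 ⊢
    exact deriv_axis e2 e4 e3 (e1.mono fun s hs => by rw [ea, hs])
  have hd₂ : ∀ᶠ y in 𝓝 (0 : ℂ), fderiv ℂ Θ (y, 0) (1, 0) = deriv α₂ y • deriv S₂ (α₂ y) := by
    filter_upwards [hr.eventually_nhds, tb.eventually hΘa.eventually_analyticAt,
      hα₂.1.eventually_analyticAt, tα₂.eventually h₂.1.eventually_analyticAt] with y e1 e2 e3 e4
    rw [← eb] at e2 ⊢
    exact deriv_axis e2 e4 e3 (e1.mono fun s hs => by rw [eb, hs])
  have hA0 : ∀ᶠ x in 𝓝 (0 : ℂ), pullback Θ ω (x, 0) (1, 0) = 0 := by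
    filter_upwards [hd₂, hr, tα₂.eventually h₂.2.2.2] with x e1 e2 e3
    rw [pullback, ContinuousLinearMap.comp_apply, e1, e2, map_smul, e3, smul_zero]
  have hB0 : ∀ᶠ y in 𝓝 (0 : ℂ), pullback Θ ω (0, y) (0, 1) = 0 := by
    filter_upwards [hd₁, hl, tα₁.eventually h₁.2.2.2] with x e1 e2 e3
    rw [pullback, ContinuousLinearMap.comp_apply, e1, e2, map_smul, e3, smul_zero]
  have hAa := analyticAt_apply_const hPa (1, 0)
  have hBa := analyticAt_apply_const hPa (0, 1)
  obtain ⟨a, ha, hAe⟩ := exists_eq_snd_mul (c := 0) hAa hA0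
  obtain ⟨b, hb, hBe⟩ := exists_eq_fst_mul (c := 0) hBa hB0
  rw [Prod.mk_zero_zero] at ha hb hAe hBe
  have hc₁ := hα₁.deriv_ne_zero
  have hc₂ := hα₂.deriv_ne_zero
  have e₁ := hd₁.self_of_nhds
  have e₂ := hd₂.self_of_nhds
  rw [Prod.mk_zero_zero, hα₁.2.1] at e₁
  rw [Prod.mk_zero_zero, hα₂.2.1] at e₂
  have ha0 : a 0 = deriv α₁ 0 * deriv α₂ 0 * fderiv ℂ ω 0 (deriv S₁ 0) (deriv S₂ 0) := by
    have h3 : fderiv ℂ (fun p => pullback Θ ω p (1, 0)) 0 (0, 1) = a 0 := by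
      rw [EventuallyEq.fderiv_eq hAe]
      have d := (hasFDerivAt_snd (𝕜 := ℂ) (E := ℂ) (F := ℂ) (p := (0 : Plane))).fun_mul
        ha.differentiableAt.hasFDerivAt
      refine (congrArg (fun T : Plane →L[ℂ] ℂ => T (0, 1)) d.fderiv).trans ?_
      simp
    rw [← h3, fderiv_apply_const hPa, fderiv_pullback hω hf.zero hΘa hΘ0, e₁, e₂]
    simp only [map_smul, smul_apply, smul_eq_mul]
    ring
  have hb0 : b 0 = deriv α₁ 0 * deriv α₂ 0 * fderiv ℂ ω 0 (deriv S₂ 0) (deriv S₁ 0) := by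
    have h3 : fderiv ℂ (fun p => pullback Θ ω p (0, 1)) 0 (1, 0) = b 0 := by
      rw [EventuallyEq.fderiv_eq hBe]
      have d := (hasFDerivAt_fst (𝕜 := ℂ) (E := ℂ) (F := ℂ) (p := (0 : Plane))).fun_mul
        hb.differentiableAt.hasFDerivAt
      refine (congrArg (fun T : Plane →L[ℂ] ℂ => T (1, 0)) d.fderiv).trans ?_
      simp
    rw [← h3, fderiv_apply_const hPa, fderiv_pullback hω hf.zero hΘa hΘ0, e₁, e₂]
    simp only [map_smul, smul_apply, smul_eq_mul]
    ring
  have ha0' : a 0 ≠ 0 := by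
    rw [ha0]
    exact mul_ne_zero (mul_ne_zero hc₁ hc₂) hf.mixed_ne_zero
  refine ⟨Θ, fun p => b p / a p, a, ⟨hΘ, hb.div ha ha0', ?_, ha, ha0', ?_, hzΘ,
    ⟨α₁, hα₁, hl⟩, ⟨α₂, hα₂, hr⟩⟩⟩
  · rw [div_eq_iff ha0', ha0, hb0, hf.mixed]
    ring
  · filter_upwards [hAe, hBe, ha.continuousAt.eventually_ne ha0'] with p e1 e2 e3 v
    rw [clm_apply_prod, e1, e2]
    field_simp

lemma wedge_pullback (ω η : OneForm) (Θ : Plane → Plane) (p : Plane) :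
    wedge (pullback Θ ω) (pullback Θ η) p
      = wedge ω η (Θ p) * det₂ (fderiv ℂ Θ p (1, 0)) (fderiv ℂ Θ p (0, 1)) := by
  simp only [wedge, pullback, ContinuousLinearMap.comp_apply, det₂]
  rw [clm_apply_prod (ω (Θ p)) (fderiv ℂ Θ p (1, 0)),
    clm_apply_prod (ω (Θ p)) (fderiv ℂ Θ p (0, 1)),
    clm_apply_prod (η (Θ p)) (fderiv ℂ Θ p (1, 0)),
    clm_apply_prod (η (Θ p)) (fderiv ℂ Θ p (0, 1))]
  ring

lemma IsDiffeoGerm.det_ne_zero {Θ : Plane → Plane} (hΘ : IsDiffeoGerm univ univ Θ) :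
    ∀ᶠ p in 𝓝 (0 : Plane), det₂ (fderiv ℂ Θ p (1, 0)) (fderiv ℂ Θ p (0, 1)) ≠ 0 := by
  have h0 : det₂ (fderiv ℂ Θ 0 (1, 0)) (fderiv ℂ Θ 0 (0, 1)) ≠ 0 := by
    intro hc
    have h1 : fderiv ℂ Θ 0 (1, 0) ≠ 0 := fun h => by simpa using hΘ.injective_fderiv _ h
    obtain ⟨c, h2⟩ := det₂_eq_zero h1 hc
    have h3 := hΘ.injective_fderiv ((0, 1) - c • (1, 0)) (by rw [map_sub, map_smul, h2, sub_self])
    simp [Prod.ext_iff] at h3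
  have hc : ContinuousAt (fun p => det₂ (fderiv ℂ Θ p (1, 0)) (fderiv ℂ Θ p (0, 1))) 0 := by
    have h1 : ContinuousAt (fderiv ℂ Θ) 0 := hΘ.1.fderiv.continuousAt
    unfold det₂
    fun_prop
  exact hc.eventually_ne h0

/-- In the chart the two forms are proportional to y dx + μ x dy and dx + dy, whose exterior product
has coefficient y - μ x. -/
lemma IsNormalChart.wedge_eq {ω η : OneForm} {z u : Plane → ℂ} {S₁ S₂ : ℂ → Plane} {lam : ℂ}
    {Θ : Plane → Plane} {μ a : Plane → ℂ} (h : IsNormalChart ω z S₁ S₂ lam Θ μ a)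
    (hz : AnalyticAt ℂ z 0) (hηz : ∀ᶠ p in 𝓝 (0 : Plane), η p = u p • fderiv ℂ z p) :
    ∀ᶠ p in 𝓝 (0 : Plane), wedge ω η (Θ p)
      * det₂ (fderiv ℂ Θ p (1, 0)) (fderiv ℂ Θ p (0, 1)) = a p * u (Θ p) * (p.2 - μ p * p.1) := by
  have hΘt := analyticAt_tendsto_zero h.diffeo.1 h.diffeo.2.1
  filter_upwards [h.form_eq, h.integral_eq.eventually_nhds, hΘt.eventually hηz,
    hΘt.eventually hz.eventually_analyticAt, h.diffeo.1.eventually_analyticAt] with p e1 e2 e3 e4 e5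
  rw [← wedge_pullback]
  have h1 : ∀ v : Plane, pullback Θ η p v = u (Θ p) * (v.1 + v.2) := fun v => by
    rw [pullback, ContinuousLinearMap.comp_apply, e3, smul_apply, smul_eq_mul,
      ← fderiv_comp_apply e4 e5, EventuallyEq.fderiv_eq e2]
    have d := (hasFDerivAt_fst (𝕜 := ℂ) (E := ℂ) (F := ℂ) (p := p)).fun_add hasFDerivAt_snd
    rw [d.fderiv]
    rfl
  simp only [wedge, e1, h1]
  ring

lemma IsNormalChart.mem_tangentCurve {ω η : OneForm} {z u : Plane → ℂ} {S₁ S₂ : ℂ → Plane}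
    {lam : ℂ} {Θ : Plane → Plane} {μ a : Plane → ℂ} (h : IsNormalChart ω z S₁ S₂ lam Θ μ a)
    (hz : AnalyticAt ℂ z 0) (hu : AnalyticAt ℂ u 0) (hu0 : u 0 ≠ 0)
    (hηz : ∀ᶠ p in 𝓝 (0 : Plane), η p = u p • fderiv ℂ z p) :
    ∀ᶠ p in 𝓝 (0 : Plane), Θ p ∈ tangentCurve ω η ↔ p.2 = μ p * p.1 := by
  have hΘt := analyticAt_tendsto_zero h.diffeo.1 h.diffeo.2.1
  filter_upwards [h.wedge_eq hz hηz, h.diffeo.det_ne_zero,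
    hΘt.eventually (hu.continuousAt.eventually_ne hu0),
    h.unit_analytic.continuousAt.eventually_ne h.unit_ne_zero] with p e1 e2 e3 e4
  change wedge ω η (Θ p) = 0 ↔ _
  rw [← sub_eq_zero (a := p.2)]
  constructor
  · intro h1
    rw [h1, zero_mul] at e1
    exact (mul_eq_zero.1 e1.symm).resolve_left (mul_ne_zero e4 e3)
  · intro h1
    rw [h1, mul_zero] at e1
    exact (mul_eq_zero.1 e1).resolve_right e2

/-- The tangent curve `y = μ x` of a normal form, parametrized by `x + y`. -/
lemma exists_tangentCurve_param {μ : Plane → ℂ} {lam : ℂ} (hμ : AnalyticAt ℂ μ 0)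
    (hμ0 : μ 0 = lam) (h1 : 1 + lam ≠ 0) : ∃ q : ℂ → Plane, AnalyticAt ℂ q 0 ∧ q 0 = 0 ∧
      (∀ᶠ u in 𝓝 (0 : ℂ), (q u).1 + (q u).2 = u ∧ (q u).2 = μ (q u) * (q u).1) ∧
      ∀ᶠ p in 𝓝 (0 : Plane), p.2 = μ p * p.1 → q (p.1 + p.2) = p := by
  set K : Plane → Plane := fun p => (p.1 + p.2, p.2 - μ p * p.1) with hK
  have hKa : AnalyticAt ℂ K 0 :=
    (analyticAt_fst.add analyticAt_snd).prod (analyticAt_snd.sub (hμ.mul analyticAt_fst))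
  have hKd : IsDiffeoGerm univ univ K := by
    refine isDiffeoGerm_of_injective_fderiv hKa (by simp [hK]) fun v hv => ?_
    have d1 : HasFDerivAt K _ 0 := (hasFDerivAt_fst.fun_add hasFDerivAt_snd).prodMk
      (hasFDerivAt_snd.fun_sub (hμ.differentiableAt.hasFDerivAt.fun_mul
        (hasFDerivAt_fst (𝕜 := ℂ) (E := ℂ) (F := ℂ) (p := (0 : Plane)))))
    rw [d1.fderiv] at hv
    simp [hμ0] at hv
    obtain ⟨h2, h3⟩ := hv
    have h4 : (1 + lam) * v.1 = 0 := by linear_combination h2 - h3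
    have h5 := (mul_eq_zero.1 h4).resolve_left h1
    refine Prod.ext h5 ?_
    rw [h5, zero_add] at h2
    exact h2
  obtain ⟨J, hJ, hJ1, hJ2⟩ := hKd.exists_symm
  have ht : Tendsto (fun u : ℂ => (u, (0 : ℂ))) (𝓝 0) (𝓝 0) := tendsto_mk_left 0 0
  refine ⟨fun u => J (u, 0), analyticAt_comp_mk_left hJ.1, hJ.2.1, ?_, ?_⟩
  · filter_upwards [ht.eventually hJ2] with u hu
    exact ⟨congrArg Prod.fst hu, sub_eq_zero.1 (congrArg Prod.snd hu)⟩
  · filter_upwards [hJ1] with p hp h2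
    have : K p = (p.1 + p.2, 0) := by simp only [hK, h2, sub_self]
    rw [← this, hp]

/-! ### First integrals on a strip of the blow-up -/

/-- The function `1 / (1 + μ)` in the coordinates `(w, y)`, `x = e ^ w y`. -/
noncomputable def leafSlope (μ : Plane → ℂ) (p : Plane) : ℂ :=
  1 / (1 + μ (Complex.exp p.1 * p.2, p.2))

/-- The function `y e ^ k` of `(w, y)` is a first integral of `y dx + μ x dy = 0`. -/
structure IsLeafExponent (μ : Plane → ℂ) (w₀ : ℂ) (R : ℝ) (k : Plane → ℂ) : Prop where
  base : k (w₀, 0) = 0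
  analytic : ∀ w ∈ Metric.ball w₀ R, AnalyticAt ℂ k (w, 0)
  eq : ∀ w ∈ Metric.ball w₀ R, ∀ᶠ p in 𝓝 (w, (0 : ℂ)),
    fderiv ℂ k p (1, 0) = leafSlope μ p * (1 + p.2 * fderiv ℂ k p (0, 1))

/-- The first integral `y e ^ k`. -/
noncomputable def leafIntegral (k : Plane → ℂ) (p : Plane) : ℂ := p.2 * Complex.exp (k p)

lemma analyticAt_exp_blowup (p : Plane) :
    AnalyticAt ℂ (fun p : Plane => (Complex.exp p.1 * p.2, p.2)) p :=
  (analyticAt_fst.cexp.mul analyticAt_snd).prod analyticAt_snd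

lemma tendsto_exp_blowup (w : ℂ) :
    Tendsto (fun p : Plane => (Complex.exp p.1 * p.2, p.2)) (𝓝 (w, 0)) (𝓝 0) := by
  have := (analyticAt_exp_blowup (w, 0)).continuousAt.tendsto
  simpa [← Prod.zero_eq_mk] using this

lemma analyticAt_comp_exp_blowup {μ : Plane → ℂ} (hμ : AnalyticAt ℂ μ 0) (w : ℂ) :
    AnalyticAt ℂ (fun p : Plane => μ (Complex.exp p.1 * p.2, p.2)) (w, 0) :=
  AnalyticAt.fun_comp (g := μ) (f := fun p : Plane => (Complex.exp p.1 * p.2, p.2))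
    (by simpa [← Prod.zero_eq_mk] using hμ) (analyticAt_exp_blowup _)

lemma analyticAt_leafSlope {μ : Plane → ℂ} (hμ : AnalyticAt ℂ μ 0) (h1 : 1 + μ 0 ≠ 0) (w : ℂ) :
    AnalyticAt ℂ (leafSlope μ) (w, 0) :=
  analyticAt_const.div (analyticAt_const.add (analyticAt_comp_exp_blowup hμ w)) (by simpa [← Prod.zero_eq_mk] using h1)

lemma leafSlope_axis (μ : Plane → ℂ) (w : ℂ) : leafSlope μ (w, 0) = 1 / (1 + μ 0) := by
  simp [leafSlope, ← Prod.zero_eq_mk]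

lemma exists_leafExponent {μ : Plane → ℂ} (hμ : AnalyticAt ℂ μ 0) (h1 : 1 + μ 0 ≠ 0) (w₀ : ℂ)
    {R : ℝ} (hR : 0 < R) : ∃ k, IsLeafExponent μ w₀ R k := by
  obtain ⟨k, hk0, hk⟩ := exists_first_integral_exponent (c := w₀) hR
    (fun w _ => analyticAt_leafSlope hμ h1 w)
  exact ⟨k, hk0, fun w hw => (hk w hw).1, fun w hw => (hk w hw).2⟩

lemma fderiv_leafIntegral {k : Plane → ℂ} {p : Plane} (hk : AnalyticAt ℂ k p) (v : Plane) :
    fderiv ℂ (leafIntegral k) p v = Complex.exp (k p) * (v.2 + p.2 * fderiv ℂ k p v) := by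
  have h : HasFDerivAt (leafIntegral k) _ p :=
    (hasFDerivAt_snd (𝕜 := ℂ) (E := ℂ) (F := ℂ) (p := p)).mul
      hk.differentiableAt.hasFDerivAt.cexp
  rw [h.fderiv]
  simp
  ring

lemma analyticAt_leafIntegral {k : Plane → ℂ} {p : Plane} (hk : AnalyticAt ℂ k p) :
    AnalyticAt ℂ (leafIntegral k) p :=
  analyticAt_snd.mul hk.cexp

namespace IsLeafExponent

variable {μ k : Plane → ℂ} {w₀ : ℂ} {R : ℝ}

lemma fderiv_eq (h : IsLeafExponent μ w₀ R k) {w : ℂ} (hw : w ∈ Metric.ball w₀ R) :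
    ∀ᶠ p in 𝓝 (w, (0 : ℂ)), fderiv ℂ (leafIntegral k) p (1, 0)
      = p.2 * leafSlope μ p * fderiv ℂ (leafIntegral k) p (0, 1) := by
  filter_upwards [h.eq w hw, (h.analytic w hw).eventually_analyticAt] with p e1 e2
  rw [fderiv_leafIntegral e2, fderiv_leafIntegral e2, e1]
  ring

/-- On y = 0 the equation for k reduces to k_w = 1 / (1 + μ(0)): the restriction of the first
integral to the divisor depends only on the index. -/
lemma apply_axis (h : IsLeafExponent μ w₀ R k) (hR : 0 < R) {w : ℂ} (hw : w ∈ Metric.ball w₀ R) :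
    k (w, 0) = 1 / (1 + μ 0) * (w - w₀) := by
  have hd : ∀ w ∈ Metric.ball w₀ R,
      HasDerivAt (fun w => k (w, 0) - 1 / (1 + μ 0) * (w - w₀)) 0 w := fun w hw => by
    have h1 := hasDerivAt_mk_left (h.analytic w hw)
    have h2 := (h.eq w hw).self_of_nhds
    rw [h2, leafSlope_axis, zero_mul, add_zero, mul_one] at h1
    refine (h1.sub (((hasDerivAt_id w).sub_const w₀).const_mul (1 / (1 + μ 0)))).congr_deriv ?_
    ring
  have h1 := Metric.isOpen_ball.is_const_of_deriv_eq_zero (convex_ball w₀ R).isPreconnected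
    (fun w hw => (hd w hw).differentiableAt.differentiableWithinAt)
    (fun w hw => (hd w hw).deriv) hw (Metric.mem_ball_self hR)
  simp only [h.base, sub_self, mul_zero] at h1
  exact sub_eq_zero.1 h1

/-- Along a path in a leaf, the first integral is constant. -/
lemma eq_of_path (h : IsLeafExponent μ w₀ 8 k) (hμ : AnalyticAt ℂ μ 0) (h1 : 1 + μ 0 ≠ 0)
    {lam : ℂ} (hlam : Complex.exp w₀ * lam = 1) :
    ∃ ε > 0, ∀ X Y X' Y' : ℝ → ℂ,
      (∀ s ∈ Icc (0 : ℝ) 1, HasDerivWithinAt X (X' s) (Icc 0 1) s ∧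
        HasDerivWithinAt Y (Y' s) (Icc 0 1) s ∧
        Y s * X' s + μ (X s, Y s) * X s * Y' s = 0 ∧ Y s ≠ 0 ∧ ‖Y s‖ < ε ∧
        ‖lam * X s / Y s * Complex.exp (-(2 * Real.pi * Complex.I * s)) - 1‖ < ε) →
      leafIntegral k (w₀ + Complex.log (lam * X 0 / Y 0), Y 0)
        = leafIntegral k (w₀ + Complex.log (lam * X 1 / Y 1) + 2 * Real.pi * Complex.I, Y 1) := by
  -- The lifted path stays within 2π + 3/4 < 7.5 of w₀. A compact disc inside the disc of radius 8
  -- permits a uniform width in y.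
  have hball : ∀ w ∈ Metric.closedBall w₀ 7.5, w ∈ Metric.ball w₀ 8 := fun w hw =>
    Metric.closedBall_subset_ball (by norm_num) hw
  have hne : ∀ w : ℂ, ∀ᶠ p in 𝓝 (w, (0 : ℂ)), 1 + μ (Complex.exp p.1 * p.2, p.2) ≠ 0 := fun w =>
    (analyticAt_const.add (analyticAt_comp_exp_blowup hμ w)).continuousAt.eventually_ne
      (by simpa [← Prod.zero_eq_mk] using h1)
  obtain ⟨δ, hδ, hδ'⟩ := exists_uniform_of_eventually (isCompact_closedBall w₀ 7.5)
    (P := fun p => AnalyticAt ℂ k p ∧ fderiv ℂ (leafIntegral k) p (1, 0)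
      = p.2 * leafSlope μ p * fderiv ℂ (leafIntegral k) p (0, 1) ∧
        1 + μ (Complex.exp p.1 * p.2, p.2) ≠ 0)
    fun w hw => (h.analytic w (hball w hw)).eventually_analyticAt.and
      ((h.fderiv_eq (hball w hw)).and (hne w))
  have hlam0 : lam ≠ 0 := right_ne_zero_of_mul_eq_one hlam
  refine ⟨min δ (1 / 2), lt_min hδ (by norm_num), fun X Y X' Y' hXY => ?_⟩
  set E : ℝ → ℂ := fun s => Complex.exp (-(2 * Real.pi * Complex.I * s)) with hE
  set V : ℝ → ℂ := fun s => lam * X s / Y s * E s with hV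
  -- A continuous logarithm of X / Y along the path: once the rotation is removed, V stays within
  -- 1/2 of 1, where the principal logarithm is analytic and has norm at most 3/4.
  set W : ℝ → ℂ := fun s => w₀ + 2 * Real.pi * Complex.I * s + Complex.log (V s) with hW
  have hVs : ∀ s ∈ Icc (0 : ℝ) 1, V s ∈ Complex.slitPlane ∧ ‖Complex.log (V s)‖ ≤ 3 / 4 := by
    intro s hs
    obtain ⟨-, -, -, -, -, h6⟩ := hXY s hs
    have h7 : ‖V s - 1‖ < 1 / 2 := lt_of_lt_of_le h6 (min_le_right _ _)
    have h8 := Complex.mem_slitPlane_of_norm_lt_one (h7.trans (by norm_num))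
    have h9 := Complex.norm_log_one_add_half_le_self h7.le
    rw [add_sub_cancel] at h8 h9
    exact ⟨h8, h9.trans (by linarith)⟩
  have hWb : ∀ s ∈ Icc (0 : ℝ) 1, W s ∈ Metric.closedBall w₀ 7.5 := by
    intro s hs
    rw [mem_closedBall_iff_norm]
    have e1 : W s - w₀ = 2 * Real.pi * Complex.I * s + Complex.log (V s) := by
      simp only [hW]
      ring
    have e2 : ‖(2 * Real.pi * Complex.I * s : ℂ)‖ ≤ 2 * Real.pi := by
      simp only [norm_mul, Complex.norm_real, Complex.norm_I, mul_one, RCLike.norm_ofNat,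
        Real.norm_eq_abs, abs_of_pos Real.pi_pos, abs_of_nonneg hs.1]
      nlinarith [Real.pi_pos, hs.2]
    rw [e1]
    have e3 := norm_add_le (2 * Real.pi * Complex.I * s : ℂ) (Complex.log (V s))
    have e4 := (hVs s hs).2
    have e5 := Real.pi_lt_d2
    linarith
  have hderiv : ∀ s ∈ Icc (0 : ℝ) 1,
      HasDerivWithinAt (fun s => leafIntegral k (W s, Y s)) 0 (Icc 0 1) s := by
    intro s hs
    obtain ⟨dX, dY, hleaf, hY0, hYδ, -⟩ := hXY s hs
    obtain ⟨hka, hL, hMne⟩ := hδ' _ (hWb s hs) (Y s) (lt_of_lt_of_le hYδ (min_le_left _ _))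
    have hV0 : V s ≠ 0 := Complex.slitPlane_ne_zero (hVs s hs).1
    have hX0 : X s ≠ 0 := by
      intro hc
      simp [hV, hc] at hV0
    have dE : HasDerivWithinAt E (E s * (-(2 * Real.pi * Complex.I))) (Icc 0 1) s := by
      have d1 : HasDerivAt (fun s : ℝ => -(2 * Real.pi * Complex.I * (s : ℂ)))
          (-(2 * Real.pi * Complex.I * 1)) s :=
        ((Complex.ofRealCLM.hasDerivAt (x := s)).const_mul (2 * Real.pi * Complex.I)).neg
      have d2 := d1.cexp.hasDerivWithinAt (s := Icc 0 1)
      rwa [mul_one] at d2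
    have dV := ((dX.const_mul lam).div dY hY0).mul dE
    have dW := ((((Complex.ofRealCLM.hasDerivAt (x := s)).const_mul
      (2 * Real.pi * Complex.I)).const_add w₀).hasDerivWithinAt (s := Icc 0 1)).add
        (dV.clog_real (hVs s hs).1)
    have hWX : Complex.exp (W s) * Y s = X s := by
      have e1 : Complex.exp (2 * Real.pi * Complex.I * s) * E s = 1 := by
        rw [hE, ← Complex.exp_add, add_neg_cancel, Complex.exp_zero]
      simp only [hW]
      rw [Complex.exp_add, Complex.exp_add, Complex.exp_log hV0]
      simp only [hV]
      field_simp
      linear_combination Complex.exp (2 * Real.pi * Complex.I * s) * E s * hlam + e1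
    have hW' : ∃ W', HasDerivWithinAt W W' (Icc 0 1) s ∧ W' = X' s / X s - Y' s / Y s := by
      refine ⟨_, dW, ?_⟩
      have hE0 : E s ≠ 0 := Complex.exp_ne_zero _
      simp only [Pi.mul_apply, Pi.div_apply]
      field_simp
      ring_nf
      simp
    obtain ⟨W', dW, hW'⟩ := hW'
    have hH := (analyticAt_leafIntegral hka).differentiableAt.hasFDerivAt.restrictScalars ℝ
    have hc := hH.comp_hasDerivWithinAt s (dW.prodMk dY)
    refine hc.congr_deriv ?_
    change fderiv ℂ (leafIntegral k) (W s, Y s) (W', Y' s) = 0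
    rw [clm_apply_prod, hL]
    simp only [leafSlope, hWX]
    simp only [hWX] at hMne
    rw [hW']
    field_simp
    linear_combination fderiv ℂ (leafIntegral k) (W s, Y s) (0, 1) * hleaf
  have hconst : leafIntegral k (W 1, Y 1) = leafIntegral k (W 0, Y 0) := by
    refine constant_of_has_deriv_right_zero (fun s hs => (hderiv s hs).continuousWithinAt)
      (fun s hs => ?_) 1 (right_mem_Icc.2 zero_le_one)
    exact (hderiv s ⟨hs.1, hs.2.le⟩).mono_of_mem_nhdsWithin (Icc_mem_nhdsGE_of_mem hs)
  have hE0 : E 0 = 1 := by simp [hE]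
  have hE1 : E 1 = 1 := by
    rw [hE]
    simp only [Complex.ofReal_one, mul_one]
    rw [Complex.exp_neg, Complex.exp_two_pi_mul_I, inv_one]
  have hW0 : W 0 = w₀ + Complex.log (lam * X 0 / Y 0) := by simp [hW, hV, hE0]
  have hW1 : W 1 = w₀ + Complex.log (lam * X 1 / Y 1) + 2 * Real.pi * Complex.I := by
    simp only [hW, hV, hE1, mul_one, Complex.ofReal_one]
    ring
  rw [← hW0, ← hW1, hconst]

end IsLeafExponent

/-! ### The holonomy in a normal chart -/

lemma plane_eq (v : Plane) : v = v.1 • ((1 : ℂ), (0 : ℂ)) + v.2 • ((0 : ℂ), (1 : ℂ)) := by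
  ext <;> simp

lemma det₂_clm (A : Plane →L[ℂ] Plane) (v w : Plane) :
    det₂ (A v) (A w) = det₂ (A (1, 0)) (A (0, 1)) * det₂ v w := by
  have hv : A v = v.1 • A (1, 0) + v.2 • A (0, 1) := by
    conv_lhs => rw [plane_eq v]
    rw [map_add, map_smul, map_smul]
  have hw : A w = w.1 • A (1, 0) + w.2 • A (0, 1) := by
    conv_lhs => rw [plane_eq w]
    rw [map_add, map_smul, map_smul]
  rw [hv, hw]
  simp only [det₂, Prod.fst_add, Prod.snd_add, Prod.smul_fst, Prod.smul_snd, smul_eq_mul]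
  ring

lemma norm_det₂_le (v w : Plane) : ‖det₂ v w‖ ≤ 2 * ‖v‖ * ‖w‖ := by
  unfold det₂
  have h1 := norm_fst_le v
  have h2 := norm_snd_le v
  have h3 := norm_fst_le w
  have h4 := norm_snd_le w
  calc ‖v.1 * w.2 - v.2 * w.1‖ ≤ ‖v.1 * w.2‖ + ‖v.2 * w.1‖ := norm_sub_le _ _
    _ = ‖v.1‖ * ‖w.2‖ + ‖v.2‖ * ‖w.1‖ := by rw [norm_mul, norm_mul]
    _ ≤ ‖v‖ * ‖w‖ + ‖v‖ * ‖w‖ := by gcongr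
    _ = 2 * ‖v‖ * ‖w‖ := by ring

/-- A point of `ℂ²` whose direction is close to `[ζ : lam]`. -/
lemma ratio_of_norm_le {lam ζ : ℂ} (hlam : lam ≠ 0) (hζ : ‖ζ‖ = 1) {ε δ : ℝ}
    (hδ₁ : δ ≤ ‖lam‖ / 2) (hδ₂ : δ * (1 + 2 / ‖lam‖) < ε) {q : Plane} (hq : q ≠ 0)
    (h : ‖ζ * q.2 - lam * q.1‖ ≤ δ * ‖q‖) :
    q.2 ≠ 0 ∧ ‖lam * q.1 / q.2 * ζ⁻¹ - 1‖ < ε := by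
  have hl : 0 < ‖lam‖ := norm_pos_iff.2 hlam
  have hqpos : 0 < ‖q‖ := norm_pos_iff.2 hq
  have hδ0 : 0 ≤ δ := by
    by_contra hc
    have := norm_nonneg (ζ * q.2 - lam * q.1)
    nlinarith
  have h1 : ‖lam‖ * ‖q.1‖ ≤ ‖q.2‖ + δ * ‖q‖ := by
    have e1 : lam * q.1 = ζ * q.2 - (ζ * q.2 - lam * q.1) := by ring
    have e2 := norm_sub_le (ζ * q.2) (ζ * q.2 - lam * q.1)
    rw [← e1, norm_mul, norm_mul, hζ, one_mul] at e2
    linarith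
  have h2 : ‖q‖ ≤ (1 + 2 / ‖lam‖) * ‖q.2‖ := by
    have hpos : 0 ≤ 2 / ‖lam‖ * ‖q.2‖ := by positivity
    rcases max_choice ‖q.1‖ ‖q.2‖ with e | e
    · have e3 : ‖q‖ = ‖q.1‖ := by rw [Prod.norm_def, e]
      have e4 : ‖q.1‖ ≤ 2 / ‖lam‖ * ‖q.2‖ := by
        rw [div_mul_eq_mul_div, le_div_iff₀ hl]
        have e5 : δ * ‖q‖ ≤ ‖lam‖ / 2 * ‖q.1‖ := by
          rw [e3]
          gcongr
        nlinarith
      rw [e3]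
      nlinarith [norm_nonneg q.2]
    · have e3 : ‖q‖ = ‖q.2‖ := by rw [Prod.norm_def, e]
      rw [e3]
      nlinarith
  have hy : q.2 ≠ 0 := by
    intro hc
    rw [hc, norm_zero, mul_zero] at h2
    linarith
  have hy' : 0 < ‖q.2‖ := norm_pos_iff.2 hy
  have hζ0 : ζ ≠ 0 := by
    intro hc
    simp [hc] at hζ
  refine ⟨hy, lt_of_le_of_lt ?_ hδ₂⟩
  have e1 : lam * q.1 / q.2 * ζ⁻¹ - 1 = -(ζ * q.2 - lam * q.1) / (q.2 * ζ) := by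
    field_simp
    ring
  rw [e1, norm_div, norm_neg, norm_mul, hζ, mul_one, div_le_iff₀ hy']
  calc ‖ζ * q.2 - lam * q.1‖ ≤ δ * ‖q‖ := h
    _ ≤ δ * ((1 + 2 / ‖lam‖) * ‖q.2‖) := by gcongr
    _ = δ * (1 + 2 / ‖lam‖) * ‖q.2‖ := by ring

/-- The condition on directions in the definition of holonomy is linear in the original coordinates.
As Θ is tangent to its linear part A, the determinant of A(ζ, lam) and c is det A times ζ y - lam x
up to a small multiple of the norm, where (x, y) = χ(c). This yields a bound on the slope in the
chart. -/
lemma exists_cone_control {Θ χ : Plane → Plane} (hΘ : IsDiffeoGerm univ univ Θ)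
    (hχ : AnalyticAt ℂ χ 0) (hχ0 : χ 0 = 0) (hχ2 : ∀ᶠ p in 𝓝 (0 : Plane), Θ (χ p) = p)
    {β lam : ℂ} (hβ : β ≠ 0) (hlam : lam ≠ 0) {ε₁ : ℝ} (hε₁ : 0 < ε₁) :
    ∃ ε > 0, ∀ (c : Plane) (ζ : ℂ), ‖ζ‖ = 1 → c ≠ 0 → ‖c‖ ≤ ε →
      ‖det₂ (β • fderiv ℂ Θ 0 (ζ, lam)) c‖ ≤ ε * ‖c‖ →
      (χ c).2 ≠ 0 ∧ ‖(χ c).2‖ < ε₁ ∧ ‖lam * (χ c).1 / (χ c).2 * ζ⁻¹ - 1‖ < ε₁ := by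
  set A := fderiv ℂ Θ 0 with hA
  set D := det₂ (A (1, 0)) (A (0, 1)) with hD
  have hD0 : D ≠ 0 := hΘ.det_ne_zero.self_of_nhds
  set K := ‖β * D‖ with hK
  have hKpos : 0 < K := norm_pos_iff.2 (mul_ne_zero hβ hD0)
  set C := 1 + 2 / ‖lam‖ with hC
  have hCpos : 0 < C := by positivity
  have hl : 0 < ‖lam‖ := norm_pos_iff.2 hlam
  set δ := min (‖lam‖ / 2) (ε₁ / (2 * C)) with hδ
  have hδpos : 0 < δ := lt_min (by positivity) (by positivity)
  have hδ1 : δ ≤ ‖lam‖ / 2 := min_le_left _ _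
  have hδ2 : δ * C < ε₁ := by
    have h1 : δ ≤ ε₁ / (2 * C) := min_le_right _ _
    rw [le_div_iff₀ (by positivity)] at h1
    nlinarith [mul_pos hδpos hCpos]
  set B := 2 * (‖β‖ * (‖A‖ * (1 + ‖lam‖))) with hB
  have hB0 : 0 ≤ B := by positivity
  set ε₂ := min 1 (K * δ / (2 * (B + 1))) with hε₂
  have hε₂pos : 0 < ε₂ := lt_min one_pos (by positivity)
  have hχt := analyticAt_tendsto_zero hχ hχ0
  have hlin : ∀ᶠ q in 𝓝 (0 : Plane), ‖Θ q - A q‖ ≤ ε₂ * ‖q‖ := by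
    have h1 := hΘ.1.differentiableAt.hasFDerivAt.isLittleO.def hε₂pos
    simpa [hΘ.2.1] using h1
  have hsmall : ∀ᶠ q in 𝓝 (0 : Plane), ‖q‖ < ε₁ := by
    have := Metric.ball_mem_nhds (0 : Plane) hε₁
    filter_upwards [this] with q hq
    simpa using hq
  have hev := (hχt.eventually hlin).and ((hχt.eventually hsmall).and hχ2)
  obtain ⟨r, hr, hball⟩ := Metric.eventually_nhds_iff.1 hev
  set ε := min (r / 2) (K * δ / (2 * (1 + ‖A‖))) with hε
  have hA1 : 0 < 1 + ‖A‖ := by positivity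
  have hεpos : 0 < ε := lt_min (by positivity) (by positivity)
  refine ⟨ε, hεpos, fun c ζ hζ hc hcε hdet => ?_⟩
  obtain ⟨h1, h2, h3⟩ := hball (y := c) (by
    rw [dist_zero_right]
    have : ε ≤ r / 2 := min_le_left _ _
    linarith)
  rw [h3] at h1
  set q := χ c with hq
  have hq0 : q ≠ 0 := by
    intro h0
    rw [h0, hΘ.2.1] at h3
    exact hc h3.symm
  have hcq : ‖c‖ ≤ (1 + ‖A‖) * ‖q‖ := by
    have e1 : c = (c - A q) + A q := by abel
    have e2 := norm_add_le (c - A q) (A q)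
    rw [← e1] at e2
    have e3 := A.le_opNorm q
    have e4 : ε₂ * ‖q‖ ≤ 1 * ‖q‖ := by
      gcongr
      exact min_le_left _ _
    linarith
  have hvn : 2 * ‖β • A (ζ, lam)‖ ≤ B := by
    rw [norm_smul, hB]
    have e1 := A.le_opNorm (ζ, lam)
    have e2 : ‖((ζ, lam) : Plane)‖ ≤ 1 + ‖lam‖ := by
      rw [Prod.norm_def]
      exact max_le (by simp [hζ]) (by simp)
    gcongr
    exact e1.trans (by gcongr)
  have hkey : β * D * (ζ * q.2 - lam * q.1)
      = det₂ (β • A (ζ, lam)) c - det₂ (β • A (ζ, lam)) (c - A q) := by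
    have e1 : det₂ (β • A (ζ, lam)) c - det₂ (β • A (ζ, lam)) (c - A q)
        = β * det₂ (A (ζ, lam)) (A q) := by
      simp only [det₂, Prod.smul_fst, Prod.smul_snd, smul_eq_mul, Prod.fst_sub, Prod.snd_sub]
      ring
    rw [e1, det₂_clm, ← hD]
    simp only [det₂]
    ring
  have hbound : K * ‖ζ * q.2 - lam * q.1‖ ≤ K * (δ * ‖q‖) := by
    rw [hK, ← norm_mul, hkey]
    have e1 := norm_det₂_le (β • A (ζ, lam)) (c - A q)
    have e2 : 2 * ‖β • A (ζ, lam)‖ * ‖c - A q‖ ≤ B * (ε₂ * ‖q‖) := by gcongr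
    have e3 : ε * ‖c‖ ≤ K * δ / (2 * (1 + ‖A‖)) * ((1 + ‖A‖) * ‖q‖) := by
      gcongr
      exact min_le_right _ _
    have e4 : K * δ / (2 * (1 + ‖A‖)) * ((1 + ‖A‖) * ‖q‖) = K * δ * ‖q‖ / 2 := by
      field_simp
    have e5 : B * ε₂ ≤ K * δ / 2 := by
      have e6 : ε₂ ≤ K * δ / (2 * (B + 1)) := min_le_right _ _
      rw [le_div_iff₀ (by positivity)] at e6
      nlinarith
    have e7 : B * (ε₂ * ‖q‖) ≤ K * δ / 2 * ‖q‖ := by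
      rw [← mul_assoc]
      gcongr
    have e8 := norm_sub_le (det₂ (β • A (ζ, lam)) c) (det₂ (β • A (ζ, lam)) (c - A q))
    rw [← hK]
    linarith
  have hfin := ratio_of_norm_le hlam hζ hδ1 hδ2 hq0 (le_of_mul_le_mul_left hbound hKpos)
  exact ⟨hfin.1, (norm_snd_le q).trans_lt h2, hfin.2⟩

namespace IsNormalChart

variable {ω η : OneForm} {z u : Plane → ℂ} {S₁ S₂ : ℂ → Plane} {lam : ℂ}
  {Θ : Plane → Plane} {μ a : Plane → ℂ}

lemma fderiv_axes (h : IsNormalChart ω z S₁ S₂ lam Θ μ a) (hS₁ : AnalyticAt ℂ S₁ 0)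
    (hS₂ : AnalyticAt ℂ S₂ 0) :
    (∃ c : ℂ, c ≠ 0 ∧ deriv S₁ 0 = c • fderiv ℂ Θ 0 (0, 1)) ∧
      ∃ c : ℂ, c ≠ 0 ∧ deriv S₂ 0 = c • fderiv ℂ Θ 0 (1, 0) := by
  obtain ⟨α₁, hα₁, hl⟩ := h.left
  obtain ⟨α₂, hα₂, hr⟩ := h.right
  have h1 : fderiv ℂ Θ 0 (0, 1) = deriv α₁ 0 • deriv S₁ 0 := by
    have := deriv_axis (Θ := Θ) (S := S₁) (α := α₁) (e := ((0 : ℂ), (1 : ℂ))) (x := 0)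
      (by rw [zero_smul]; exact h.diffeo.1) (by rwa [hα₁.2.1]) hα₁.1
      (hl.mono fun y hy => by rw [← hy]; simp)
    rwa [zero_smul, hα₁.2.1] at this
  have h2 : fderiv ℂ Θ 0 (1, 0) = deriv α₂ 0 • deriv S₂ 0 := by
    have := deriv_axis (Θ := Θ) (S := S₂) (α := α₂) (e := ((1 : ℂ), (0 : ℂ))) (x := 0)
      (by rw [zero_smul]; exact h.diffeo.1) (by rwa [hα₂.2.1]) hα₂.1
      (hr.mono fun y hy => by rw [← hy]; simp)
    rwa [zero_smul, hα₂.2.1] at this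
  refine ⟨⟨(deriv α₁ 0)⁻¹, inv_ne_zero hα₁.deriv_ne_zero, ?_⟩,
    ⟨(deriv α₂ 0)⁻¹, inv_ne_zero hα₂.deriv_ne_zero, ?_⟩⟩
  · rw [h1, inv_smul_smul₀ hα₁.deriv_ne_zero]
  · rw [h2, inv_smul_smul₀ hα₂.deriv_ne_zero]

/-- The loop of directions in the linear coordinates of the chart. -/
lemma exists_direction (h : IsNormalChart ω z S₁ S₂ lam Θ μ a) (hω : AnalyticAt ℂ ω 0)
    (hη : AnalyticAt ℂ η 0) (hz : AnalyticAt ℂ z 0) (hu : AnalyticAt ℂ u 0) (hu0 : u 0 ≠ 0)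
    (hηz : ∀ᶠ p in 𝓝 (0 : Plane), η p = u p • fderiv ℂ z p)
    (hS₁ : IsSeparatrix ω S₁) (hS₂ : IsSeparatrix ω S₂) {v₁ v₂ : Plane}
    (hv₁ : IsTangentVector S₁ v₁) (hv₂ : IsTangentVector S₂ v₂)
    (hv : fderiv ℂ (wedge ω η) 0 (v₁ + v₂) = 0) :
    ∃ β : ℂ, β ≠ 0 ∧ ∀ ζ : ℂ, v₁ + ζ • v₂ = β • fderiv ℂ Θ 0 (ζ, lam) := by
  obtain ⟨⟨c₁, hc₁, h1⟩, c₂, hc₂, h2⟩ := h.fderiv_axes hS₁.1 hS₂.1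
  have hA01 : fderiv ℂ Θ 0 (0, 1) ≠ 0 := fun hc => by simpa using h.diffeo.injective_fderiv _ hc
  have hA10 : fderiv ℂ Θ 0 (1, 0) ≠ 0 := fun hc => by simpa using h.diffeo.injective_fderiv _ hc
  obtain ⟨d₁, hd₁, rfl⟩ := (hS₁.isTangentVector_iff
    (by rw [h1]; exact smul_ne_zero hc₁ hA01) v₁).1 hv₁
  obtain ⟨d₂, hd₂, rfl⟩ := (hS₂.isTangentVector_iff
    (by rw [h2]; exact smul_ne_zero hc₂ hA10) v₂).1 hv₂
  have hlin : ∀ x y : ℂ, fderiv ℂ Θ 0 (x, y)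
      = x • fderiv ℂ Θ 0 (1, 0) + y • fderiv ℂ Θ 0 (0, 1) := fun x y => by
    rw [← map_smul, ← map_smul, ← map_add]
    congr 1
    ext <;> simp
  rw [h1, h2, smul_smul, smul_smul] at hv ⊢
  set b₁ := d₁ * c₁
  set b₂ := d₂ * c₂
  -- Differentiate `wedge_eq` at the origin in the direction (b₂, b₁): the vector v₁ + v₂ is tangent
  -- to y = lam x. This fixes the relative scale of v₁ and v₂, which are otherwise arbitrary tangent
  -- vectors.
  have hrel : b₁ = lam * b₂ := by
    have hW : AnalyticAt ℂ (wedge ω η) 0 :=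
      ((analyticAt_apply_const hω _).mul (analyticAt_apply_const hη _)).sub
        ((analyticAt_apply_const hω _).mul (analyticAt_apply_const hη _))
    have hΘ0 := h.diffeo.2.1
    have hΘa := h.diffeo.1
    have he := h.wedge_eq hz hηz
    have hu' : AnalyticAt ℂ (fun p => u (Θ p)) 0 :=
      AnalyticAt.fun_comp (g := u) (f := Θ) (by rwa [hΘ0]) hΘa
    have hdet0 := h.diffeo.det_ne_zero.self_of_nhds
    have hW0 : wedge ω η 0 = 0 := by
      have := he.self_of_nhds
      rw [hΘ0] at this
      simp only [Prod.snd_zero, Prod.fst_zero, mul_zero, sub_self] at this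
      exact (mul_eq_zero.1 this).resolve_right hdet0
    set v : Plane := (b₂, b₁) with hv_def
    have hAv : fderiv ℂ Θ 0 v = b₁ • fderiv ℂ Θ 0 (0, 1) + b₂ • fderiv ℂ Θ 0 (1, 0) := by
      rw [hv_def, hlin, add_comm]
    have hdetd : DifferentiableAt ℂ
        (fun p => det₂ (fderiv ℂ Θ p (1, 0)) (fderiv ℂ Θ p (0, 1))) 0 := by
      have h3 : DifferentiableAt ℂ (fderiv ℂ Θ) 0 := hΘa.fderiv.differentiableAt
      unfold det₂
      fun_prop
    have hWΘ : AnalyticAt ℂ (fun p => wedge ω η (Θ p)) 0 :=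
      AnalyticAt.fun_comp (g := wedge ω η) (f := Θ) (by rwa [hΘ0]) hΘa
    have dL := hWΘ.differentiableAt.hasFDerivAt.mul hdetd.hasFDerivAt
    have dR := ((h.unit_analytic.mul hu').differentiableAt.hasFDerivAt).mul
      ((hasFDerivAt_snd (𝕜 := ℂ) (E := ℂ) (F := ℂ) (p := (0 : Plane))).fun_sub
        (h.mu_analytic.differentiableAt.hasFDerivAt.fun_mul hasFDerivAt_fst))
    have h4 := congrArg (fun T : Plane →L[ℂ] ℂ => T v)
      ((dL.congr_of_eventuallyEq (he.mono fun p hp => hp.symm)).unique dR)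
    have h5 : fderiv ℂ (fun p => wedge ω η (Θ p)) 0 v = 0 := by
      rw [fderiv_comp_apply (by rwa [hΘ0]) hΘa, hΘ0, hAv, hv]
    simp [hΘ0, hW0, h5, h.mu_zero] at h4
    rcases h4 with h4 | h4
    · exact absurd h4 (by
        rintro (h6 | h6)
        · exact h.unit_ne_zero h6
        · exact hu0 h6)
    · simp only [hv_def] at h4
      linear_combination h4
  have hb₂ : b₂ ≠ 0 := mul_ne_zero hd₂ hc₂
  refine ⟨b₂, hb₂, fun ζ => ?_⟩
  rw [hlin ζ lam, hrel, smul_add, smul_smul, smul_smul, smul_smul, add_comm, mul_comm b₂ ζ,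
    mul_comm b₂ lam]

end IsNormalChart

/-- The holonomy on the tangent curve, read on the parameter of the curve: the first integral
takes the same value at the endpoints of the lifted loop. -/
lemma IsNormalChart.holonomy {ω η : OneForm} {z u : Plane → ℂ} {S₁ S₂ : ℂ → Plane} {lam : ℂ}
    {Θ : Plane → Plane} {μ a : Plane → ℂ} (h : IsNormalChart ω z S₁ S₂ lam Θ μ a)
    (hω : AnalyticAt ℂ ω 0) (hη : AnalyticAt ℂ η 0) (hz : AnalyticAt ℂ z 0) (hz0 : z 0 = 0)
    (hu : AnalyticAt ℂ u 0) (hu0 : u 0 ≠ 0)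
    (hηz : ∀ᶠ p in 𝓝 (0 : Plane), η p = u p • fderiv ℂ z p)
    (hS₁ : IsSeparatrix ω S₁) (hS₂ : IsSeparatrix ω S₂) (h1 : 1 + lam ≠ 0)
    {w₀ : ℂ} (hw₀ : Complex.exp w₀ * lam = 1) {k : Plane → ℂ} (hk : IsLeafExponent μ w₀ 8 k)
    {q : ℂ → Plane} (hq : AnalyticAt ℂ q 0) (hq0 : q 0 = 0)
    (hqT : ∀ᶠ v in 𝓝 (0 : ℂ), (q v).1 + (q v).2 = v ∧ (q v).2 = μ (q v) * (q v).1)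
    (hqinv : ∀ᶠ p in 𝓝 (0 : Plane), p.2 = μ p * p.1 → q (p.1 + p.2) = p)
    {hol : Plane → Plane} (hh : IsTangentCurveHolonomy ω η S₁ S₂ hol) :
    ∃ f : ℂ → ℂ, Tendsto f (𝓝 0) (𝓝 0) ∧ ∀ᶠ v in 𝓝 (0 : ℂ), hol (Θ (q v)) = Θ (q (f v)) ∧
      leafIntegral k (w₀ + Complex.log (lam * (q v).1 / (q v).2), (q v).2)
        = leafIntegral k (w₀ + Complex.log (lam * (q (f v)).1 / (q (f v)).2)
          + 2 * Real.pi * Complex.I, (q (f v)).2) := by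
  obtain ⟨v₁, v₂, hv₁, hv₂, hv, hol0, holT, hpath⟩ := hh
  obtain ⟨β, hβ, hdir⟩ := h.exists_direction hω hη hz hu hu0 hηz hS₁ hS₂ hv₁ hv₂ hv
  have hlam : lam ≠ 0 := right_ne_zero_of_mul_eq_one hw₀
  have hΘ := h.diffeo
  have hΘa := hΘ.1
  have hΘ0 := hΘ.2.1
  have hΘt := analyticAt_tendsto_zero hΘa hΘ0
  obtain ⟨χ, hχ, hχ1, hχ2⟩ := hΘ.exists_symm
  have hχt := analyticAt_tendsto_zero hχ.1 hχ.2.1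
  have hqt := analyticAt_tendsto_zero hq hq0
  have hPt : Tendsto (fun v => Θ (q v)) (𝓝 0) (𝓝 0) := hΘt.comp hqt
  have hmem := h.mem_tangentCurve hz hu hu0 hηz
  have hPT : ∀ᶠ v in 𝓝 (0 : ℂ), Θ (q v) ∈ tangentCurve ω η := by
    filter_upwards [hqt.eventually hmem, hqT] with v e1 e2
    exact e1.2 e2.2
  have hP0 : ∀ᶠ v in 𝓝[≠] (0 : ℂ), Θ (q v) ≠ 0 := by
    filter_upwards [self_mem_nhdsWithin, nhdsWithin_le_nhds (hqt.eventually hχ1),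
      nhdsWithin_le_nhds hqT] with v e1 e2 e3 e4
    rw [e4, hχ.2.1] at e2
    rw [← e2] at e3
    exact e1 (by rw [← e3.1]; simp)
  have hPw : Tendsto (fun v => Θ (q v)) (𝓝 0) (𝓝[tangentCurve ω η] 0) :=
    tendsto_nhdsWithin_iff.2 ⟨hPt, hPT⟩
  have hPw' : Tendsto (fun v => Θ (q v)) (𝓝[≠] 0) (𝓝[tangentCurve ω η \ {0}] 0) :=
    tendsto_nhdsWithin_iff.2 ⟨hPt.mono_left nhdsWithin_le_nhds,
      ((hPT.filter_mono nhdsWithin_le_nhds).and hP0).mono fun v hv => hv⟩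
  set F : ℂ → Plane := fun v => hol (Θ (q v)) with hF
  have hF0 : F 0 = 0 := by simp only [hF, hq0, hΘ0, hol0]
  -- Continuity of the holonomy at 0 is not part of its definition; it follows from the smallness of
  -- the lifted paths at their endpoint.
  have hFt' : Tendsto F (𝓝[≠] 0) (𝓝 0) := by
    refine Metric.tendsto_nhds.2 fun ε hε => ?_
    filter_upwards [hPw'.eventually (hpath (ε / 2) (by positivity))] with v hv
    obtain ⟨c, c', -, hc1, hc⟩ := hv
    have := (hc 1 (right_mem_Icc.2 zero_le_one)).2.2.2.1
    rw [hc1] at this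
    rw [dist_zero_right]
    exact this.trans_lt (by linarith)
  have hFt : Tendsto F (𝓝 0) (𝓝 0) := by
    rw [← nhdsNE_sup_pure, tendsto_sup]
    refine ⟨hFt', ?_⟩
    rw [tendsto_pure_left]
    intro s hs
    rw [hF0]
    exact mem_of_mem_nhds hs
  have hFT : ∀ᶠ v in 𝓝 (0 : ℂ), F v ∈ tangentCurve ω η := hPw.eventually holT
  have hzt : Tendsto z (𝓝 0) (𝓝 0) := analyticAt_tendsto_zero hz hz0
  have hχF : Tendsto (fun v => χ (F v)) (𝓝 0) (𝓝 0) := hχt.comp hFt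
  have hFq : ∀ᶠ v in 𝓝 (0 : ℂ), q (z (F v)) = χ (F v) ∧ F v = Θ (q (z (F v))) := by
    filter_upwards [hFT, hχF.eventually hmem, hχF.eventually hqinv, hχF.eventually h.integral_eq,
      hFt.eventually hχ2] with v e1 e2 e3 e4 e5
    rw [e5] at e2 e4
    have e6 := e3 (e2.1 e1)
    rw [← e4] at e6
    exact ⟨e6, by rw [e6, e5]⟩
  refine ⟨fun v => z (F v), hzt.comp hFt, ?_⟩
  have hmu1 : 1 + μ 0 ≠ 0 := by rwa [h.mu_zero]
  obtain ⟨ε₁, hε₁, hleaf⟩ := hk.eq_of_path h.mu_analytic hmu1 hw₀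
  obtain ⟨ε₂, hε₂, hcone⟩ := exists_cone_control hΘ hχ.1 hχ.2.1 hχ2 hβ hlam hε₁
  have hev : ∀ᶠ c in 𝓝 (0 : Plane), (∀ᶠ p in 𝓝 c, Θ (χ p) = p) ∧ AnalyticAt ℂ χ c ∧
      AnalyticAt ℂ Θ (χ c) ∧ (∀ v : Plane, pullback Θ ω (χ c) v
        = a (χ c) * ((χ c).2 * v.1 + μ (χ c) * (χ c).1 * v.2)) ∧ a (χ c) ≠ 0 := by
    filter_upwards [hχ2.eventually_nhds, hχ.1.eventually_analyticAt,
      hχt.eventually hΘa.eventually_analyticAt, hχt.eventually h.form_eq,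
      hχt.eventually (h.unit_analytic.continuousAt.eventually_ne h.unit_ne_zero)]
      with c e1 e2 e3 e4 e5
    exact ⟨e1, e2, e3, e4, e5⟩
  obtain ⟨ε₃, hε₃, hball⟩ := Metric.eventually_nhds_iff.1 hev
  have hmain : ∀ᶠ v in 𝓝[≠] (0 : ℂ),
      leafIntegral k (w₀ + Complex.log (lam * (q v).1 / (q v).2), (q v).2)
        = leafIntegral k (w₀ + Complex.log (lam * (χ (F v)).1 / (χ (F v)).2)
          + 2 * Real.pi * Complex.I, (χ (F v)).2) := by
    filter_upwards [hPw'.eventually (hpath (min ε₂ (ε₃ / 2)) (by positivity)),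
      nhdsWithin_le_nhds (hqt.eventually hχ1)] with v hv hχq
    obtain ⟨c, c', hc0, hc1, hc⟩ := hv
    have := hleaf (fun s => (χ (c s)).1) (fun s => (χ (c s)).2)
      (fun s => (fderiv ℂ χ (c s) (c' s)).1) (fun s => (fderiv ℂ χ (c s) (c' s)).2)
      fun s hs => by
        obtain ⟨d1, d2, d3, d4, d5⟩ := hc s hs
        obtain ⟨e1, e2, e3, e4, e5⟩ := hball (y := c s) (by
          rw [dist_zero_right]
          have := d4.trans (min_le_right _ _)
          linarith)
        have dχ : HasDerivWithinAt (fun s => χ (c s)) (fderiv ℂ χ (c s) (c' s)) (Icc 0 1) s :=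
          (e2.differentiableAt.hasFDerivAt.restrictScalars ℝ).comp_hasDerivWithinAt s d1
        have hDD : fderiv ℂ Θ (χ (c s)) (fderiv ℂ χ (c s) (c' s)) = c' s := by
          rw [← fderiv_comp_apply e3 e2, EventuallyEq.fderiv_eq e1, fderiv_fun_id]
          rfl
        have hlf := e4 (fderiv ℂ χ (c s) (c' s))
        rw [pullback, ContinuousLinearMap.comp_apply, hDD, e1.self_of_nhds, d2] at hlf
        have hζ : ‖Complex.exp (2 * Real.pi * Complex.I * s)‖ = 1 := by
          rw [show (2 * Real.pi * Complex.I * s : ℂ) = ((2 * Real.pi * s : ℝ) : ℂ) * Complex.I by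
            push_cast; ring]
          exact Complex.norm_exp_ofReal_mul_I _
        obtain ⟨f1, f2, f3⟩ := hcone (c s) (Complex.exp (2 * Real.pi * Complex.I * s)) hζ d3
          (d4.trans (min_le_left _ _)) (by
            rw [← hdir]
            exact d5.trans (by gcongr; exact min_le_left _ _))
        refine ⟨dχ.fst, dχ.snd, ?_, f1, f2, ?_⟩
        · exact (mul_eq_zero.1 hlf.symm).resolve_left e5
        · rwa [Complex.exp_neg]
    simp only [hc0, hc1] at this
    rw [hχq] at this
    exact this
  -- Lifted paths exist only for points other than the origin. At v = 0 both sides vanish, because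
  -- the first integral has the factor y.
  have hmain' : ∀ᶠ v in 𝓝 (0 : ℂ),
      leafIntegral k (w₀ + Complex.log (lam * (q v).1 / (q v).2), (q v).2)
        = leafIntegral k (w₀ + Complex.log (lam * (χ (F v)).1 / (χ (F v)).2)
          + 2 * Real.pi * Complex.I, (χ (F v)).2) := by
    rw [← nhdsNE_sup_pure, eventually_sup]
    refine ⟨hmain, ?_⟩
    simp [hF0, hχ.2.1, hq0, leafIntegral]
  filter_upwards [hFq, hmain'] with v e1 e2
  refine ⟨e1.2, ?_⟩
  rw [e1.1]
  exact e2

/-! ### Comparison of fold maps -/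

/-- Two pairs of germs related by the same reparametrization are related by the same germ. -/
lemma exists_transition {A B A' B' f : ℂ → ℂ} (hA : IsDiffeoGerm univ univ A)
    (hB : IsDiffeoGerm univ univ B) (hA' : IsDiffeoGerm univ univ A')
    (hf : Tendsto f (𝓝 0) (𝓝 0)) (h : ∀ᶠ v in 𝓝 (0 : ℂ), A v = B (f v))
    (h' : ∀ᶠ v in 𝓝 (0 : ℂ), A' v = B' (f v)) :
    ∃ θ : ℂ → ℂ, IsDiffeoGerm univ univ θ ∧ (∀ᶠ v in 𝓝 (0 : ℂ), A' v = θ (A v)) ∧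
      ∀ᶠ v in 𝓝 (0 : ℂ), B' v = θ (B v) := by
  obtain ⟨a, ha, ha1, ha2⟩ := hA.exists_symm
  obtain ⟨b, hb, hb1, hb2⟩ := hB.exists_symm
  -- Take θ = A' ∘ A⁻¹. On germs f = B⁻¹ ∘ A, hence B' = A' ∘ f⁻¹ = θ ∘ B. Only continuity of f at 0
  -- is used.
  refine ⟨A' ∘ a, isDiffeoGerm_comp hA' ha, ?_, ?_⟩
  · filter_upwards [ha1] with v hv
    simp only [Function.comp_apply, hv]
  · have ht : Tendsto (fun v => a (B v)) (𝓝 0) (𝓝 0) :=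
      (analyticAt_tendsto_zero ha.1 ha.2.1).comp (analyticAt_tendsto_zero hB.1 hB.2.1)
    filter_upwards [ht.eventually h, ht.eventually h',
      (analyticAt_tendsto_zero hB.1 hB.2.1).eventually ha2,
      (hf.comp ht).eventually hb1, hb1] with v e1 e2 e3 e4 e5
    simp only [Function.comp_apply] at e4 ⊢
    rw [e3] at e1
    rw [← e1, e5] at e4
    rw [e2, ← e4]

lemma analyticAt_shift {E : Type*} [NormedAddCommGroup E] [NormedSpace ℂ E] {Q : Plane → E}
    {τ : ℂ → ℂ} {c : ℂ} (hQ : AnalyticAt ℂ Q (c, 0)) (hτ : AnalyticAt ℂ τ 0) (hτ0 : τ 0 = c) :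
    AnalyticAt ℂ (fun p : Plane => Q (τ p.2 + p.1, p.2)) 0 := by
  have h1 : AnalyticAt ℂ (fun p : Plane => τ p.2) 0 :=
    AnalyticAt.fun_comp (g := τ) (f := fun p : Plane => p.2) hτ analyticAt_snd
  exact AnalyticAt.fun_comp (g := Q) (f := fun p : Plane => (τ p.2 + p.1, p.2))
    (by simpa [hτ0] using hQ) ((h1.add analyticAt_fst).prod analyticAt_snd)

/-- Taylor expansion of order two along a curve of critical points. -/
lemma exists_eq_sq_mul {Q : Plane → ℂ} {τ : ℂ → ℂ} {c : ℂ} (hQ : AnalyticAt ℂ Q (c, 0))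
    (hτ : AnalyticAt ℂ τ 0) (hτ0 : τ 0 = c)
    (hcrit : ∀ᶠ z in 𝓝 (0 : ℂ), fderiv ℂ Q (τ z, z) (1, 0) = 0) :
    ∃ U : Plane → ℂ, AnalyticAt ℂ U 0 ∧ ∀ᶠ p in 𝓝 (0 : Plane),
      Q (τ p.2 + p.1, p.2) - Q (τ p.2, p.2) = p.1 ^ 2 * U p := by
  have hτs : AnalyticAt ℂ (fun p : Plane => τ p.2) 0 :=
    AnalyticAt.fun_comp (g := τ) (f := fun p : Plane => p.2) hτ analyticAt_snd
  have h0 : AnalyticAt ℂ (fun p : Plane => Q (τ p.2, p.2)) 0 :=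
    AnalyticAt.fun_comp (g := Q) (f := fun p : Plane => (τ p.2, p.2))
      (by simpa [hτ0] using hQ) (hτs.prod analyticAt_snd)
  set P : Plane → ℂ := fun p => Q (τ p.2 + p.1, p.2) - Q (τ p.2, p.2) with hP
  have hPa : AnalyticAt ℂ P 0 := (analyticAt_shift hQ hτ hτ0).sub h0
  obtain ⟨P₁, hP₁, hPe⟩ := exists_eq_fst_mul (c := 0) hPa
    (Eventually.of_forall fun y => by simp [hP])
  rw [Prod.mk_zero_zero] at hP₁ hPe
  have ht : Tendsto (fun z : ℂ => ((0 : ℂ), z)) (𝓝 0) (𝓝 0) := tendsto_mk_right 0 0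
  have hτt : Tendsto (fun z : ℂ => (τ z, z)) (𝓝 0) (𝓝 (c, 0)) := by
    have := hτ.continuousAt.tendsto.prodMk_nhds (tendsto_id (x := 𝓝 (0 : ℂ)))
    rwa [hτ0] at this
  have hP₁0 : ∀ᶠ z in 𝓝 (0 : ℂ), P₁ (0, z) = 0 := by
    filter_upwards [hcrit, ht.eventually hPe.eventually_nhds, hτt.eventually hQ.eventually_analyticAt,
      ht.eventually hP₁.eventually_analyticAt] with z e1 e2 e3 e4
    have d1 : HasDerivAt (fun s : ℂ => Q (τ z + s, z) - Q (τ z, z)) 0 0 := by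
      have d := hasDerivAt_mk_left (c := τ z + 0) (d := z) (f := Q) (by rwa [add_zero])
      rw [add_zero, e1] at d
      have d' : HasDerivAt (fun s : ℂ => τ z + s) 1 0 := (hasDerivAt_id (0 : ℂ)).const_add (τ z)
      have := HasDerivAt.comp (h₂ := fun x => Q (x, z)) (h := fun s : ℂ => τ z + s) (0 : ℂ)
        (by simpa using d) d'
      simpa using this.sub_const (Q (τ z, z))
    have d2 : HasDerivAt (fun s : ℂ => s * P₁ (s, z)) (P₁ (0, z)) 0 := by
      have d := (hasDerivAt_id' (0 : ℂ)).fun_mul (hasDerivAt_mk_left e4)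
      simpa using d
    have e5 : (fun s : ℂ => s * P₁ (s, z)) =ᶠ[𝓝 0] fun s => Q (τ z + s, z) - Q (τ z, z) :=
      ((tendsto_mk_left 0 z).eventually e2).mono fun s hs => hs.symm
    exact d2.unique (d1.congr_of_eventuallyEq e5)
  obtain ⟨U, hU, hUe⟩ := exists_eq_fst_mul (c := 0) hP₁ hP₁0
  rw [Prod.mk_zero_zero] at hU hUe
  refine ⟨U, hU, ?_⟩
  filter_upwards [hPe, hUe] with p e1 e2
  change P p = _
  rw [e1, e2]
  ring

/-- The value of the second order coefficient. -/
lemma fold_coeff {f s U : ℂ → ℂ} {c b : ℂ} (hU : AnalyticAt ℂ U 0)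
    (hfd : ∀ᶠ w in 𝓝 c, HasDerivAt f (f w * s w) w) (hs0 : s c = 0) {s' : ℂ}
    (hs : HasDerivAt s s' c) (hf : ∀ᶠ p in 𝓝 (0 : ℂ), f (c + p) - b = p ^ 2 * U p) :
    2 * U 0 = f c * s' := by
  have h1 : HasDerivAt (fun w => f w * s w) (f c * s') c := by
    have := hfd.self_of_nhds.mul hs
    rwa [hs0, mul_zero, zero_add] at this
  have htr : Tendsto (fun w => w - c) (𝓝 c) (𝓝 0) := by
    have : Tendsto (fun w => w - c) (𝓝 c) (𝓝 (c - c)) := tendsto_id.sub_const c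
    rwa [sub_self] at this
  have h2 : (fun w => f w * s w) =ᶠ[𝓝 c]
      fun w => (w - c) * (2 * U (w - c) + (w - c) * deriv U (w - c)) := by
    filter_upwards [hfd, htr.eventually hf.eventually_nhds,
      htr.eventually hU.eventually_analyticAt] with w e1 e2 e3
    have d0 : HasDerivAt (fun w => w - c) 1 w := (hasDerivAt_id w).sub_const c
    have d1 : HasDerivAt (fun w => U (w - c)) (deriv U (w - c)) w := by
      have := HasDerivAt.comp (h₂ := U) (h := fun w => w - c) w e3.differentiableAt.hasDerivAt d0
      rwa [mul_one] at this
    have d2 : HasDerivAt (fun w => (w - c) ^ 2 * U (w - c) + b)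
        ((2 * (w - c)) * U (w - c) + (w - c) ^ 2 * deriv U (w - c)) w := by
      refine (((d0.pow 2).mul d1).add_const b).congr_deriv ?_
      simp
    have hw : Tendsto (fun v => v - c) (𝓝 w) (𝓝 (w - c)) := tendsto_id.sub_const c
    have e4 : f =ᶠ[𝓝 w] fun w => (w - c) ^ 2 * U (w - c) + b := by
      filter_upwards [hw.eventually e2] with v hv
      rw [add_sub_cancel] at hv
      rw [← hv, sub_add_cancel]
    have e5 := e1.unique (d2.congr_of_eventuallyEq e4)
    simp only [e5]
    ring
  have h3 : HasDerivAt (fun w => (w - c) * (2 * U (w - c) + (w - c) * deriv U (w - c)))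
      (2 * U 0) c := by
    have d0 : HasDerivAt (fun w => w - c) 1 c := (hasDerivAt_id c).sub_const c
    have hUa : AnalyticAt ℂ (fun p => 2 * U p + p * deriv U p) 0 :=
      (analyticAt_const.mul hU).add (analyticAt_id.mul hU.deriv)
    have d1 : HasDerivAt (fun w => 2 * U (w - c) + (w - c) * deriv U (w - c)) _ c :=
      HasDerivAt.comp (h₂ := fun p => 2 * U p + p * deriv U p) (h := fun w => w - c) c
        (by rw [sub_self]; exact hUa.differentiableAt.hasDerivAt) d0
    refine (d0.mul d1).congr_deriv ?_
    simp
  exact (h1.congr_of_eventuallyEq (h2.symm)).unique h3 |>.symm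

/-- The square root of the quotient of two units, composed with itself implicitly. -/
lemma exists_fold_factor {U U' : Plane → ℂ} (hU : AnalyticAt ℂ U 0) (hU' : AnalyticAt ℂ U' 0)
    (h0 : U 0 = U' 0) (hne : U' 0 ≠ 0) :
    ∃ q : Plane → ℂ, AnalyticAt ℂ q 0 ∧ q 0 = 1 ∧
      (∀ᶠ p in 𝓝 (0 : Plane), q p ^ 2 * U' (p.1 * q p, p.2) = U p) ∧
      ∀ᶠ r in 𝓝 ((0 : Plane), (1 : ℂ)), r.2 ^ 2 * U' (r.1.1 * r.2, r.1.2) = U r.1 →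
        r.2 = q r.1 := by
  set F : Plane × ℂ → ℂ := fun r => r.2 ^ 2 * U' (r.1.1 * r.2, r.1.2) - U r.1 with hF
  -- Implicit function theorem through the inverse of (p, s) ↦ (p, F(p, s)); at (0, 1) the
  -- derivative in s is 2 U'(0), which is not zero.
  set K : Plane × ℂ → Plane × ℂ := fun r => (r.1, F r) with hK
  have a1 : AnalyticAt ℂ (fun r : Plane × ℂ => r.1) (0, 1) := analyticAt_fst
  have a2 : AnalyticAt ℂ (fun r : Plane × ℂ => r.2) (0, 1) := analyticAt_snd
  have a11 : AnalyticAt ℂ (fun r : Plane × ℂ => r.1.1) (0, 1) := analyticAt_fst.fun_comp a1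
  have a12 : AnalyticAt ℂ (fun r : Plane × ℂ => r.1.2) (0, 1) := analyticAt_snd.fun_comp a1
  have a3 : AnalyticAt ℂ (fun r : Plane × ℂ => U' (r.1.1 * r.2, r.1.2)) (0, 1) :=
    AnalyticAt.fun_comp (g := U') (f := fun r : Plane × ℂ => (r.1.1 * r.2, r.1.2))
      (by simpa [← Prod.zero_eq_mk] using hU') ((a11.mul a2).prod a12)
  have a4 : AnalyticAt ℂ (fun r : Plane × ℂ => U r.1) (0, 1) :=
    AnalyticAt.fun_comp (g := U) (f := fun r : Plane × ℂ => r.1) hU a1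
  have hFa : AnalyticAt ℂ F (0, 1) := ((a2.pow 2).mul a3).sub a4
  have hKa : AnalyticAt ℂ K (0, 1) := a1.prod hFa
  have hK1 : K (0, 1) = (0, 0) := by
    simp [hK, hF, ← Prod.zero_eq_mk, h0]
  have hFq : fderiv ℂ F (0, 1) (0, 1) = 2 * U' 0 := by
    have dl : HasDerivAt (fun s : ℂ => ((0 : Plane), s)) (0, 1) 1 :=
      (hasDerivAt_const (1 : ℂ) (0 : Plane)).prodMk (hasDerivAt_id (1 : ℂ))
    have d1 : HasDerivAt (fun s : ℂ => F (0, s)) (fderiv ℂ F (0, 1) (0, 1)) 1 :=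
      hFa.differentiableAt.hasFDerivAt.comp_hasDerivAt (1 : ℂ) dl
    have e1 : (fun s : ℂ => F (0, s)) = fun s => s ^ 2 * U' 0 - U 0 := by
      funext s
      simp [hF, ← Prod.zero_eq_mk]
    rw [e1] at d1
    have d2 : HasDerivAt (fun s : ℂ => s ^ 2 * U' 0 - U 0) (2 * U' 0) 1 := by
      refine (((hasDerivAt_pow 2 (1 : ℂ)).mul_const (U' 0)).sub_const (U 0)).congr_deriv ?_
      simp
    exact d1.unique d2
  have hinj : ∀ v, fderiv ℂ K (0, 1) v = 0 → v = 0 := fun v hv => by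
    have d : HasFDerivAt K _ (0, 1) :=
      (hasFDerivAt_fst (𝕜 := ℂ) (E := Plane) (F := ℂ) (p := (0, 1))).prodMk
        hFa.differentiableAt.hasFDerivAt
    rw [d.fderiv, ContinuousLinearMap.prod_apply, Prod.mk_eq_zero] at hv
    obtain ⟨e1, e2⟩ := hv
    have e1' : v.1 = 0 := e1
    have e3 : v = v.2 • ((0 : Plane), (1 : ℂ)) := Prod.ext (by simp [e1']) (by simp)
    rw [e3, map_smul, hFq, smul_eq_mul] at e2
    rw [e3, (mul_eq_zero.1 e2).resolve_right (mul_ne_zero two_ne_zero hne), zero_smul]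
  obtain ⟨J, hJ, hJ1, hJ2, hJ3⟩ := exists_analytic_inverse hKa hinj
  rw [hK1] at hJ hJ1 hJ3
  have hJr : AnalyticAt ℂ (fun p : Plane => J (p, 0)) 0 :=
    AnalyticAt.fun_comp (g := J) (f := fun p : Plane => (p, (0 : ℂ))) hJ
      (analyticAt_id.prod analyticAt_const)
  have ht : Tendsto (fun p : Plane => (p, (0 : ℂ))) (𝓝 0) (𝓝 (0, 0)) := by
    have : ContinuousAt (fun p : Plane => (p, (0 : ℂ))) 0 := by fun_prop
    exact this.tendsto
  refine ⟨fun p => (J (p, 0)).2, analyticAt_snd.fun_comp hJr, by simp only [hJ1], ?_, ?_⟩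
  · filter_upwards [ht.eventually hJ3] with p hp
    have e1 : (J (p, 0)).1 = p := congrArg Prod.fst hp
    have e2 : F (J (p, 0)) = 0 := congrArg Prod.snd hp
    simp only [hF, e1] at e2
    exact sub_eq_zero.1 e2
  · filter_upwards [hJ2] with r hr h1
    have e1 : K r = (r.1, 0) := by simp only [hK, hF, h1, sub_self]
    rw [e1] at hr
    rw [hr]

/-- Two functions with a curve of nondegenerate critical points, equal critical values and equal
restrictions to `z = 0` are conjugate by a unique germ `W` fibered over `z`. -/
theorem exists_fold_conjugation {Q Q' : Plane → ℂ} {τ τ' : ℂ → ℂ} {c : ℂ}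
    (hQ : AnalyticAt ℂ Q (c, 0)) (hQ' : AnalyticAt ℂ Q' (c, 0)) (hτ : AnalyticAt ℂ τ 0)
    (hτ' : AnalyticAt ℂ τ' 0) (hτ0 : τ 0 = c) (hτ'0 : τ' 0 = c)
    (hcrit : ∀ᶠ z in 𝓝 (0 : ℂ), fderiv ℂ Q (τ z, z) (1, 0) = 0)
    (hcrit' : ∀ᶠ z in 𝓝 (0 : ℂ), fderiv ℂ Q' (τ' z, z) (1, 0) = 0)
    (hval : ∀ᶠ z in 𝓝 (0 : ℂ), Q' (τ' z, z) = Q (τ z, z))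
    (haxis : ∀ᶠ w in 𝓝 c, Q' (w, 0) = Q (w, 0)) {s : ℂ → ℂ} {s' : ℂ}
    (hfd : ∀ᶠ w in 𝓝 c, HasDerivAt (fun w => Q' (w, 0)) (Q' (w, 0) * s w) w) (hs0 : s c = 0)
    (hs : HasDerivAt s s' c) (hs' : s' ≠ 0) (hne : Q' (c, 0) ≠ 0) :
    ∃ W : Plane → ℂ, AnalyticAt ℂ W (c, 0) ∧ (∀ᶠ w in 𝓝 c, W (w, 0) = w) ∧
      (∀ᶠ z in 𝓝 (0 : ℂ), W (τ z, z) = τ' z) ∧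
      (∀ᶠ p in 𝓝 (c, (0 : ℂ)), Q' (W p, p.2) = Q p) ∧
      ∀ V : Plane → ℂ, AnalyticAt ℂ V (c, 0) → (∀ᶠ w in 𝓝 c, V (w, 0) = w) →
        (∀ᶠ z in 𝓝 (0 : ℂ), V (τ z, z) = τ' z) →
        (∀ᶠ p in 𝓝 (c, (0 : ℂ)), Q' (V p, p.2) = Q p) → V =ᶠ[𝓝 (c, 0)] W := by
  obtain ⟨U, hU, hUe⟩ := exists_eq_sq_mul hQ hτ hτ0 hcrit
  obtain ⟨U', hU', hUe'⟩ := exists_eq_sq_mul hQ' hτ' hτ'0 hcrit'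
  have htl : Tendsto (fun x : ℂ => (x, (0 : ℂ))) (𝓝 0) (𝓝 0) := tendsto_mk_left 0 0
  have htr : Tendsto (fun z : ℂ => ((0 : ℂ), z)) (𝓝 0) (𝓝 0) := tendsto_mk_right 0 0
  have hsnd : Tendsto (fun p : Plane => p.2) (𝓝 0) (𝓝 0) := continuous_snd.tendsto' _ _ rfl
  have hcp : Tendsto (fun x : ℂ => c + x) (𝓝 0) (𝓝 c) := by
    simpa using (tendsto_id (x := 𝓝 (0 : ℂ))).const_add c
  have hU'ne : U' 0 ≠ 0 := by
    have h1 : ∀ᶠ p in 𝓝 (0 : ℂ), Q' (c + p, 0) - Q' (c, 0) = p ^ 2 * U' (p, 0) := by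
      filter_upwards [htl.eventually hUe'] with p hp
      simpa [hτ'0] using hp
    have h2 := fold_coeff (f := fun w => Q' (w, 0)) (U := fun p => U' (p, 0))
      (analyticAt_comp_mk_left hU') hfd hs0 hs h1
    intro hc
    rw [Prod.mk_zero_zero, hc, mul_zero] at h2
    exact mul_ne_zero hne hs' h2.symm
  have hUU : ∀ᶠ x in 𝓝[≠] (0 : ℂ), U (x, 0) = U' (x, 0) := by
    filter_upwards [nhdsWithin_le_nhds (htl.eventually hUe), nhdsWithin_le_nhds (htl.eventually hUe'),
      nhdsWithin_le_nhds (hcp.eventually haxis), self_mem_nhdsWithin] with x e1 e2 e3 e4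
    have e5 := haxis.self_of_nhds
    simp only [hτ0, hτ'0] at e1 e2
    rw [e3, e5, e1] at e2
    exact mul_left_cancel₀ (pow_ne_zero 2 e4) e2
  have hU0 : U 0 = U' 0 := by
    have l1 := (tendsto_apply_prod_left hU.continuousAt).mono_left (nhdsWithin_le_nhds (s := {0}ᶜ))
    have l2 := (tendsto_apply_prod_left hU'.continuousAt).mono_left (nhdsWithin_le_nhds (s := {0}ᶜ))
    exact tendsto_nhds_unique (l1.congr' hUU) l2
  obtain ⟨q, hq, hq0, hqe, hqu⟩ := exists_fold_factor hU hU' hU0 hU'ne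
  -- On the axis U = U', so the constant 1 solves the equation and is its only solution near 1. This
  -- will give W(w, 0) = w.
  have hqax : ∀ᶠ x in 𝓝 (0 : ℂ), q (x, 0) = 1 := by
    have h1 : ∀ᶠ x in 𝓝[≠] (0 : ℂ), q (x, 0) = 1 := by
      have ht : Tendsto (fun x : ℂ => (((x, (0 : ℂ)) : Plane), (1 : ℂ))) (𝓝 0) (𝓝 (0, 1)) :=
        htl.prodMk_nhds tendsto_const_nhds
      filter_upwards [nhdsWithin_le_nhds (ht.eventually hqu), hUU] with x e1 e2
      exact (e1 (by simp [e2])).symm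
    rw [← nhdsNE_sup_pure, eventually_sup]
    exact ⟨h1, by simpa [← Prod.zero_eq_mk] using hq0⟩
  have hτs : AnalyticAt ℂ (fun p : Plane => τ p.2) (c, 0) :=
    AnalyticAt.fun_comp (g := τ) (f := fun p : Plane => p.2) hτ analyticAt_snd
  have hτ's : AnalyticAt ℂ (fun p : Plane => τ' p.2) (c, 0) :=
    AnalyticAt.fun_comp (g := τ') (f := fun p : Plane => p.2) hτ' analyticAt_snd
  have hS : AnalyticAt ℂ (fun p : Plane => ((p.1 - τ p.2, p.2) : Plane)) (c, 0) :=
    (analyticAt_fst.sub hτs).prod analyticAt_snd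
  have hSt : Tendsto (fun p : Plane => ((p.1 - τ p.2, p.2) : Plane)) (𝓝 (c, 0)) (𝓝 0) := by
    have := hS.continuousAt.tendsto
    simpa [hτ0, ← Prod.zero_eq_mk] using this
  have hqs : AnalyticAt ℂ (fun p : Plane => q (p.1 - τ p.2, p.2)) (c, 0) :=
    AnalyticAt.fun_comp (g := q) (f := fun p : Plane => ((p.1 - τ p.2, p.2) : Plane))
      (by simpa [hτ0, ← Prod.zero_eq_mk] using hq) hS
  have hmulq : Tendsto (fun p : Plane => ((p.1 * q p, p.2) : Plane)) (𝓝 0) (𝓝 0) := by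
    have h1 : ContinuousAt (fun p : Plane => ((p.1 * q p, p.2) : Plane)) 0 :=
      (continuousAt_fst.mul hq.continuousAt).prodMk continuousAt_snd
    have h2 := h1.tendsto
    simpa [← Prod.zero_eq_mk] using h2
  -- Relative to the critical values the functions are p² U and p² U', with p the distance to the
  -- critical curve. The map p ↦ p q carries one to the other when q² U'(p q, z) = U. The root with
  -- q = 1 at the origin excludes the other branch of the fold.
  refine ⟨fun p => τ' p.2 + (p.1 - τ p.2) * q (p.1 - τ p.2, p.2),
    hτ's.add ((analyticAt_fst.sub hτs).mul hqs), ?_, ?_, ?_, ?_⟩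
  · have ht : Tendsto (fun w : ℂ => w - c) (𝓝 c) (𝓝 0) := by
      simpa using (tendsto_id (x := 𝓝 c)).sub_const c
    filter_upwards [ht.eventually hqax] with w hw
    simp only [hτ0, hτ'0, hw]
    ring
  · exact Eventually.of_forall fun z => by simp
  · have hval' : Tendsto (fun p : Plane => p.2) (𝓝 (c, 0)) (𝓝 (0 : ℂ)) :=
      continuousAt_snd
    filter_upwards [hSt.eventually hUe, hSt.eventually (hmulq.eventually hUe'),
      hSt.eventually hqe, hval'.eventually hval] with p e1 e2 e3 e4
    simp only [add_sub_cancel] at e1 e2 e3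
    have e5 : Q' (τ' p.2 + (p.1 - τ p.2) * q (p.1 - τ p.2, p.2), p.2) - Q' (τ' p.2, p.2)
        = Q (p.1, p.2) - Q (τ p.2, p.2) := by
      rw [e1, e2, ← e3]
      ring
    rw [e4] at e5
    exact sub_left_inj.1 e5
  · intro V hV hVax hVτ hVQ
    set f : Plane → ℂ := fun p => V (τ p.2 + p.1, p.2) - τ' p.2 with hf
    have hτ0s : AnalyticAt ℂ (fun p : Plane => τ' p.2) 0 :=
      AnalyticAt.fun_comp (g := τ') (f := fun p : Plane => p.2) hτ' analyticAt_snd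
    have hfa : AnalyticAt ℂ f 0 := (analyticAt_shift hV hτ hτ0).sub hτ0s
    -- A competitor V also has the form τ' + p g. The condition on the axis gives g = 1 at the base
    -- point, and g satisfies the equation of q wherever p ≠ 0.
    obtain ⟨g, hg, hge⟩ := exists_eq_fst_mul (c := 0) hfa (by
      filter_upwards [hVτ] with z hz
      simp [hf, hz])
    rw [Prod.mk_zero_zero] at hg hge
    have hg0 : g 0 = 1 := by
      have h1 : ∀ᶠ x in 𝓝[≠] (0 : ℂ), g (x, 0) = 1 := by
        filter_upwards [nhdsWithin_le_nhds (htl.eventually hge),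
          nhdsWithin_le_nhds (hcp.eventually hVax), self_mem_nhdsWithin] with x e1 e2 e3
        simp only [hf, hτ0, hτ'0, e2, add_sub_cancel_left] at e1
        exact (mul_left_cancel₀ e3 ((mul_one x).trans e1)).symm
      have l1 := (tendsto_apply_prod_left hg.continuousAt).mono_left
        (nhdsWithin_le_nhds (s := {0}ᶜ))
      exact tendsto_nhds_unique (l1.congr' h1) tendsto_const_nhds
    have hmulg : Tendsto (fun p : Plane => ((p.1 * g p, p.2) : Plane)) (𝓝 0) (𝓝 0) := by
      have h1 : ContinuousAt (fun p : Plane => ((p.1 * g p, p.2) : Plane)) 0 :=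
        (continuousAt_fst.mul hg.continuousAt).prodMk continuousAt_snd
      simpa [← Prod.zero_eq_mk] using h1.tendsto
    have hgt : Tendsto (fun p : Plane => (p, g p)) (𝓝 0) (𝓝 (0, 1)) := by
      have h1 : ContinuousAt (fun p : Plane => (p, g p)) 0 := continuousAt_id.prodMk hg.continuousAt
      simpa [hg0] using h1.tendsto
    have hsh : Tendsto (fun p : Plane => ((τ p.2 + p.1, p.2) : Plane)) (𝓝 0) (𝓝 (c, 0)) := by
      have h1 : AnalyticAt ℂ (fun p : Plane => ((τ p.2 + p.1, p.2) : Plane)) 0 :=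
        analyticAt_shift (Q := fun p => p) analyticAt_id hτ hτ0
      simpa [hτ0] using h1.continuousAt.tendsto
    have hgq : ∀ᶠ p in 𝓝 (0 : Plane), p.1 ≠ 0 → g p = q p := by
      filter_upwards [hge, hmulg.eventually hUe', hUe, hgt.eventually hqu, hsh.eventually hVQ,
        hsnd.eventually hval] with p e1 e2 e3 e4 e5 e6 hp
      refine e4 ?_
      have e7 : τ' p.2 + p.1 * g p = V (τ p.2 + p.1, p.2) := by
        rw [← e1]
        simp only [hf]
        ring
      simp only [e7] at e2
      rw [e5, e6, e3] at e2
      refine mul_left_cancel₀ (pow_ne_zero 2 hp) ?_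
      rw [e2]
      ring
    have hsnd' : Tendsto (fun p : Plane => p.2) (𝓝 (c, 0)) (𝓝 (0 : ℂ)) :=
      continuousAt_snd
    filter_upwards [hSt.eventually hgq, hSt.eventually hge, hsnd'.eventually hVτ] with p e1 e2 e3
    simp only [hf, add_sub_cancel] at e2
    by_cases hp : p.1 - τ p.2 = 0
    · have h5 : p = (τ p.2, p.2) := Prod.ext (sub_eq_zero.1 hp) rfl
      rw [hp, zero_mul, add_zero]
      conv_lhs => rw [h5]
      exact e3
    · rw [← e1 hp, ← e2]
      ring

/-! ### The first integral in the coordinates `(w, z)`, `z = x + y` -/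

/-- The first integral divided by `z`, in the coordinates `(w, z)` with `y = z / (1 + e ^ w)`. -/
noncomputable def levelFunction (k : Plane → ℂ) (p : Plane) : ℂ :=
  Complex.exp (k (p.1, p.2 / (1 + Complex.exp p.1))) / (1 + Complex.exp p.1)

lemma snd_mul_levelFunction (k : Plane → ℂ) (p : Plane) :
    p.2 * levelFunction k p = leafIntegral k (p.1, p.2 / (1 + Complex.exp p.1)) := by
  simp only [levelFunction, leafIntegral]
  ring

lemma analyticAt_level_coord {p : Plane} (h : 1 + Complex.exp p.1 ≠ 0) :
    AnalyticAt ℂ (fun p : Plane => ((p.1, p.2 / (1 + Complex.exp p.1)) : Plane)) p :=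
  analyticAt_fst.prod (analyticAt_snd.div (analyticAt_const.add analyticAt_fst.cexp) h)

lemma tendsto_level_coord {w : ℂ} (h : 1 + Complex.exp w ≠ 0) :
    Tendsto (fun p : Plane => ((p.1, p.2 / (1 + Complex.exp p.1)) : Plane)) (𝓝 (w, 0))
      (𝓝 (w, 0)) := by
  have := (analyticAt_level_coord (p := (w, 0)) h).continuousAt.tendsto
  simpa using this

lemma eventually_one_add_exp_ne {w : ℂ} (h : 1 + Complex.exp w ≠ 0) :
    ∀ᶠ p in 𝓝 (w, (0 : ℂ)), 1 + Complex.exp p.1 ≠ 0 := by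
  have : ContinuousAt (fun p : ℂ × ℂ => 1 + Complex.exp p.1) (w, 0) := by fun_prop
  exact this.eventually_ne h

namespace IsLeafExponent

variable {μ k : Plane → ℂ} {w₀ : ℂ} {R : ℝ}

lemma analyticAt_levelFunction (h : IsLeafExponent μ w₀ R k) {w : ℂ}
    (hw : w ∈ Metric.ball w₀ R) (h1 : 1 + Complex.exp w ≠ 0) :
    AnalyticAt ℂ (levelFunction k) (w, 0) := by
  have hk : AnalyticAt ℂ (fun p : Plane => k (p.1, p.2 / (1 + Complex.exp p.1))) (w, 0) :=
    AnalyticAt.fun_comp (g := k)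
      (f := fun p : Plane => ((p.1, p.2 / (1 + Complex.exp p.1)) : Plane))
      (by simpa using h.analytic w hw) (analyticAt_level_coord h1)
  exact hk.cexp.div (analyticAt_const.add analyticAt_fst.cexp) h1

lemma levelFunction_axis (h : IsLeafExponent μ w₀ R k) (hR : 0 < R) {w : ℂ}
    (hw : w ∈ Metric.ball w₀ R) : levelFunction k (w, 0)
      = Complex.exp (1 / (1 + μ 0) * (w - w₀)) / (1 + Complex.exp w) := by
  simp only [levelFunction, zero_div]
  rw [h.apply_axis hR hw]

lemma hasDerivAt_levelFunction_axis (h : IsLeafExponent μ w₀ R k) (hR : 0 < R) {w : ℂ}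
    (hw : w ∈ Metric.ball w₀ R) (h1 : 1 + Complex.exp w ≠ 0) :
    HasDerivAt (fun w => levelFunction k (w, 0)) (levelFunction k (w, 0)
      * (1 / (1 + μ 0) - Complex.exp w / (1 + Complex.exp w))) w := by
  have d1 : HasDerivAt (fun w => Complex.exp (1 / (1 + μ 0) * (w - w₀)))
      (Complex.exp (1 / (1 + μ 0) * (w - w₀)) * (1 / (1 + μ 0) * 1)) w :=
    (((hasDerivAt_id' w).sub_const w₀).const_mul _).cexp
  have d2 : HasDerivAt (fun w => 1 + Complex.exp w) (Complex.exp w) w :=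
    (Complex.hasDerivAt_exp w).const_add 1
  have d3 := d1.fun_div d2 h1
  have he : (fun w => levelFunction k (w, 0)) =ᶠ[𝓝 w]
      fun w => Complex.exp (1 / (1 + μ 0) * (w - w₀)) / (1 + Complex.exp w) := by
    filter_upwards [Metric.isOpen_ball.mem_nhds hw] with v hv
    exact h.levelFunction_axis hR hv
  refine (d3.congr_of_eventuallyEq he).congr_deriv ?_
  rw [h.levelFunction_axis hR hw]
  generalize 1 / (1 + μ 0) = σ
  field_simp

/-- The hypothesis says that μ x = y, that is, the point lies on the tangent curve. There dz is
proportional to the form of the foliation, so the first integral is stationary along z = const. -/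
lemma fderiv_levelFunction (h : IsLeafExponent μ w₀ R k) {w : ℂ}
    (hw : w ∈ Metric.ball w₀ R) (h1 : 1 + Complex.exp w ≠ 0) :
    ∀ᶠ p in 𝓝 (w, (0 : ℂ)), μ (Complex.exp p.1 * (p.2 / (1 + Complex.exp p.1)),
        p.2 / (1 + Complex.exp p.1)) * Complex.exp p.1 = 1 →
      fderiv ℂ (levelFunction k) p (1, 0) = 0 := by
  have ht := tendsto_level_coord h1
  filter_upwards [ht.eventually (h.eq w hw), ht.eventually (h.analytic w hw).eventually_analyticAt,
    eventually_one_add_exp_ne h1, (h.analyticAt_levelFunction hw h1).eventually_analyticAt]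
    with p e1 e2 e3 e4 hp
  obtain ⟨v, z⟩ := p
  simp only at e1 e2 e3 hp ⊢
  have d0 : HasDerivAt (fun w => 1 + Complex.exp w) (Complex.exp v) v :=
    (Complex.hasDerivAt_exp v).const_add 1
  have d1 : HasDerivAt (fun w => z / (1 + Complex.exp w))
      ((0 * (1 + Complex.exp v) - z * Complex.exp v) / (1 + Complex.exp v) ^ 2) v :=
    (hasDerivAt_const v z).fun_div d0 e3
  have d2 : HasDerivAt (fun w => k (w, z / (1 + Complex.exp w))) _ v :=
    e2.differentiableAt.hasFDerivAt.comp_hasDerivAt v ((hasDerivAt_id' v).prodMk d1)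
  have d3 : HasDerivAt (fun w => levelFunction k (w, z)) _ v := d2.cexp.fun_div d0 e3
  rw [(hasDerivAt_mk_left e4).unique d3, clm_apply_prod, e1]
  set y := z / (1 + Complex.exp v)
  have hM : leafSlope μ (v, y) = Complex.exp v / (1 + Complex.exp v) := by
    have hμe : μ (Complex.exp v * y, y) = (Complex.exp v)⁻¹ := eq_inv_of_mul_eq_one_left hp
    simp only [leafSlope, hμe]
    have := Complex.exp_ne_zero v
    rw [show 1 + (Complex.exp v)⁻¹ = (1 + Complex.exp v) / Complex.exp v by field_simp; ring,
      one_div_div]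
  rw [hM]
  have hz : z = y * (1 + Complex.exp v) := by simp only [y]; field_simp
  rw [hz]
  field_simp
  ring

end IsLeafExponent

/-- The data of a normal form: the foliation `y dx + μ x dy`, a first integral, and the tangent
curve with the pencil `x + y`, in the coordinates `(w, y)`. -/
structure IsStripModel (lam w₀ : ℂ) (μ k : Plane → ℂ) (τ : ℂ → ℂ) : Prop where
  exp_base : Complex.exp w₀ * lam = 1
  one_add_ne : 1 + lam ≠ 0
  mu_analytic : AnalyticAt ℂ μ 0
  mu_zero : μ 0 = lam
  leaf : IsLeafExponent μ w₀ 8 k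
  tau_analytic : AnalyticAt ℂ τ 0
  tau_zero : τ 0 = w₀
  tau_eq : ∀ᶠ v in 𝓝 (0 : ℂ), μ (Complex.exp (τ v) * (v / (1 + Complex.exp (τ v))),
    v / (1 + Complex.exp (τ v))) * Complex.exp (τ v) = 1

namespace IsStripModel

variable {lam w₀ : ℂ} {μ k : Plane → ℂ} {τ : ℂ → ℂ}

lemma lam_ne (h : IsStripModel lam w₀ μ k τ) : lam ≠ 0 := right_ne_zero_of_mul_eq_one h.exp_base

lemma exp_eq (h : IsStripModel lam w₀ μ k τ) : Complex.exp w₀ = 1 / lam :=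
  eq_div_of_mul_eq h.lam_ne h.exp_base

lemma one_add_exp_ne (h : IsStripModel lam w₀ μ k τ) : 1 + Complex.exp w₀ ≠ 0 := by
  rw [h.exp_eq]
  have := h.lam_ne
  have h1 := h.one_add_ne
  intro hc
  field_simp at hc
  exact h1 (by linear_combination hc)

lemma one_add_mu_ne (h : IsStripModel lam w₀ μ k τ) : 1 + μ 0 ≠ 0 := by
  rw [h.mu_zero]
  exact h.one_add_ne

lemma mem_ball (_ : IsStripModel lam w₀ μ k τ) : w₀ ∈ Metric.ball w₀ 8 :=
  Metric.mem_ball_self (by norm_num)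

lemma mem_ball_add (w₀ : ℂ) : w₀ + 2 * Real.pi * Complex.I ∈ Metric.ball w₀ 8 := by
  rw [mem_ball_iff_norm, add_sub_cancel_left]
  simp only [norm_mul, Complex.norm_real, Complex.norm_I, mul_one, RCLike.norm_ofNat,
    Real.norm_eq_abs, abs_of_pos Real.pi_pos]
  have := Real.pi_lt_d2
  linarith

/-- The tangent curve is defined in terms of e^w, so its translate by a period is again a curve of
critical points. This serves for w = 0 and for w = 2πi. -/
lemma critical (h : IsStripModel lam w₀ μ k τ) {w : ℂ} (hw : w₀ + w ∈ Metric.ball w₀ 8)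
    (hexp : Complex.exp w = 1) :
    ∀ᶠ v in 𝓝 (0 : ℂ), fderiv ℂ (levelFunction k) (τ v + w, v) (1, 0) = 0 := by
  have h1 : 1 + Complex.exp (w₀ + w) ≠ 0 := by
    rw [Complex.exp_add, hexp, mul_one]
    exact h.one_add_exp_ne
  have ht : Tendsto (fun v => (τ v + w, v)) (𝓝 0) (𝓝 (w₀ + w, 0)) := by
    have h2 := h.tau_analytic.continuousAt.tendsto
    rw [h.tau_zero] at h2
    exact (h2.add_const w).prodMk_nhds tendsto_id
  filter_upwards [ht.eventually (h.leaf.fderiv_levelFunction hw h1),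
    h.tau_eq] with v e1 e2
  refine e1 ?_
  simp only [Complex.exp_add, hexp, mul_one]
  exact e2

/-- This is the logarithmic derivative of the level function on the divisor, and it vanishes in the
direction e^{w₀} = 1/lam of the tangent curve. Its derivative there is not zero, so the critical
point is nondegenerate. -/
lemma slope_base (h : IsStripModel lam w₀ μ k τ) :
    1 / (1 + μ 0) - Complex.exp w₀ / (1 + Complex.exp w₀) = 0 := by
  have h1 := h.one_add_exp_ne
  have h2 := h.one_add_ne
  have h3 := h.lam_ne
  rw [h.mu_zero, sub_eq_zero, div_eq_div_iff h2 h1]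
  linear_combination -h.exp_base

lemma hasDerivAt_slope (h : IsStripModel lam w₀ μ k τ) :
    ∃ s' : ℂ, s' ≠ 0 ∧ HasDerivAt
      (fun w => 1 / (1 + μ 0) - Complex.exp w / (1 + Complex.exp w)) s' w₀ := by
  have h1 := h.one_add_exp_ne
  have d0 : HasDerivAt (fun w => 1 + Complex.exp w) (Complex.exp w₀) w₀ :=
    (Complex.hasDerivAt_exp w₀).const_add 1
  have d1 := ((Complex.hasDerivAt_exp w₀).fun_div d0 h1).const_sub (1 / (1 + μ 0))
  refine ⟨_, ?_, d1⟩
  rw [neg_ne_zero]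
  refine div_ne_zero ?_ (pow_ne_zero 2 h1)
  have : Complex.exp w₀ * (1 + Complex.exp w₀) - Complex.exp w₀ * Complex.exp w₀
      = Complex.exp w₀ := by ring
  rw [this]
  exact Complex.exp_ne_zero _

end IsStripModel

/-- The first integral of the source, corrected by `θ` and divided by `z`. -/
noncomputable def correctedLevel (k : Plane → ℂ) (ϑ : ℂ → ℂ) (p : Plane) : ℂ :=
  levelFunction k p * ϑ (p.2 * levelFunction k p)

/-- In the coordinates `(w, z)`, there is a unique local conjugacy between the first integrals
which preserves `z` and respects the tangent curves. -/
lemma IsStripModel.exists_local {lam w₀ : ℂ} {μ k μ' k' : Plane → ℂ} {τ τ' ϑ : ℂ → ℂ}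
    (h : IsStripModel lam w₀ μ k τ) (h' : IsStripModel lam w₀ μ' k' τ') (hϑ : AnalyticAt ℂ ϑ 0)
    (hϑ0 : ϑ 0 = 1)
    (hval : ∀ᶠ v in 𝓝 (0 : ℂ), v * levelFunction k' (τ' v, v) = v * correctedLevel k ϑ (τ v, v)) :
    ∃ W : Plane → ℂ, AnalyticAt ℂ W (w₀, 0) ∧ (∀ᶠ w in 𝓝 w₀, W (w, 0) = w) ∧
      (∀ᶠ z in 𝓝 (0 : ℂ), W (τ z, z) = τ' z) ∧
      (∀ᶠ p in 𝓝 (w₀, (0 : ℂ)), levelFunction k' (W p, p.2) = correctedLevel k ϑ p) ∧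
      ∀ V : Plane → ℂ, AnalyticAt ℂ V (w₀, 0) → (∀ᶠ w in 𝓝 w₀, V (w, 0) = w) →
        (∀ᶠ z in 𝓝 (0 : ℂ), V (τ z, z) = τ' z) →
        (∀ᶠ p in 𝓝 (w₀, (0 : ℂ)), levelFunction k' (V p, p.2) = correctedLevel k ϑ p) →
        V =ᶠ[𝓝 (w₀, 0)] W := by
  have hR : (0 : ℝ) < 8 := by norm_num
  have hL := h.leaf.analyticAt_levelFunction h.mem_ball h.one_add_exp_ne
  have hL' := h'.leaf.analyticAt_levelFunction h.mem_ball h.one_add_exp_ne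
  have hm : AnalyticAt ℂ (fun p : Plane => p.2 * levelFunction k p) (w₀, 0) :=
    analyticAt_snd.mul hL
  have hC : AnalyticAt ℂ (correctedLevel k ϑ) (w₀, 0) :=
    hL.mul (AnalyticAt.fun_comp (g := ϑ) (f := fun p : Plane => p.2 * levelFunction k p)
      (by simpa using hϑ) hm)
  have hτt : Tendsto (fun v => (τ v, v)) (𝓝 0) (𝓝 (w₀, 0)) := by
    have h2 := h.tau_analytic.continuousAt.tendsto
    rw [h.tau_zero] at h2
    exact h2.prodMk_nhds tendsto_id
  have hτt' : Tendsto (fun v => (τ' v, v)) (𝓝 0) (𝓝 (w₀, 0)) := by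
    have h2 := h'.tau_analytic.continuousAt.tendsto
    rw [h'.tau_zero] at h2
    exact h2.prodMk_nhds tendsto_id
  have hc0 := h.critical (w := 0) (by rw [add_zero]; exact h.mem_ball) Complex.exp_zero
  have hc0' := h'.critical (w := 0) (by rw [add_zero]; exact h.mem_ball) Complex.exp_zero
  simp only [add_zero] at hc0 hc0'
  have hmt : Tendsto (fun p : Plane => p.2 * levelFunction k p) (𝓝 (w₀, 0)) (𝓝 0) := by
    simpa using hm.continuousAt.tendsto
  -- For fixed z the corrected function depends only on the value of the level function, so the
  -- critical curve is unchanged.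
  have hcrit : ∀ᶠ v in 𝓝 (0 : ℂ), fderiv ℂ (correctedLevel k ϑ) (τ v, v) (1, 0) = 0 := by
    filter_upwards [hc0, hτt.eventually hL.eventually_analyticAt,
      hτt.eventually hC.eventually_analyticAt,
      hτt.eventually (hmt.eventually hϑ.eventually_analyticAt)] with v e1 e2 e3 e4
    have d1 := hasDerivAt_mk_left e2
    rw [e1] at d1
    have d2 : HasDerivAt (fun w => ϑ (v * levelFunction k (w, v))) _ (τ v) :=
      HasDerivAt.comp (h₂ := ϑ) (h := fun w => v * levelFunction k (w, v)) (τ v)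
        e4.differentiableAt.hasDerivAt (d1.const_mul v)
    have d3 : HasDerivAt (fun w => correctedLevel k ϑ (w, v)) _ (τ v) := d1.fun_mul d2
    rw [(hasDerivAt_mk_left e3).unique d3]
    ring
  have hax : ∀ᶠ w in 𝓝 w₀, w ∈ Metric.ball w₀ 8 ∧ 1 + Complex.exp w ≠ 0 := by
    refine Eventually.and (Metric.isOpen_ball.mem_nhds h.mem_ball) ?_
    have : ContinuousAt (fun w => 1 + Complex.exp w) w₀ := by fun_prop
    exact this.eventually_ne h.one_add_exp_ne
  -- Here the equality of the Camacho–Sad indices enters: on z = 0 both functions depend only on the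
  -- common value lam of μ and μ' at the origin.
  have haxis : ∀ᶠ w in 𝓝 w₀, levelFunction k' (w, 0) = correctedLevel k ϑ (w, 0) := by
    filter_upwards [hax] with w hw
    simp only [correctedLevel, zero_mul, hϑ0, mul_one]
    rw [h.leaf.levelFunction_axis hR hw.1, h'.leaf.levelFunction_axis hR hw.1, h.mu_zero,
      h'.mu_zero]
  have hval' : ∀ᶠ v in 𝓝 (0 : ℂ), levelFunction k' (τ' v, v) = correctedLevel k ϑ (τ v, v) := by
    rw [← nhdsNE_sup_pure, eventually_sup]
    constructor
    · filter_upwards [nhdsWithin_le_nhds hval, self_mem_nhdsWithin] with v e1 e2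
      exact mul_left_cancel₀ e2 e1
    · simpa [h.tau_zero, h'.tau_zero] using haxis.self_of_nhds
  obtain ⟨s', hs', hs⟩ := h'.hasDerivAt_slope
  refine exists_fold_conjugation hC hL' h.tau_analytic h'.tau_analytic h.tau_zero h'.tau_zero hcrit
    hc0' hval' haxis (hax.mono fun w hw => h'.leaf.hasDerivAt_levelFunction_axis hR hw.1 hw.2)
    h'.slope_base hs hs' ?_
  rw [h'.leaf.levelFunction_axis hR h.mem_ball]
  exact div_ne_zero (Complex.exp_ne_zero _) h.one_add_exp_ne

/-! ### Maps preserving `x + y` and the axes -/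

lemma hasDerivAt_line {E : Type*} [NormedAddCommGroup E] [NormedSpace ℂ E] {f : Plane → E}
    {p : Plane} (hf : AnalyticAt ℂ f p) (v : Plane) :
    HasDerivAt (fun s : ℂ => f (p + s • v)) (fderiv ℂ f p v) 0 := by
  have d : HasDerivAt (fun s : ℂ => p + s • v) v 0 := by
    simpa using ((hasDerivAt_id (0 : ℂ)).smul_const v).const_add p
  have h0 : HasFDerivAt f (fderiv ℂ f p) (p + (0 : ℂ) • v) := by
    rw [zero_smul, add_zero]
    exact hf.differentiableAt.hasFDerivAt
  exact h0.comp_hasDerivAt (0 : ℂ) d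

/-- The map `(x, y) ↦ (x (1 + y g), y (1 - x g))` in the coordinates `(w, y)`, `x = e ^ w y`. -/
noncomputable def shear (g : Plane → ℂ) (p : Plane) : Plane :=
  (p.1 + Complex.log (1 + p.2 * g p) - Complex.log (1 - Complex.exp p.1 * p.2 * g p),
    p.2 * (1 - Complex.exp p.1 * p.2 * g p))

lemma shear_axis (g : Plane → ℂ) (w : ℂ) : shear g (w, 0) = (w, 0) := by
  simp [shear]

lemma analyticAt_shear_factors {g : Plane → ℂ} {p : Plane} (hg : AnalyticAt ℂ g p) :
    AnalyticAt ℂ (fun p : Plane => 1 + p.2 * g p) p ∧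
      AnalyticAt ℂ (fun p : Plane => 1 - Complex.exp p.1 * p.2 * g p) p :=
  ⟨analyticAt_const.add (analyticAt_snd.mul hg),
    analyticAt_const.sub ((analyticAt_fst.cexp.mul analyticAt_snd).mul hg)⟩

lemma eventually_shear_slit {g : Plane → ℂ} {w : ℂ} (hg : AnalyticAt ℂ g (w, 0)) :
    ∀ᶠ p in 𝓝 (w, (0 : ℂ)), 1 + p.2 * g p ∈ Complex.slitPlane ∧
      1 - Complex.exp p.1 * p.2 * g p ∈ Complex.slitPlane := by
  obtain ⟨h1, h2⟩ := analyticAt_shear_factors hg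
  refine Eventually.and ?_ ?_
  · exact h1.continuousAt.eventually (Complex.isOpen_slitPlane.mem_nhds (by simp))
  · exact h2.continuousAt.eventually (Complex.isOpen_slitPlane.mem_nhds (by simp))

lemma analyticAt_shear {g : Plane → ℂ} {p : Plane} (hg : AnalyticAt ℂ g p)
    (hA : 1 + p.2 * g p ∈ Complex.slitPlane)
    (hB : 1 - Complex.exp p.1 * p.2 * g p ∈ Complex.slitPlane) : AnalyticAt ℂ (shear g) p := by
  obtain ⟨h1, h2⟩ := analyticAt_shear_factors hg
  exact ((analyticAt_fst.add (h1.clog hA)).sub (h2.clog hB)).prod (analyticAt_snd.mul h2)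

lemma analyticAt_shear_axis {g : Plane → ℂ} {w : ℂ} (hg : AnalyticAt ℂ g (w, 0)) :
    AnalyticAt ℂ (shear g) (w, 0) :=
  analyticAt_shear hg (by simp) (by simp)

lemma tendsto_shear {g : Plane → ℂ} {w : ℂ} (hg : AnalyticAt ℂ g (w, 0)) :
    Tendsto (shear g) (𝓝 (w, 0)) (𝓝 (w, 0)) := by
  have := (analyticAt_shear_axis hg).continuousAt.tendsto
  rwa [shear_axis] at this

lemma exp_shear {g : Plane → ℂ} {p : Plane} (hA : 1 + p.2 * g p ≠ 0)
    (hB : 1 - Complex.exp p.1 * p.2 * g p ≠ 0) :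
    Complex.exp (shear g p).1 * (shear g p).2 = Complex.exp p.1 * p.2 * (1 + p.2 * g p) := by
  simp only [shear]
  rw [Complex.exp_sub, Complex.exp_add, Complex.exp_log hA, Complex.exp_log hB]
  field_simp

lemma fderiv_shear {g : Plane → ℂ} {p : Plane} (hg : AnalyticAt ℂ g p)
    (hA : 1 + p.2 * g p ∈ Complex.slitPlane)
    (hB : 1 - Complex.exp p.1 * p.2 * g p ∈ Complex.slitPlane) (v : Plane) :
    fderiv ℂ (shear g) p v =
      (v.1 + (v.2 * g p + p.2 * fderiv ℂ g p v) / (1 + p.2 * g p)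
        + ((Complex.exp p.1 * v.1 * p.2 + Complex.exp p.1 * v.2) * g p
          + Complex.exp p.1 * p.2 * fderiv ℂ g p v) / (1 - Complex.exp p.1 * p.2 * g p),
      v.2 * (1 - Complex.exp p.1 * p.2 * g p)
        - p.2 * ((Complex.exp p.1 * v.1 * p.2 + Complex.exp p.1 * v.2) * g p
          + Complex.exp p.1 * p.2 * fderiv ℂ g p v)) := by
  have dg := hasDerivAt_line hg v
  have d1 : HasDerivAt (fun s : ℂ => (p + s • v).1) v.1 0 := by
    have := hasDerivAt_line (f := fun q : Plane => q.1) (p := p) analyticAt_fst v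
    rwa [fderiv_fst] at this
  have d2 : HasDerivAt (fun s : ℂ => (p + s • v).2) v.2 0 := by
    have := hasDerivAt_line (f := fun q : Plane => q.2) (p := p) analyticAt_snd v
    rwa [fderiv_snd] at this
  have dA := (d2.fun_mul dg).const_add 1
  have dB := ((d1.cexp.fun_mul d2).fun_mul dg).const_sub 1
  have dW := (d1.fun_add (dA.clog (by simpa using hA))).fun_sub (dB.clog (by simpa using hB))
  have dY := d2.fun_mul dB
  have d : HasDerivAt (fun s : ℂ => shear g (p + s • v)) _ 0 := dW.prodMk dY
  rw [(hasDerivAt_line (analyticAt_shear hg hA hB) v).unique d]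
  simp only [zero_smul, add_zero]
  refine Prod.ext ?_ ?_
  · simp only
    ring
  · simp only
    ring

/-- The derivative, along the foliation of the source, of the first integral of the target. -/
lemma fderiv_leafIntegral_shear {μ μ' k' g : Plane → ℂ} {w₀ w : ℂ} {R : ℝ}
    (hμ : AnalyticAt ℂ μ 0) (hμ1 : 1 + μ 0 ≠ 0) (hμ' : AnalyticAt ℂ μ' 0) (hμ'1 : 1 + μ' 0 ≠ 0)
    (hk' : IsLeafExponent μ' w₀ R k') (hw : w ∈ Metric.ball w₀ R) (hg : AnalyticAt ℂ g (w, 0)) :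
    ∀ᶠ p in 𝓝 (w, (0 : ℂ)),
      fderiv ℂ (fun p => leafIntegral k' (shear g p)) p (1, -(p.2 * leafSlope μ p))
        = p.2 * (fderiv ℂ (leafIntegral k') (shear g p) (0, 1) * leafSlope μ' (shear g p)
          * leafSlope μ p / (1 + p.2 * g p)) *
          ((1 - Complex.exp p.1 * p.2 * g p) * μ (Complex.exp p.1 * p.2, p.2)
          - μ' (Complex.exp p.1 * p.2 * (1 + p.2 * g p), p.2 * (1 - Complex.exp p.1 * p.2 * g p))
            * (1 + p.2 * g p)
          + (p.2 * (1 - Complex.exp p.1 * p.2 * g p)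
            - μ' (Complex.exp p.1 * p.2 * (1 + p.2 * g p),
                p.2 * (1 - Complex.exp p.1 * p.2 * g p))
              * (Complex.exp p.1 * p.2 * (1 + p.2 * g p)))
            * ((μ (Complex.exp p.1 * p.2, p.2) - 1) * g p
              + (1 + μ (Complex.exp p.1 * p.2, p.2))
                * fderiv ℂ g p (1, -(p.2 * leafSlope μ p)))) := by
  have ht := tendsto_shear hg
  have hne : ∀ {ν : Plane → ℂ} (hν : AnalyticAt ℂ ν 0) (hν1 : 1 + ν 0 ≠ 0),
      ∀ᶠ p in 𝓝 (w, (0 : ℂ)), 1 + ν (Complex.exp p.1 * p.2, p.2) ≠ 0 := fun {ν} hν hν1 =>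
    (analyticAt_const.add (analyticAt_comp_exp_blowup hν w)).continuousAt.eventually_ne
      (by simpa [← Prod.zero_eq_mk] using hν1)
  filter_upwards [eventually_shear_slit hg, hg.eventually_analyticAt,
    ht.eventually (hk'.fderiv_eq hw), ht.eventually (hk'.analytic w hw).eventually_analyticAt,
    hne hμ hμ1, ht.eventually (hne hμ' hμ'1)] with p e1 e2 e3 e4 e5 e6
  have hA := Complex.slitPlane_ne_zero e1.1
  have hB := Complex.slitPlane_ne_zero e1.2
  have e7 := exp_shear hA hB
  rw [fderiv_comp_apply (analyticAt_leafIntegral e4) (analyticAt_shear e2 e1.1 e1.2),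
    clm_apply_prod, e3, fderiv_shear e2 e1.1 e1.2]
  simp only [leafSlope, e7] at e6 ⊢
  have e8 : (shear g p).2 = p.2 * (1 - Complex.exp p.1 * p.2 * g p) := rfl
  rw [e8] at e6 ⊢
  generalize fderiv ℂ g p (1, -(p.2 * (1 / (1 + μ (Complex.exp p.1 * p.2, p.2))))) = a
  generalize fderiv ℂ (leafIntegral k') (shear g p) (0, 1) = b
  generalize μ' (Complex.exp p.1 * p.2 * (1 + p.2 * g p),
    p.2 * (1 - Complex.exp p.1 * p.2 * g p)) = m' at e6 ⊢
  generalize μ (Complex.exp p.1 * p.2, p.2) = m at e5 ⊢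
  generalize g p = G at hA hB ⊢
  generalize Complex.exp p.1 = E at hA hB ⊢
  generalize p.2 = y at hA hB ⊢
  have hB' : 1 - y * G * E ≠ 0 := by
    rwa [mul_assoc, mul_comm E] at hB
  field_simp
  ring

/-- The obstruction for `(x (1 + y G), y (1 - x G))` to be a conjugacy from `y dx + μ x dy = 0`
to `y dx + μ' x dy = 0`. -/
noncomputable def conjDefect (μ μ' G : Plane → ℂ) (p : Plane) : ℂ :=
  (1 - p.1 * G p) * μ p - μ' (p.1 * (1 + p.2 * G p), p.2 * (1 - p.1 * G p)) * (1 + p.2 * G p)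
    + (p.2 * (1 - p.1 * G p) - μ' (p.1 * (1 + p.2 * G p), p.2 * (1 - p.1 * G p))
      * (p.1 * (1 + p.2 * G p)))
      * ((μ p - 1) * G p + (p.1 * μ p * fderiv ℂ G p (1, 0) - p.2 * fderiv ℂ G p (0, 1)))

lemma analyticAt_conjDefect {μ μ' G : Plane → ℂ} (hμ : AnalyticAt ℂ μ 0)
    (hμ' : AnalyticAt ℂ μ' 0) (hG : AnalyticAt ℂ G 0) : AnalyticAt ℂ (conjDefect μ μ' G) 0 := by
  have a1 : AnalyticAt ℂ (fun p : Plane => 1 - p.1 * G p) 0 :=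
    analyticAt_const.sub (analyticAt_fst.mul hG)
  have a2 : AnalyticAt ℂ (fun p : Plane => 1 + p.2 * G p) 0 :=
    analyticAt_const.add (analyticAt_snd.mul hG)
  have a3 : AnalyticAt ℂ (fun p : Plane => μ' (p.1 * (1 + p.2 * G p), p.2 * (1 - p.1 * G p))) 0 :=
    AnalyticAt.fun_comp (g := μ')
      (f := fun p : Plane => (p.1 * (1 + p.2 * G p), p.2 * (1 - p.1 * G p)))
      (by simpa [← Prod.zero_eq_mk] using hμ')
      ((analyticAt_fst.mul a2).prod (analyticAt_snd.mul a1))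
  exact ((a1.mul hμ).sub (a3.mul a2)).add (((analyticAt_snd.mul a1).sub
    (a3.mul (analyticAt_fst.mul a2))).mul (((hμ.sub analyticAt_const).mul hG).add
      (((analyticAt_fst.mul hμ).mul (analyticAt_fderiv_apply hG _)).sub
        (analyticAt_snd.mul (analyticAt_fderiv_apply hG _)))))

lemma conjDefect_zero {μ μ' G : Plane → ℂ} (h : μ 0 = μ' 0) : conjDefect μ μ' G 0 = 0 := by
  simp [conjDefect, ← Prod.zero_eq_mk, h]

/-- The function on the plane read in the coordinates `(w, y)`. -/
noncomputable def expBlowup (P : Plane → ℂ) (p : Plane) : ℂ := P (Complex.exp p.1 * p.2, p.2)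

lemma analyticAt_expBlowup {P : Plane → ℂ} (hP : AnalyticAt ℂ P 0) (w : ℂ) :
    AnalyticAt ℂ (expBlowup P) (w, 0) := analyticAt_comp_exp_blowup hP w

lemma fderiv_expBlowup {P : Plane → ℂ} {p : Plane}
    (hP : AnalyticAt ℂ P (Complex.exp p.1 * p.2, p.2)) (v : Plane) :
    fderiv ℂ (expBlowup P) p v = fderiv ℂ P (Complex.exp p.1 * p.2, p.2)
      (Complex.exp p.1 * v.1 * p.2 + Complex.exp p.1 * v.2, v.2) := by
  have d1 : HasDerivAt (fun s : ℂ => (p + s • v).1) v.1 0 := by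
    have := hasDerivAt_line (f := fun q : Plane => q.1) (p := p) analyticAt_fst v
    rwa [fderiv_fst] at this
  have d2 : HasDerivAt (fun s : ℂ => (p + s • v).2) v.2 0 := by
    have := hasDerivAt_line (f := fun q : Plane => q.2) (p := p) analyticAt_snd v
    rwa [fderiv_snd] at this
  have d := (d1.cexp.fun_mul d2).prodMk d2
  have dl := hasDerivAt_line (analyticAt_exp_blowup p) v
  rw [show expBlowup P = fun p => P (Complex.exp p.1 * p.2, p.2) from rfl]
  rw [fderiv_comp_apply hP (analyticAt_exp_blowup p), dl.unique d]
  simp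

/-- In the plane the leaf direction (1, -y / (1 + μ)) of the (w, y) coordinates becomes (μ x, -y) /
(1 + μ). Hence a singular equation on the plane controls how far the pulled back first integral is
from being constant on leaves. -/
lemma fderiv_leafIntegral_shear_expBlowup {μ μ' k' P : Plane → ℂ} {w₀ w : ℂ} {R : ℝ}
    (hμ : AnalyticAt ℂ μ 0) (hμ1 : 1 + μ 0 ≠ 0) (hμ' : AnalyticAt ℂ μ' 0) (hμ'1 : 1 + μ' 0 ≠ 0)
    (hk' : IsLeafExponent μ' w₀ R k') (hw : w ∈ Metric.ball w₀ R) (hP : AnalyticAt ℂ P 0) :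
    ∀ᶠ p in 𝓝 (w, (0 : ℂ)),
      fderiv ℂ (fun p => leafIntegral k' (shear (expBlowup P) p)) p (1, -(p.2 * leafSlope μ p))
        = p.2 * (fderiv ℂ (leafIntegral k') (shear (expBlowup P) p) (0, 1)
          * leafSlope μ' (shear (expBlowup P) p) * leafSlope μ p / (1 + p.2 * expBlowup P p))
          * conjDefect μ μ' P (Complex.exp p.1 * p.2, p.2) := by
  have hne : ∀ᶠ p in 𝓝 (w, (0 : ℂ)), 1 + μ (Complex.exp p.1 * p.2, p.2) ≠ 0 :=
    (analyticAt_const.add (analyticAt_comp_exp_blowup hμ w)).continuousAt.eventually_ne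
      (by simpa [← Prod.zero_eq_mk] using hμ1)
  filter_upwards [fderiv_leafIntegral_shear hμ hμ1 hμ' hμ'1 hk' hw (analyticAt_expBlowup hP w),
    (tendsto_exp_blowup w).eventually hP.eventually_analyticAt, hne] with p e1 e2 e3
  have e4 := fderiv_expBlowup e2 (1, -(p.2 * leafSlope μ p))
  rw [clm_apply_prod (fderiv ℂ P _)] at e4
  rw [e1, e4]
  simp only [expBlowup, conjDefect, leafSlope]
  congr 1
  field_simp
  ring

/-! ### The local conjugacy near the tangent curve -/

/-- The difference has imaginary part smaller than π, so the principal logarithm recovers it. -/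
lemma eq_of_exp_eq {a b : ℂ} (h : Complex.exp a = Complex.exp b) (hn : ‖a - b‖ < 1) : a = b := by
  have h1 : Complex.exp (a - b) = 1 := by
    rw [Complex.exp_sub, h, div_self (Complex.exp_ne_zero b)]
  have h2 := abs_le.1 ((Complex.abs_im_le_norm (a - b)).trans hn.le)
  have h3 := Real.pi_gt_three
  have h4 := Complex.log_exp (x := a - b) (by linarith [h2.1]) (by linarith [h2.2])
  rw [h1, Complex.log_one] at h4
  exact sub_eq_zero.1 h4.symm

/-- Two strip models with matching first integrals on the tangent curve, before and after one
turn. -/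
structure IsMatched (w₀ : ℂ) (k k' : Plane → ℂ) (τ τ' θ : ℂ → ℂ) : Prop where
  analytic : AnalyticAt ℂ θ 0
  zero : θ 0 = 0
  base : ∀ᶠ v in 𝓝 (0 : ℂ), leafIntegral k' (τ' v, v / (1 + Complex.exp (τ' v)))
    = θ (leafIntegral k (τ v, v / (1 + Complex.exp (τ v))))
  turn : ∀ᶠ v in 𝓝 (0 : ℂ),
    leafIntegral k' (τ' v + 2 * Real.pi * Complex.I, v / (1 + Complex.exp (τ' v)))
    = θ (leafIntegral k (τ v + 2 * Real.pi * Complex.I, v / (1 + Complex.exp (τ v))))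

lemma tendsto_mk_tau {lam w₀ : ℂ} {μ k : Plane → ℂ} {τ : ℂ → ℂ}
    (h : IsStripModel lam w₀ μ k τ) : Tendsto (fun v => (τ v, v)) (𝓝 0) (𝓝 (w₀, 0)) := by
  have h2 := h.tau_analytic.continuousAt.tendsto
  rw [h.tau_zero] at h2
  exact h2.prodMk_nhds tendsto_id

/-- Divide the matching relation on the tangent curve by v and let v tend to 0. Both level functions
have the same nonzero value at (w₀, 0), so θ is tangent to the identity. -/
lemma IsMatched.exists_factor {lam w₀ : ℂ} {μ k μ' k' : Plane → ℂ} {τ τ' θ : ℂ → ℂ}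
    (hm : IsMatched w₀ k k' τ τ' θ)
    (h : IsStripModel lam w₀ μ k τ) (h' : IsStripModel lam w₀ μ' k' τ') :
    ∃ ϑ : ℂ → ℂ, AnalyticAt ℂ ϑ 0 ∧ ϑ 0 = 1 ∧ (∀ t, θ t = t * ϑ t) ∧
      ∀ᶠ v in 𝓝 (0 : ℂ), v * levelFunction k' (τ' v, v) = v * correctedLevel k ϑ (τ v, v) := by
  obtain ⟨ϑ, hϑ, -, hθ⟩ := exists_eq_mul_of_apply_zero hm.analytic hm.zero
  have hval : ∀ᶠ v in 𝓝 (0 : ℂ),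
      v * levelFunction k' (τ' v, v) = v * correctedLevel k ϑ (τ v, v) := by
    filter_upwards [hm.base] with v hv
    have e1 := snd_mul_levelFunction k' (τ' v, v)
    have e2 := snd_mul_levelFunction k (τ v, v)
    simp only at e1 e2
    rw [e1, hv, ← e2, hθ, correctedLevel, smul_eq_mul]
    ring
  have hL := h.leaf.analyticAt_levelFunction h.mem_ball h.one_add_exp_ne
  have hL' := h'.leaf.analyticAt_levelFunction h.mem_ball h.one_add_exp_ne
  have l1 := hL.continuousAt.tendsto.comp (tendsto_mk_tau h)
  have l2 := hL'.continuousAt.tendsto.comp (tendsto_mk_tau h')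
  have l3 : Tendsto (fun v => v * levelFunction k (τ v, v)) (𝓝 0) (𝓝 0) := by
    have := (tendsto_id (x := 𝓝 (0 : ℂ))).mul l1
    simpa using this
  have l4 := l1.mul (hϑ.continuousAt.tendsto.comp l3)
  have l5 : Tendsto (fun v => levelFunction k' (τ' v, v)) (𝓝[≠] 0)
      (𝓝 (levelFunction k (w₀, 0) * ϑ 0)) := by
    refine (l4.mono_left nhdsWithin_le_nhds).congr' ?_
    filter_upwards [nhdsWithin_le_nhds hval, self_mem_nhdsWithin] with v e1 e2
    exact (mul_left_cancel₀ e2 e1).symm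
  have l6 := tendsto_nhds_unique l5 (l2.mono_left nhdsWithin_le_nhds)
  have hR : (0 : ℝ) < 8 := by norm_num
  rw [h.leaf.levelFunction_axis hR h.mem_ball, h'.leaf.levelFunction_axis hR h.mem_ball,
    h.mu_zero, h'.mu_zero] at l6
  have hne : Complex.exp (1 / (1 + lam) * (w₀ - w₀)) / (1 + Complex.exp w₀) ≠ 0 :=
    div_ne_zero (Complex.exp_ne_zero _) h.one_add_exp_ne
  exact ⟨ϑ, hϑ, mul_left_cancel₀ hne (l6.trans (mul_one _).symm), hθ, hval⟩

lemma tendsto_unlevel {w : ℂ} : Tendsto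
    (fun p : Plane => ((p.1, p.2 * (1 + Complex.exp p.1)) : Plane)) (𝓝 (w, 0)) (𝓝 (w, 0)) := by
  have : ContinuousAt (fun p : Plane => ((p.1, p.2 * (1 + Complex.exp p.1)) : Plane)) (w, 0) := by
    fun_prop
  simpa using this.tendsto

lemma shear_snd_eq {g : Plane → ℂ} {p : Plane} (hA : 1 + p.2 * g p ≠ 0)
    (hB : 1 - Complex.exp p.1 * p.2 * g p ≠ 0) (h1 : 1 + Complex.exp (shear g p).1 ≠ 0) :
    (shear g p).2 = p.2 * (1 + Complex.exp p.1) / (1 + Complex.exp (shear g p).1) := by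
  rw [eq_div_iff h1]
  have h2 := exp_shear hA hB
  have h3 : (shear g p).2 = p.2 * (1 - Complex.exp p.1 * p.2 * g p) := rfl
  linear_combination h2 + h3

/-- Existence and uniqueness of the conjugacy near the tangent curve, in the coordinates
`(w, y)`. -/
theorem IsMatched.exists_local_shear {lam w₀ : ℂ} {μ k μ' k' : Plane → ℂ} {τ τ' θ : ℂ → ℂ}
    (hm : IsMatched w₀ k k' τ τ' θ)
    (h : IsStripModel lam w₀ μ k τ) (h' : IsStripModel lam w₀ μ' k' τ') :
    ∃ g : Plane → ℂ, AnalyticAt ℂ g (w₀, 0) ∧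
      (∀ᶠ p in 𝓝 (w₀, (0 : ℂ)), leafIntegral k' (shear g p) = θ (leafIntegral k p)) ∧
      (∀ᶠ v in 𝓝 (0 : ℂ), (shear g (τ v, v / (1 + Complex.exp (τ v)))).1 = τ' v) ∧
      ∀ f : Plane → ℂ, AnalyticAt ℂ f (w₀, 0) →
        (∀ᶠ p in 𝓝 (w₀, (0 : ℂ)), leafIntegral k' (shear f p) = θ (leafIntegral k p)) →
        (∀ᶠ v in 𝓝 (0 : ℂ), (shear f (τ v, v / (1 + Complex.exp (τ v)))).1 = τ' v) →
        f =ᶠ[𝓝 (w₀, 0)] g := by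
  obtain ⟨ϑ, hϑ, hϑ0, hθ, hval⟩ := hm.exists_factor h h'
  obtain ⟨W, hW, hWax, hWτ, hWeq, hWuniq⟩ := h.exists_local h' hϑ hϑ0 hval
  have hc := h.one_add_exp_ne
  set V : Plane → ℂ := fun p => W (p.1, p.2 * (1 + Complex.exp p.1)) with hV
  have hVa : AnalyticAt ℂ V (w₀, 0) :=
    AnalyticAt.fun_comp (g := W)
      (f := fun p : Plane => ((p.1, p.2 * (1 + Complex.exp p.1)) : Plane))
      (by simpa using hW)
      (analyticAt_fst.prod (analyticAt_snd.mul (analyticAt_const.add analyticAt_fst.cexp)))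
  have hVax : ∀ᶠ w in 𝓝 w₀, V (w, 0) = w := hWax.mono fun w hw => by simpa [hV] using hw
  have hV0 : V (w₀, 0) = w₀ := hVax.self_of_nhds
  have hVt : Tendsto V (𝓝 (w₀, 0)) (𝓝 w₀) := by
    have := hVa.continuousAt.tendsto
    rwa [hV0] at this
  have hV1 : AnalyticAt ℂ (fun p => 1 + Complex.exp (V p)) (w₀, 0) :=
    analyticAt_const.add hVa.cexp
  have hV1ne : 1 + Complex.exp (V (w₀, 0)) ≠ 0 := by rwa [hV0]
  -- The image has the same z = y (1 + e^w) and logarithmic slope V, so its second coordinate is z /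
  -- (1 + e^V). Comparison with y (1 - e^w y g) gives e^w y g = n, and n vanishes on y = 0 because V
  -- = w there.
  set n : Plane → ℂ := fun p => Complex.exp (V p) / (1 + Complex.exp (V p))
    * (1 + Complex.exp p.1) - Complex.exp p.1 with hn
  have hna : AnalyticAt ℂ n (w₀, 0) :=
    ((hVa.cexp.div hV1 hV1ne).mul (analyticAt_const.add analyticAt_fst.cexp)).sub
      analyticAt_fst.cexp
  have hwne : ∀ᶠ w in 𝓝 w₀, 1 + Complex.exp w ≠ 0 := by
    have : ContinuousAt (fun w => 1 + Complex.exp w) w₀ := by fun_prop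
    exact this.eventually_ne hc
  obtain ⟨n₁, hn₁, hne⟩ := exists_eq_snd_mul hna (by
    filter_upwards [hVax, hwne] with w e1 e2
    simp only [hn, e1]
    field_simp
    ring)
  set g : Plane → ℂ := fun p => n₁ p / Complex.exp p.1 with hg
  have hga : AnalyticAt ℂ g (w₀, 0) := hn₁.div analyticAt_fst.cexp (Complex.exp_ne_zero _)
  have hshear : ∀ᶠ p in 𝓝 (w₀, (0 : ℂ)), shear g p
      = (V p, p.2 * (1 + Complex.exp p.1) / (1 + Complex.exp (V p))) := by
    have hclose : ∀ᶠ p in 𝓝 (w₀, (0 : ℂ)), ‖(shear g p).1 - V p‖ < 1 := by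
      have l1 : Tendsto (fun p => (shear g p).1 - V p) (𝓝 (w₀, 0)) (𝓝 (w₀ - w₀)) :=
        ((continuous_fst.tendsto _).comp (tendsto_shear hga)).sub hVt
      rw [sub_self] at l1
      filter_upwards [l1.eventually (Metric.ball_mem_nhds 0 one_pos)] with p hp
      simpa using hp
    filter_upwards [hne, hV1.continuousAt.eventually_ne hV1ne, eventually_one_add_exp_ne hc,
      hclose] with p e1 e2 e3 e4
    have hE := Complex.exp_ne_zero p.1
    have hEV := Complex.exp_ne_zero (V p)
    have f1 : 1 + p.2 * g p = Complex.exp (V p) / (1 + Complex.exp (V p))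
        * (1 + Complex.exp p.1) / Complex.exp p.1 := by
      have : p.2 * g p = n p / Complex.exp p.1 := by
        rw [e1]
        simp only [hg]
        ring
      rw [this]
      simp only [hn]
      field_simp
      ring
    have f2 : 1 - Complex.exp p.1 * p.2 * g p
        = (1 + Complex.exp p.1) / (1 + Complex.exp (V p)) := by
      have : Complex.exp p.1 * p.2 * g p = n p := by
        rw [e1]
        simp only [hg]
        field_simp
      rw [this]
      simp only [hn]
      field_simp
      ring
    have hA : 1 + p.2 * g p ≠ 0 := by
      rw [f1]
      exact div_ne_zero (mul_ne_zero (div_ne_zero hEV e2) e3) hE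
    have hB : 1 - Complex.exp p.1 * p.2 * g p ≠ 0 := by
      rw [f2]
      exact div_ne_zero e3 e2
    refine Prod.ext (eq_of_exp_eq ?_ e4) ?_
    · simp only [shear]
      rw [Complex.exp_sub, Complex.exp_add, Complex.exp_log hA, Complex.exp_log hB, f1, f2]
      field_simp
    · simp only [shear]
      rw [f2]
      ring
  have key : ∀ f : Plane → ℂ, AnalyticAt ℂ f (w₀, 0) → ∀ᶠ p in 𝓝 (w₀, (0 : ℂ)),
      leafIntegral k' (shear f p) = p.2 * (1 + Complex.exp p.1)
        * levelFunction k' ((shear f p).1, p.2 * (1 + Complex.exp p.1)) := by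
    intro f hf
    have l1 : Tendsto (fun p => (shear f p).1) (𝓝 (w₀, 0)) (𝓝 w₀) :=
      (continuous_fst.tendsto _).comp (tendsto_shear hf)
    filter_upwards [eventually_shear_slit hf, l1.eventually hwne] with p e1 e2
    have e3 := snd_mul_levelFunction k' ((shear f p).1, p.2 * (1 + Complex.exp p.1))
    simp only at e3
    rw [e3, ← shear_snd_eq (Complex.slitPlane_ne_zero e1.1) (Complex.slitPlane_ne_zero e1.2) e2]
  have keyθ : ∀ᶠ p in 𝓝 (w₀, (0 : ℂ)), θ (leafIntegral k p) = p.2 * (1 + Complex.exp p.1)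
      * correctedLevel k ϑ (p.1, p.2 * (1 + Complex.exp p.1)) := by
    filter_upwards [eventually_one_add_exp_ne hc] with p e1
    have e3 := snd_mul_levelFunction k (p.1, p.2 * (1 + Complex.exp p.1))
    simp only at e3
    rw [mul_div_cancel_right₀ _ e1] at e3
    simp only [correctedLevel]
    rw [hθ, e3, ← e3]
    ring
  have hyt : Tendsto (fun v => ((τ v, v / (1 + Complex.exp (τ v))) : Plane)) (𝓝 0)
      (𝓝 (w₀, 0)) := (tendsto_level_coord hc).comp (tendsto_mk_tau h)
  have hτne : ∀ᶠ v in 𝓝 (0 : ℂ), 1 + Complex.exp (τ v) ≠ 0 :=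
    (tendsto_mk_tau h).eventually (eventually_one_add_exp_ne hc)
  refine ⟨g, hga, ?_, ?_, ?_⟩
  · filter_upwards [hshear, tendsto_unlevel.eventually hWeq, key g hga, keyθ] with p e1 e2 e3 e4
    rw [e3, e4, ← e2, e1]
  · filter_upwards [hyt.eventually hshear, hWτ, hτne] with v e1 e2 e3
    rw [e1]
    simp only [hV]
    rw [div_mul_cancel₀ _ e3, e2]
  · intro f hf hf1 hf2
    have ht := tendsto_level_coord hc
    have hsa := analyticAt_shear_axis hf
    set V₁ : Plane → ℂ := fun p => (shear f (p.1, p.2 / (1 + Complex.exp p.1))).1 with hV₁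
    have hV₁a : AnalyticAt ℂ V₁ (w₀, 0) := by
      refine analyticAt_fst.fun_comp (AnalyticAt.fun_comp (g := shear f)
        (f := fun p : Plane => ((p.1, p.2 / (1 + Complex.exp p.1)) : Plane)) ?_
        (analyticAt_level_coord hc))
      simpa using hsa
    have hV₁0 : V₁ (w₀, 0) = w₀ := by simp [hV₁, shear]
    have hV₁ax : ∀ᶠ w in 𝓝 w₀, V₁ (w, 0) = w := Eventually.of_forall fun w => by
      simp [hV₁, shear]
    have hL := h.leaf.analyticAt_levelFunction h.mem_ball h.one_add_exp_ne
    have hL' := h'.leaf.analyticAt_levelFunction h.mem_ball h.one_add_exp_ne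
    have hC : AnalyticAt ℂ (correctedLevel k ϑ) (w₀, 0) :=
      hL.mul (AnalyticAt.fun_comp (g := ϑ) (f := fun p : Plane => p.2 * levelFunction k p)
        (by simpa using hϑ) (analyticAt_snd.mul hL))
    have hLV : AnalyticAt ℂ (fun p => levelFunction k' (V₁ p, p.2)) (w₀, 0) :=
      AnalyticAt.fun_comp (g := levelFunction k') (f := fun p : Plane => (V₁ p, p.2))
        (by simpa [hV₁0] using hL') (hV₁a.prod analyticAt_snd)
    have hVeq := hWuniq V₁ hV₁a hV₁ax hf2 (by
      refine eventuallyEq_of_pow_snd_mul_eq (n := 1) hLV hC ?_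
      filter_upwards [ht.eventually (key f hf), ht.eventually keyθ, ht.eventually hf1,
        eventually_one_add_exp_ne hc] with p e1 e2 e3 e4
      rw [e3] at e1
      rw [e1] at e2
      simp only [div_mul_cancel₀ _ e4] at e2
      simpa using e2)
    -- The second component of the map is y - e^w y² f, so it determines y² f.
    refine eventuallyEq_of_pow_snd_mul_eq (n := 2) hf hga ?_
    have l1 : Tendsto (fun p => (shear f p).1) (𝓝 (w₀, 0)) (𝓝 w₀) :=
      (continuous_fst.tendsto _).comp (tendsto_shear hf)
    filter_upwards [hshear, tendsto_unlevel.eventually hVeq, eventually_one_add_exp_ne hc,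
      eventually_shear_slit hf, l1.eventually hwne] with p e1 e2 e3 e4 e5
    simp only [hV₁, mul_div_cancel_right₀ _ e3] at e2
    have e6 : (shear f p).1 = V p := e2
    have e7 := shear_snd_eq (Complex.slitPlane_ne_zero e4.1) (Complex.slitPlane_ne_zero e4.2) e5
    rw [e6] at e7
    have e8 : (shear f p).2 = (shear g p).2 := by rw [e7, e1]
    simp only [shear] at e8
    have hE := Complex.exp_ne_zero p.1
    refine mul_left_cancel₀ hE ?_
    linear_combination -e8

/-! ### A linear differential equation on the strip -/

lemma hasDerivAt_eval_exp (q : Polynomial ℂ) (w : ℂ) :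
    HasDerivAt (fun w => q.eval (Complex.exp w))
      (q.derivative.eval (Complex.exp w) * Complex.exp w) w :=
  HasDerivAt.comp (h₂ := fun x => q.eval x) w (q.hasDerivAt _) (Complex.hasDerivAt_exp w)

/-- For a parameter which is not a negative rational number, the solutions with equal values at
the endpoints of a turn are polynomials in `e ^ w`. -/
theorem exists_polynomial_of_ode {n : ℕ} (hn : n ≠ 0) {σ lam w₀ : ℂ} (hσ : σ * (1 + lam) = 1)
    (hratio : ∀ r : ℚ, r < 0 → lam ≠ (r : ℂ)) {q : Polynomial ℂ} (hq : q.natDegree ≤ n)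
    {f : ℂ → ℂ} (hf : ∀ w ∈ Metric.ball w₀ 8,
      HasDerivAt f (n * σ * f w + q.eval (Complex.exp w)) w)
    (h0 : f w₀ = 0) (h1 : f (w₀ + 2 * Real.pi * Complex.I) = 0) :
    ∃ p : Polynomial ℂ, p.natDegree ≤ n ∧ ∀ w ∈ Metric.ball w₀ 8, f w = p.eval (Complex.exp w) := by
  have hσ0 : σ ≠ 0 := left_ne_zero_of_mul_eq_one hσ
  have hn0 : (n : ℂ) ≠ 0 := by exact_mod_cast hn
  -- A particular solution found monomial by monomial. If i = n σ, division by zero returns 0, and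
  -- the resonant monomial is simply left out.
  set b : Polynomial ℂ := ∑ i ∈ Finset.range (n + 1),
    Polynomial.monomial i (q.coeff i / (i - n * σ)) with hb
  have hbdeg : b.natDegree ≤ n := by
    refine Polynomial.natDegree_sum_le_of_forall_le _ _ fun i hi => ?_
    exact (Polynomial.natDegree_monomial_le _).trans (by rw [Finset.mem_range] at hi; omega)
  -- The resonant monomial that b cannot produce; at most one index contributes.
  set κ : ℂ → ℂ := fun w => ∑ i ∈ Finset.range (n + 1),
    if (i : ℂ) = n * σ then q.coeff i * Complex.exp w ^ i else 0 with hκ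
  have hbd : ∀ w : ℂ, b.derivative.eval (Complex.exp w) * Complex.exp w
      = n * σ * b.eval (Complex.exp w) + q.eval (Complex.exp w) - κ w := fun w => by
    have e1 : q.eval (Complex.exp w) = ∑ i ∈ Finset.range (n + 1), q.coeff i * Complex.exp w ^ i :=
      Polynomial.eval_eq_sum_range' (by omega) _
    rw [e1, hb, hκ, Polynomial.derivative_sum, Polynomial.eval_finsetSum,
      Polynomial.eval_finsetSum, Finset.mul_sum, Finset.sum_mul, ← Finset.sum_add_distrib,
      ← Finset.sum_sub_distrib]
    refine Finset.sum_congr rfl fun i _ => ?_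
    rw [Polynomial.derivative_monomial, Polynomial.eval_monomial, Polynomial.eval_monomial]
    have e2 : (i : ℂ) * Complex.exp w ^ (i - 1) * Complex.exp w = i * Complex.exp w ^ i := by
      rcases i with _ | i
      · simp
      · rw [Nat.add_sub_cancel, pow_succ]
        ring
    split_ifs with hi
    · rw [hi, sub_self, div_zero]
      ring
    · have hi' : (i : ℂ) - n * σ ≠ 0 := sub_ne_zero.2 hi
      have e3 : q.coeff i / (i - n * σ) * i * Complex.exp w ^ (i - 1) * Complex.exp w
          = q.coeff i / (i - n * σ) * (i * Complex.exp w ^ i) := by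
        rw [← e2]
        ring
      rw [e3]
      field_simp
      ring
  set u : ℂ → ℂ := fun w => f w - b.eval (Complex.exp w) with hu
  set E : ℂ → ℂ := fun w => Complex.exp (-(n * σ * (w - w₀))) with hE
  have hdE : ∀ w, HasDerivAt E (E w * (-(n * σ))) w := fun w => by
    have := ((((hasDerivAt_id' w).sub_const w₀).const_mul (n * σ)).neg).cexp
    rwa [mul_one] at this
  have hdU : ∀ w ∈ Metric.ball w₀ 8, HasDerivAt (fun w => u w * E w) (κ w * E w) w := fun w hw => by
    refine (((hf w hw).fun_sub (hasDerivAt_eval_exp b w)).fun_mul (hdE w)).congr_deriv ?_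
    rw [hbd]
    ring
  have hexp : Complex.exp (w₀ + 2 * Real.pi * Complex.I) = Complex.exp w₀ := by
    rw [Complex.exp_add, Complex.exp_two_pi_mul_I, mul_one]
  have hu01 : u (w₀ + 2 * Real.pi * Complex.I) = u w₀ := by
    simp only [hu, h0, h1, hexp]
  have hw₀ : w₀ ∈ Metric.ball w₀ 8 := Metric.mem_ball_self (by norm_num)
  have hw₁ := IsStripModel.mem_ball_add w₀
  have hconst : ∀ κ₀ : ℂ, (∀ w ∈ Metric.ball w₀ 8, κ w * E w = κ₀) →
      ∀ w ∈ Metric.ball w₀ 8, u w * E w = u w₀ + κ₀ * (w - w₀) := fun κ₀ hκ₀ w hw => by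
    have hd : ∀ w ∈ Metric.ball w₀ 8, HasDerivAt (fun w => u w * E w - κ₀ * (w - w₀)) 0 w :=
      fun w hw => by
        refine ((hdU w hw).fun_sub (((hasDerivAt_id' w).sub_const w₀).const_mul κ₀)).congr_deriv ?_
        rw [hκ₀ w hw]
        ring
    have h2 := Metric.isOpen_ball.is_const_of_deriv_eq_zero (convex_ball w₀ 8).isPreconnected
      (fun w hw => (hd w hw).differentiableAt.differentiableWithinAt)
      (fun w hw => (hd w hw).deriv) hw hw₀
    have hE0 : E w₀ = 1 := by simp [hE]
    simp only [sub_self, mul_zero, sub_zero, hE0, mul_one] at h2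
    linear_combination h2
  have hEne : ∀ w, E w ≠ 0 := fun w => Complex.exp_ne_zero _
  have hE1 : E (w₀ + 2 * Real.pi * Complex.I) = Complex.exp (-(n * σ * (2 * Real.pi * Complex.I))) := by
    simp only [hE, add_sub_cancel_left]
  have h2pi : (2 * Real.pi * Complex.I : ℂ) ≠ 0 := Complex.two_pi_I_ne_zero
  -- With resonance, u E is affine in w and E has period 2πi, so equal end values kill its slope:
  -- the logarithmic term disappears and u is a multiple of e^{i₀ w}. Without resonance u E is
  -- constant, and equal end values force u = 0 unless n σ is an integer.
  by_cases hres : ∃ i ∈ Finset.range (n + 1), (i : ℂ) = n * σ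
  · obtain ⟨i₀, hi₀, hi₀'⟩ := hres
    have hκE : ∀ w ∈ Metric.ball w₀ 8, κ w * E w = q.coeff i₀ * Complex.exp (i₀ * w₀) :=
      fun w _ => by
        have e1 : κ w = q.coeff i₀ * Complex.exp w ^ i₀ := by
          simp only [hκ]
          rw [Finset.sum_eq_single i₀]
          · rw [if_pos hi₀']
          · intro j _ hj
            rw [if_neg]
            intro hc
            rw [← hi₀'] at hc
            exact hj (by exact_mod_cast hc)
          · intro hc
            exact absurd hi₀ hc
        rw [e1, ← Complex.exp_nat_mul, mul_assoc]
        simp only [hE]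
        rw [← Complex.exp_add, ← hi₀']
        congr 2
        ring
    have h3 := hconst _ hκE
    have h4 := h3 _ hw₁
    rw [hu01, hE1, ← hi₀', add_sub_cancel_left] at h4
    have h5 : Complex.exp (-(i₀ * (2 * Real.pi * Complex.I))) = 1 := by
      rw [Complex.exp_neg, Complex.exp_nat_mul, Complex.exp_two_pi_mul_I, one_pow, inv_one]
    rw [h5, mul_one, left_eq_add] at h4
    have h6 := (mul_eq_zero.1 h4).resolve_right h2pi
    refine ⟨b + Polynomial.monomial i₀ (u w₀ * Complex.exp (-(i₀ * w₀))), ?_, fun w hw => ?_⟩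
    · refine (Polynomial.natDegree_add_le _ _).trans (max_le hbdeg ?_)
      exact (Polynomial.natDegree_monomial_le _).trans (by rw [Finset.mem_range] at hi₀; omega)
    · have h7 := h3 w hw
      rw [h6, zero_mul, add_zero] at h7
      have h8 : u w = u w₀ * Complex.exp (-(i₀ * w₀)) * Complex.exp w ^ i₀ := by
        rw [← Complex.exp_nat_mul, mul_assoc, ← Complex.exp_add, ← h7, mul_assoc]
        simp only [hE]
        rw [← Complex.exp_add, ← hi₀']
        have : -((i₀ : ℂ) * (w - w₀)) + (-(i₀ * w₀) + i₀ * w) = 0 := by ring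
        rw [this, Complex.exp_zero, mul_one]
      rw [Polynomial.eval_add, Polynomial.eval_monomial, ← h8]
      simp only [hu]
      ring
  · have hκE : ∀ w ∈ Metric.ball w₀ 8, κ w * E w = 0 := fun w _ => by
      have e1 : κ w = 0 := Finset.sum_eq_zero fun i hi => if_neg fun hc => hres ⟨i, hi, hc⟩
      rw [e1, zero_mul]
    have h3 := hconst _ hκE
    have h4 := h3 _ hw₁
    rw [hu01, hE1, zero_mul, add_zero] at h4
    have hu0 : u w₀ = 0 := by
      by_contra hne
      have h5 : Complex.exp (-(n * σ * (2 * Real.pi * Complex.I))) = 1 :=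
        mul_left_cancel₀ hne (h4.trans (mul_one _).symm)
      obtain ⟨j, hj⟩ := Complex.exp_eq_one_iff.1 h5
      have h6 : (n : ℂ) * σ = ((-j : ℤ) : ℂ) := by
        refine mul_right_cancel₀ h2pi ?_
        push_cast
        linear_combination -hj
      set l : ℤ := -j with hl
      have hl0 : l ≠ 0 := by
        intro hc
        rw [hc, Int.cast_zero] at h6
        exact (mul_ne_zero hn0 hσ0) h6
      -- If n σ were an integer l, it would lie outside 0, …, n. From l (1 + lam) = n it would
      -- follow that lam = (n - l) / l is negative and rational.
      have hlr : l < 0 ∨ (n : ℤ) < l := by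
        by_contra hc
        push Not at hc
        obtain ⟨hc1, hc2⟩ := hc
        obtain ⟨i, hi⟩ := Int.eq_ofNat_of_zero_le hc1
        refine hres ⟨i, ?_, ?_⟩
        · rw [Finset.mem_range]
          omega
        · rw [h6, hi]
          rfl
      have hlc : (l : ℂ) ≠ 0 := by exact_mod_cast hl0
      have hlam : lam = (((n - l : ℤ) / l : ℚ) : ℂ) := by
        push_cast
        rw [eq_div_iff hlc]
        have h7 : (l : ℂ) * (1 + lam) = n := by
          rw [← h6, mul_assoc, hσ, mul_one]
        linear_combination h7
      refine hratio _ ?_ hlam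
      rcases hlr with h7 | h7
      · refine div_neg_of_pos_of_neg ?_ (by exact_mod_cast h7)
        have : (0 : ℤ) < n - l := by omega
        exact_mod_cast this
      · refine div_neg_of_neg_of_pos ?_ ?_
        · have : (n : ℤ) - l < 0 := by omega
          exact_mod_cast this
        · have : (0 : ℤ) < l := by omega
          exact_mod_cast this
    refine ⟨b, hbdeg, fun w hw => ?_⟩
    have h5 := h3 w hw
    rw [hu0, zero_mul, add_zero] at h5
    have h6 := (mul_eq_zero.1 h5).resolve_right (hEne w)
    exact sub_eq_zero.1 h6

/-! ### Divisibility by a power of `y` from limits on the fibres -/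

/-- A finite limit on a fibre forces F(w, 0) = 0 as long as the exponent is positive, so one factor
y is split off at each step. No uniformity in w is required. -/
lemma exists_eq_pow_snd_mul_of_tendsto {c : ℂ} (n : ℕ) : ∀ {F : Plane → ℂ},
    AnalyticAt ℂ F (c, 0) → (∀ᶠ w in 𝓝 c, ∃ L : ℂ,
      Tendsto (fun y : ℂ => (y ^ n)⁻¹ * F (w, y)) (𝓝[≠] 0) (𝓝 L)) →
    ∃ D : Plane → ℂ, AnalyticAt ℂ D (c, 0) ∧ ∀ᶠ p in 𝓝 (c, (0 : ℂ)), F p = p.2 ^ n * D p := by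
  induction n with
  | zero =>
    intro F hF _
    exact ⟨F, hF, Eventually.of_forall fun p => by simp⟩
  | succ n ih =>
    intro F hF hlim
    have h0 : ∀ᶠ w in 𝓝 c, F (w, 0) = 0 := by
      filter_upwards [hlim, (tendsto_mk_left c 0).eventually hF.eventually_analyticAt]
        with w ⟨L, hL⟩ hw
      have h1 : Tendsto (fun y : ℂ => F (w, y)) (𝓝[≠] 0) (𝓝 (F (w, 0))) :=
        (analyticAt_comp_mk_right hw).continuousAt.tendsto.mono_left nhdsWithin_le_nhds
      have h2 : Tendsto (fun y : ℂ => y ^ (n + 1)) (𝓝[≠] 0) (𝓝 0) := by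
        have : Tendsto (fun y : ℂ => y ^ (n + 1)) (𝓝 0) (𝓝 0) :=
          (continuous_pow (n + 1)).tendsto' 0 0 (by simp)
        exact this.mono_left nhdsWithin_le_nhds
      have h3 := h2.mul hL
      rw [zero_mul] at h3
      refine tendsto_nhds_unique h1 (h3.congr' ?_)
      filter_upwards [self_mem_nhdsWithin] with y hy
      rw [mul_inv_cancel_left₀ (pow_ne_zero _ hy)]
    obtain ⟨F₁, hF₁, hFe⟩ := exists_eq_snd_mul hF h0
    obtain ⟨D, hD, hDe⟩ := ih hF₁ (by
      filter_upwards [hlim, (tendsto_mk_left c 0).eventually hFe.eventually_nhds]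
        with w ⟨L, hL⟩ hw
      refine ⟨L, hL.congr' ?_⟩
      filter_upwards [self_mem_nhdsWithin,
        nhdsWithin_le_nhds ((tendsto_mk_right w 0).eventually hw)] with y hy hy2
      have hy' : y ≠ 0 := hy
      rw [hy2, pow_succ]
      field_simp)
    refine ⟨D, hD, ?_⟩
    filter_upwards [hFe, hDe] with p e1 e2
    rw [e1, e2]
    ring

/-! ### The homogeneous components of the conjugacy -/

/-- The first integral after the map is y j(y u, y) with j analytic at 0, so a discrepancy y^m ρ
between the functions u appears at order m + 2. Its coefficient contains σ (1 + e^w) - e^w, with σ =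
1 / (1 + μ(0)), the factor that vanishes in the direction of the tangent curve. -/
lemma tendsto_leafIntegral_shear_sub {μ k f g ρ : Plane → ℂ} {w₀ w : ℂ} {R : ℝ} (hR : 0 < R)
    (hk : IsLeafExponent μ w₀ R k) (hw : w ∈ Metric.ball w₀ R) {m : ℕ}
    (hf : AnalyticAt ℂ f (w, 0)) (hg : AnalyticAt ℂ g (w, 0)) (hρ : AnalyticAt ℂ ρ (w, 0))
    (heq : ∀ᶠ p in 𝓝 (w, (0 : ℂ)), g p - f p = p.2 ^ m * ρ p) :
    Tendsto (fun y : ℂ => (y ^ (m + 2))⁻¹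
        * (leafIntegral k (shear f (w, y)) - leafIntegral k (shear g (w, y)))) (𝓝[≠] 0)
      (𝓝 (-(Complex.exp (1 / (1 + μ 0) * (w - w₀))
        * (1 / (1 + μ 0) * (1 + Complex.exp w) - Complex.exp w) * ρ (w, 0)))) := by
  set κ : Plane → Plane := fun q => (w + Complex.log (1 + q.1)
    - Complex.log (1 - Complex.exp w * q.1), q.2 * (1 - Complex.exp w * q.1)) with hκ
  have hκa : AnalyticAt ℂ κ 0 := by
    have a1 : AnalyticAt ℂ (fun q : Plane => 1 + q.1) 0 := analyticAt_const.add analyticAt_fst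
    have a2 : AnalyticAt ℂ (fun q : Plane => 1 - Complex.exp w * q.1) 0 :=
      analyticAt_const.sub (analyticAt_const.mul analyticAt_fst)
    exact ((analyticAt_const.add (a1.clog (by simp))).sub (a2.clog (by simp))).prod
      (analyticAt_snd.mul a2)
  have hκ0 : κ 0 = (w, 0) := by simp [hκ]
  set j : Plane → ℂ := fun q => (1 - Complex.exp w * q.1) * Complex.exp (k (κ q)) with hj
  have hja : AnalyticAt ℂ j 0 := by
    refine (analyticAt_const.sub (analyticAt_const.mul analyticAt_fst)).mul
      (AnalyticAt.cexp (AnalyticAt.fun_comp (g := k) (f := κ) ?_ hκa))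
    rw [hκ0]
    exact hk.analytic w hw
  have hjs : ∀ (u : Plane → ℂ) (y : ℂ),
      leafIntegral k (shear u (w, y)) = y * j (y * u (w, y), y) := fun u y => by
    simp only [leafIntegral, shear, hj, hκ]
    ring_nf
  have hjd : fderiv ℂ j 0 (1, 0) = Complex.exp (1 / (1 + μ 0) * (w - w₀))
      * (1 / (1 + μ 0) * (1 + Complex.exp w) - Complex.exp w) := by
    have d1 : HasDerivAt (fun ξ : ℂ => 1 + ξ) 1 0 := (hasDerivAt_id' (0 : ℂ)).const_add 1
    have d2 : HasDerivAt (fun ξ : ℂ => 1 - Complex.exp w * ξ) (-(Complex.exp w * 1)) 0 :=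
      ((hasDerivAt_id' (0 : ℂ)).const_mul _).const_sub 1
    have d3 : HasDerivAt (fun ξ : ℂ => w + Complex.log (1 + ξ)
        - Complex.log (1 - Complex.exp w * ξ) - w₀) _ 0 :=
      (((d1.clog (by simp)).const_add w).fun_sub (d2.clog (by simp))).sub_const w₀
    have d4 := d2.fun_mul (d3.const_mul (1 / (1 + μ 0))).cexp
    have he : (fun ξ : ℂ => j (ξ, 0)) =ᶠ[𝓝 0] fun ξ : ℂ => (1 - Complex.exp w * ξ)
        * Complex.exp (1 / (1 + μ 0) * (w + Complex.log (1 + ξ)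
          - Complex.log (1 - Complex.exp w * ξ) - w₀)) := by
      have ht := (hκa.continuousAt.tendsto.comp (tendsto_mk_left 0 0))
      rw [hκ0] at ht
      have ht1 := (continuous_fst.tendsto _).comp ht
      filter_upwards [ht1.eventually (Metric.isOpen_ball.mem_nhds hw)] with ξ hξ
      have e1 : κ (ξ, 0) = ((κ (ξ, 0)).1, 0) := by simp [hκ]
      simp only [hj]
      rw [e1, hk.apply_axis hR (w := (κ (ξ, 0)).1) hξ]
    have d5 := d4.congr_of_eventuallyEq he
    have d6 := hasDerivAt_mk_left (f := j) (c := 0) (d := 0) hja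
    have d7 := d6.unique d5
    rw [Prod.mk_zero_zero] at d7
    rw [d7]
    simp
    ring
  have ta : ∀ u : Plane → ℂ, AnalyticAt ℂ u (w, 0) →
      Tendsto (fun y : ℂ => ((y * u (w, y), y) : Plane)) (𝓝[≠] 0) (𝓝 0) := fun u hu => by
    have hc : ContinuousAt (fun y : ℂ => ((y * u (w, y), y) : Plane)) 0 :=
      (continuousAt_id.mul (analyticAt_comp_mk_right hu).continuousAt).prodMk continuousAt_id
    have := hc.tendsto
    simp only [zero_mul, Prod.mk_zero_zero] at this
    exact this.mono_left nhdsWithin_le_nhds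
  have hρt : Tendsto (fun y : ℂ => ((-ρ (w, y), 0) : Plane)) (𝓝[≠] 0) (𝓝 (-ρ (w, 0), 0)) := by
    have hc : ContinuousAt (fun y : ℂ => ((-ρ (w, y), 0) : Plane)) 0 :=
      (analyticAt_comp_mk_right hρ).continuousAt.neg.prodMk continuousAt_const
    exact hc.tendsto.mono_left nhdsWithin_le_nhds
  have hv : Tendsto (fun y : ℂ => ((y ^ (m + 1))⁻¹ : ℂ) •
      (((y * f (w, y), y) : Plane) - (y * g (w, y), y))) (𝓝[≠] 0) (𝓝 (-ρ (w, 0), 0)) := by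
    refine hρt.congr' ?_
    filter_upwards [nhdsWithin_le_nhds ((tendsto_mk_right w 0).eventually heq),
      self_mem_nhdsWithin] with y e1 e2
    have hy : y ≠ 0 := e2
    refine Prod.ext ?_ (by simp)
    have e3 : f (w, y) = g (w, y) - y ^ m * ρ (w, y) := by rw [← e1]; ring
    simp only [Prod.mk_sub_mk, Prod.smul_mk, smul_eq_mul, e3]
    field_simp
    ring
  have hlim := tendsto_smul_sub_of_strict hja.hasStrictFDerivAt (ta f hf) (ta g hg) hv
  have hval : fderiv ℂ j 0 (-ρ (w, 0), 0) = -(Complex.exp (1 / (1 + μ 0) * (w - w₀))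
        * (1 / (1 + μ 0) * (1 + Complex.exp w) - Complex.exp w) * ρ (w, 0)) := by
    rw [clm_apply_prod, hjd]
    ring
  rw [hval] at hlim
  refine hlim.congr' ?_
  filter_upwards [self_mem_nhdsWithin] with y hy
  have hy : y ≠ 0 := hy
  rw [hjs, hjs, smul_eq_mul]
  field_simp
  ring

-- After one turn the curve is again critical for the level function. The w-coordinates of the two
-- images differ by O(v^{m+1}), so the level functions differ by o(v^{m+1}), and the factor v turns
-- this into o(v^{m+2}). The exact map g may thus be replaced by its approximation f over w₀ + 2πi,
-- where g itself need not be defined.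
set_option maxHeartbeats 400000 in
lemma tendsto_leafIntegral_shear_turn {μ' k' f g ρ : Plane → ℂ} {lam w₀ : ℂ} {τ τ' : ℂ → ℂ}
    (h' : IsStripModel lam w₀ μ' k' τ') (hτ : AnalyticAt ℂ τ 0) (hτ0 : τ 0 = w₀) {m : ℕ}
    (hf : AnalyticAt ℂ f (w₀, 0)) (hg : AnalyticAt ℂ g (w₀, 0)) (hρ : AnalyticAt ℂ ρ (w₀, 0))
    (heq : ∀ᶠ p in 𝓝 (w₀, (0 : ℂ)), g p - f p = p.2 ^ m * ρ p)
    (hgτ : ∀ᶠ v in 𝓝 (0 : ℂ), (shear g (τ v, v / (1 + Complex.exp (τ v)))).1 = τ' v) :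
    Tendsto (fun v : ℂ => (v ^ (m + 2))⁻¹ *
      (leafIntegral k' ((shear f (τ v, v / (1 + Complex.exp (τ v)))).1 + 2 * Real.pi * Complex.I,
          (shear f (τ v, v / (1 + Complex.exp (τ v)))).2)
        - leafIntegral k' (τ' v + 2 * Real.pi * Complex.I, v / (1 + Complex.exp (τ' v)))))
      (𝓝[≠] 0) (𝓝 0) := by
  have hc := h'.one_add_exp_ne
  have hexp : Complex.exp (2 * Real.pi * Complex.I) = 1 := Complex.exp_two_pi_mul_I
  have htm : Tendsto (fun v => (τ v, v)) (𝓝 0) (𝓝 (w₀, 0)) := by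
    have h2 := hτ.continuousAt.tendsto
    rw [hτ0] at h2
    exact h2.prodMk_nhds tendsto_id
  have hyt : Tendsto (fun v => ((τ v, v / (1 + Complex.exp (τ v))) : Plane)) (𝓝 0)
      (𝓝 (w₀, 0)) := (tendsto_level_coord hc).comp htm
  have hyt2 : Tendsto (fun v => v / (1 + Complex.exp (τ v))) (𝓝 0) (𝓝 0) :=
    (continuous_snd.tendsto _).comp hyt
  have hτt : Tendsto τ (𝓝 0) (𝓝 w₀) := (continuous_fst.tendsto _).comp hyt
  have hτne : ∀ᶠ v in 𝓝 (0 : ℂ), 1 + Complex.exp (τ v) ≠ 0 :=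
    htm.eventually (eventually_one_add_exp_ne hc)
  have hW : ∀ u : Plane → ℂ, AnalyticAt ℂ u (w₀, 0) →
      Tendsto (fun v => (shear u (τ v, v / (1 + Complex.exp (τ v)))).1) (𝓝 0) (𝓝 w₀) :=
    fun u hu => (continuous_fst.tendsto _).comp ((tendsto_shear hu).comp hyt)
  have hwne : ∀ᶠ w in 𝓝 w₀, 1 + Complex.exp w ≠ 0 := by
    have : ContinuousAt (fun w => 1 + Complex.exp w) w₀ := by fun_prop
    exact this.eventually_ne hc
  have hkey : ∀ u : Plane → ℂ, AnalyticAt ℂ u (w₀, 0) → ∀ᶠ v in 𝓝 (0 : ℂ),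
      leafIntegral k' ((shear u (τ v, v / (1 + Complex.exp (τ v)))).1 + 2 * Real.pi * Complex.I,
          (shear u (τ v, v / (1 + Complex.exp (τ v)))).2)
        = v * levelFunction k' ((shear u (τ v, v / (1 + Complex.exp (τ v)))).1
          + 2 * Real.pi * Complex.I, v) := fun u hu => by
    filter_upwards [hyt.eventually (eventually_shear_slit hu), (hW u hu).eventually hwne,
      hτne] with v e1 e2 e3
    have e4 := shear_snd_eq (g := u) (p := (τ v, v / (1 + Complex.exp (τ v))))
      (Complex.slitPlane_ne_zero e1.1) (Complex.slitPlane_ne_zero e1.2) e2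
    simp only [div_mul_cancel₀ _ e3] at e4
    have e5 := snd_mul_levelFunction k' ((shear u (τ v, v / (1 + Complex.exp (τ v)))).1
          + 2 * Real.pi * Complex.I, v)
    simp only [Complex.exp_add, hexp, mul_one] at e5
    rw [e5, e4]
  set κ : Plane → ℂ := fun q => Complex.log (1 + q.1) - Complex.log (1 - q.2 * q.1) with hκ
  have hκa : AnalyticAt ℂ κ (0, Complex.exp w₀) := by
    have a1 : AnalyticAt ℂ (fun q : Plane => 1 + q.1) (0, Complex.exp w₀) :=
      analyticAt_const.add analyticAt_fst
    have a2 : AnalyticAt ℂ (fun q : Plane => 1 - q.2 * q.1) (0, Complex.exp w₀) :=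
      analyticAt_const.sub (analyticAt_snd.mul analyticAt_fst)
    exact (a1.clog (by simp)).sub (a2.clog (by simp))
  have hκs : ∀ (u : Plane → ℂ) (p : Plane),
      (shear u p).1 = p.1 + κ (p.2 * u p, Complex.exp p.1) := fun u p => by
    simp only [shear, hκ]
    ring_nf
  have ta : ∀ u : Plane → ℂ, AnalyticAt ℂ u (w₀, 0) →
      Tendsto (fun v : ℂ => ((v / (1 + Complex.exp (τ v)) * u (τ v, v / (1 + Complex.exp (τ v))),
        Complex.exp (τ v)) : Plane)) (𝓝 0) (𝓝 (0, Complex.exp w₀)) := fun u hu => by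
    have h1 := hyt2.mul (hu.continuousAt.tendsto.comp hyt)
    rw [zero_mul] at h1
    exact h1.prodMk_nhds ((Complex.continuous_exp.tendsto _).comp hτt)
  have hv : Tendsto (fun v : ℂ => ((v ^ (m + 1))⁻¹ : ℂ) •
      (((v / (1 + Complex.exp (τ v)) * f (τ v, v / (1 + Complex.exp (τ v))),
        Complex.exp (τ v)) : Plane) - (v / (1 + Complex.exp (τ v)) *
          g (τ v, v / (1 + Complex.exp (τ v))), Complex.exp (τ v)))) (𝓝[≠] 0)
      (𝓝 (-(((1 + Complex.exp w₀) ^ (m + 1))⁻¹ * ρ (w₀, 0)), 0)) := by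
    have h1 : Tendsto (fun v => ((1 + Complex.exp (τ v)) ^ (m + 1))⁻¹) (𝓝 0)
        (𝓝 ((1 + Complex.exp w₀) ^ (m + 1))⁻¹) :=
      ((((Complex.continuous_exp.tendsto _).comp hτt).const_add 1).pow (m + 1)).inv₀
        (pow_ne_zero _ hc)
    have h2 := (h1.mul (hρ.continuousAt.tendsto.comp hyt)).neg
    have h3 := (h2.prodMk_nhds (tendsto_const_nhds (x := (0 : ℂ)))).mono_left
      (nhdsWithin_le_nhds (s := {0}ᶜ))
    refine h3.congr' ?_
    filter_upwards [nhdsWithin_le_nhds (hyt.eventually heq), nhdsWithin_le_nhds hτne,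
      self_mem_nhdsWithin] with v e1 e2 e3
    have hv : v ≠ 0 := e3
    refine Prod.ext ?_ (by simp)
    simp only [Function.comp_apply, Prod.mk_sub_mk, Prod.smul_mk, smul_eq_mul]
    rw [← mul_sub, ← neg_sub (g _), e1, div_pow]
    field_simp
    ring
  have hWv := tendsto_smul_sub_of_strict hκa.hasStrictFDerivAt
    ((ta f hf).mono_left nhdsWithin_le_nhds) ((ta g hg).mono_left nhdsWithin_le_nhds) hv
  set c := fderiv ℂ κ (0, Complex.exp w₀)
    (-(((1 + Complex.exp w₀) ^ (m + 1))⁻¹ * ρ (w₀, 0)), 0)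
  have hL : AnalyticAt ℂ (levelFunction k') (w₀ + 2 * Real.pi * Complex.I, 0) :=
    h'.leaf.analyticAt_levelFunction (IsStripModel.mem_ball_add w₀)
      (by rwa [Complex.exp_add, hexp, mul_one])
  have hcrit : fderiv ℂ (levelFunction k') (w₀ + 2 * Real.pi * Complex.I, 0) (1, 0) = 0 := by
    have := (h'.critical (IsStripModel.mem_ball_add w₀) hexp).self_of_nhds
    rwa [h'.tau_zero] at this
  have tb : ∀ u : Plane → ℂ, AnalyticAt ℂ u (w₀, 0) →
      Tendsto (fun v => (((shear u (τ v, v / (1 + Complex.exp (τ v)))).1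
        + 2 * Real.pi * Complex.I, v) : Plane)) (𝓝[≠] 0)
        (𝓝 (w₀ + 2 * Real.pi * Complex.I, 0)) := fun u hu =>
    (((hW u hu).add_const _).prodMk_nhds tendsto_id).mono_left nhdsWithin_le_nhds
  have hv2 : Tendsto (fun v : ℂ => ((v ^ (m + 1))⁻¹ : ℂ) •
      (((shear f (τ v, v / (1 + Complex.exp (τ v)))).1 + 2 * Real.pi * Complex.I, v) -
        ((shear g (τ v, v / (1 + Complex.exp (τ v)))).1 + 2 * Real.pi * Complex.I, v) : Plane))
      (𝓝[≠] 0) (𝓝 (c, 0)) := by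
    have h3 := hWv.prodMk_nhds (tendsto_const_nhds (x := (0 : ℂ)))
    refine h3.congr' (Eventually.of_forall fun v => ?_)
    refine Prod.ext ?_ (by simp)
    simp only [hκs, Prod.mk_sub_mk, Prod.smul_mk, smul_eq_mul]
    ring
  have hlim := tendsto_smul_sub_of_strict hL.hasStrictFDerivAt (tb f hf) (tb g hg) hv2
  rw [clm_apply_prod, hcrit, mul_zero, zero_mul, add_zero] at hlim
  refine hlim.congr' ?_
  filter_upwards [nhdsWithin_le_nhds (hkey f hf), nhdsWithin_le_nhds hgτ,
    self_mem_nhdsWithin] with v e1 e3 e4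
  have hv : v ≠ 0 := e4
  have e5 := snd_mul_levelFunction k' (τ' v + 2 * Real.pi * Complex.I, v)
  simp only [Complex.exp_add, hexp, mul_one] at e5
  rw [e1, e3, ← e5, smul_eq_mul]
  field_simp
  ring

/-- The equation satisfied by the leading coefficient of the error of an approximate conjugacy. -/
lemma exists_hasDerivAt_axis_of_error {lam w₀ : ℂ} {μ k μ' k' P D : Plane → ℂ} {θ τ τ' : ℂ → ℂ}
    (h : IsStripModel lam w₀ μ k τ) (h' : IsStripModel lam w₀ μ' k' τ') (hθ : AnalyticAt ℂ θ 0)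
    (hP : AnalyticAt ℂ P 0) {n : ℕ} (hn : n ≠ 0)
    (hD : ∀ w ∈ Metric.ball w₀ 8, AnalyticAt ℂ D (w, 0))
    (hE : ∀ w ∈ Metric.ball w₀ 8, ∀ᶠ p in 𝓝 (w, (0 : ℂ)),
      leafIntegral k' (shear (expBlowup P) p) - θ (leafIntegral k p) = p.2 ^ (n + 1) * D p) :
    ∃ q : Polynomial ℂ, q.natDegree ≤ n ∧ ∀ w ∈ Metric.ball w₀ 8,
      HasDerivAt (fun w => D (w, 0)) ((n + 1) * (1 / (1 + lam)) * D (w, 0)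
        + Complex.exp (1 / (1 + lam) * (w - w₀)) * (1 / (1 + lam)) * (1 / (1 + lam))
          * q.eval (Complex.exp w)) w := by
  obtain ⟨q, hq, hqr⟩ := exists_homogeneous_component
    (analyticAt_conjDefect h.mu_analytic h'.mu_analytic hP) n
  refine ⟨q, hq, fun w hw => ?_⟩
  have hPa := analyticAt_expBlowup hP w
  have hts := tendsto_shear hPa
  have hsa := analyticAt_shear_axis hPa
  set C : Plane → ℂ := fun p => fderiv ℂ (leafIntegral k') (shear (expBlowup P) p) (0, 1)
    * leafSlope μ' (shear (expBlowup P) p) * leafSlope μ p / (1 + p.2 * expBlowup P p) with hC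
  have hMa := analyticAt_leafSlope h.mu_analytic h.one_add_mu_ne w
  have hcomp : ∀ {F : Plane → ℂ}, AnalyticAt ℂ F (w, 0) →
      AnalyticAt ℂ (fun p => F (shear (expBlowup P) p)) (w, 0) := fun {F} hF =>
    AnalyticAt.fun_comp (g := F) (f := shear (expBlowup P)) (by rwa [shear_axis]) hsa
  have hCa : AnalyticAt ℂ C (w, 0) :=
    (((hcomp (analyticAt_fderiv_apply (analyticAt_leafIntegral (h'.leaf.analytic w hw)) _)).mul
      (hcomp (analyticAt_leafSlope h'.mu_analytic h'.one_add_mu_ne w))).mul hMa).div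
      (analyticAt_shear_factors hPa).1 (by simp)
  have hCw : C (w, 0) = Complex.exp (1 / (1 + lam) * (w - w₀)) * (1 / (1 + lam))
      * (1 / (1 + lam)) := by
    simp only [hC, shear_axis, leafSlope_axis, h.mu_zero, h'.mu_zero]
    rw [fderiv_leafIntegral (h'.leaf.analytic w hw),
      h'.leaf.apply_axis (by norm_num) hw, h'.mu_zero]
    simp
  have hCne : C (w, 0) ≠ 0 := by
    rw [hCw]
    have h2 := one_div_ne_zero h.one_add_ne
    exact mul_ne_zero (mul_ne_zero (Complex.exp_ne_zero _) h2) h2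
  set Rf : Plane → ℂ := fun p => (fderiv ℂ D p (1, 0) - p.2 * leafSlope μ p * fderiv ℂ D p (0, 1)
    - (n + 1) * leafSlope μ p * D p) / C p with hRf
  have hRa : AnalyticAt ℂ Rf (w, 0) :=
    (((analyticAt_fderiv_apply (hD w hw) _).sub ((analyticAt_snd.mul hMa).mul
      (analyticAt_fderiv_apply (hD w hw) _))).sub
      ((analyticAt_const.mul hMa).mul (hD w hw))).div hCa hCne
  have hHt : Tendsto (leafIntegral k) (𝓝 (w, 0)) (𝓝 0) := by
    have := (analyticAt_leafIntegral (h.leaf.analytic w hw)).continuousAt.tendsto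
    simpa [leafIntegral] using this
  -- Apply the leaf derivation ∂_w - y M ∂_y, with M = `leafSlope μ`, to the error y^{n+1} D. It
  -- kills θ ∘ H and sends the other term to y C times the defect; the right-hand side becomes
  -- y^{n+1} (D_w - y M D_y - (n + 1) M D).
  have hmain : ∀ᶠ p in 𝓝 (w, (0 : ℂ)), p.2 ≠ 0 →
      conjDefect μ μ' P (Complex.exp p.1 * p.2, p.2) = p.2 ^ n * Rf p := by
    filter_upwards [(hE w hw).eventually_nhds, (hD w hw).eventually_analyticAt,
      fderiv_leafIntegral_shear_expBlowup h.mu_analytic h.one_add_mu_ne h'.mu_analytic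
        h'.one_add_mu_ne h'.leaf hw hP, h.leaf.fderiv_eq hw,
      (h.leaf.analytic w hw).eventually_analyticAt, hHt.eventually hθ.eventually_analyticAt,
      hCa.continuousAt.eventually_ne hCne, eventually_shear_slit hPa, hPa.eventually_analyticAt,
      hts.eventually (h'.leaf.analytic w hw).eventually_analyticAt]
      with p e1 e2 e3 e4 e5 e6 e7 e8 e9 e10 hp
    have a1 := analyticAt_leafIntegral e5
    have a2 : AnalyticAt ℂ (fun p => θ (leafIntegral k p)) p :=
      AnalyticAt.fun_comp (g := θ) (f := leafIntegral k) e6 a1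
    have a3 : AnalyticAt ℂ (fun p => leafIntegral k' (shear (expBlowup P) p)) p :=
      AnalyticAt.fun_comp (g := leafIntegral k') (f := shear (expBlowup P))
        (analyticAt_leafIntegral e10) (analyticAt_shear e9 e8.1 e8.2)
    have d2 : fderiv ℂ (fun p => θ (leafIntegral k p)) p (1, -(p.2 * leafSlope μ p)) = 0 := by
      have h1 := (e6.differentiableAt.hasDerivAt.comp_hasFDerivAt p
        a1.differentiableAt.hasFDerivAt).fderiv
      rw [show (fun p => θ (leafIntegral k p)) = θ ∘ leafIntegral k from rfl, h1]
      rw [_root_.smul_apply, clm_apply_prod (fderiv ℂ (leafIntegral k) p), e4]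
      simp only [smul_eq_mul]
      ring
    have d3 : fderiv ℂ (fun p => leafIntegral k' (shear (expBlowup P) p) - θ (leafIntegral k p)) p
        = fderiv ℂ (fun p : Plane => p.2 ^ (n + 1) * D p) p := EventuallyEq.fderiv_eq e1
    rw [show (fun p => leafIntegral k' (shear (expBlowup P) p) - θ (leafIntegral k p))
      = (fun p => leafIntegral k' (shear (expBlowup P) p)) - fun p => θ (leafIntegral k p) from rfl,
      fderiv_sub a3.differentiableAt a2.differentiableAt] at d3
    have d4 := congrArg (fun T : Plane →L[ℂ] ℂ => p.2 * T (1, -(p.2 * leafSlope μ p))) d3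
    simp only [_root_.sub_apply] at d4
    rw [d2, e3, fderiv_pow_snd_mul e2, clm_apply_prod (fderiv ℂ D p)] at d4
    have d5 : p.2 * p.2 * (C p * conjDefect μ μ' P (Complex.exp p.1 * p.2, p.2))
        = p.2 * p.2 * (p.2 ^ n * (fderiv ℂ D p (1, 0) - p.2 * leafSlope μ p * fderiv ℂ D p (0, 1)
    - (n + 1) * leafSlope μ p * D p)) := by
      push_cast at d4
      linear_combination d4
    have d6 := mul_left_cancel₀ (mul_ne_zero hp hp) d5
    simp only [hRf]
    field_simp
    linear_combination d6
  -- On y = 0 this is the homogeneous component of degree n of the defect, evaluated at the slope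
  -- e^w. The point y = 0 is checked apart, because the identity was obtained by division by y; it
  -- holds there since n ≠ 0 and the defect vanishes at the origin.
  have hR0 := hqr (Complex.exp w) (fun y => Rf (w, y)) (analyticAt_comp_mk_right hRa) (by
    filter_upwards [(tendsto_mk_right w 0).eventually hmain] with y hy
    rcases eq_or_ne y 0 with rfl | hy0
    · rw [mul_zero, zero_pow hn, zero_mul, Prod.mk_zero_zero,
        conjDefect_zero (h.mu_zero.trans h'.mu_zero.symm)]
    · exact hy hy0)
  refine (hasDerivAt_mk_left (hD w hw)).congr_deriv ?_
  simp only [hRf, leafSlope_axis, h.mu_zero, zero_mul, sub_zero] at hR0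
  rw [← hR0, ← hCw]
  field_simp
  ring

/-- The homogeneous components of the conjugacy are polynomials. -/
theorem IsMatched.exists_polynomial_component {lam w₀ : ℂ} {μ k μ' k' g : Plane → ℂ}
    {τ τ' θ : ℂ → ℂ}
    (hm : IsMatched w₀ k k' τ τ' θ)
    (h : IsStripModel lam w₀ μ k τ) (h' : IsStripModel lam w₀ μ' k' τ')
    (hratio : ∀ r : ℚ, r < 0 → lam ≠ (r : ℂ)) (hg : AnalyticAt ℂ g (w₀, 0))
    (hgθ : ∀ᶠ p in 𝓝 (w₀, (0 : ℂ)), leafIntegral k' (shear g p) = θ (leafIntegral k p))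
    (hgτ : ∀ᶠ v in 𝓝 (0 : ℂ), (shear g (τ v, v / (1 + Complex.exp (τ v)))).1 = τ' v)
    {m : ℕ} {P ρ : Plane → ℂ} (hP : AnalyticAt ℂ P 0) (hρ : AnalyticAt ℂ ρ (w₀, 0))
    (heq : ∀ᶠ p in 𝓝 (w₀, (0 : ℂ)), g p - expBlowup P p = p.2 ^ m * ρ p) :
    ∃ q : Polynomial ℂ, q.natDegree ≤ m ∧ ∀ᶠ w in 𝓝 w₀, ρ (w, 0) = q.eval (Complex.exp w) := by
  have hR : (0 : ℝ) < 8 := by norm_num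
  set σ : ℂ := 1 / (1 + lam) with hσdef
  have hσ : σ * (1 + lam) = 1 := one_div_mul_cancel h.one_add_ne
  have hσ0 : σ ≠ 0 := left_ne_zero_of_mul_eq_one hσ
  -- Unlike g, which exists only near w₀, this error is defined along the whole strip, up to w₀ +
  -- 2πi, since P comes from the plane.
  set E : Plane → ℂ := fun p => leafIntegral k' (shear (expBlowup P) p) - θ (leafIntegral k p)
    with hEdef
  have hEa : ∀ w ∈ Metric.ball w₀ 8, AnalyticAt ℂ E (w, 0) := fun w hw => by
    refine AnalyticAt.sub (AnalyticAt.fun_comp (g := leafIntegral k') (f := shear (expBlowup P))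
      ?_ (analyticAt_shear_axis (analyticAt_expBlowup hP w)))
      (AnalyticAt.fun_comp (g := θ) (f := leafIntegral k) ?_
        (analyticAt_leafIntegral (h.leaf.analytic w hw)))
    · rw [shear_axis]
      exact analyticAt_leafIntegral (h'.leaf.analytic w hw)
    · simpa [leafIntegral] using hm.analytic
  have hlim : ∀ᶠ w in 𝓝 w₀, Tendsto (fun y : ℂ => (y ^ (m + 2))⁻¹ * E (w, y)) (𝓝[≠] 0)
      (𝓝 (-(Complex.exp (σ * (w - w₀)) * (σ * (1 + Complex.exp w) - Complex.exp w)
        * ρ (w, 0)))) := by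
    have t := tendsto_mk_left w₀ 0
    filter_upwards [t.eventually hg.eventually_analyticAt, t.eventually hρ.eventually_analyticAt,
      t.eventually heq.eventually_nhds, t.eventually hgθ.eventually_nhds,
      Metric.ball_mem_nhds w₀ hR] with w e1 e2 e3 e4 e5
    have h1 := tendsto_leafIntegral_shear_sub hR h'.leaf e5 (analyticAt_expBlowup hP w) e1 e2 e3
    rw [h'.mu_zero] at h1
    refine h1.congr' ?_
    filter_upwards [nhdsWithin_le_nhds ((tendsto_mk_right w 0).eventually e4)] with y hy
    rw [hy]
  -- Divisibility by y^{m+2} is known near w₀ by comparison with g; the identity theorem then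
  -- extends it along the disc.
  obtain ⟨D₀, hD₀, hED₀⟩ := exists_eq_pow_snd_mul_of_tendsto (m + 2) (hEa w₀ h.mem_ball)
    (hlim.mono fun w hw => ⟨_, hw⟩)
  obtain ⟨D, hD, hED⟩ := exists_eq_pow_snd_mul_of_disc hR hEa (m + 2) hD₀ hED₀
  obtain ⟨q, hq, hqD⟩ := exists_hasDerivAt_axis_of_error h h' hm.analytic hP (n := m + 1)
    (Nat.succ_ne_zero m) hD hED
  have hval : ∀ᶠ w in 𝓝 w₀, D (w, 0) = -(Complex.exp (σ * (w - w₀))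
      * (σ * (1 + Complex.exp w) - Complex.exp w) * ρ (w, 0)) := by
    filter_upwards [hlim, Metric.ball_mem_nhds w₀ hR] with w e1 e2
    refine tendsto_nhds_unique ?_ e1
    have c1 := (analyticAt_comp_mk_right (hD w e2)).continuousAt.tendsto.mono_left
      (nhdsWithin_le_nhds (s := {0}ᶜ))
    refine c1.congr' ?_
    filter_upwards [nhdsWithin_le_nhds ((tendsto_mk_right w 0).eventually (hED w e2)),
      self_mem_nhdsWithin] with y e3 e4
    have hy : y ≠ 0 := e4
    rw [e3]
    field_simp
  have hlamσ : ∀ t : ℂ, σ * (1 + t) - t = σ * (1 - lam * t) := fun t => by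
    linear_combination t * hσ
  -- The factor 1 - lam e^w vanishes in the direction of the tangent curve.
  have hD0 : D (w₀, 0) = 0 := by
    rw [hval.self_of_nhds, hlamσ, mul_comm lam, h.exp_base]
    simp
  have hexp : Complex.exp (2 * Real.pi * Complex.I) = 1 := Complex.exp_two_pi_mul_I
  -- Evaluate the error on the translate of the tangent curve by 2πi. The map of P commutes with
  -- this translation, and `hm.turn` replaces θ ∘ H by H' on the target curve; the difference is
  -- then of order higher than m + 2.
  have hD1 : D (w₀ + 2 * Real.pi * Complex.I, 0) = 0 := by
    have h1 := tendsto_leafIntegral_shear_turn h' h.tau_analytic h.tau_zero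
      (analyticAt_expBlowup hP w₀) hg hρ heq hgτ
    have hc := h.one_add_exp_ne
    have hyt : Tendsto (fun v => ((τ v, v / (1 + Complex.exp (τ v))) : Plane)) (𝓝 0)
      (𝓝 (w₀, 0)) := (tendsto_level_coord hc).comp (tendsto_mk_tau h)
    have hyt' : Tendsto (fun v => ((τ v + 2 * Real.pi * Complex.I,
        v / (1 + Complex.exp (τ v))) : Plane)) (𝓝 0) (𝓝 (w₀ + 2 * Real.pi * Complex.I, 0)) :=
      (((continuous_fst.tendsto _).comp hyt).add_const _).prodMk_nhds
        ((continuous_snd.tendsto _).comp hyt)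
    have hτt : Tendsto τ (𝓝 0) (𝓝 w₀) := (continuous_fst.tendsto _).comp hyt
    have hτne : ∀ᶠ v in 𝓝 (0 : ℂ), 1 + Complex.exp (τ v) ≠ 0 :=
      (tendsto_mk_tau h).eventually (eventually_one_add_exp_ne hc)
    have hball := IsStripModel.mem_ball_add w₀
    have hinv : Tendsto (fun v => ((1 + Complex.exp (τ v)) ^ (m + 2))⁻¹) (𝓝 0)
        (𝓝 ((1 + Complex.exp w₀) ^ (m + 2))⁻¹) :=
      ((((Complex.continuous_exp.tendsto _).comp hτt).const_add 1).pow (m + 2)).inv₀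
        (pow_ne_zero _ hc)
    have h2 := (hinv.mul ((hD _ hball).continuousAt.tendsto.comp hyt')).mono_left
      (nhdsWithin_le_nhds (s := {0}ᶜ))
    have h3 := tendsto_nhds_unique (h2.congr' ?_) h1
    · exact (mul_eq_zero.1 h3).resolve_left (inv_ne_zero (pow_ne_zero _ hc))
    · filter_upwards [nhdsWithin_le_nhds (hyt'.eventually (hED _ hball)),
        nhdsWithin_le_nhds hτne, nhdsWithin_le_nhds hm.turn, nhdsWithin_le_nhds hm.turn,
        self_mem_nhdsWithin] with v e1 e2 e3 e4 e5
      have hv : v ≠ 0 := e5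
      have e6 : shear (expBlowup P) (τ v + 2 * Real.pi * Complex.I, v / (1 + Complex.exp (τ v)))
          = ((shear (expBlowup P) (τ v, v / (1 + Complex.exp (τ v)))).1
              + 2 * Real.pi * Complex.I,
            (shear (expBlowup P) (τ v, v / (1 + Complex.exp (τ v)))).2) := by
        simp only [shear, expBlowup, Complex.exp_add, hexp, mul_one]
        refine Prod.ext ?_ rfl
        simp only
        ring
      simp only [hEdef] at e1
      rw [e6] at e1
      rw [e3, e1]
      simp only [Function.comp_apply, div_pow]
      field_simp
  -- Removing the exponential common to D and to the source term changes the coefficient m + 2 of σ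
  -- into m + 1, the degree bound of the source term.
  set f : ℂ → ℂ := fun w => Complex.exp (-(σ * (w - w₀))) * D (w, 0) with hf
  have hfd : ∀ w ∈ Metric.ball w₀ 8, HasDerivAt f ((m + 1 : ℕ) * σ * f w
      + (Polynomial.C (σ * σ) * q).eval (Complex.exp w)) w := fun w hw => by
    have d1 : HasDerivAt (fun w => Complex.exp (-(σ * (w - w₀)))) _ w :=
      (((hasDerivAt_id' w).sub_const w₀).const_mul σ).neg.cexp
    refine (d1.fun_mul (hqD w hw)).congr_deriv ?_
    have he : Complex.exp (-(σ * (w - w₀))) * Complex.exp (σ * (w - w₀)) = 1 := by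
      rw [← Complex.exp_add, neg_add_cancel, Complex.exp_zero]
    simp only [hf, Polynomial.eval_mul, Polynomial.eval_C]
    push_cast
    linear_combination (σ * σ * q.eval (Complex.exp w)) * he
  obtain ⟨p, hp, hpf⟩ := exists_polynomial_of_ode (Nat.succ_ne_zero m) hσ hratio
    (q := Polynomial.C (σ * σ) * q) ((Polynomial.natDegree_C_mul_le _ _).trans hq) hfd
    (by simp only [hf, hD0, mul_zero]) (by simp only [hf, hD1, mul_zero])
  -- The vanishing of D at w₀ is a root at the slope 1/lam. Dividing by it cancels the factor 1 -
  -- lam e^w and lowers the degree from m + 1 to m, the bound needed for the descent.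
  have hp0 : p.eval (1 / lam) = 0 := by
    rw [← h.exp_eq, ← hpf w₀ h.mem_ball]
    simp only [hf, hD0, mul_zero]
  obtain ⟨p₂, hp₂⟩ := Polynomial.dvd_iff_isRoot.2 hp0
  have hdeg : p₂.natDegree ≤ m := by
    rcases eq_or_ne p₂ 0 with rfl | hne
    · simp
    · have h1 := hp
      rw [hp₂, Polynomial.natDegree_mul (Polynomial.X_sub_C_ne_zero _) hne,
        Polynomial.natDegree_X_sub_C] at h1
      omega
  have hlam := h.lam_ne
  refine ⟨Polynomial.C (1 / (σ * lam)) * p₂, (Polynomial.natDegree_C_mul_le _ _).trans hdeg, ?_⟩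
  have hne : ∀ᶠ w in 𝓝[≠] w₀, ρ (w, 0)
      = (Polynomial.C (1 / (σ * lam)) * p₂).eval (Complex.exp w) := by
    have hinj : ∀ᶠ w in 𝓝 w₀, ‖w - w₀‖ < 1 := by
      filter_upwards [Metric.ball_mem_nhds w₀ one_pos] with w hw
      simpa [dist_eq_norm] using hw
    filter_upwards [nhdsWithin_le_nhds hval, nhdsWithin_le_nhds (Metric.ball_mem_nhds w₀ hR),
      nhdsWithin_le_nhds hinj, self_mem_nhdsWithin] with w e1 e2 e3 e4
    have e5 : Complex.exp w - 1 / lam ≠ 0 := fun hc => e4 (by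
      refine eq_of_exp_eq ?_ e3
      rw [h.exp_eq]
      exact sub_eq_zero.1 hc)
    have e6 := hpf w e2
    have he : Complex.exp (-(σ * (w - w₀))) * Complex.exp (σ * (w - w₀)) = 1 := by
      rw [← Complex.exp_add, neg_add_cancel, Complex.exp_zero]
    simp only [hf, e1, hp₂, Polynomial.eval_mul, Polynomial.eval_sub, Polynomial.eval_X,
      Polynomial.eval_C, hlamσ] at e6
    rw [Polynomial.eval_mul, Polynomial.eval_C]
    refine mul_left_cancel₀ e5 ?_
    have e7 : (Complex.exp w - 1 / lam) * Polynomial.eval (Complex.exp w) p₂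
        = -(σ * (1 - lam * Complex.exp w) * ρ (w, 0)) := by
      linear_combination -e6 - (σ * (1 - lam * Complex.exp w) * ρ (w, 0)) * he
    have e8 : (Complex.exp w - 1 / lam) * (1 / (σ * lam) * Polynomial.eval (Complex.exp w) p₂)
        = 1 / (σ * lam) * -(σ * (1 - lam * Complex.exp w) * ρ (w, 0)) := by
      rw [← e7]
      ring
    rw [e8]
    field_simp
    ring
  have hcont : ρ (w₀, 0) = (Polynomial.C (1 / (σ * lam)) * p₂).eval (Complex.exp w₀) := by
    have c1 := (analyticAt_comp_mk_left hρ).continuousAt.tendsto.mono_left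
      (nhdsWithin_le_nhds (s := {w₀}ᶜ))
    have c2 : ContinuousAt (fun w =>
        (Polynomial.C (1 / (σ * lam)) * p₂).eval (Complex.exp w)) w₀ :=
      (hasDerivAt_eval_exp _ w₀).continuousAt
    exact tendsto_nhds_unique (c1.congr' hne)
      (c2.tendsto.mono_left nhdsWithin_le_nhds)
  rw [← nhdsNE_sup_pure, eventually_sup]
  exact ⟨hne, hcont⟩

/-! ### The conjugacy of the normal forms -/

/-- The exponential has the local inverse w₀ + log(t / e^{w₀}), so statements near (w₀, 0) pass to
the blow-up coordinate t = e^w. -/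
lemma eventually_of_exp {w₀ : ℂ} {Q : Plane → Prop}
    (h : ∀ᶠ p in 𝓝 (w₀, (0 : ℂ)), Q (Complex.exp p.1, p.2)) :
    ∀ᶠ p in 𝓝 (Complex.exp w₀, (0 : ℂ)), Q p := by
  have hE := Complex.exp_ne_zero w₀
  have hc : ContinuousAt (fun p : Plane => ((w₀ + Complex.log (p.1 / Complex.exp w₀), p.2) : Plane))
      (Complex.exp w₀, 0) := by
    have h1 : ContinuousAt (fun p : Plane => p.1 / Complex.exp w₀) (Complex.exp w₀, 0) := by
      fun_prop
    exact (continuousAt_const.add (h1.clog (by simp [hE]))).prodMk continuousAt_snd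
  have ht := hc.tendsto
  simp only [div_self hE, Complex.log_one, add_zero] at ht
  have hne : ∀ᶠ p : Plane in 𝓝 (Complex.exp w₀, (0 : ℂ)), p.1 ≠ 0 :=
    continuousAt_fst.eventually_ne hE
  filter_upwards [ht.eventually h, hne] with p h1 h2
  simp only [Complex.exp_add, Complex.exp_log (div_ne_zero h2 hE), mul_div_cancel₀ _ hE] at h1
  exact h1

lemma tendsto_exp_mk (w₀ : ℂ) :
    Tendsto (fun p : Plane => (Complex.exp p.1, p.2)) (𝓝 (w₀, 0)) (𝓝 (Complex.exp w₀, 0)) := by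
  have : ContinuousAt (fun p : Plane => (Complex.exp p.1, p.2)) (w₀, 0) := by fun_prop
  exact this.tendsto

lemma IsLeafExponent.fderiv_comp_leafIntegral {μ k : Plane → ℂ} {w₀ w : ℂ} {R : ℝ}
    (h : IsLeafExponent μ w₀ R k) (hw : w ∈ Metric.ball w₀ R) {θ : ℂ → ℂ}
    (hθ : AnalyticAt ℂ θ 0) : ∀ᶠ p in 𝓝 (w, (0 : ℂ)), AnalyticAt ℂ (fun p => θ (leafIntegral k p)) p ∧
      fderiv ℂ (fun p => θ (leafIntegral k p)) p (1, -(p.2 * leafSlope μ p)) = 0 := by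
  have hHt : Tendsto (leafIntegral k) (𝓝 (w, 0)) (𝓝 0) := by
    have := (analyticAt_leafIntegral (h.analytic w hw)).continuousAt.tendsto
    simpa [leafIntegral] using this
  filter_upwards [h.fderiv_eq hw, (h.analytic w hw).eventually_analyticAt,
    hHt.eventually hθ.eventually_analyticAt] with p e4 e5 e6
  have a1 := analyticAt_leafIntegral e5
  refine ⟨AnalyticAt.fun_comp (g := θ) (f := leafIntegral k) e6 a1, ?_⟩
  have h1 := (e6.differentiableAt.hasDerivAt.comp_hasFDerivAt p
    a1.differentiableAt.hasFDerivAt).fderiv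
  rw [show (fun p => θ (leafIntegral k p)) = θ ∘ leafIntegral k from rfl, h1]
  rw [_root_.smul_apply, clm_apply_prod (fderiv ℂ (leafIntegral k) p), e4]
  simp only [smul_eq_mul]
  ring

/-- A function constant on the horizontal lines. -/
lemma eventually_eq_of_fderiv_fst_eq_zero {f : Plane → ℂ} {c d : ℂ} (hf : AnalyticAt ℂ f (c, d))
    (h : ∀ᶠ p in 𝓝 (c, d), fderiv ℂ f p (1, 0) = 0) : ∀ᶠ p in 𝓝 (c, d), f p = f (c, p.2) := by
  obtain ⟨ε, hε, hb⟩ := Metric.eventually_nhds_iff_ball.1 (h.and hf.eventually_analyticAt)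
  filter_upwards [Metric.ball_mem_nhds (c, d) hε] with p hp
  rw [← ball_prod_same] at hp hb
  obtain ⟨hp1, hp2⟩ := hp
  have hd : ∀ w ∈ Metric.ball c ε, HasDerivAt (fun w => f (w, p.2)) 0 w := fun w hw => by
    obtain ⟨e1, e2⟩ := hb (w, p.2) ⟨hw, hp2⟩
    have := hasDerivAt_mk_left e2
    rwa [e1] at this
  exact Metric.isOpen_ball.is_const_of_deriv_eq_zero (convex_ball c ε).isPreconnected
    (fun w hw => (hd w hw).differentiableAt.differentiableWithinAt)
    (fun w hw => (hd w hw).deriv) hp1 (Metric.mem_ball_self hε)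

/-- The first integral is a parameter on the tangent curve. -/
lemma IsStripModel.isDiffeoGerm_leafIntegral {lam w₀ : ℂ} {μ k : Plane → ℂ} {τ : ℂ → ℂ}
    (h : IsStripModel lam w₀ μ k τ) {w : ℂ} (hw : w₀ + w ∈ Metric.ball w₀ 8)
    (hexp : Complex.exp w = 1) : IsDiffeoGerm univ univ
      (fun v => leafIntegral k (τ v + w, v / (1 + Complex.exp (τ v)))) := by
  have he : (fun v => leafIntegral k (τ v + w, v / (1 + Complex.exp (τ v))))
      = fun v => v * levelFunction k (τ v + w, v) := funext fun v => by
    have := snd_mul_levelFunction k (τ v + w, v)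
    simp only [Complex.exp_add, hexp, mul_one] at this
    exact this.symm
  rw [he]
  have h1 : 1 + Complex.exp (w₀ + w) ≠ 0 := by
    rw [Complex.exp_add, hexp, mul_one]
    exact h.one_add_exp_ne
  have hL : AnalyticAt ℂ (fun v => levelFunction k (τ v + w, v)) 0 :=
    AnalyticAt.fun_comp (g := levelFunction k) (f := fun v => (τ v + w, v))
      (by simpa [h.tau_zero] using h.leaf.analyticAt_levelFunction hw h1)
      ((h.tau_analytic.add analyticAt_const).prod analyticAt_id)
  refine isDiffeoGerm_of_deriv_ne_zero (analyticAt_id.mul hL) (by simp) ?_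
  have d := ((hasDerivAt_id' (0 : ℂ)).fun_mul hL.differentiableAt.hasDerivAt).deriv
  rw [d, zero_mul, add_zero, one_mul, h.tau_zero, h.leaf.levelFunction_axis (by norm_num) hw]
  exact div_ne_zero (Complex.exp_ne_zero _) h1

/-- A first integral which vanishes on the tangent curve is zero. -/
lemma IsStripModel.eq_zero_of_tangentCurve {lam w₀ : ℂ} {μ k J : Plane → ℂ} {τ : ℂ → ℂ}
    (h : IsStripModel lam w₀ μ k τ) (hJ : AnalyticAt ℂ J (w₀, 0))
    (hL : ∀ᶠ p in 𝓝 (w₀, (0 : ℂ)), fderiv ℂ J p (1, -(p.2 * leafSlope μ p)) = 0)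
    (hT : ∀ᶠ v in 𝓝 (0 : ℂ), J (τ v, v / (1 + Complex.exp (τ v))) = 0) :
    ∀ᶠ p in 𝓝 (w₀, (0 : ℂ)), J p = 0 := by
  set H := leafIntegral k with hH
  have hHa : AnalyticAt ℂ H (w₀, 0) := analyticAt_leafIntegral (h.leaf.analytic _ h.mem_ball)
  have hH0 : H (w₀, 0) = 0 := by simp [hH, leafIntegral]
  have hHy : fderiv ℂ H (w₀, 0) (0, 1) ≠ 0 := by
    rw [hH, fderiv_leafIntegral (h.leaf.analytic _ h.mem_ball)]
    simp
  -- In the coordinates (w, H) the leaves are horizontal and J depends on H alone. Since H is a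
  -- parameter on the tangent curve, vanishing on that curve is enough.
  set K : Plane → Plane := fun p => (p.1, H p) with hK
  have hKa : AnalyticAt ℂ K (w₀, 0) := analyticAt_fst.prod hHa
  have hKd : ∀ {p : Plane}, AnalyticAt ℂ H p → ∀ v, fderiv ℂ K p v = (v.1, fderiv ℂ H p v) :=
    fun {p} hp v => by
      have d : HasFDerivAt K _ p := hasFDerivAt_fst.prodMk hp.differentiableAt.hasFDerivAt
      rw [d.fderiv]
      rfl
  obtain ⟨Λ, hΛ, hΛ0, hΛ1, hΛ2⟩ := exists_analytic_inverse hKa fun v hv => by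
    rw [hKd hHa, Prod.mk_eq_zero, clm_apply_prod (fderiv ℂ H _)] at hv
    obtain ⟨e1, e2⟩ := hv
    rw [e1, zero_mul, zero_add] at e2
    exact Prod.ext e1 ((mul_eq_zero.1 e2).resolve_right hHy)
  have hK0 : K (w₀, 0) = (w₀, 0) := by simp [hK, hH0]
  rw [hK0] at hΛ hΛ0 hΛ2
  have hΛt : Tendsto Λ (𝓝 (w₀, 0)) (𝓝 (w₀, 0)) := by
    have := hΛ.continuousAt.tendsto
    rwa [hΛ0] at this
  have hKt : Tendsto K (𝓝 (w₀, 0)) (𝓝 (w₀, 0)) := by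
    have := hKa.continuousAt.tendsto
    rwa [hK0] at this
  have hJΛ : AnalyticAt ℂ (fun p => J (Λ p)) (w₀, 0) :=
    AnalyticAt.fun_comp (g := J) (f := Λ) (by rwa [hΛ0]) hΛ
  have hconst := eventually_eq_of_fderiv_fst_eq_zero hJΛ (by
    filter_upwards [hΛt.eventually hL, hΛ.eventually_analyticAt, hΛ2.eventually_nhds,
      hΛt.eventually hHa.eventually_analyticAt, hΛt.eventually hJ.eventually_analyticAt,
      hΛt.eventually (h.leaf.fderiv_eq h.mem_ball), hΛt.eventually
        ((analyticAt_fderiv_apply hHa (0, 1)).continuousAt.eventually_ne hHy)]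
      with p e1 e2 e3 e4 e5 e6 e7
    have h1 : fderiv ℂ K (Λ p) (fderiv ℂ Λ p (1, 0)) = (1, 0) := by
      have hKΛ : AnalyticAt ℂ K (Λ p) := analyticAt_fst.prod e4
      rw [← fderiv_comp_apply hKΛ e2]
      have : (fun q => K (Λ q)) =ᶠ[𝓝 p] fun q => q := e3
      rw [EventuallyEq.fderiv_eq this]
      simp
    rw [hKd e4, Prod.mk.injEq, clm_apply_prod (fderiv ℂ H _), e6] at h1
    obtain ⟨h2, h3⟩ := h1
    rw [fderiv_comp_apply e5 e2]
    have h4 : fderiv ℂ Λ p (1, 0) = (1, -((Λ p).2 * leafSlope μ (Λ p))) := by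
      refine Prod.ext h2 ?_
      refine mul_right_cancel₀ e7 ?_
      rw [h2] at h3
      simp only
      linear_combination h3
    rw [h4, e1])
  obtain ⟨b, hb, -, hb2⟩ := (h.isDiffeoGerm_leafIntegral (w := 0)
    (by simp) Complex.exp_zero).exists_symm
  simp only [add_zero] at hb2
  have hbt := analyticAt_tendsto_zero hb.1 hb.2.1
  have hyt : Tendsto (fun v => ((τ v, v / (1 + Complex.exp (τ v))) : Plane)) (𝓝 0)
    (𝓝 (w₀, 0)) := (tendsto_level_coord h.one_add_exp_ne).comp (tendsto_mk_tau h)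
  have hzero : ∀ᶠ s in 𝓝 (0 : ℂ), J (Λ (w₀, s)) = 0 := by
    filter_upwards [hb2, hbt.eventually (hyt.eventually (hKt.eventually hconst)),
      hbt.eventually (hyt.eventually hΛ1), hbt.eventually hT] with s e1 e2 e3 e4
    rw [e3, e4] at e2
    simp only [hK, hH, e1] at e2
    exact e2.symm
  filter_upwards [hKt.eventually hconst, hΛ1,
    ((continuous_snd.tendsto _).comp hKt).eventually hzero] with p e1 e2 e3
  rw [e2] at e1
  exact e1.trans e3

/-- With an invertible factor C, the derivative along the leaves vanishes off y = 0 exactly when the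
defect does. One direction serves for existence, the other for uniqueness. -/
lemma exists_shear_factor_ne_zero {lam w₀ : ℂ} {μ k μ' k' P : Plane → ℂ} {τ τ' : ℂ → ℂ}
    (h : IsStripModel lam w₀ μ k τ) (h' : IsStripModel lam w₀ μ' k' τ') (hP : AnalyticAt ℂ P 0) :
    ∃ C : Plane → ℂ, (∀ᶠ p in 𝓝 (w₀, (0 : ℂ)), C p ≠ 0) ∧ ∀ᶠ p in 𝓝 (w₀, (0 : ℂ)),
      fderiv ℂ (fun p => leafIntegral k' (shear (expBlowup P) p)) p (1, -(p.2 * leafSlope μ p))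
        = p.2 * C p * conjDefect μ μ' P (Complex.exp p.1 * p.2, p.2) := by
  have hPa := analyticAt_expBlowup hP w₀
  refine ⟨_, ?_, fderiv_leafIntegral_shear_expBlowup h.mu_analytic h.one_add_mu_ne h'.mu_analytic
        h'.one_add_mu_ne h'.leaf h.mem_ball hP⟩
  have hk' := h'.leaf.analytic _ h.mem_ball
  have hM := analyticAt_leafSlope h.mu_analytic h.one_add_mu_ne w₀
  have hM' := analyticAt_leafSlope h'.mu_analytic h'.one_add_mu_ne w₀
  have hts := tendsto_shear hPa
  have n1 : fderiv ℂ (leafIntegral k') (w₀, 0) (0, 1) ≠ 0 := by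
    rw [fderiv_leafIntegral hk']
    simp
  filter_upwards [hts.eventually ((analyticAt_fderiv_apply (analyticAt_leafIntegral hk')
    (0, 1)).continuousAt.eventually_ne n1),
    hts.eventually (hM'.continuousAt.eventually_ne (by
      rw [leafSlope_axis]; exact one_div_ne_zero h'.one_add_mu_ne)),
    hM.continuousAt.eventually_ne (by
      rw [leafSlope_axis]; exact one_div_ne_zero h.one_add_mu_ne),
    eventually_shear_slit hPa] with p e1 e2 e3 e4
  exact div_ne_zero (mul_ne_zero (mul_ne_zero e1 e2) e3) (Complex.slitPlane_ne_zero e4.1)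

/-- Existence and uniqueness of the conjugacy of two normal forms with matching holonomies. -/
theorem IsMatched.exists_conjugation {lam w₀ : ℂ} {μ k μ' k' : Plane → ℂ} {τ τ' θ : ℂ → ℂ}
    (hm : IsMatched w₀ k k' τ τ' θ)
    (h : IsStripModel lam w₀ μ k τ) (h' : IsStripModel lam w₀ μ' k' τ')
    (hratio : ∀ r : ℚ, r < 0 → lam ≠ (r : ℂ)) :
    ∃ G : Plane → ℂ, AnalyticAt ℂ G 0 ∧ (∀ᶠ p in 𝓝 (0 : Plane), conjDefect μ μ' G p = 0) ∧
      (∀ᶠ v in 𝓝 (0 : ℂ), (shear (expBlowup G) (τ v, v / (1 + Complex.exp (τ v)))).1 = τ' v) ∧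
      ∀ F : Plane → ℂ, AnalyticAt ℂ F 0 → (∀ᶠ p in 𝓝 (0 : Plane), conjDefect μ μ' F p = 0) →
        (∀ᶠ v in 𝓝 (0 : ℂ), (shear (expBlowup F) (τ v, v / (1 + Complex.exp (τ v)))).1 = τ' v) →
        F =ᶠ[𝓝 0] G := by
  obtain ⟨g, hg, hgθ, hgτ, huniq⟩ := hm.exists_local_shear h h'
  have hE := Complex.exp_ne_zero w₀
  set ℓ : Plane → Plane := fun p => (w₀ + Complex.log (p.1 / Complex.exp w₀), p.2) with hℓ
  have hℓa : AnalyticAt ℂ ℓ (Complex.exp w₀, 0) :=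
    (analyticAt_const.add ((analyticAt_fst.div analyticAt_const hE).clog (by simp [hE]))).prod
      analyticAt_snd
  have hℓ0 : ℓ (Complex.exp w₀, 0) = (w₀, 0) := by simp [hℓ, hE]
  have hℓe : ∀ᶠ p in 𝓝 (w₀, (0 : ℂ)), ℓ (Complex.exp p.1, p.2) = p := by
    have ht : Tendsto (fun p : Plane => (ℓ (Complex.exp p.1, p.2)).1 - p.1) (𝓝 (w₀, 0))
        (𝓝 0) := by
      have h1 := (hℓa.continuousAt.tendsto.comp (tendsto_exp_mk w₀))
      rw [hℓ0] at h1
      have := ((continuous_fst.tendsto _).comp h1).sub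
        (continuous_fst.tendsto ((w₀, 0) : Plane))
      simpa using this
    filter_upwards [ht.eventually (Metric.ball_mem_nhds 0 one_pos)] with p hp
    refine Prod.ext (eq_of_exp_eq ?_ (by simpa using hp)) rfl
    simp only [hℓ]
    rw [Complex.exp_add, Complex.exp_log (div_ne_zero (Complex.exp_ne_zero _) hE),
      mul_div_cancel₀ _ hE]
  have hG₁ : AnalyticAt ℂ (fun p => g (ℓ p)) (Complex.exp w₀, 0) :=
    AnalyticAt.fun_comp (g := g) (f := ℓ) (by rwa [hℓ0]) hℓa
  -- The local solution, read in the variable t = x / y, descends to the plane; the required degree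
  -- bounds are those of `exists_polynomial_component`.
  obtain ⟨G, hG, hGg⟩ := exists_blowdown hG₁ fun m P r hP hr heq => by
    have hρ : AnalyticAt ℂ (fun p : Plane => r (Complex.exp p.1, p.2)) (w₀, 0) :=
      AnalyticAt.fun_comp (g := r) (f := fun p : Plane => (Complex.exp p.1, p.2)) hr
        (analyticAt_fst.cexp.prod analyticAt_snd)
    obtain ⟨q, hq, hqr⟩ := hm.exists_polynomial_component h h' hratio hg hgθ hgτ hP hρ (m := m) (by
      filter_upwards [(tendsto_exp_mk w₀).eventually heq, hℓe] with p e1 e2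
      rw [e2] at e1
      exact e1)
    refine ⟨q, hq, ?_⟩
    refine (tendsto_mk_left (Complex.exp w₀) 0).eventually
      (p := fun p : Plane => r (p.1, 0) = q.eval p.1) (eventually_of_exp ?_)
    exact (continuous_fst.tendsto ((w₀, 0) : Plane)).eventually hqr
  have hGe : expBlowup G =ᶠ[𝓝 (w₀, 0)] g := by
    filter_upwards [(tendsto_exp_mk w₀).eventually hGg, hℓe] with p e1 e2
    rw [e2] at e1
    exact e1
  have hyt : Tendsto (fun v => ((τ v, v / (1 + Complex.exp (τ v))) : Plane)) (𝓝 0)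
    (𝓝 (w₀, 0)) := (tendsto_level_coord h.one_add_exp_ne).comp (tendsto_mk_tau h)
  refine ⟨G, hG, ?_, ?_, fun F hF hF1 hF2 => ?_⟩
  -- Near the direction of the tangent curve the pulled back first integral is θ ∘ H, constant on
  -- leaves, so the defect vanishes there; the identity theorem spreads this to a neighbourhood of
  -- the origin.
  · refine eventually_eq_zero_of_blowup (analyticAt_conjDefect h.mu_analytic h'.mu_analytic hG)
      (t₀ := Complex.exp w₀) (eventually_of_exp ?_)
    obtain ⟨C, hC, hCeq⟩ := exists_shear_factor_ne_zero h h' hG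
    have hJ : (fun p => leafIntegral k' (shear (expBlowup G) p)) =ᶠ[𝓝 (w₀, 0)]
        fun p => θ (leafIntegral k p) := by
      filter_upwards [hGe, hgθ] with p e1 e2
      rw [← e2]
      simp only [shear, e1]
    filter_upwards [hC, hCeq, hJ.eventually_nhds,
      h.leaf.fderiv_comp_leafIntegral h.mem_ball hm.analytic] with p e1 e2 e3 e4 hp
    rw [EventuallyEq.fderiv_eq e3, e4.2] at e2
    exact (mul_eq_zero.1 e2.symm).resolve_left (mul_ne_zero hp e1)
  · filter_upwards [hyt.eventually hGe, hgτ] with v e1 e2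
    rw [← e2]
    simp only [shear, e1]
  · have hFa := analyticAt_expBlowup hF w₀
    have hFg : expBlowup F =ᶠ[𝓝 (w₀, 0)] g := by
      refine huniq _ hFa ?_ hF2
      have hJa : AnalyticAt ℂ (fun p => leafIntegral k' (shear (expBlowup F) p)) (w₀, 0) :=
        AnalyticAt.fun_comp (g := leafIntegral k') (f := shear (expBlowup F)) (by
          rw [shear_axis]
          exact analyticAt_leafIntegral (h'.leaf.analytic _ h.mem_ball))
          (analyticAt_shear_axis hFa)
      have hθa := (h.leaf.fderiv_comp_leafIntegral h.mem_ball hm.analytic).self_of_nhds.1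
      obtain ⟨C, -, hCeq⟩ := exists_shear_factor_ne_zero h h' hF
      -- For a competitor F the difference of the two first integrals is constant on leaves, and it
      -- vanishes on the tangent curve by `hm.base`. So F satisfies the same local equation as g.
      have hzero := h.eq_zero_of_tangentCurve (J := fun p =>
        leafIntegral k' (shear (expBlowup F) p) - θ (leafIntegral k p)) (hJa.sub hθa) (by
          filter_upwards [hCeq, (tendsto_exp_blowup w₀).eventually hF1,
            h.leaf.fderiv_comp_leafIntegral h.mem_ball hm.analytic, hJa.eventually_analyticAt]
            with p e1 e2 e3 e4
          have d := e4.differentiableAt.hasFDerivAt.fun_sub e3.1.differentiableAt.hasFDerivAt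
          rw [d.fderiv, _root_.sub_apply, e1, e3.2, e2]
          ring) (by
          have hWt : Tendsto (fun v => (shear (expBlowup F)
              (τ v, v / (1 + Complex.exp (τ v)))).1) (𝓝 0) (𝓝 w₀) :=
            (continuous_fst.tendsto _).comp ((tendsto_shear hFa).comp hyt)
          have hwne : ∀ᶠ w in 𝓝 w₀, 1 + Complex.exp w ≠ 0 := by
            have : ContinuousAt (fun w => 1 + Complex.exp w) w₀ := by fun_prop
            exact this.eventually_ne h.one_add_exp_ne
          filter_upwards [hF2, hm.base, hyt.eventually (eventually_shear_slit hFa),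
            hWt.eventually hwne, (tendsto_mk_tau h).eventually
              (eventually_one_add_exp_ne h.one_add_exp_ne)] with v e1 e2 e3 e4 e5
          have e6 := shear_snd_eq (g := expBlowup F) (p := (τ v, v / (1 + Complex.exp (τ v))))
            (Complex.slitPlane_ne_zero e3.1) (Complex.slitPlane_ne_zero e3.2) e4
          simp only [div_mul_cancel₀ _ e5] at e6
          rw [e1] at e6
          have e7 : shear (expBlowup F) (τ v, v / (1 + Complex.exp (τ v)))
            = (τ' v, v / (1 + Complex.exp (τ' v))) := Prod.ext e1 e6
          rw [e7, e2, sub_self])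
      exact hzero.mono fun p hp => sub_eq_zero.1 hp
    have hFG : ∀ᶠ p in 𝓝 (0 : Plane), F p - G p = 0 := by
      refine eventually_eq_zero_of_blowup (hF.sub hG) (t₀ := Complex.exp w₀)
        (eventually_of_exp ?_)
      filter_upwards [hFg, hGe] with p e1 e2 _
      exact sub_eq_zero.2 (e1.trans e2.symm)
    exact hFG.mono fun p hp => sub_eq_zero.1 hp

/-! ### Charts adapted to the tangent curve -/

/-- The logarithm of the slope of the tangent curve. -/
lemma exists_isStripModel {lam w₀ : ℂ} {μ k : Plane → ℂ} {q : ℂ → Plane} (hμ : AnalyticAt ℂ μ 0)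
    (hμ0 : μ 0 = lam) (h1 : 1 + lam ≠ 0) (hw₀ : Complex.exp w₀ * lam = 1)
    (hk : IsLeafExponent μ w₀ 8 k) (hq : AnalyticAt ℂ q 0) (hq0 : q 0 = 0)
    (hqT : ∀ᶠ v in 𝓝 (0 : ℂ), (q v).1 + (q v).2 = v ∧ (q v).2 = μ (q v) * (q v).1) :
    ∃ τ : ℂ → ℂ, IsStripModel lam w₀ μ k τ ∧
      (∀ᶠ v in 𝓝 (0 : ℂ), w₀ + Complex.log (lam * (q v).1 / (q v).2) = τ v) ∧
      ∀ᶠ v in 𝓝 (0 : ℂ), q v = (Complex.exp (τ v) * (v / (1 + Complex.exp (τ v))),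
        v / (1 + Complex.exp (τ v))) := by
  have hlam : lam ≠ 0 := right_ne_zero_of_mul_eq_one hw₀
  have hμq : AnalyticAt ℂ (fun v => μ (q v)) 0 :=
    AnalyticAt.fun_comp (g := μ) (f := q) (by rwa [hq0]) hq
  have hμq0 : μ (q 0) = lam := by rw [hq0, hμ0]
  -- On the tangent curve x / y = 1 / μ = e^{w₀} lam / μ. The logarithm is taken near 1, and this
  -- expression is analytic also at v = 0, where x / y has no meaning.
  set τ : ℂ → ℂ := fun v => w₀ + Complex.log (lam / μ (q v)) with hτ
  have hm : ∀ᶠ v in 𝓝 (0 : ℂ), μ (q v) ≠ 0 := hμq.continuousAt.eventually_ne (by rwa [hμq0])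
  have hm1 : ∀ᶠ v in 𝓝 (0 : ℂ), 1 + μ (q v) ≠ 0 :=
    (analyticAt_const.add hμq).continuousAt.eventually_ne (by simpa [hμq0] using h1)
  have hexp : ∀ᶠ v in 𝓝 (0 : ℂ), Complex.exp (τ v) * μ (q v) = 1 := by
    filter_upwards [hm] with v e1
    simp only [hτ]
    rw [Complex.exp_add, Complex.exp_log (div_ne_zero hlam e1)]
    field_simp
    exact hw₀
  have hqeq : ∀ᶠ v in 𝓝 (0 : ℂ), q v = (Complex.exp (τ v) * (v / (1 + Complex.exp (τ v))),
        v / (1 + Complex.exp (τ v))) := by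
    filter_upwards [hexp, hm, hm1, hqT] with v e1 e2 e3 e4
    have h2 : 1 + Complex.exp (τ v) ≠ 0 := fun hc => e3 (by linear_combination μ (q v) * hc - e1)
    have h3 : (q v).2 = v / (1 + Complex.exp (τ v)) := by
      rw [eq_div_iff h2]
      linear_combination e4.1 + Complex.exp (τ v) * e4.2 + (q v).1 * e1
    refine Prod.ext ?_ h3
    rw [← h3]
    linear_combination -Complex.exp (τ v) * e4.2 - (q v).1 * e1
  refine ⟨τ, ⟨hw₀, h1, hμ, hμ0, hk, ?_, ?_, ?_⟩, ?_, hqeq⟩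
  · exact analyticAt_const.add ((analyticAt_const.div hμq (by rwa [hμq0])).clog
      (by simp [hμq0, hlam]))
  · simp only [hτ]
    rw [hμq0, div_self hlam, Complex.log_one, add_zero]
  · filter_upwards [hqeq, hexp] with v e1 e2
    rw [← e1, mul_comm, e2]
  · filter_upwards [hqT, hm] with v e1 e2
    simp only [hτ]
    -- At v = 0 the quotient is 0 / 0 = 0 and log 0 = 0 by convention, which happens to agree with
    -- log 1.
    rcases eq_or_ne v 0 with rfl | hv
    · rw [hμq0, div_self hlam, hq0]
      simp
    · have hx : (q v).1 ≠ 0 := fun hc => by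
        rw [hc, mul_zero] at e1
        rw [e1.2, add_zero] at e1
        exact hv e1.1.symm
      rw [e1.2, mul_div_mul_right _ _ hx]

/-- A normal chart for the pair `(ω, η)` with a first integral of `η` and a parameter of the
tangent curve. -/
structure IsFramedChart (ω η : OneForm) (S₁ S₂ : ℂ → Plane) (lam : ℂ) (z u : Plane → ℂ)
    (Θ : Plane → Plane) (μ a : Plane → ℂ) (q : ℂ → Plane) : Prop where
  chart : IsNormalChart ω z S₁ S₂ lam Θ μ a
  integral_analytic : AnalyticAt ℂ z 0
  integral_zero : z 0 = 0
  factor_analytic : AnalyticAt ℂ u 0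
  factor_ne_zero : u 0 ≠ 0
  factor_eq : ∀ᶠ p in 𝓝 (0 : Plane), η p = u p • fderiv ℂ z p
  curve_analytic : AnalyticAt ℂ q 0
  curve_zero : q 0 = 0
  curve_spec : ∀ᶠ v in 𝓝 (0 : ℂ), (q v).1 + (q v).2 = v ∧ (q v).2 = μ (q v) * (q v).1
  curve_inv : ∀ᶠ p in 𝓝 (0 : Plane), p.2 = μ p * p.1 → q (p.1 + p.2) = p

lemma exists_framedChart {ω η : OneForm} (hω : AnalyticAt ℂ ω 0) {S₁ S₂ : ℂ → Plane} {lam : ℂ}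
    (h₁ : IsSeparatrix ω S₁) (h₂ : IsSeparatrix ω S₂) (hf : HasSeparatrixFrame ω S₁ S₂ lam)
    (h1 : 1 + lam ≠ 0) {z u : Plane → ℂ} (hz : AnalyticAt ℂ z 0) (hz0 : z 0 = 0)
    (hu : AnalyticAt ℂ u 0) (hu0 : u 0 ≠ 0)
    (hηz : ∀ᶠ p in 𝓝 (0 : Plane), η p = u p • fderiv ℂ z p)
    (hη₁ : η 0 (deriv S₁ 0) ≠ 0) (hη₂ : η 0 (deriv S₂ 0) ≠ 0) :
    ∃ Θ μ a q, IsFramedChart ω η S₁ S₂ lam z u Θ μ a q := by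
  have hz' : ∀ v, η 0 v ≠ 0 → fderiv ℂ z 0 v ≠ 0 := fun v hv hc => hv (by
    rw [hηz.self_of_nhds, _root_.smul_apply, hc, smul_zero])
  obtain ⟨Θ, μ, a, hc⟩ := exists_normalChart hω h₁ h₂ hf hz hz0 (hz' _ hη₁) (hz' _ hη₂)
  obtain ⟨q, hq, hq0, hq1, hq2⟩ := exists_tangentCurve_param hc.mu_analytic hc.mu_zero h1
  exact ⟨Θ, μ, a, q, hc, hz, hz0, hu, hu0, hηz, hq, hq0, hq1, hq2⟩

namespace IsFramedChart

variable {ω η : OneForm} {S₁ S₂ : ℂ → Plane} {lam : ℂ} {z u : Plane → ℂ} {Θ : Plane → Plane}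
  {μ a : Plane → ℂ} {q : ℂ → Plane}

lemma tendsto_curve (h : IsFramedChart ω η S₁ S₂ lam z u Θ μ a q) :
    Tendsto (fun v => Θ (q v)) (𝓝 0) (𝓝[tangentCurve ω η] 0) := by
  have hqt := analyticAt_tendsto_zero h.curve_analytic h.curve_zero
  refine tendsto_nhdsWithin_iff.2
    ⟨(analyticAt_tendsto_zero h.chart.diffeo.1 h.chart.diffeo.2.1).comp hqt, ?_⟩
  filter_upwards [hqt.eventually (h.chart.mem_tangentCurve h.integral_analytic h.factor_analytic
    h.factor_ne_zero h.factor_eq), h.curve_spec] with v e1 e2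
  exact e1.2 e2.2

lemma integral_curve (h : IsFramedChart ω η S₁ S₂ lam z u Θ μ a q) :
    ∀ᶠ v in 𝓝 (0 : ℂ), z (Θ (q v)) = v := by
  have hqt := analyticAt_tendsto_zero h.curve_analytic h.curve_zero
  filter_upwards [hqt.eventually h.chart.integral_eq, h.curve_spec] with v e1 e2
  rw [e1, e2.1]

lemma curve_integral (h : IsFramedChart ω η S₁ S₂ lam z u Θ μ a q) :
    ∀ᶠ p in 𝓝[tangentCurve ω η] (0 : Plane), Θ (q (z p)) = p := by
  obtain ⟨χ, hχ, -, hχ2⟩ := h.chart.diffeo.exists_symm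
  have hχt := analyticAt_tendsto_zero hχ.1 hχ.2.1
  filter_upwards [nhdsWithin_le_nhds hχ2, nhdsWithin_le_nhds (hχt.eventually h.curve_inv),
    nhdsWithin_le_nhds (hχt.eventually h.chart.integral_eq), self_mem_nhdsWithin,
    nhdsWithin_le_nhds (hχt.eventually (h.chart.mem_tangentCurve h.integral_analytic
      h.factor_analytic h.factor_ne_zero h.factor_eq))] with p e1 e2 e3 e4 e5
  rw [e1] at e3 e5
  rw [e3, e2 (e5.1 e4), e1]

/-- A framed chart of the target which matches a given identification of the tangent curves. -/
lemma exists_matching {ω' η' : OneForm} {S₁' S₂' : ℂ → Plane}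
    (h : IsFramedChart ω η S₁ S₂ lam z u Θ μ a q) (hω' : AnalyticAt ℂ ω' 0)
    (h₁ : IsSeparatrix ω' S₁') (h₂ : IsSeparatrix ω' S₂')
    (hf : HasSeparatrixFrame ω' S₁' S₂' lam)
    (h1 : 1 + lam ≠ 0) {z' u' : Plane → ℂ} (hz : AnalyticAt ℂ z' 0) (hz0 : z' 0 = 0)
    (hu : AnalyticAt ℂ u' 0) (hu0 : u' 0 ≠ 0)
    (hηz : ∀ᶠ p in 𝓝 (0 : Plane), η' p = u' p • fderiv ℂ z' p)
    (hη₁ : η' 0 (deriv S₁' 0) ≠ 0) (hη₂ : η' 0 (deriv S₂' 0) ≠ 0) {φ : Plane → Plane}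
    (hφ : IsDiffeoGerm (tangentCurve ω η) (tangentCurve ω' η') φ) :
    ∃ z' u' Θ' μ' a' q', IsFramedChart ω' η' S₁' S₂' lam z' u' Θ' μ' a' q' ∧
      ∀ᶠ v in 𝓝 (0 : ℂ), φ (Θ (q v)) = Θ' (q' v) := by
  obtain ⟨Θ₀, μ₀, a₀, q₀, h₀⟩ := exists_framedChart hω' h₁ h₂ hf h1 hz hz0 hu hu0 hηz hη₁ hη₂
  obtain ⟨hφa, hφ0, g, hg, hg0, hφ1, -⟩ := hφ
  have hΘq : AnalyticAt ℂ (fun v => Θ (q v)) 0 :=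
    AnalyticAt.fun_comp (g := Θ) (f := q) (by rw [h.curve_zero]; exact h.chart.diffeo.1)
      h.curve_analytic
  have hΘq0 : Θ (q 0) = 0 := by rw [h.curve_zero, h.chart.diffeo.2.1]
  have hφq : AnalyticAt ℂ (fun v => φ (Θ (q v))) 0 :=
    AnalyticAt.fun_comp (g := φ) (f := fun v => Θ (q v)) (by rwa [hΘq0]) hΘq
  have hφq0 : φ (Θ (q 0)) = 0 := by rw [hΘq0, hφ0]
  have hφt : Tendsto (fun v => φ (Θ (q v))) (𝓝 0) (𝓝[tangentCurve ω' η'] 0) :=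
    tendsto_nhdsWithin_iff.2 ⟨analyticAt_tendsto_zero hφq hφq0,
      (h.tendsto_curve.eventually hφ1).mono fun v hv => hv.1⟩
  -- The map φ written in the parameters z and z' of the two tangent curves. Replacing z' by ρ⁻¹ ∘
  -- z' keeps the target pencil and turns φ into the identity of the parameters. The inverse g of φ
  -- provides a left inverse of ρ, whence ρ'(0) ≠ 0.
  set ρ : ℂ → ℂ := fun v => z' (φ (Θ (q v))) with hρ
  have hρa : AnalyticAt ℂ ρ 0 :=
    AnalyticAt.fun_comp (g := z') (f := fun v => φ (Θ (q v))) (by rwa [hφq0]) hφq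
  have hρ0 : ρ 0 = 0 := by simp only [hρ, hφq0, hz0]
  have hΘ₀q₀ : AnalyticAt ℂ (fun v => Θ₀ (q₀ v)) 0 :=
    AnalyticAt.fun_comp (g := Θ₀) (f := q₀) (by rw [h₀.curve_zero]; exact h₀.chart.diffeo.1)
      h₀.curve_analytic
  have hΘ₀q₀0 : Θ₀ (q₀ 0) = 0 := by rw [h₀.curve_zero, h₀.chart.diffeo.2.1]
  have hgΘ : AnalyticAt ℂ (fun v => g (Θ₀ (q₀ v))) 0 :=
    AnalyticAt.fun_comp (g := g) (f := fun v => Θ₀ (q₀ v)) (by rwa [hΘ₀q₀0]) hΘ₀q₀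
  have hσa : AnalyticAt ℂ (fun v => z (g (Θ₀ (q₀ v)))) 0 :=
    AnalyticAt.fun_comp (g := z) (f := fun v => g (Θ₀ (q₀ v)))
      (by rw [hΘ₀q₀0, hg0]; exact h.integral_analytic) hgΘ
  have hσρ : (fun v => z (g (Θ₀ (q₀ (ρ v))))) =ᶠ[𝓝 0] fun v => v := by
    filter_upwards [hφt.eventually h₀.curve_integral, h.tendsto_curve.eventually hφ1,
      h.integral_curve] with v e1 e2 e3
    rw [hρ, e1, e2.2, e3]
  have hρd : IsDiffeoGerm univ univ ρ := by
    refine isDiffeoGerm_of_deriv_ne_zero hρa hρ0 fun hc => ?_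
    have d1 : HasDerivAt (fun v => z (g (Θ₀ (q₀ (ρ v))))) _ 0 :=
      HasDerivAt.comp (h₂ := fun v => z (g (Θ₀ (q₀ v)))) (h := ρ) 0
        (by rw [hρ0]; exact hσa.differentiableAt.hasDerivAt) hρa.differentiableAt.hasDerivAt
    have d2 := (d1.congr_of_eventuallyEq hσρ.symm).unique (hasDerivAt_id' (0 : ℂ))
    rw [hc, mul_zero] at d2
    exact zero_ne_one d2
  obtain ⟨σ, hσ, hσ1, -⟩ := hρd.exists_symm
  have hzt := analyticAt_tendsto_zero hz hz0
  have hσz : AnalyticAt ℂ (fun p => σ (z' p)) 0 :=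
    AnalyticAt.fun_comp (g := σ) (f := z') (by rw [hz0]; exact hσ.1) hz
  have hσz0 : σ (z' 0) = 0 := by rw [hz0, hσ.2.1]
  have hd : AnalyticAt ℂ (fun p => deriv σ (z' p)) 0 :=
    AnalyticAt.fun_comp (g := deriv σ) (f := z') (by rw [hz0]; exact hσ.1.deriv) hz
  have hd0 : deriv σ (z' 0) ≠ 0 := by
    rw [hz0]
    exact hσ.deriv_ne_zero
  obtain ⟨Θ', μ', a', q', h'⟩ := exists_framedChart (η := η') hω' h₁ h₂ hf h1 hσz hσz0
    (u := fun p => u' p / deriv σ (z' p)) (hu.div hd hd0) (div_ne_zero hu0 hd0) (by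
      filter_upwards [hηz, hd.continuousAt.eventually_ne hd0, hz.eventually_analyticAt,
        hzt.eventually hσ.1.eventually_analyticAt] with p e1 e2 e3 e4
      have d := (e4.differentiableAt.hasDerivAt.comp_hasFDerivAt p
        e3.differentiableAt.hasFDerivAt).fderiv
      rw [e1, show (fun p => σ (z' p)) = σ ∘ z' from rfl, d, smul_smul, div_mul_cancel₀ _ e2])
    hη₁ hη₂
  refine ⟨_, _, Θ', μ', a', q', h', ?_⟩
  filter_upwards [hφt.eventually h'.curve_integral, hσ1] with v e1 e2
  rw [← e1]
  exact congrArg (fun s => Θ' (q' s)) e2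

/-- Commuting holonomies match the first integrals of the normal forms. -/
lemma exists_isMatched {ω' η' : OneForm} {S₁' S₂' : ℂ → Plane} {z' u' : Plane → ℂ}
    {Θ' : Plane → Plane} {μ' a' : Plane → ℂ} {q' : ℂ → Plane}
    (h : IsFramedChart ω η S₁ S₂ lam z u Θ μ a q)
    (h' : IsFramedChart ω' η' S₁' S₂' lam z' u' Θ' μ' a' q')
    (hω : AnalyticAt ℂ ω 0) (hη : AnalyticAt ℂ η 0)
    (hω' : AnalyticAt ℂ ω' 0) (hη' : AnalyticAt ℂ η' 0)
    (hS₁ : IsSeparatrix ω S₁) (hS₂ : IsSeparatrix ω S₂)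
    (hS₁' : IsSeparatrix ω' S₁') (hS₂' : IsSeparatrix ω' S₂')
    (hlam : lam ≠ 0) (h1 : 1 + lam ≠ 0) {hol hol' φ : Plane → Plane}
    (hh : IsTangentCurveHolonomy ω η S₁ S₂ hol)
    (hh' : IsTangentCurveHolonomy ω' η' S₁' S₂' hol')
    (hφ : ∀ᶠ v in 𝓝 (0 : ℂ), φ (Θ (q v)) = Θ' (q' v))
    (hcomm : ∀ᶠ p in 𝓝[tangentCurve ω η] (0 : Plane), φ (hol p) = hol' (φ p)) :
    ∃ (w₀ : ℂ) (k k' : Plane → ℂ) (τ τ' θ : ℂ → ℂ), IsMatched w₀ k k' τ τ' θ ∧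
      IsStripModel lam w₀ μ k τ ∧ IsStripModel lam w₀ μ' k' τ' ∧
      (∀ᶠ v in 𝓝 (0 : ℂ), q v = (Complex.exp (τ v) * (v / (1 + Complex.exp (τ v))),
        v / (1 + Complex.exp (τ v)))) ∧
      ∀ᶠ v in 𝓝 (0 : ℂ), q' v = (Complex.exp (τ' v) * (v / (1 + Complex.exp (τ' v))),
        v / (1 + Complex.exp (τ' v))) := by
  obtain ⟨w₀, hw₀⟩ : ∃ w₀ : ℂ, Complex.exp w₀ * lam = 1 :=
    ⟨Complex.log (1 / lam), by
      rw [Complex.exp_log (one_div_ne_zero hlam), one_div_mul_cancel hlam]⟩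
  have hR : (0 : ℝ) < 8 := by norm_num
  have hc := h.chart
  have hc' := h'.chart
  obtain ⟨k, hk⟩ := exists_leafExponent hc.mu_analytic (by rwa [hc.mu_zero]) w₀ hR
  obtain ⟨k', hk'⟩ := exists_leafExponent hc'.mu_analytic (by rwa [hc'.mu_zero]) w₀ hR
  obtain ⟨τ, hτ, hτq, hq⟩ := exists_isStripModel hc.mu_analytic hc.mu_zero h1 hw₀ hk
    h.curve_analytic h.curve_zero h.curve_spec
  obtain ⟨τ', hτ', hτq', hq'⟩ := exists_isStripModel hc'.mu_analytic hc'.mu_zero h1 hw₀ hk'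
    h'.curve_analytic h'.curve_zero h'.curve_spec
  obtain ⟨f, hf, hfe⟩ := hc.holonomy hω hη h.integral_analytic h.integral_zero h.factor_analytic
    h.factor_ne_zero h.factor_eq hS₁ hS₂ h1 hw₀ hk h.curve_analytic h.curve_zero h.curve_spec
    h.curve_inv hh
  obtain ⟨f', hf', hfe'⟩ := hc'.holonomy hω' hη' h'.integral_analytic h'.integral_zero
    h'.factor_analytic h'.factor_ne_zero h'.factor_eq hS₁' hS₂' h1 hw₀ hk' h'.curve_analytic
    h'.curve_zero h'.curve_spec h'.curve_inv hh'
  have hff : ∀ᶠ v in 𝓝 (0 : ℂ), f v = f' v := by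
    filter_upwards [hfe, hfe', h.tendsto_curve.eventually hcomm, hφ, hf.eventually hφ,
      hf.eventually h'.integral_curve, hf'.eventually h'.integral_curve]
      with v e1 e2 e3 e4 e5 e6 e7
    rw [e1.1, e4, e2.1, e5] at e3
    rw [← e6, e3, e7]
  have hmem : w₀ + 0 ∈ Metric.ball w₀ 8 := by simp
  have hexp : Complex.exp (2 * Real.pi * Complex.I) = 1 := Complex.exp_two_pi_mul_I
  have hball := IsStripModel.mem_ball_add w₀
  -- Over w₀ and over w₀ + 2πi the first integral restricts to parameters A and B of the tangent
  -- curve, and the holonomy is expressed by A = B ∘ f. Commutation with φ has shown that the target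
  -- has the same f.
  obtain ⟨θ, hθ, hθ1, hθ2⟩ := exists_transition
    (hτ.isDiffeoGerm_leafIntegral hmem Complex.exp_zero) (hτ.isDiffeoGerm_leafIntegral hball hexp)
    (hτ'.isDiffeoGerm_leafIntegral hmem Complex.exp_zero) hf
    (B' := fun v => leafIntegral k' (τ' v + 2 * Real.pi * Complex.I, v / (1 + Complex.exp (τ' v))))
    (by
      filter_upwards [hfe, hτq, hq, hf.eventually hτq, hf.eventually hq] with v e1 e2 e3 e4 e5
      have e6 := e1.2
      rw [e2, e4] at e6
      rw [add_zero]
      rwa [congrArg Prod.snd e3, congrArg Prod.snd e5] at e6)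
    (by
      filter_upwards [hfe', hτq', hq', hf'.eventually hτq', hf'.eventually hq', hff]
        with v e1 e2 e3 e4 e5 e0
      have e6 := e1.2
      rw [e2, e4] at e6
      rw [add_zero, e0]
      rwa [congrArg Prod.snd e3, congrArg Prod.snd e5] at e6)
  simp only [add_zero] at hθ1
  exact ⟨w₀, k, k', τ, τ', θ, ⟨hθ.1, hθ.2.1, hθ1, hθ2⟩, hτ, hτ', hq, hq'⟩

end IsFramedChart

/-! ### Conjugacies in the charts -/

lemma SendsFoliation.comp {Φ Φ' : Plane → Plane} {ω ω' ω'' : OneForm}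
    (h : SendsFoliation Φ ω ω') (h' : SendsFoliation Φ' ω' ω'') (hΦ : AnalyticAt ℂ Φ 0)
    (hΦ0 : Φ 0 = 0) (hΦ' : AnalyticAt ℂ Φ' 0) : SendsFoliation (Φ' ∘ Φ) ω ω'' := by
  obtain ⟨u, hu, hu0, he⟩ := h
  obtain ⟨u', hu', hu0', he'⟩ := h'
  have ht := analyticAt_tendsto_zero hΦ hΦ0
  refine ⟨fun p => u' (Φ p) * u p, (AnalyticAt.fun_comp (g := u') (f := Φ) (by rwa [hΦ0]) hΦ).mul hu,
    mul_ne_zero (by rwa [hΦ0]) hu0, ?_⟩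
  filter_upwards [he, ht.eventually he', ht.eventually hΦ'.eventually_analyticAt,
    hΦ.eventually_analyticAt] with p e1 e2 e3 e4
  have d := (e3.differentiableAt.hasFDerivAt.comp p e4.differentiableAt.hasFDerivAt).fderiv
  refine ContinuousLinearMap.ext fun v => ?_
  have h1 := congrArg (fun T : Plane →L[ℂ] ℂ => T v) e1
  have h2 := congrArg (fun T : Plane →L[ℂ] ℂ => T (fderiv ℂ Φ p v)) e2
  simp only [pullback, ContinuousLinearMap.comp_apply, _root_.smul_apply, smul_eq_mul] at h1 h2 ⊢
  rw [d, ContinuousLinearMap.comp_apply]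
  rw [Function.comp_apply, h2, h1, mul_assoc]

lemma SendsFoliation.symm {Φ χ : Plane → Plane} {ω ω' : OneForm} (h : SendsFoliation Φ ω ω')
    (hΦ : AnalyticAt ℂ Φ 0) (hχ : AnalyticAt ℂ χ 0) (hχ0 : χ 0 = 0)
    (hΦχ : ∀ᶠ p in 𝓝 (0 : Plane), Φ (χ p) = p) : SendsFoliation χ ω' ω := by
  obtain ⟨u, hu, hu0, he⟩ := h
  have ht := analyticAt_tendsto_zero hχ hχ0
  have huχ : AnalyticAt ℂ (fun p => u (χ p)) 0 :=
    AnalyticAt.fun_comp (g := u) (f := χ) (by rwa [hχ0]) hχ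
  have huχ0 : u (χ 0) ≠ 0 := by rwa [hχ0]
  refine ⟨fun p => (u (χ p))⁻¹, huχ.inv huχ0, inv_ne_zero huχ0, ?_⟩
  filter_upwards [ht.eventually he, ht.eventually hΦ.eventually_analyticAt,
    hχ.eventually_analyticAt, hΦχ.eventually_nhds, huχ.continuousAt.eventually_ne huχ0]
    with p e1 e2 e3 e4 e5
  have d := (e2.differentiableAt.hasFDerivAt.comp p e3.differentiableAt.hasFDerivAt).fderiv
  have d2 : Φ ∘ χ =ᶠ[𝓝 p] fun q => q := e4
  rw [EventuallyEq.fderiv_eq d2] at d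
  refine ContinuousLinearMap.ext fun v => ?_
  have h1 := congrArg (fun T : Plane →L[ℂ] ℂ => T (fderiv ℂ χ p v)) e1
  have h2 := congrArg (fun T : Plane →L[ℂ] Plane => T v) d
  simp only [pullback, ContinuousLinearMap.comp_apply, _root_.smul_apply, smul_eq_mul, fderiv_fun_id,
    ContinuousLinearMap.id_apply] at h1 h2 ⊢
  rw [← h2, e4.self_of_nhds] at h1
  rw [h1, inv_mul_cancel_left₀ e5]

/-- The form `y dx + μ x dy`. -/
noncomputable def normalForm (μ : Plane → ℂ) : OneForm := fun p =>
  p.2 • ContinuousLinearMap.fst ℂ ℂ ℂ + (μ p * p.1) • ContinuousLinearMap.snd ℂ ℂ ℂ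

lemma normalForm_apply (μ : Plane → ℂ) (p v : Plane) :
    normalForm μ p v = p.2 * v.1 + μ p * p.1 * v.2 := rfl

/-- The form `dx + dy`. -/
noncomputable def sumForm : OneForm := fun _ =>
  ContinuousLinearMap.fst ℂ ℂ ℂ + ContinuousLinearMap.snd ℂ ℂ ℂ

lemma sumForm_apply (p v : Plane) : sumForm p v = v.1 + v.2 := rfl

/-- The map `(x (1 + y G), y (1 - x G))`, which preserves `x + y` and the axes. -/
noncomputable def slide (G : Plane → ℂ) (p : Plane) : Plane :=
  (p.1 * (1 + p.2 * G p), p.2 * (1 - p.1 * G p))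

lemma analyticAt_slide {G : Plane → ℂ} {p : Plane} (hG : AnalyticAt ℂ G p) :
    AnalyticAt ℂ (slide G) p :=
  (analyticAt_fst.mul (analyticAt_const.add (analyticAt_snd.mul hG))).prod
    (analyticAt_snd.mul (analyticAt_const.sub (analyticAt_fst.mul hG)))

lemma slide_zero (G : Plane → ℂ) : slide G 0 = 0 := by simp [slide]

lemma fderiv_slide {G : Plane → ℂ} {p : Plane} (hG : AnalyticAt ℂ G p) (v : Plane) :
    fderiv ℂ (slide G) p v
      = (v.1 + ((v.1 * p.2 + p.1 * v.2) * G p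
          + p.1 * p.2 * (v.1 * fderiv ℂ G p (1, 0) + v.2 * fderiv ℂ G p (0, 1))),
        v.2 - ((v.1 * p.2 + p.1 * v.2) * G p
          + p.1 * p.2 * (v.1 * fderiv ℂ G p (1, 0) + v.2 * fderiv ℂ G p (0, 1)))) := by
  have dg := hasDerivAt_line hG v
  have d1 : HasDerivAt (fun s : ℂ => (p + s • v).1) v.1 0 := by
    have := hasDerivAt_line (f := fun q : Plane => q.1) (p := p) analyticAt_fst v
    rwa [fderiv_fst] at this
  have d2 : HasDerivAt (fun s : ℂ => (p + s • v).2) v.2 0 := by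
    have := hasDerivAt_line (f := fun q : Plane => q.2) (p := p) analyticAt_snd v
    rwa [fderiv_snd] at this
  have d : HasDerivAt (fun s : ℂ => slide G (p + s • v)) _ 0 :=
    (d1.fun_mul ((d2.fun_mul dg).const_add 1)).prodMk
      (d2.fun_mul ((d1.fun_mul dg).const_sub 1))
  rw [(hasDerivAt_line (analyticAt_slide hG) v).unique d, clm_apply_prod (fderiv ℂ G p)]
  simp only [zero_smul, add_zero]
  refine Prod.ext ?_ ?_
  · simp only
    ring
  · simp only
    ring

lemma isDiffeoGerm_slide {G : Plane → ℂ} (hG : AnalyticAt ℂ G 0) :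
    IsDiffeoGerm univ univ (slide G) := by
  refine isDiffeoGerm_of_injective_fderiv (analyticAt_slide hG) (slide_zero G) fun v hv => ?_
  rw [fderiv_slide hG] at hv
  simpa using hv

lemma sendsFoliation_slide_sumForm {G : Plane → ℂ} (hG : AnalyticAt ℂ G 0) :
    SendsFoliation (slide G) sumForm sumForm := by
  refine ⟨fun _ => 1, analyticAt_const, one_ne_zero, ?_⟩
  filter_upwards [hG.eventually_analyticAt] with p hp
  refine ContinuousLinearMap.ext fun v => ?_
  simp only [pullback, ContinuousLinearMap.comp_apply, sumForm_apply, fderiv_slide hp, one_smul]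
  ring

/-- The factor of `slide G` on the normal forms. -/
noncomputable def slideFactor (μ' G : Plane → ℂ) (p : Plane) : ℂ :=
  1 - p.1 * G p + (p.2 * (1 - p.1 * G p) - μ' (slide G p) * (p.1 * (1 + p.2 * G p)))
    * (G p + p.1 * fderiv ℂ G p (1, 0))

/-- The factor is chosen so that the dx coefficients agree; what remains in dy is x times the
defect. This explains the form of `conjDefect`. -/
lemma pullback_slide (μ μ' : Plane → ℂ) {G : Plane → ℂ} {p : Plane} (hG : AnalyticAt ℂ G p)
    (v : Plane) : pullback (slide G) (normalForm μ') p v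
      = slideFactor μ' G p * normalForm μ p v - p.1 * conjDefect μ μ' G p * v.2 := by
  simp only [pullback, ContinuousLinearMap.comp_apply, normalForm_apply, fderiv_slide hG,
    slideFactor, conjDefect, slide]
  ring

lemma sendsFoliation_slide {μ μ' G : Plane → ℂ} (hμ' : AnalyticAt ℂ μ' 0) (hG : AnalyticAt ℂ G 0)
    (h : ∀ᶠ p in 𝓝 (0 : Plane), conjDefect μ μ' G p = 0) :
    SendsFoliation (slide G) (normalForm μ) (normalForm μ') := by
  have a1 : AnalyticAt ℂ (fun p : Plane => 1 - p.1 * G p) 0 :=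
    analyticAt_const.sub (analyticAt_fst.mul hG)
  have a2 : AnalyticAt ℂ (fun p : Plane => 1 + p.2 * G p) 0 :=
    analyticAt_const.add (analyticAt_snd.mul hG)
  have a3 : AnalyticAt ℂ (fun p : Plane => μ' (slide G p)) 0 :=
    AnalyticAt.fun_comp (g := μ') (f := slide G) (by rwa [slide_zero]) (analyticAt_slide hG)
  refine ⟨slideFactor μ' G, a1.add (((analyticAt_snd.mul a1).sub
    (a3.mul (analyticAt_fst.mul a2))).mul
      (hG.add (analyticAt_fst.mul (analyticAt_fderiv_apply hG _)))), by simp [slideFactor], ?_⟩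
  filter_upwards [h, hG.eventually_analyticAt] with p e1 e2
  refine ContinuousLinearMap.ext fun v => ?_
  rw [pullback_slide μ μ' e2, e1, _root_.smul_apply, smul_eq_mul]
  ring

/-- Comparing dx coefficients identifies the unit u with `slideFactor`, and the dy coefficients then
give x times the defect equal to 0. Points near the direction x = y are used, where both coordinates
may be cancelled. -/
lemma conjDefect_eq_zero_of_sendsFoliation {μ μ' G : Plane → ℂ} (hμ : AnalyticAt ℂ μ 0)
    (hμ' : AnalyticAt ℂ μ' 0) (hG : AnalyticAt ℂ G 0)
    (h : SendsFoliation (slide G) (normalForm μ) (normalForm μ')) :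
    ∀ᶠ p in 𝓝 (0 : Plane), conjDefect μ μ' G p = 0 := by
  obtain ⟨u, -, -, he⟩ := h
  have ht : Tendsto (fun p : Plane => (p.1 * p.2, p.2)) (𝓝 (1, 0)) (𝓝 0) := by
    have : ContinuousAt (fun p : Plane => (p.1 * p.2, p.2)) (1, 0) := by fun_prop
    simpa [ContinuousAt, ← Prod.zero_eq_mk] using this
  have hne : ∀ᶠ p : Plane in 𝓝 (1, 0), p.1 ≠ 0 := continuousAt_fst.eventually_ne one_ne_zero
  refine eventually_eq_zero_of_blowup (analyticAt_conjDefect hμ hμ' hG) (t₀ := 1) ?_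
  filter_upwards [ht.eventually he, ht.eventually hG.eventually_analyticAt, hne]
    with p e1 e2 e3 hp
  have h1 := congrArg (fun T : Plane →L[ℂ] ℂ => T (1, 0)) e1
  have h2 := congrArg (fun T : Plane →L[ℂ] ℂ => T (0, 1)) e1
  simp only [pullback_slide μ μ' e2, _root_.smul_apply, smul_eq_mul, normalForm_apply, mul_one,
    mul_zero, add_zero, zero_add, sub_zero] at h1 h2
  rw [mul_right_cancel₀ hp h1] at h2
  have h3 : p.1 * p.2 * conjDefect μ μ' G (p.1 * p.2, p.2) = 0 := by linear_combination -h2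
  exact (mul_eq_zero.1 h3).resolve_left (mul_ne_zero e3 hp)

/-- A map which preserves the foliation `x + y = const`, the axes, and `x + y` on a curve. -/
lemma exists_eq_slide {Ψ : Plane → Plane} (hΨ : AnalyticAt ℂ Ψ 0)
    (hs : SendsFoliation Ψ sumForm sumForm) {q : ℂ → Plane} (hq : AnalyticAt ℂ q 0) (hq0 : q 0 = 0)
    (hqs : ∀ᶠ v in 𝓝 (0 : ℂ), (q v).1 + (q v).2 = v ∧ (Ψ (q v)).1 + (Ψ (q v)).2 = v)
    (hl : ∀ᶠ y in 𝓝 (0 : ℂ), (Ψ (0, y)).1 = 0) (hr : ∀ᶠ x in 𝓝 (0 : ℂ), (Ψ (x, 0)).2 = 0) :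
    ∃ G : Plane → ℂ, AnalyticAt ℂ G 0 ∧ Ψ =ᶠ[𝓝 0] slide G := by
  have hX : AnalyticAt ℂ (fun p => (Ψ p).1) 0 := analyticAt_fst.fun_comp hΨ
  have hY : AnalyticAt ℂ (fun p => (Ψ p).2) 0 := analyticAt_snd.fun_comp hΨ
  -- Preservation of the pencil makes K constant on the lines x + y = const, which M parametrizes.
  -- The curve q meets each of them and K vanishes on it, so K = 0.
  set K : Plane → ℂ := fun p => (Ψ p).1 + (Ψ p).2 - p.1 - p.2 with hK
  have hKa : AnalyticAt ℂ K 0 := ((hX.add hY).sub analyticAt_fst).sub analyticAt_snd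
  set M : Plane → Plane := fun p => (p.1, p.2 - p.1) with hM
  have hMa : ∀ p, AnalyticAt ℂ M p := fun p => analyticAt_fst.prod (analyticAt_snd.sub analyticAt_fst)
  have hM0 : M 0 = 0 := by simp [hM]
  have hMt := analyticAt_tendsto_zero (hMa 0) hM0
  have hMd : ∀ p, fderiv ℂ M p (1, 0) = (1, -1) := fun p => by
    have d : HasFDerivAt M _ p := (hasFDerivAt_fst (𝕜 := ℂ) (E := ℂ) (F := ℂ) (p := p)).prodMk
      (hasFDerivAt_snd.fun_sub hasFDerivAt_fst)
    rw [d.fderiv]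
    simp
  have hKM : AnalyticAt ℂ (fun p => K (M p)) (0, 0) :=
    AnalyticAt.fun_comp (g := K) (f := M) (by rwa [Prod.mk_zero_zero, hM0]) (hMa _)
  have hconst := eventually_eq_of_fderiv_fst_eq_zero hKM (by
    obtain ⟨c, -, -, he⟩ := hs
    rw [Prod.mk_zero_zero]
    filter_upwards [hMt.eventually he, hMt.eventually hΨ.eventually_analyticAt,
      hMt.eventually hKa.eventually_analyticAt] with p e1 e2 e3
    rw [fderiv_comp_apply e3 (hMa p), hMd]
    have d1 := e2.differentiableAt.hasFDerivAt
    have d : HasFDerivAt K _ (M p) :=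
      ((((hasFDerivAt_fst.comp (M p) d1).fun_add (hasFDerivAt_snd.comp (M p) d1)).fun_sub
        hasFDerivAt_fst).fun_sub hasFDerivAt_snd)
    rw [d.fderiv]
    have h1 := congrArg (fun T : Plane →L[ℂ] ℂ => T (1, -1)) e1
    simp only [pullback, ContinuousLinearMap.comp_apply, sumForm_apply, _root_.smul_apply,
      smul_eq_mul, add_neg_cancel, mul_zero] at h1
    simpa using h1)
  rw [Prod.mk_zero_zero] at hconst
  have hqt := analyticAt_tendsto_zero hq hq0
  have hN : Tendsto (fun p : Plane => (p.1, p.1 + p.2)) (𝓝 0) (𝓝 0) := by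
    have : ContinuousAt (fun p : Plane => (p.1, p.1 + p.2)) 0 := by fun_prop
    simpa [ContinuousAt, ← Prod.zero_eq_mk] using this
  have hline : ∀ᶠ p in 𝓝 (0 : Plane), K p = K (0, p.1 + p.2) := by
    filter_upwards [hN.eventually hconst] with p hp
    simpa [hM] using hp
  have hK0 : ∀ᶠ v in 𝓝 (0 : ℂ), K (0, v) = 0 := by
    filter_upwards [hqt.eventually hline, hqs] with v e1 e2
    rw [e2.1] at e1
    rw [← e1]
    simp only [hK]
    linear_combination e2.2 - e2.1
  have hsum : Tendsto (fun p : Plane => p.1 + p.2) (𝓝 0) (𝓝 0) := by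
    have : ContinuousAt (fun p : Plane => p.1 + p.2) 0 := by fun_prop
    simpa [ContinuousAt] using this
  have hKz : ∀ᶠ p in 𝓝 (0 : Plane), K p = 0 := by
    filter_upwards [hline, hsum.eventually hK0] with p e1 e2
    rw [e1, e2]
  obtain ⟨a, ha, hae⟩ := exists_eq_fst_mul (f := fun p => (Ψ p).1 - p.1) (c := 0)
    (hX.sub analyticAt_fst) (hl.mono fun y hy => by simp [hy])
  -- On y = 0 the second component vanishes and the sum is preserved, so the first component is x
  -- itself; the cofactor a is therefore divisible by y.
  have ha0 : ∀ᶠ x in 𝓝 (0 : ℂ), a (x, 0) = 0 := by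
    have hne : ∀ᶠ x in 𝓝[≠] (0 : ℂ), a (x, 0) = 0 := by
      have ht := tendsto_mk_left 0 0
      filter_upwards [nhdsWithin_le_nhds (ht.eventually hae),
        nhdsWithin_le_nhds (ht.eventually (p := fun p : Plane => K p = 0) hKz),
        nhdsWithin_le_nhds hr, self_mem_nhdsWithin] with x e1 e2 e3 e4
      simp only [hK, e3] at e2
      have e5 : x * a (x, 0) = 0 := by
        linear_combination e2 - e1
      exact (mul_eq_zero.1 e5).resolve_left e4
    have hc := (analyticAt_comp_mk_left ha).continuousAt.tendsto.mono_left
      (nhdsWithin_le_nhds (s := {0}ᶜ))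
    have h0 : a (0, 0) = 0 := tendsto_nhds_unique hc
      (tendsto_const_nhds.congr' (hne.mono fun x hx => hx.symm))
    rw [← nhdsNE_sup_pure, eventually_sup]
    exact ⟨hne, h0⟩
  obtain ⟨G, hG, hGe⟩ := exists_eq_snd_mul ha ha0
  refine ⟨G, hG, ?_⟩
  filter_upwards [hae, hGe, hKz] with p e1 e2 e3
  rw [e2] at e1
  simp only [hK] at e3
  refine Prod.ext ?_ ?_
  · simp only [slide]
    linear_combination e1
  · simp only [slide]
    linear_combination e3 - e1

/-- The map `slide G` on the tangent curve, in the coordinates `(w, y)`. -/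
lemma slide_curve_iff {lam w₀ : ℂ} {μ k μ' k' G : Plane → ℂ} {τ τ' : ℂ → ℂ}
    (h : IsStripModel lam w₀ μ k τ) (h' : IsStripModel lam w₀ μ' k' τ') (hG : AnalyticAt ℂ G 0) :
    (∀ᶠ v in 𝓝 (0 : ℂ), (shear (expBlowup G) (τ v, v / (1 + Complex.exp (τ v)))).1 = τ' v) ↔
      ∀ᶠ v in 𝓝 (0 : ℂ), slide G (Complex.exp (τ v) * (v / (1 + Complex.exp (τ v))),
          v / (1 + Complex.exp (τ v)))
        = (Complex.exp (τ' v) * (v / (1 + Complex.exp (τ' v))), v / (1 + Complex.exp (τ' v))) := by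
  have hGa := analyticAt_expBlowup hG w₀
  have hc := h.one_add_exp_ne
  have hyt : Tendsto (fun v => ((τ v, v / (1 + Complex.exp (τ v))) : Plane)) (𝓝 0)
    (𝓝 (w₀, 0)) := (tendsto_level_coord hc).comp (tendsto_mk_tau h)
  have hslide : ∀ᶠ v in 𝓝 (0 : ℂ), slide G (Complex.exp (τ v) * (v / (1 + Complex.exp (τ v))),
      v / (1 + Complex.exp (τ v)))
      = (Complex.exp (shear (expBlowup G) (τ v, v / (1 + Complex.exp (τ v)))).1
          * (shear (expBlowup G) (τ v, v / (1 + Complex.exp (τ v)))).2,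
        (shear (expBlowup G) (τ v, v / (1 + Complex.exp (τ v)))).2) := by
    filter_upwards [hyt.eventually (eventually_shear_slit hGa)] with v e1
    rw [exp_shear (g := expBlowup G) (p := (τ v, v / (1 + Complex.exp (τ v))))
      (Complex.slitPlane_ne_zero e1.1) (Complex.slitPlane_ne_zero e1.2)]
    rfl
  have hWt : Tendsto (fun v => (shear (expBlowup G) (τ v, v / (1 + Complex.exp (τ v)))).1) (𝓝 0)
      (𝓝 w₀) := (continuous_fst.tendsto _).comp ((tendsto_shear hGa).comp hyt)
  have hwne : ∀ᶠ w in 𝓝 w₀, 1 + Complex.exp w ≠ 0 := by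
    have : ContinuousAt (fun w => 1 + Complex.exp w) w₀ := by fun_prop
    exact this.eventually_ne hc
  have hτt' : Tendsto τ' (𝓝 0) (𝓝 w₀) := (continuous_fst.tendsto _).comp (tendsto_mk_tau h')
  have hτt : Tendsto τ (𝓝 0) (𝓝 w₀) := (continuous_fst.tendsto _).comp (tendsto_mk_tau h)
  constructor
  · intro H
    filter_upwards [H, hslide, hyt.eventually (eventually_shear_slit hGa), hτt'.eventually hwne,
      hτt.eventually hwne] with v e1 e2 e3 e4 e5
    have e6 := shear_snd_eq (g := expBlowup G) (p := (τ v, v / (1 + Complex.exp (τ v))))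
      (Complex.slitPlane_ne_zero e3.1) (Complex.slitPlane_ne_zero e3.2) (by rwa [e1])
    simp only [div_mul_cancel₀ _ e5] at e6
    rw [e2, e6, e1]
  · intro H
    have hlim := hWt.sub hτt'
    rw [sub_self] at hlim
    filter_upwards [H, hslide, hlim.eventually (Metric.ball_mem_nhds 0 one_pos),
      hτt'.eventually hwne] with v e1 e2 e3 e4
    refine eq_of_exp_eq ?_ (by simpa using e3)
    rcases eq_or_ne v 0 with rfl | hv
    · rw [zero_div, shear_axis, h.tau_zero, h'.tau_zero]
    · rw [e2, Prod.mk.injEq] at e1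
      obtain ⟨e5, e6⟩ := e1
      rw [e6] at e5
      exact mul_right_cancel₀ (div_ne_zero hv e4) e5

namespace IsFramedChart

variable {ω η ω' η' : OneForm} {S₁ S₂ S₁' S₂' : ℂ → Plane} {lam : ℂ} {z u z' u' : Plane → ℂ}
  {Θ Θ' : Plane → Plane} {μ a μ' a' : Plane → ℂ} {q q' : ℂ → Plane}

lemma sendsFoliation (h : IsFramedChart ω η S₁ S₂ lam z u Θ μ a q) :
    SendsFoliation Θ (normalForm μ) ω ∧ SendsFoliation Θ sumForm η := by
  have hΘ := h.chart.diffeo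
  have hΘt := analyticAt_tendsto_zero hΘ.1 hΘ.2.1
  refine ⟨⟨a, h.chart.unit_analytic, h.chart.unit_ne_zero, ?_⟩, fun p => u (Θ p),
    AnalyticAt.fun_comp (g := u) (f := Θ) (by rw [hΘ.2.1]; exact h.factor_analytic) hΘ.1,
    by simpa only [hΘ.2.1] using h.factor_ne_zero, ?_⟩
  · filter_upwards [h.chart.form_eq] with p hp
    exact ContinuousLinearMap.ext hp
  · filter_upwards [h.chart.integral_eq.eventually_nhds, hΘt.eventually h.factor_eq,
      hΘt.eventually h.integral_analytic.eventually_analyticAt, hΘ.1.eventually_analyticAt]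
      with p e2 e3 e4 e5
    refine ContinuousLinearMap.ext fun v => ?_
    have d := (hasFDerivAt_fst (𝕜 := ℂ) (E := ℂ) (F := ℂ) (p := p)).fun_add hasFDerivAt_snd
    rw [pullback, ContinuousLinearMap.comp_apply, e3, _root_.smul_apply, _root_.smul_apply,
      ← fderiv_comp_apply e4 e5, EventuallyEq.fderiv_eq e2, d.fderiv]
    rfl

/-- The conjugacy read in the charts. -/
lemma isConjugacyExtending_slide (h : IsFramedChart ω η S₁ S₂ lam z u Θ μ a q)
    (h' : IsFramedChart ω' η' S₁' S₂' lam z' u' Θ' μ' a' q') {χ φ : Plane → Plane}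
    (hχ : IsDiffeoGerm univ univ χ) (hχΘ : ∀ᶠ p in 𝓝 (0 : Plane), χ (Θ p) = p)
    (hΘχ : ∀ᶠ p in 𝓝 (0 : Plane), Θ (χ p) = p)
    (hφ : ∀ᶠ v in 𝓝 (0 : ℂ), φ (Θ (q v)) = Θ' (q' v)) {G : Plane → ℂ} (hG : AnalyticAt ℂ G 0)
    (hdef : ∀ᶠ p in 𝓝 (0 : Plane), conjDefect μ μ' G p = 0)
    (hcurve : ∀ᶠ v in 𝓝 (0 : ℂ), slide G (q v) = q' v) :
    IsConjugacyExtending (Θ' ∘ slide G ∘ χ) φ ω η ω' η' ∧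
      SameBranch ((Θ' ∘ slide G ∘ χ) ∘ S₁) S₁' ∧ SameBranch ((Θ' ∘ slide G ∘ χ) ∘ S₂) S₂' := by
  have hΘ := h.chart.diffeo
  have hΘ' := h'.chart.diffeo
  have hs := isDiffeoGerm_slide hG
  have hsχ := isDiffeoGerm_comp hs hχ
  have hsend : ∀ {α β α' β' : OneForm}, SendsFoliation Θ α β → SendsFoliation (slide G) α α' →
      SendsFoliation Θ' α' β' → SendsFoliation (Θ' ∘ slide G ∘ χ) β β' := fun h1 h2 h3 =>
    ((h1.symm hΘ.1 hχ.1 hχ.2.1 hΘχ).comp h2 hχ.1 hχ.2.1 hs.1).comp h3 hsχ.1 hsχ.2.1 hΘ'.1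
  have hqt := analyticAt_tendsto_zero h.curve_analytic h.curve_zero
  have hzt : Tendsto z (𝓝[tangentCurve ω η] 0) (𝓝 0) :=
    (analyticAt_tendsto_zero h.integral_analytic h.integral_zero).mono_left nhdsWithin_le_nhds
  refine ⟨⟨isDiffeoGerm_comp hΘ' hsχ, ?_, ?_, ?_⟩, ?_, ?_⟩
  · exact hsend h.sendsFoliation.1 (sendsFoliation_slide h'.chart.mu_analytic hG hdef)
      h'.sendsFoliation.1
  · exact hsend h.sendsFoliation.2 (sendsFoliation_slide_sumForm hG) h'.sendsFoliation.2
  · filter_upwards [h.curve_integral, hzt.eventually (hqt.eventually hχΘ), hzt.eventually hcurve,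
      hzt.eventually hφ] with p e1 e2 e3 e4
    rw [e1] at e2 e4
    simp only [Function.comp_apply]
    rw [e2, e3, e4]
  · obtain ⟨α, hα, hl⟩ := h.chart.left
    obtain ⟨α', hα', hl'⟩ := h'.chart.left
    refine SameBranch.of_comp hα hα' ?_
    filter_upwards [hl, hl', (tendsto_mk_right 0 0).eventually hχΘ] with y e1 e2 e3
    simp only [Function.comp_apply]
    rw [← e1, e3, ← e2]
    simp [slide]
  · obtain ⟨α, hα, hr⟩ := h.chart.right
    obtain ⟨α', hα', hr'⟩ := h'.chart.right
    refine SameBranch.of_comp hα hα' ?_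
    filter_upwards [hr, hr', (tendsto_mk_left 0 0).eventually hχΘ] with y e1 e2 e3
    simp only [Function.comp_apply]
    rw [← e1, e3, ← e2]
    simp [slide]

/-- Every conjugacy has the form of `isConjugacyExtending_slide`. -/
lemma exists_slide_of_isConjugacyExtending (h : IsFramedChart ω η S₁ S₂ lam z u Θ μ a q)
    (h' : IsFramedChart ω' η' S₁' S₂' lam z' u' Θ' μ' a' q') {χ φ Ψ : Plane → Plane}
    (hχ : IsDiffeoGerm univ univ χ) (hΘχ : ∀ᶠ p in 𝓝 (0 : Plane), Θ (χ p) = p)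
    (hφ : ∀ᶠ v in 𝓝 (0 : ℂ), φ (Θ (q v)) = Θ' (q' v))
    (hΨ : IsConjugacyExtending Ψ φ ω η ω' η') (hΨ₁ : SameBranch (Ψ ∘ S₁) S₁')
    (hΨ₂ : SameBranch (Ψ ∘ S₂) S₂') :
    ∃ G : Plane → ℂ, AnalyticAt ℂ G 0 ∧ (∀ᶠ p in 𝓝 (0 : Plane), conjDefect μ μ' G p = 0) ∧
      (∀ᶠ v in 𝓝 (0 : ℂ), slide G (q v) = q' v) ∧ Ψ =ᶠ[𝓝 0] Θ' ∘ slide G ∘ χ := by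
  obtain ⟨hΨd, hΨω, hΨη, hΨT⟩ := hΨ
  have hΘ := h.chart.diffeo
  have hΘ' := h'.chart.diffeo
  obtain ⟨χ', hχ', hχΘ', hΘχ'⟩ := hΘ'.exists_symm
  have hΨΘ := isDiffeoGerm_comp hΨd hΘ
  have hΞ := isDiffeoGerm_comp hχ' hΨΘ
  have hsend : ∀ {α β α' β' : OneForm}, SendsFoliation Θ α β → SendsFoliation Ψ β β' →
      SendsFoliation Θ' α' β' → SendsFoliation (χ' ∘ Ψ ∘ Θ) α α' := fun h1 h2 h3 =>
    (h1.comp h2 hΘ.1 hΘ.2.1 hΨd.1).comp (h3.symm hΘ'.1 hχ'.1 hχ'.2.1 hΘχ') hΨΘ.1 hΨΘ.2.1 hχ'.1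
  have hqt := analyticAt_tendsto_zero h.curve_analytic h.curve_zero
  have hqt' := analyticAt_tendsto_zero h'.curve_analytic h'.curve_zero
  have hΞq : ∀ᶠ v in 𝓝 (0 : ℂ), (χ' ∘ Ψ ∘ Θ) (q v) = q' v := by
    filter_upwards [h.tendsto_curve.eventually hΨT, hφ, hqt'.eventually hχΘ'] with v e1 e2 e3
    simp only [Function.comp_apply]
    rw [e1, e2, e3]
  -- Read in the charts, a map carrying a source separatrix to the corresponding target one carries
  -- the axis into the axis; the common argument covers both pairs.
  have haxis : ∀ {S S' α α' : ℂ → Plane} {β β' : ℂ → ℂ}, IsDiffeoGerm univ univ β →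
      IsDiffeoGerm univ univ β' → (∀ᶠ t in 𝓝 (0 : ℂ), Θ (α t) = S (β t)) →
      (∀ᶠ t in 𝓝 (0 : ℂ), Θ' (α' t) = S' (β' t)) → Tendsto α' (𝓝 0) (𝓝 0) →
      SameBranch (Ψ ∘ S) S' → ∀ᶠ t in 𝓝 (0 : ℂ), ∃ s, (χ' ∘ Ψ ∘ Θ) (α t) = α' s := by
    intro S S' α α' β β' hβ hβ' hα hα' ht hS
    obtain ⟨b', hb', -, hb2⟩ := hβ'.exists_symm
    obtain ⟨γ, hγ, hγe⟩ := hS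
    have tβ := analyticAt_tendsto_zero hβ.1 hβ.2.1
    have tγ := analyticAt_tendsto_zero hγ.1 hγ.2.1
    have tb := analyticAt_tendsto_zero hb'.1 hb'.2.1
    filter_upwards [hα, tβ.eventually hγe, (tγ.comp tβ).eventually hb2,
      (tb.comp (tγ.comp tβ)).eventually hα', (tb.comp (tγ.comp tβ)).eventually (ht.eventually hχΘ')]
      with t e1 e2 e3 e4 e5
    refine ⟨b' (γ (β t)), ?_⟩
    simp only [Function.comp_apply] at e2 e3 e4 e5 ⊢
    rw [e1, e2, ← e5, e4, e3]
  obtain ⟨α₁, hα₁, hl⟩ := h.chart.left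
  obtain ⟨α₁', hα₁', hl'⟩ := h'.chart.left
  obtain ⟨α₂, hα₂, hr⟩ := h.chart.right
  obtain ⟨α₂', hα₂', hr'⟩ := h'.chart.right
  have hleft := haxis hα₁ hα₁' hl hl' (tendsto_mk_right 0 0) hΨ₁
  have hright := haxis hα₂ hα₂' hr hr' (tendsto_mk_left 0 0) hΨ₂
  obtain ⟨G, hG, hGe⟩ := exists_eq_slide hΞ.1
    (hsend h.sendsFoliation.2 hΨη h'.sendsFoliation.2) h.curve_analytic h.curve_zero
    (by
      filter_upwards [h.curve_spec, h'.curve_spec, hΞq] with v e1 e2 e3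
      exact ⟨e1.1, by rw [e3, e2.1]⟩)
    (hleft.mono fun y ⟨s, hs⟩ => by rw [hs])
    (hright.mono fun y ⟨s, hs⟩ => by rw [hs])
  refine ⟨G, hG, ?_, ?_, ?_⟩
  · refine conjDefect_eq_zero_of_sendsFoliation h.chart.mu_analytic h'.chart.mu_analytic hG ?_
    obtain ⟨c, hc, hc0, he⟩ := hsend h.sendsFoliation.1 hΨω h'.sendsFoliation.1
    refine ⟨c, hc, hc0, ?_⟩
    filter_upwards [he, hGe.eventually_nhds] with p e1 e2
    have e3 : slide G =ᶠ[𝓝 p] χ' ∘ Ψ ∘ Θ := e2.mono fun s hs => hs.symm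
    rw [← e1, pullback, pullback, EventuallyEq.fderiv_eq e3, e3.self_of_nhds]
  · filter_upwards [hΞq, hqt.eventually hGe] with v e1 e2
    rw [← e2, e1]
  · have hχt := analyticAt_tendsto_zero hχ.1 hχ.2.1
    filter_upwards [hχt.eventually hGe, hΘχ,
      (analyticAt_tendsto_zero hΨd.1 hΨd.2.1).eventually hΘχ'] with p e1 e2 e3
    simp only [Function.comp_apply] at e1 ⊢
    rw [← e1, e2, e3]

end IsFramedChart

end PlaneFoliation

/-! ### The main theorem -/

theorem mainTheorem5
    (ω ω' η η' : OneForm)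
    (hω : IsNondegenerateReduced ω) (hω' : IsNondegenerateReduced ω')
    (hη : IsRegularFoliation η) (hη' : IsRegularFoliation η')
    (S₁ S₂ S₁' S₂' : ℂ → Plane)
    (hS : AreSeparatrices ω S₁ S₂) (hS' : AreSeparatrices ω' S₁' S₂')
    (hηS₁ : IsTransverse η S₁) (hηS₂ : IsTransverse η S₂)
    (hηS₁' : IsTransverse η' S₁') (hηS₂' : IsTransverse η' S₂')
    (hCS : ∃ l : ℂ, HasCamachoSadIndex ω S₁ l ∧ HasCamachoSadIndex ω' S₁' l)
    (h h' : Plane → Plane)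
    (hh : IsTangentCurveHolonomy ω η S₁ S₂ h)
    (hh' : IsTangentCurveHolonomy ω' η' S₁' S₂' h')
    (φ : Plane → Plane)
    (hφ : IsDiffeoGerm (tangentCurve ω η) (tangentCurve ω' η') φ)
    (hcomm : ∀ᶠ q in 𝓝[tangentCurve ω η] (0 : Plane), φ (h q) = h' (φ q)) :
    ∃ Φ : Plane → Plane,
      (IsConjugacyExtending Φ φ ω η ω' η' ∧
        SameBranch (Φ ∘ S₁) S₁' ∧ SameBranch (Φ ∘ S₂) S₂') ∧
      ∀ Ψ : Plane → Plane,
        IsConjugacyExtending Ψ φ ω η ω' η' ∧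
          SameBranch (Ψ ∘ S₁) S₁' ∧ SameBranch (Ψ ∘ S₂) S₂' →
        Ψ =ᶠ[𝓝 0] Φ := by
  obtain ⟨l, hl, hl'⟩ := hCS
  have hf := exists_separatrixFrame hω hS hl
  have hf' := exists_separatrixFrame hω' hS' hl'
  obtain ⟨hS₁, hS₂, -⟩ := hS
  obtain ⟨hS₁', hS₂', -⟩ := hS'
  -- With lam = -l, the excluded value lam = -1 is what makes the tangent curve transverse to the
  -- pencil x + y = const and 1 + μ a unit.
  have h1 : 1 + -l ≠ 0 := fun hc => hf.ratio (-1) (by norm_num) (by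
    push_cast
    linear_combination hc)
  have htr : ∀ {ω η : OneForm} {S₁ S₂ : ℂ → Plane} {lam : ℂ}, HasSeparatrixFrame ω S₁ S₂ lam →
      IsSeparatrix ω S₁ → IsSeparatrix ω S₂ → IsTransverse η S₁ → IsTransverse η S₂ →
      η 0 (deriv S₁ 0) ≠ 0 ∧ η 0 (deriv S₂ 0) ≠ 0 := by
    intro ω η S₁ S₂ lam hf hS₁ hS₂ ht₁ ht₂
    have n1 : deriv S₁ 0 ≠ 0 := fun hc => hf.det_ne_zero (by simp [hc, det₂])
    have n2 : deriv S₂ 0 ≠ 0 := fun hc => hf.det_ne_zero (by simp [hc, det₂])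
    exact ⟨ht₁ _ ((hS₁.isTangentVector_iff n1 _).2 ⟨1, one_ne_zero, (one_smul _ _).symm⟩),
      ht₂ _ ((hS₂.isTangentVector_iff n2 _).2 ⟨1, one_ne_zero, (one_smul _ _).symm⟩)⟩
  obtain ⟨t₁, t₂⟩ := htr hf hS₁ hS₂ hηS₁ hηS₂
  obtain ⟨t₁', t₂'⟩ := htr hf' hS₁' hS₂' hηS₁' hηS₂'
  obtain ⟨z, u, hz, hz0, hu, hu0, hηz⟩ := exists_first_integral_of_regular hη
  obtain ⟨z', u', hz', hz0', hu', hu0', hηz'⟩ := exists_first_integral_of_regular hη'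
  obtain ⟨Θ, μ, a, q, hc⟩ := exists_framedChart hω.1 hS₁ hS₂ hf h1 hz hz0 hu hu0 hηz t₁ t₂
  obtain ⟨z'', u'', Θ', μ', a', q', hc', hφq⟩ := hc.exists_matching hω'.1 hS₁' hS₂' hf' h1
    hz' hz0' hu' hu0' hηz' t₁' t₂' hφ
  obtain ⟨w₀, k, k', τ, τ', θ, hm, hτ, hτ', hq, hq'⟩ := hc.exists_isMatched hc' hω.1 hη.1 hω'.1
    hη'.1 hS₁ hS₂ hS₁' hS₂' hf.ne_zero h1 hh hh' hφq hcomm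
  obtain ⟨G, hG, hdef, hcurve, huniq⟩ := hm.exists_conjugation hτ hτ' hf.ratio
  obtain ⟨χ, hχ, hχΘ, hΘχ⟩ := hc.chart.diffeo.exists_symm
  have hslide := (slide_curve_iff hτ hτ' hG).1 hcurve
  refine ⟨Θ' ∘ slide G ∘ χ, hc.isConjugacyExtending_slide hc' hχ hχΘ hΘχ hφq hG hdef ?_, ?_⟩
  · filter_upwards [hslide, hq, hq'] with v e1 e2 e3
    rw [e2, e1, ← e3]
  · rintro Ψ ⟨hΨ, hΨ₁, hΨ₂⟩
    obtain ⟨F, hF, hFdef, hFq, hΨF⟩ :=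
      hc.exists_slide_of_isConjugacyExtending hc' hχ hΘχ hφq hΨ hΨ₁ hΨ₂
    have hFG := huniq F hF hFdef ((slide_curve_iff hτ hτ' hF).2 (by
      filter_upwards [hFq, hq, hq'] with v e1 e2 e3
      rw [← e2, e1, ← e3]))
    have hχt := analyticAt_tendsto_zero hχ.1 hχ.2.1
    filter_upwards [hΨF, hχt.eventually hFG] with p e1 e2
    rw [e1]
    simp only [Function.comp_apply, slide, e2]
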